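/- Let $G$ be a finitely generated, torsion-free, nilpotent group of class $2$ whose centre $Z(G)$ is free abelian of rank $3$ and whose quotient $G/Z(G)$ is free abelian of rank $d=2r$ (for instance $G'=Z(G)\cong\mathbb{Z}^3$, $G/G'\cong\mathbb{Z}^{2r}$). Choose $x_1,\dots,x_d\in G$ inducing a basis of $G/Z(G)$ and a basis $y_1,y_2,y_3$ of $Z(G)$, and write $[x_i,x_j]=\prod_k y_k^{B_{ijk}}$. Let $M(\mathbf y)$ be the anti-symmetric $d\times d$ matrix of linear forms $M(\mathbf y)_{ij}=\sum_k B_{ijk}y_k$, and let $F=\sqrt{\det M(\mathbf y)}\in\mathbb{Z}[y_1,y_2,y_3]$ be its Pfaffian. Assume that $F$ is non-zero and square-free over $\mathbb{Q}$. Let $E_1,\dots,E_l$ be the irreducible components over $\mathbb{Q}$ of the plane curve $\mathcal{P}_G=(F=0)\subset\mathbb{P}^2$, given by polynomials with integer coefficients. Assume that none of them is a line, and that every singular point of $\mathcal{P}_G$ over $\overline{\mathbb{Q}}$ is a $\mathbb{Q}$-rational ordinary double point (ODP) whose two (distinct) tangent lines are defined over $\mathbb{Q}$. For a prime $p$ let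 $\zeta^\triangleleft_{G,p}(s)=\sum_{n\ge0}a^\triangleleft_{p^n}p^{-ns}$, where $a^\triangleleft_m$ is the number of normal subgroups of $G$ of index $m$; let $\zeta_{\mathbb{Z}_p^d}(s)$ be the zeta function counting subgroups of $p$-power index of $\mathbb{Z}_p^d$, and let $\zeta_p(s)=(1-p^{-s})^{-1}$. Let $c_{p,i}$ be the number of $\mathbb{F}_p$-points of the non-singular projective curve birationally equivalent to the reduction of $E_i$ mod $p$. For $j=1,2$ let $n_p^{(j)}$ be the number of points $\alpha\in\mathbb{P}^2(\mathbb{F}_p)$ that are ODPs of the reduction of $\mathcal{P}_G$ mod $p$ and satisfy $\operatorname{rk}M(\alpha)=2(r-j)$. Then for all but finitely many primes $p$, as an identity of formal Laurent series in $p^{-s}$, $$\frac{\zeta^\triangleleft_{G,p}(s)}{\zeta_{\mathbb{Z}_p^d}(s)\,\zeta_p((d+3)s-3d)}=W_1(p,p^{-s})+\Big(\sum_{i=1}^l c_{p,i}\Big)W_2(p,p^{-s})+n_p^{(1)}W_3(p,p^{-s})+n_p^{(2)}W_4(p,p^{-s}),$$ where $$W_1(X,Y)=\frac{1+X^{2r}Y^{2r+1}+X^{2r+1}Y^{2r+1}+X^{4r}Y^{2r+2}+X^{4r+1}Y^{2r+2}+X^{6r+1}Y^{4r+3}}{(1-X^{4r+2}Y^{2r+2})(1-X^{2r+2}Y^{2r+1})},$$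 $$W_2(X,Y)=\frac{(1-Y)(1+Y)X^{2r}Y^{2r-1}(1+X^{4r+1}Y^{2r+2})}{(1-X^{2r+1}Y^{2r-1})(1-X^{2r+2}Y^{2r+1})(1-X^{4r+2}Y^{2r+2})},$$ $$W_3(X,Y)=-\frac{(1-Y)(1+Y)X^{2r}Y^{2r-1}(1-X^{2r+2}Y^{2r-1})(1+X^{4r+1}Y^{2r+2})}{(1-X^{2r+1}Y^{2r-1})^2(1-X^{2r+2}Y^{2r+1})(1-X^{4r+2}Y^{2r+2})},$$ $$W_4(X,Y)=\frac{(1-Y)^2(1+Y)^2X^{2r}Y^{2r-3}(1+X^{2r+1}Y^{2r-1})(1+X^{4r+1}Y^{2r+2})}{(1-X^{2r+2}Y^{2r+1})(1-X^{2r}Y^{2r-3})(1-X^{2r+1}Y^{2r-1})(1-X^{4r+2}Y^{2r+2})}.$$ -/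

import Mathlib

open MvPolynomial

noncomputable section

namespace PfaffianZeta

/-! ### Groups and zeta functions -/

/-- The local normal zeta function of `G` at `p`, as the formal power series
`∑ₙ a_{pⁿ}^◁ Tⁿ` in `T = p^{-s}`, where `a_m^◁` is the number of normal subgroups of index `m`. -/
def localNormalZeta (p : ℕ) (G : Type*) [Group G] : PowerSeries ℚ :=
  PowerSeries.mk fun n => (Nat.card {H : Subgroup G // H.Normal ∧ H.index = p ^ n} : ℚ)

/-- The zeta function of `ℤ_pᵈ`, counting its subgroups of `p`-power index. -/
def zetaZp (p d : ℕ) [Fact p.Prime] : PowerSeries ℚ :=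
  localNormalZeta p (Multiplicative (Fin d → ℤ_[p]))

/-- `ζ_p(s) = (1 - p^{-s})⁻¹`, as a function of `u = p^{-s}`. -/
def zetaFactor {K : Type*} [Field K] (u : K) : K := (1 - u)⁻¹

/-- `G` is a central extension of `ℤᵈ` by `Z(G) ≅ ℤ^{d'}`, with `x₁, …, x_d ∈ G` inducing a basis
of `G/Z(G)`, `y₁, …, y_{d'}` a basis of `Z(G)`, and commutators `[xᵢ, xⱼ] = ∏ₖ yₖ ^ B i j k`.
Here `π` is the coordinate map of `G/Z(G)` and `ι` the inverse coordinate map of `Z(G)`. -/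
structure CommutatorPresentation (G : Type*) [Group G] {d d' : ℕ}
    (B : Fin d → Fin d → Fin d' → ℤ) where
  π : G →* Multiplicative (Fin d → ℤ)
  π_surjective : Function.Surjective π
  ker_π : π.ker = Subgroup.center G
  ι : Multiplicative (Fin d' → ℤ) →* G
  ι_injective : Function.Injective ι
  range_ι : ι.range = Subgroup.center G
  x : Fin d → G
  π_x : ∀ i, π (x i) = Multiplicative.ofAdd (Pi.single i 1)
  commutator_x : ∀ i j, x i * x j * (x i)⁻¹ * (x j)⁻¹ = ι (Multiplicative.ofAdd (B i j))

/-- The matrix `M(y)` of linear forms `M(y)ᵢⱼ = ∑ₖ B i j k · yₖ`. -/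
def commutatorMatrix {d d' : ℕ} (B : Fin d → Fin d → Fin d' → ℤ) :
    Matrix (Fin d) (Fin d) (MvPolynomial (Fin d') ℤ) :=
  Matrix.of fun i j => ∑ k, C (B i j k) * X k

/-! ### Plane curves -/

/-- Base change of a ternary integral polynomial. -/
def baseChange (K : Type*) [CommRing K] (F : MvPolynomial (Fin 3) ℤ) : MvPolynomial (Fin 3) K :=
  map (Int.castRingHom K) F

/-- The plane curve `F = 0` passes through the point with homogeneous coordinates `v` and is
singular there. -/
def IsSingularPoint {K : Type*} [Field K] (F : MvPolynomial (Fin 3) K) (v : Fin 3 → K) : Prop :=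
  eval v F = 0 ∧ ∀ i, eval v (pderiv i F) = 0

/-- The linear form `∑ aᵢ yᵢ`. -/
def linForm {K : Type*} [Field K] (a : Fin 3 → K) : MvPolynomial (Fin 3) K :=
  ∑ i, C (a i) * X i

/-- `F(v + y)`, the expansion of `F` around `v`. -/
def expandAt {K : Type*} [Field K] (F : MvPolynomial (Fin 3) K) (v : Fin 3 → K) :
    MvPolynomial (Fin 3) K :=
  aeval (fun i => C (v i) + X i) F

/-- The point with homogeneous coordinates `v` is an ordinary double point of `F = 0` whose two
tangent lines `a`, `b` are defined over `K` (rational slopes): the expansion of `F` at `v` has no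
terms of degree `< 2`, and its quadratic part is the product of two independent linear forms. -/
def IsRationalODP {K : Type*} [Field K] (F : MvPolynomial (Fin 3) K) (v : Fin 3 → K) : Prop :=
  v ≠ 0 ∧ homogeneousComponent 0 (expandAt F v) = 0 ∧ homogeneousComponent 1 (expandAt F v) = 0 ∧
    ∃ a b : Fin 3 → K, LinearIndependent K ![a, b] ∧
      homogeneousComponent 2 (expandAt F v) = linForm a * linForm b

/-- The point with homogeneous coordinates `v ∈ K³` is an ordinary double point of `F = 0`:
over an algebraic closure it is a double point with two distinct tangent lines. -/
def IsODP {K : Type*} [Field K] (F : MvPolynomial (Fin 3) K) (v : Fin 3 → K) : Prop :=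
  IsRationalODP (map (algebraMap K (AlgebraicClosure K)) F)
    (fun i => algebraMap K (AlgebraicClosure K) (v i))

/-- All singular points of `F = 0` over an algebraic closure of `ℚ` are `ℚ`-rational ordinary
double points with `ℚ`-rational slopes. -/
def HasOnlyRationalODPs (F : MvPolynomial (Fin 3) ℤ) : Prop :=
  ∀ v : Fin 3 → AlgebraicClosure ℚ, v ≠ 0 →
    IsSingularPoint (baseChange (AlgebraicClosure ℚ) F) v →
    ∃ (w : Fin 3 → ℚ) (c : AlgebraicClosure ℚ),
      (v = fun i => c * algebraMap ℚ (AlgebraicClosure ℚ) (w i)) ∧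
      IsRationalODP (baseChange ℚ F) w

/-- `n_p^{(j)}`: the number of `α ∈ ℙ²(𝔽_p)` that are ordinary double points of the reduction
of `F = 0` mod `p` and at which `M(α)` has rank `d - 2j`. -/
def odpCount {d : ℕ} (B : Fin d → Fin d → Fin 3 → ℤ) (F : MvPolynomial (Fin 3) ℤ)
    (p : ℕ) [Fact p.Prime] (j : ℕ) : ℕ :=
  Nat.card {α : Projectivization (ZMod p) (Fin 3 → ZMod p) //
    IsODP (baseChange (ZMod p) F) α.rep ∧
    ((commutatorMatrix B).map (aeval α.rep : MvPolynomial (Fin 3) ℤ →ₐ[ℤ] ZMod p)).rank + 2 * j = d}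

/-- The function field of the integral plane curve `f = 0` (`f` homogeneous), generated by the
ratios of the coordinate functions inside the fraction field of the homogeneous coordinate ring. -/
def functionField {k : Type*} [Field k] (f : MvPolynomial (Fin 3) k)
    [(Ideal.span {f}).IsPrime] :
    IntermediateField k (FractionRing (MvPolynomial (Fin 3) k ⧸ Ideal.span {f})) :=
  IntermediateField.adjoin k (Set.range fun ij : Fin 3 × Fin 3 =>
    algebraMap (MvPolynomial (Fin 3) k ⧸ Ideal.span {f}) (FractionRing _)
        (Ideal.Quotient.mk (Ideal.span {f}) (X ij.1)) /
      algebraMap (MvPolynomial (Fin 3) k ⧸ Ideal.span {f}) (FractionRing _)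
        (Ideal.Quotient.mk (Ideal.span {f}) (X ij.2)))

/-- The `k`-rational points of the non-singular projective curve with function field `K/k`: this
curve is the set of non-trivial valuation rings `O` of `K` containing `k` (the local rings at its
closed points), and a point is `k`-rational if its residue field is `k`. -/
def ModelPoint (k K : Type*) [Field k] [Field K] [Algebra k K] : Type _ :=
  {O : ValuationSubring K // O ≠ ⊤ ∧ (∀ c : k, algebraMap k K c ∈ O) ∧
    ∀ x ∈ O, ∃ c : k, x - algebraMap k K c ∈ O.nonunits}

open Classical in
/-- The number of `k`-rational points of the non-singular projective curve birationally equivalent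
to the plane curve `f = 0`. (The value is `0` if `f` is not prime, which concerns only finitely
many reductions mod `p` of a geometrically irreducible curve.) -/
def modelPointCount {k : Type*} [Field k] (f : MvPolynomial (Fin 3) k) : ℕ :=
  if _h : (Ideal.span {f}).IsPrime then Nat.card (ModelPoint k (functionField f)) else 0

/-! ### The rational functions -/

section RationalFunctions

variable {K : Type*} [Field K]

def W₁ (r : ℤ) (X Y : K) : K :=
  (1 + X ^ (2 * r) * Y ^ (2 * r + 1) + X ^ (2 * r + 1) * Y ^ (2 * r + 1)
      + X ^ (4 * r) * Y ^ (2 * r + 2) + X ^ (4 * r + 1) * Y ^ (2 * r + 2)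
      + X ^ (6 * r + 1) * Y ^ (4 * r + 3)) /
    ((1 - X ^ (4 * r + 2) * Y ^ (2 * r + 2)) * (1 - X ^ (2 * r + 2) * Y ^ (2 * r + 1)))

def W₂ (r : ℤ) (X Y : K) : K :=
  ((1 - Y) * (1 + Y) * X ^ (2 * r) * Y ^ (2 * r - 1) * (1 + X ^ (4 * r + 1) * Y ^ (2 * r + 2))) /
    ((1 - X ^ (2 * r + 1) * Y ^ (2 * r - 1)) * (1 - X ^ (2 * r + 2) * Y ^ (2 * r + 1))
      * (1 - X ^ (4 * r + 2) * Y ^ (2 * r + 2)))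

/-- The correction term of an ordinary double point of rank deficit `2`. -/
def W₃ (r : ℤ) (X Y : K) : K :=
  -((1 - Y) * (1 + Y) * X ^ (2 * r) * Y ^ (2 * r - 1) * (1 - X ^ (2 * r + 2) * Y ^ (2 * r - 1))
      * (1 + X ^ (4 * r + 1) * Y ^ (2 * r + 2))) /
    ((1 - X ^ (2 * r + 1) * Y ^ (2 * r - 1)) ^ 2 * (1 - X ^ (2 * r + 2) * Y ^ (2 * r + 1))
      * (1 - X ^ (4 * r + 2) * Y ^ (2 * r + 2)))

/-- The correction term of an ordinary double point of rank deficit `4`. -/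
def W₄ (r : ℤ) (X Y : K) : K :=
  ((1 - Y) ^ 2 * (1 + Y) ^ 2 * X ^ (2 * r) * Y ^ (2 * r - 3)
      * (1 + X ^ (2 * r + 1) * Y ^ (2 * r - 1)) * (1 + X ^ (4 * r + 1) * Y ^ (2 * r + 2))) /
    ((1 - X ^ (2 * r + 2) * Y ^ (2 * r + 1)) * (1 - X ^ (2 * r) * Y ^ (2 * r - 3))
      * (1 - X ^ (2 * r + 1) * Y ^ (2 * r - 1)) * (1 - X ^ (4 * r + 2) * Y ^ (2 * r + 2)))

end RationalFunctions

/-- The variable `T = p^{-s}` in the field of formal Laurent series. -/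
def T : LaurentSeries ℚ := ((PowerSeries.X : PowerSeries ℚ) : LaurentSeries ℚ)

end PfaffianZeta

end

/-! A normal subgroup H of G is recorded by Λ' = H ∩ Z(G), by its image Λ in G/Z(G) ≅ ℤᵈ, and by a
lifting of Λ modulo Λ'. Normality means that Λ lies in the lattice `comLat B Λ'` of elements
commuting with G modulo Λ', and each such pair comes from exactly [Z(G) : Λ']ᵈ subgroups
(`card_fibre`). As `comLat B Λ'` is itself isomorphic to ℤᵈ, the factor ζ of ℤ_pᵈ splits off. What
remains is the sum of p^{dk} T^{k + comExp} over the Λ' ≤ ℤ³ of index p^k (`localNormalZeta_eq`).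

Sort the Λ' by [ℤ³ : Λ' + pℤ³] = p^j. If j ≥ 2, then Λ' is annihilated modulo p by a whole line of
forms α. For almost all p the reduced curve contains no line, so some M(α) on it is invertible
modulo p, and `comLat B Λ'` is p times the lattice attached to (Λ' : p). This gives recursions
expressing j = 2, 3 through j = 0, 1 (`cdSeries_two`, `cdSeries_three`); the one for j = 3 produces
the factor ζ_p((d+3)s − 3d). For j = 1 the lattices of index p^c are the points α of ℙ²(ℤ/p^c), and
p^comExp is p^{cd} divided by the order of the kernel of M(α) modulo p^c (`comExp_cyc`).

The series for j = 1 is a sum of local series over the points of ℙ²(𝔽_p). Where the corank of M is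
at most two, skew elimination leaves at most a 2×2 matrix, so the kernel has order p^{2 min(c,
v(F(α)))} and only the number of solutions of F ≡ 0 modulo powers of p near the point matters: none
off the curve, Hensel's lemma at a smooth point, and an equation κab + (higher order) at a node, in
coordinates along the tangents. At a node of corank four the Schur complement at distance p^μ is p^μ
D with D again of corank at most two (`kc_node`). Larger coranks do not occur, because F² = det M
and F vanishes only to order two at a node. The resulting series match W₁ (all points treated as off
the curve), W₂ (correction at a smooth point) and 2W₂ + W₃ or 2W₂ + W₄ (correction at a node).

Hence W₂ has coefficient #(smooth points) + 2 #(nodes), the number of rational branches. This equals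
the sum of the c_{p,i}: each rational point of a non-singular model is centred at one point of the
plane, and local rings, after one blow-up at a node, show that there is exactly one such point for
each branch (`ncard_fibre`). This needs Eᵢ to stay prime modulo p. It does because Eᵢ is
geometrically irreducible: two distinct conjugate factors would meet in a rational node and Galois
conjugation would interchange its tangents, which are rational.

The statements for almost all p come from the Nullstellensatz: an integral system without solutions
over the algebraic closure of ℚ generates a non-zero integer (`exists_C_mem_span`). In the same way
the singular points modulo p are shown to be reductions of integral nodes, with a Hessian
determinant separating a node from all other singular points (`exists_separating`). -/

open MvPolynomial

noncomputable section

namespace PfaffianZeta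

/-! ### Sums of power series of growing order -/

/-- The power series `∑ₖ Tᵏ Dₖ`. -/
def ser (D : ℕ → PowerSeries ℚ) : PowerSeries ℚ :=
  PowerSeries.mk fun n => ∑ k ∈ Finset.range (n + 1), PowerSeries.coeff (n - k) (D k)

theorem coeff_ser (D : ℕ → PowerSeries ℚ) (n : ℕ) : PowerSeries.coeff n (ser D) =
    ∑ k ∈ Finset.range (n + 1), PowerSeries.coeff (n - k) (D k) := PowerSeries.coeff_mk _ _

/-- The terms with k > n do not reach the coefficient of Tⁿ, so identities for finite sums transfer
to `ser`. -/
theorem coeff_ser_eq_coeff_sum (D : ℕ → PowerSeries ℚ) {n N : ℕ} (h : n < N) :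
    PowerSeries.coeff n (ser D) =
      PowerSeries.coeff n (∑ k ∈ Finset.range N, PowerSeries.X ^ k * D k) := by
  rw [coeff_ser, map_sum]
  refine (Finset.sum_subset (Finset.range_mono (Nat.succ_le_of_lt h)) fun k _ hk => ?_).symm.trans
    (Finset.sum_congr rfl fun k hk => ?_) |>.symm
  · rw [PowerSeries.coeff_X_pow_mul', if_neg (by simpa using hk)]
  · rw [PowerSeries.coeff_X_pow_mul', if_pos (by simpa [Nat.lt_succ_iff] using hk)]

theorem ser_add (D D' : ℕ → PowerSeries ℚ) : ser (fun k => D k + D' k) = ser D + ser D' := by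
  ext n
  simp [coeff_ser, Finset.sum_add_distrib]

theorem ser_mul_left (f : PowerSeries ℚ) (D : ℕ → PowerSeries ℚ) :
    ser (fun k => f * D k) = f * ser D := by
  ext n
  rw [coeff_ser_eq_coeff_sum _ (Nat.lt_succ_self n), PowerSeries.coeff_mul]
  simp_rw [mul_left_comm _ f, ← Finset.mul_sum, PowerSeries.coeff_mul]
  refine Finset.sum_congr rfl fun ij h => ?_
  rw [coeff_ser_eq_coeff_sum D (N := n + 1)]
  have := Finset.HasAntidiagonal.mem_antidiagonal.1 h
  omega

theorem ser_shift (D : ℕ → PowerSeries ℚ) :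
    ser D = D 0 + PowerSeries.X * ser (fun k => D (k + 1)) := by
  ext n
  cases n with
  | zero => simp [coeff_ser]
  | succ n =>
    rw [map_add, PowerSeries.coeff_succ_X_mul, coeff_ser, coeff_ser, Finset.sum_range_succ']
    simp [add_comm]

theorem ser_sum {ι : Type*} (s : Finset ι) (D : ι → ℕ → PowerSeries ℚ) :
    ser (fun k => ∑ i ∈ s, D i k) = ∑ i ∈ s, ser (D i) := by
  ext n
  simp only [coeff_ser, map_sum]
  rw [Finset.sum_comm]

theorem ser_pow (ρ : PowerSeries ℚ) : ser (fun k => ρ ^ k) * (1 - PowerSeries.X * ρ) = 1 := by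
  have h := ser_shift (fun k => ρ ^ k)
  simp only [pow_succ', ser_mul_left, pow_zero] at h
  linear_combination h

/-! ### Finite index sublattices of `ℤⁿ` -/

theorem nsmul_mem_of_index {A : Type*} [AddCommGroup A] (H : AddSubgroup A) {n : ℕ}
    (h : H.index = n) (x : A) : n • x ∈ H := by
  subst h
  exact H.nsmul_index_mem x

/-- A subgroup of index m contains mℤⁿ, so it is determined by its image in a finite group. -/
theorem finite_setOf_index_eq (n m : ℕ) (hm : m ≠ 0) :
    {H : AddSubgroup (Fin n → ℤ) | H.index = m}.Finite := by
  let N : AddSubgroup (Fin n → ℤ) := (nsmulAddMonoidHom m).range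
  have hN : N.index ≠ 0 := by
    rw [AddSubgroup.index_range_nsmul]; exact pow_ne_zero _ hm
  have : Finite ((Fin n → ℤ) ⧸ N) := AddSubgroup.index_ne_zero_iff_finite.1 hN
  refine Set.Finite.of_injOn (f := fun H => H.map (QuotientAddGroup.mk' N)) (t := Set.univ)
    (fun _ _ => Set.mem_univ _) ?_ Set.finite_univ
  intro H hH H' hH' h
  have key : ∀ K : AddSubgroup (Fin n → ℤ), K.index = m →
      (K.map (QuotientAddGroup.mk' N)).comap (QuotientAddGroup.mk' N) = K := by
    intro K hK
    rw [AddSubgroup.comap_map_eq, QuotientAddGroup.ker_mk', sup_eq_left]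
    rintro _ ⟨x, rfl⟩
    exact nsmul_mem_of_index K hK x
  rw [← key H hH, ← key H' hH']
  exact congrArg _ h

/-- The finite set of sublattices of index `m ≠ 0`. -/
def lats (n m : ℕ) : Finset (AddSubgroup (Fin n → ℤ)) :=
  if hm : m ≠ 0 then (finite_setOf_index_eq n m hm).toFinset else ∅

theorem mem_lats {n m : ℕ} (hm : m ≠ 0) {H : AddSubgroup (Fin n → ℤ)} :
    H ∈ lats n m ↔ H.index = m := by
  simp [lats, hm]

/-- The number of sublattices of `ℤⁿ` of index `m`. -/
def latCount (n m : ℕ) : ℕ := Nat.card {H : AddSubgroup (Fin n → ℤ) // H.index = m}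

theorem exists_basis_of_index_ne_zero {n : ℕ} (H : AddSubgroup (Fin n → ℤ)) (h : H.index ≠ 0) :
    Nonempty (Module.Basis (Fin n) ℤ H) := by
  have : Finite ((Fin n → ℤ) ⧸ H) := AddSubgroup.index_ne_zero_iff_finite.1 h
  have : Finite ((Fin n → ℤ) ⧸ (AddSubgroup.toIntSubmodule H)) := this
  have h2 := (Submodule.finiteQuotient_iff (AddSubgroup.toIntSubmodule H)).1 inferInstance
  rw [Module.finrank_pi, Fintype.card_fin] at h2
  exact ⟨Module.finBasisOfFinrankEq ℤ (AddSubgroup.toIntSubmodule H) h2⟩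

theorem exists_addEquiv_of_index_ne_zero {n : ℕ} (H : AddSubgroup (Fin n → ℤ)) (h : H.index ≠ 0) :
    Nonempty ((Fin n → ℤ) ≃+ H) :=
  (exists_basis_of_index_ne_zero H h).map fun b => b.equivFun.symm.toAddEquiv

/-- A sublattice of finite index is again isomorphic to ℤⁿ, so the count does not depend on it. This
is why the zeta function of ℤ_pᵈ splits off as a factor. -/
theorem card_le_of_index {n : ℕ} (Y : AddSubgroup (Fin n → ℤ)) (hY : Y.index ≠ 0) (m : ℕ) :
    Nat.card {H : AddSubgroup (Fin n → ℤ) // H ≤ Y ∧ H.index = Y.index * m} = latCount n m := by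
  obtain ⟨e⟩ := exists_addEquiv_of_index_ne_zero Y hY
  refine (Nat.card_congr (Equiv.ofBijective (fun H : {H : AddSubgroup (Fin n → ℤ) // H.index = m} =>
    (⟨(H.1.map e.toAddMonoidHom).map Y.subtype, ?_, ?_⟩ :
      {H : AddSubgroup (Fin n → ℤ) // H ≤ Y ∧ H.index = Y.index * m})) ⟨?_, ?_⟩)).symm
  · exact AddSubgroup.map_subtype_le _
  · rw [AddSubgroup.index_map_subtype, mul_comm]
    congr 1
    exact (AddSubgroup.index_map_equiv H.1 e).trans H.2
  · rintro ⟨H, hH⟩ ⟨H', hH'⟩ h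
    simp only [Subtype.mk.injEq] at h ⊢
    exact AddSubgroup.map_injective e.injective
      (AddSubgroup.map_injective Y.subtype_injective h)
  · rintro ⟨H, hH, hi⟩
    have h1 : (((H.addSubgroupOf Y).comap e.toAddMonoidHom).map e.toAddMonoidHom).map Y.subtype
        = H := by
      rw [AddSubgroup.map_comap_eq_self_of_surjective e.surjective]
      simpa using hH
    refine ⟨⟨(H.addSubgroupOf Y).comap e.toAddMonoidHom, ?_⟩, Subtype.ext h1⟩
    have h2 := AddSubgroup.index_map_subtype (H := Y)
      (((H.addSubgroupOf Y).comap e.toAddMonoidHom).map e.toAddMonoidHom)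
    rw [h1, hi, mul_comm] at h2
    have h3 := AddSubgroup.index_map_equiv ((H.addSubgroupOf Y).comap e.toAddMonoidHom) e
    exact h3.symm.trans (Nat.eq_of_mul_eq_mul_right (Nat.pos_of_ne_zero hY) h2.symm)

/-- ℤᵈ is dense in ℤ_pᵈ and a subgroup of index pⁿ contains pⁿℤ_pᵈ, so intersecting with ℤᵈ is a
bijection between the subgroups of index pⁿ. -/
theorem coeff_zetaZp (p d : ℕ) [Fact p.Prime] (n : ℕ) :
    PowerSeries.coeff n (zetaZp p d) = latCount d (p ^ n) := by
  rw [zetaZp, localNormalZeta, PowerSeries.coeff_mk]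
  norm_cast
  let j : (Fin d → ℤ) →+ (Fin d → ℤ_[p]) :=
    { toFun := fun x i => x i, map_zero' := by ext; simp, map_add' := fun x y => by ext; simp }
  have hpn : p ^ n ≠ 0 := pow_ne_zero _ (Fact.out : p.Prime).ne_zero
  have dense : ∀ y : Fin d → ℤ_[p], ∃ x : Fin d → ℤ, ∃ z : Fin d → ℤ_[p], y = j x + p ^ n • z := by
    intro y
    have : ∀ i, ∃ x : ℤ, ∃ z : ℤ_[p], y i = x + p ^ n * z := by
      intro i
      have h := PadicInt.appr_spec n (y i)
      obtain ⟨z, hz⟩ := Ideal.mem_span_singleton'.1 h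
      exact ⟨(y i).appr n, z, by push_cast; linear_combination -hz⟩
    choose x z h using this
    exact ⟨x, z, by ext i; simp [j, h]⟩
  have inter : ∀ (x : Fin d → ℤ) (z : Fin d → ℤ_[p]), j x = p ^ n • z → ∃ w, x = p ^ n • w := by
    intro x z h
    have : ∀ i, ∃ w : ℤ, x i = p ^ n * w := by
      intro i
      have h1 := congrFun h i
      have h2 : (p : ℤ_[p]) ^ n ∣ (x i : ℤ_[p]) := ⟨z i, by simpa [j] using h1⟩
      exact (PadicInt.pow_p_dvd_int_iff n (x i)).1 h2
    choose w h using this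
    exact ⟨w, by ext i; simp [h]⟩
  have sup : ∀ H : AddSubgroup (Fin d → ℤ_[p]), H.index = p ^ n → H ⊔ j.range = ⊤ := by
    intro H hH
    rw [eq_top_iff]
    intro y _
    obtain ⟨x, z, rfl⟩ := dense y
    exact add_mem (AddSubgroup.mem_sup_right ⟨x, rfl⟩)
      (AddSubgroup.mem_sup_left (nsmul_mem_of_index H hH z))
  rw [latCount]
  let e1 : {H : Subgroup (Multiplicative (Fin d → ℤ_[p])) // H.Normal ∧ H.index = p ^ n} ≃
      {H : AddSubgroup (Fin d → ℤ_[p]) // H.index = p ^ n} :=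
    (AddSubgroup.toSubgroup.toEquiv.subtypeEquiv fun H =>
      ⟨fun h => ⟨inferInstance, (AddSubgroup.index_toSubgroup H).trans h⟩, fun h => by
        have := h.2
        exact (AddSubgroup.index_toSubgroup H).symm.trans this⟩).symm
  refine (Nat.card_congr e1).trans (Nat.card_congr (Equiv.ofBijective
    (fun H => ⟨H.1.comap j, ?_⟩) ⟨?_, ?_⟩))
  · rw [AddSubgroup.index_comap, ← AddSubgroup.relIndex_sup_left, sup _ H.2,
      AddSubgroup.relIndex_top_right, H.2]
  · rintro ⟨H, hH⟩ ⟨H', hH'⟩ h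
    simp only [Subtype.mk.injEq] at h ⊢
    have key : ∀ K : AddSubgroup (Fin d → ℤ_[p]), K.index = p ^ n → ∀ y, y ∈ K ↔
        ∃ x ∈ K.comap j, ∃ z : Fin d → ℤ_[p], y = j x + p ^ n • z := by
      refine fun K hK y => ⟨fun hy => ?_, ?_⟩
      · obtain ⟨x, z, rfl⟩ := dense y
        refine ⟨x, ?_, z, rfl⟩
        exact (add_mem_cancel_right (nsmul_mem_of_index K hK z)).1 hy
      · rintro ⟨x, hx, z, rfl⟩
        exact add_mem hx (nsmul_mem_of_index K hK z)
    ext y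
    rw [key H hH, key H' hH', h]
  · rintro ⟨Λ, hΛ⟩
    -- The inverse map is the closure: add pⁿℤ_pᵈ to the image of Λ.
    let H := Λ.map j ⊔ (nsmulAddMonoidHom (p ^ n) : (Fin d → ℤ_[p]) →+ _).range
    have hc : H.comap j = Λ := by
      ext x
      constructor
      · intro hx
        obtain ⟨_, ⟨l, hl, rfl⟩, _, ⟨z, rfl⟩, h⟩ := AddSubgroup.mem_sup.1 hx
        obtain ⟨w, hw⟩ := inter (x - l) z (by rw [map_sub, ← h]; simp)
        rw [← sub_add_cancel x l, hw]
        exact add_mem (nsmul_mem_of_index Λ hΛ w) hl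
      · exact fun hx => AddSubgroup.mem_sup_left ⟨x, hx, rfl⟩
    have htop : H ⊔ j.range = ⊤ := by
      rw [eq_top_iff]
      intro y _
      obtain ⟨x, z, rfl⟩ := dense y
      exact add_mem (AddSubgroup.mem_sup_right ⟨x, rfl⟩)
        (AddSubgroup.mem_sup_left (AddSubgroup.mem_sup_right ⟨z, rfl⟩))
    refine ⟨⟨H, ?_⟩, Subtype.ext hc⟩
    rw [← AddSubgroup.relIndex_top_right, ← htop, AddSubgroup.relIndex_sup_left,
      ← AddSubgroup.index_comap, hc, hΛ]

/-! ### Normal subgroups and pairs of lattices -/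

section Pairing

variable {d d' : ℕ}

/-- The commutator pairing `ℤᵈ × ℤᵈ → ℤ^{d'}` with the `j`-th basis vector. -/
def pairing (B : Fin d → Fin d → Fin d' → ℤ) (j : Fin d) : (Fin d → ℤ) →+ (Fin d' → ℤ) where
  toFun x := ∑ i, x i • B i j
  map_zero' := by simp
  map_add' x y := by simp [add_smul, Finset.sum_add_distrib]

/-- The lattice of elements of `G/Z(G)` commuting with `G` modulo `Λ'`. -/
def comLat (B : Fin d → Fin d → Fin d' → ℤ) (Λ' : AddSubgroup (Fin d' → ℤ)) :
    AddSubgroup (Fin d → ℤ) :=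
  ⨅ j, Λ'.comap (pairing B j)

theorem mem_comLat {B : Fin d → Fin d → Fin d' → ℤ} {Λ' : AddSubgroup (Fin d' → ℤ)}
    {x : Fin d → ℤ} : x ∈ comLat B Λ' ↔ ∀ j, pairing B j x ∈ Λ' := by
  simp [comLat, AddSubgroup.mem_iInf]

end Pairing

namespace CommutatorPresentation

variable {G : Type*} [Group G] {d d' : ℕ} {B : Fin d → Fin d → Fin d' → ℤ}
  (P : CommutatorPresentation G B)

theorem ι_mem_center (z) : P.ι z ∈ Subgroup.center G := P.range_ι ▸ ⟨z, rfl⟩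

theorem ι_comm (z) (g : G) : g * P.ι z = P.ι z * g :=
  Subgroup.mem_center_iff.1 (P.ι_mem_center z) g

theorem π_ι (z) : P.π (P.ι z) = 1 := by
  have := P.ι_mem_center z
  rwa [← P.ker_π] at this

theorem exists_ι_of_π_eq_one {g : G} (h : P.π g = 1) : ∃ z, P.ι z = g := by
  have : g ∈ P.ι.range := by rw [P.range_ι, ← P.ker_π]; exact h
  exact this

theorem exists_comm (g h : G) : ∃ z, P.ι z = h * g * h⁻¹ * g⁻¹ :=
  P.exists_ι_of_π_eq_one (by simp only [map_mul, map_inv]; rw [mul_comm (P.π h)]; simp)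

/-- The homomorphism `h ↦ [h, g]`, in coordinates of the centre. -/
def commHom (g : G) : G →* Multiplicative (Fin d' → ℤ) :=
  MonoidHom.mk' (fun h => (P.exists_comm g h).choose) fun h₁ h₂ => P.ι_injective <| by
    rw [map_mul, (P.exists_comm g (h₁ * h₂)).choose_spec, (P.exists_comm g h₁).choose_spec]
    have h2 := (P.exists_comm g h₂).choose_spec
    set c := (P.exists_comm g h₂).choose
    have h3 : h₂ * g * h₂⁻¹ = P.ι c * g := by rw [h2]; group
    calc h₁ * h₂ * g * (h₁ * h₂)⁻¹ * g⁻¹ = h₁ * (h₂ * g * h₂⁻¹) * h₁⁻¹ * g⁻¹ := by group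
      _ = (h₁ * P.ι c) * g * h₁⁻¹ * g⁻¹ := by rw [h3]; group
      _ = P.ι c * (h₁ * g * h₁⁻¹ * g⁻¹) := by rw [P.ι_comm]; group
      _ = _ := (P.ι_comm c _).symm

theorem ι_commHom (g h : G) : P.ι (P.commHom g h) = h * g * h⁻¹ * g⁻¹ :=
  (P.exists_comm g h).choose_spec

/-- The map h ↦ [h, x_j] kills the centre, so it descends to ℤᵈ, where it is compared with `pairing`
on the standard basis. -/
theorem commHom_x (j : Fin d) (h : G) :
    P.commHom (P.x j) h = Multiplicative.ofAdd (pairing B j (P.π h).toAdd) := by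
  have hker : P.π.ker ≤ (P.commHom (P.x j)).ker := by
    intro z hz
    obtain ⟨w, rfl⟩ := P.exists_ι_of_π_eq_one hz
    refine P.ι_injective ?_
    rw [P.ι_commHom, ← P.ι_comm]; simp
  let φ : (Fin d → ℤ) →+ (Fin d' → ℤ) :=
    AddMonoidHom.toMultiplicative.symm (P.π.liftOfSurjective P.π_surjective ⟨_, hker⟩)
  have hφ : ∀ h, φ (P.π h).toAdd = (P.commHom (P.x j) h).toAdd := fun h =>
    MonoidHom.liftOfRightInverse_comp_apply _ _ (Function.rightInverse_surjInv P.π_surjective)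
      ⟨_, hker⟩ h
  have : φ = pairing B j := by
    refine AddMonoidHom.toIntLinearMap_injective ((Pi.basisFun ℤ (Fin d)).ext fun i => ?_)
    have h1 := hφ (P.x i)
    rw [P.π_x] at h1
    simp only [Pi.basisFun_apply, AddMonoidHom.coe_toIntLinearMap]
    refine h1.trans ?_
    have h2 : P.commHom (P.x j) (P.x i) = Multiplicative.ofAdd (B i j) :=
      P.ι_injective (by rw [P.ι_commHom, P.commutator_x])
    rw [h2]
    simp [pairing, Pi.single_apply]
  rw [← this, hφ]; rfl

/-- Elements over `comLat B Λ'` commute with everything modulo `Λ'`. -/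
theorem comm_mem_map {Λ' : AddSubgroup (Fin d' → ℤ)} {h : G}
    (hh : (P.π h).toAdd ∈ comLat B Λ') (g : G) :
    h * g * h⁻¹ * g⁻¹ ∈ Λ'.toSubgroup.map P.ι := by
  -- The g whose commutator with h lies in Λ' form a subgroup. It contains the x_j and the centre,
  -- which together generate G.
  let K : Subgroup G := (Λ'.toSubgroup).comap (P.commHom h)
  have hK : ∀ g, g ∈ K ↔ h * g * h⁻¹ * g⁻¹ ∈ Λ'.toSubgroup.map P.ι := by
    intro g
    rw [← inv_mem_iff (x := h * g * h⁻¹ * g⁻¹)]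
    have : (h * g * h⁻¹ * g⁻¹)⁻¹ = P.ι (P.commHom h g) := by rw [P.ι_commHom]; group
    rw [this, Subgroup.mem_map_iff_mem P.ι_injective]; rfl
  rw [← hK]
  have h1 : ∀ j, P.x j ∈ K := by
    intro j
    rw [hK, ← P.ι_commHom, P.commHom_x, Subgroup.mem_map_iff_mem P.ι_injective]
    exact mem_comLat.1 hh j
  have h2 : ∀ z, P.ι z ∈ K := by
    intro z
    rw [hK, P.ι_comm]; simp
  have h3 : K.map P.π = ⊤ := by
    have hspan := (Pi.basisFun ℤ (Fin d)).span_eq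
    rw [eq_top_iff]
    intro y _
    have : y.toAdd ∈ AddSubgroup.toIntSubmodule (Subgroup.toAddSubgroup' (K.map P.π)) := by
      have hle : Submodule.span ℤ (Set.range (Pi.basisFun ℤ (Fin d))) ≤
          AddSubgroup.toIntSubmodule (Subgroup.toAddSubgroup' (K.map P.π)) := by
        rw [Submodule.span_le]
        rintro _ ⟨i, rfl⟩
        exact ⟨P.x i, h1 i, by rw [P.π_x]; simp; rfl⟩
      exact hle (hspan ▸ Submodule.mem_top)
    exact this
  have h4 : P.π g ∈ K.map P.π := h3 ▸ Subgroup.mem_top _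
  obtain ⟨k, hk, hkg⟩ := h4
  obtain ⟨z, hz⟩ := P.exists_ι_of_π_eq_one (g := k⁻¹ * g) (by simp [hkg])
  have : g = k * P.ι z := by rw [hz]; group
  rw [this]
  exact mul_mem hk (h2 z)

end CommutatorPresentation

namespace CommutatorPresentation

variable {G : Type*} [Group G] {d d' : ℕ} {B : Fin d → Fin d → Fin d' → ℤ}
  (P : CommutatorPresentation G B)

theorem normal_of_map_le {Λ' : AddSubgroup (Fin d' → ℤ)} {Λ : AddSubgroup (Fin d → ℤ)}
    (hΛ : Λ ≤ comLat B Λ') {H : Subgroup G} (h' : H.comap P.ι = Λ'.toSubgroup)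
    (h : H.map P.π = Λ.toSubgroup) : H.Normal := by
  refine ⟨fun n hn g => ?_⟩
  have h1 : (P.π n).toAdd ∈ Λ := by
    have : P.π n ∈ Λ.toSubgroup := h ▸ Subgroup.mem_map_of_mem _ hn
    exact this
  have h2 := P.comm_mem_map (hΛ h1) g
  rw [← h'] at h2
  have h3 := Subgroup.map_comap_le _ _ h2
  have : g * n * g⁻¹ = (n * g * n⁻¹ * g⁻¹)⁻¹ * n := by group
  rw [this]
  exact mul_mem (inv_mem h3) hn

theorem map_le_comLat_of_normal {H : Subgroup G} (hH : H.Normal)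
    {Λ' : AddSubgroup (Fin d' → ℤ)} {Λ : AddSubgroup (Fin d → ℤ)}
    (h' : H.comap P.ι = Λ'.toSubgroup) (h : H.map P.π = Λ.toSubgroup) : Λ ≤ comLat B Λ' := by
  intro y hy
  have h1 : Multiplicative.ofAdd y ∈ H.map P.π := h ▸ hy
  obtain ⟨n, hn, hny⟩ := h1
  rw [mem_comLat]
  intro j
  have h2 : P.commHom (P.x j) n ∈ Λ'.toSubgroup := by
    rw [← h', Subgroup.mem_comap, ι_commHom, mul_assoc, mul_assoc]
    refine mul_mem hn ?_
    rw [← mul_assoc]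
    exact hH.conj_mem _ (inv_mem hn) _
  rw [P.commHom_x, hny] at h2
  exact h2

/-- [G : H] = [G : HZ][HZ : H], and HZ/H is Z/(H ∩ Z). -/
theorem index_eq {H : Subgroup G} (hH : H.Normal)
    {Λ' : AddSubgroup (Fin d' → ℤ)} {Λ : AddSubgroup (Fin d → ℤ)}
    (h' : H.comap P.ι = Λ'.toSubgroup) (h : H.map P.π = Λ.toSubgroup) :
    H.index = Λ'.index * Λ.index := by
  have h1 : Λ.index = (H ⊔ Subgroup.center G).index := by
    rw [← AddSubgroup.index_toSubgroup, ← h, Subgroup.index_map, P.ker_π,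
      MonoidHom.range_eq_top.2 P.π_surjective, Subgroup.index_top, mul_one]
  have h2 : Λ'.index = H.relIndex (H ⊔ Subgroup.center G) := by
    rw [← AddSubgroup.index_toSubgroup, ← h', Subgroup.index_comap, P.range_ι,
      Subgroup.relIndex_sup_left]
  rw [h1, h2, Subgroup.relIndex_mul_index le_sup_left]

/-- H is determined by the classes modulo Λ' of the central corrections that move fixed lifts of a
basis of Λ into H. Conversely any d classes occur: modulo Λ' all elements over Λ are central, so no
commutator obstructs extending the chosen lifts to a homomorphism. -/
theorem card_fibre {Λ' : AddSubgroup (Fin d' → ℤ)} {Λ : AddSubgroup (Fin d → ℤ)}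
    (hΛ : Λ ≤ comLat B Λ') (hi : Λ.index ≠ 0) :
    Nat.card {H : Subgroup G // H.comap P.ι = Λ'.toSubgroup ∧ H.map P.π = Λ.toSubgroup} =
      Λ'.index ^ d := by
  obtain ⟨b⟩ := exists_basis_of_index_ne_zero Λ hi
  choose g hg using fun i => P.π_surjective (Multiplicative.ofAdd (b i : Fin d → ℤ))
  have hex : ∀ H : {H : Subgroup G // H.comap P.ι = Λ'.toSubgroup ∧ H.map P.π = Λ.toSubgroup},
      ∀ i, ∃ z : Fin d' → ℤ, g i * P.ι (Multiplicative.ofAdd z) ∈ H.1 := by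
    rintro ⟨H, h', h⟩ i
    have h1 : Multiplicative.ofAdd (b i : Fin d → ℤ) ∈ H.map P.π := h ▸ (b i).2
    obtain ⟨n, hn, hny⟩ := h1
    obtain ⟨z, hz⟩ := P.exists_ι_of_π_eq_one (g := (g i)⁻¹ * n) (by simp [hg, hny])
    refine ⟨z.toAdd, ?_⟩
    have : g i * P.ι (Multiplicative.ofAdd z.toAdd) = n := by rw [ofAdd_toAdd, hz]; group
    rw [this]
    exact hn
  have hmemι : ∀ H : Subgroup G, H.comap P.ι = Λ'.toSubgroup → ∀ z : Fin d' → ℤ,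
      P.ι (Multiplicative.ofAdd z) ∈ H ↔ z ∈ Λ' := by
    intro H h' z
    rw [← Subgroup.mem_comap, h']; rfl
  choose z hz using hex
  let Ψ : {H : Subgroup G // H.comap P.ι = Λ'.toSubgroup ∧ H.map P.π = Λ.toSubgroup} →
      (Fin d → (Fin d' → ℤ) ⧸ Λ') := fun H i => QuotientAddGroup.mk (z H i)
  have hmem : ∀ H i (y : Fin d' → ℤ), (QuotientAddGroup.mk y : (Fin d' → ℤ) ⧸ Λ') = Ψ H i ↔
      g i * P.ι (Multiplicative.ofAdd y) ∈ H.1 := by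
    intro H i y
    rw [eq_comm, QuotientAddGroup.eq, ← hmemι H.1 H.2.1]
    rw [← Subgroup.mul_mem_cancel_left _ (hz H i), ofAdd_add, map_mul, ofAdd_neg, map_inv]
    rw [mul_assoc, mul_inv_cancel_left]
  have hinj : Function.Injective Ψ := by
    have hle : ∀ H H', Ψ H = Ψ H' → H.1 ≤ H'.1 := by
      intro H H' hΨ h hh
      have hK : Λ.toSubgroup ≤ (H.1 ⊓ H'.1).map P.π := by
        intro y hy
        let K' : Submodule ℤ Λ := AddSubgroup.toIntSubmodule
          ((Subgroup.toAddSubgroup' ((H.1 ⊓ H'.1).map P.π)).comap Λ.subtype)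
        have hK' : K' = ⊤ := by
          rw [eq_top_iff, ← b.span_eq, Submodule.span_le]
          rintro _ ⟨i, rfl⟩
          refine ⟨g i * P.ι (Multiplicative.ofAdd (z H i)), ⟨hz H i, ?_⟩, ?_⟩
          · exact (hmem H' i _).1 (congrFun hΨ i)
          · rw [map_mul, P.π_ι, mul_one, hg]; rfl
        have : (⟨y.toAdd, hy⟩ : Λ) ∈ K' := hK' ▸ Submodule.mem_top
        exact this
      have h1 : P.π h ∈ Λ.toSubgroup := H.2.2 ▸ Subgroup.mem_map_of_mem _ hh
      obtain ⟨k, hk, hkh⟩ := hK h1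
      obtain ⟨y, hy⟩ := P.exists_ι_of_π_eq_one (g := k⁻¹ * h) (by simp [hkh])
      have h2 : P.ι y ∈ H.1 := hy ▸ mul_mem (inv_mem hk.1) hh
      have h3 : P.ι y ∈ H'.1 := (hmemι H'.1 H'.2.1 y.toAdd).2 ((hmemι H.1 H.2.1 y.toAdd).1 h2)
      have : h = k * P.ι y := by rw [hy]; group
      rw [this]
      exact mul_mem hk.2 h3
    exact fun H H' h => Subtype.ext (le_antisymm (hle _ _ h) (hle _ _ h.symm))
  have hsurj : Function.Surjective Ψ := by
    intro c
    choose y hy using fun i => QuotientAddGroup.mk_surjective (c i)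
    let N : Subgroup G := Λ'.toSubgroup.map P.ι
    have hNn : N.Normal := by
      refine ⟨fun n hn a => ?_⟩
      obtain ⟨w, hw, rfl⟩ := hn
      rw [P.ι_comm, mul_inv_cancel_right]
      exact ⟨w, hw, rfl⟩
    have hNmem : ∀ z : Fin d' → ℤ, P.ι (Multiplicative.ofAdd z) ∈ N ↔ z ∈ Λ' := by
      intro z
      exact Subgroup.mem_map_iff_mem P.ι_injective
    have hcent : ∀ a : G, (P.π a).toAdd ∈ Λ →
        (QuotientGroup.mk a : G ⧸ N) ∈ Subgroup.center (G ⧸ N) := by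
      intro a ha
      rw [Subgroup.mem_center_iff]
      intro q
      obtain ⟨q, rfl⟩ := QuotientGroup.mk_surjective q
      rw [← QuotientGroup.mk_mul, ← QuotientGroup.mk_mul, QuotientGroup.eq]
      have := P.comm_mem_map (hΛ ha) q
      have h2 := hNn.conj_mem _ this (q * a)⁻¹
      have h3 : (q * a)⁻¹ * (a * q * a⁻¹ * q⁻¹) * (q * a)⁻¹⁻¹ = (q * a)⁻¹ * (a * q) := by group
      rwa [h3] at h2
    have hπg : ∀ i, P.π (g i * P.ι (Multiplicative.ofAdd (y i))) =
        Multiplicative.ofAdd (b i : Fin d → ℤ) := by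
      intro i; rw [map_mul, P.π_ι, mul_one, hg]
    let _ : CommGroup (Subgroup.center (G ⧸ N)) :=
      { (inferInstance : Group (Subgroup.center (G ⧸ N))) with
        mul_comm := fun a b => Subtype.ext (Subgroup.mem_center_iff.1 b.2 a) }
    -- The prescribed lifts of the basis extend to a homomorphism from Λ to the centre of G/N,
    -- because that centre is abelian and Λ is free.
    let s0 : Λ →ₗ[ℤ] Additive (Subgroup.center (G ⧸ N)) := b.constr ℤ fun i =>
      Additive.ofMul ⟨(QuotientGroup.mk (g i * P.ι (Multiplicative.ofAdd (y i))) : G ⧸ N),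
        hcent _ (by rw [hπg]; exact (b i).2)⟩
    let s : Multiplicative Λ →* G ⧸ N :=
      (Subgroup.subtype _).comp (AddMonoidHom.toMultiplicative.symm.symm s0.toAddMonoidHom)
    have hs : ∀ i, s (Multiplicative.ofAdd (b i)) =
        QuotientGroup.mk (g i * P.ι (Multiplicative.ofAdd (y i))) := by
      intro i
      have : s0 (b i) = _ := b.constr_basis ℤ _ i
      change ((s0 (b i)).toMul : G ⧸ N) = _
      rw [this]; rfl
    let πq : G ⧸ N →* Multiplicative (Fin d → ℤ) := QuotientGroup.lift N P.π (by
      rintro _ ⟨w, _, rfl⟩; exact P.π_ι w)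
    have hπs : ∀ l : Λ, πq (s (Multiplicative.ofAdd l)) = Multiplicative.ofAdd (l : Fin d → ℤ) := by
      have : (MonoidHom.toAdditive (πq.comp s) : Λ →+ (Fin d → ℤ)).toIntLinearMap =
          Λ.subtype.toIntLinearMap := b.ext fun i => by
        change (πq (s (Multiplicative.ofAdd (b i)))).toAdd = _
        rw [hs]
        exact congrArg Multiplicative.toAdd (hπg i)
      intro l
      exact congrArg Multiplicative.ofAdd (LinearMap.congr_fun this l)
    let Q : Subgroup G := Λ.toSubgroup.comap P.π
    let πQ : Q →* Multiplicative Λ :=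
      { toFun := fun a => Multiplicative.ofAdd ⟨(P.π a).toAdd, a.2⟩
        map_one' := by
          apply Multiplicative.toAdd.injective; apply Subtype.ext; simp
        map_mul' := fun a a' => by
          apply Multiplicative.toAdd.injective; apply Subtype.ext; simp }
    -- H consists of the elements over Λ whose class modulo N is the value of this section.
    let E : Subgroup Q := MonoidHom.eqLocus ((QuotientGroup.mk' N).comp Q.subtype) (s.comp πQ)
    let H : Subgroup G := E.map Q.subtype
    have hH : ∀ a, a ∈ H ↔ ∃ h : (P.π a).toAdd ∈ Λ, (QuotientGroup.mk a : G ⧸ N) =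
        s (Multiplicative.ofAdd ⟨(P.π a).toAdd, h⟩) := by
      intro a
      constructor
      · rintro ⟨a, ha, rfl⟩
        exact ⟨a.2, ha⟩
      · rintro ⟨h, ha⟩
        exact ⟨⟨a, h⟩, ha, rfl⟩
    have h' : H.comap P.ι = Λ'.toSubgroup := by
      ext w
      rw [Subgroup.mem_comap, hH]
      have h0 : (P.π (P.ι w)).toAdd = 0 := by rw [P.π_ι]; rfl
      have : ∀ h : (P.π (P.ι w)).toAdd ∈ Λ, s (Multiplicative.ofAdd ⟨(P.π (P.ι w)).toAdd, h⟩) = 1 := by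
        intro h
        have : (⟨(P.π (P.ι w)).toAdd, h⟩ : Λ) = 0 := Subtype.ext h0
        rw [this]; exact map_one s
      constructor
      · rintro ⟨h, hw⟩
        rw [this, QuotientGroup.eq_one_iff] at hw
        exact (hNmem w.toAdd).1 hw
      · intro hw
        refine ⟨h0 ▸ zero_mem _, ?_⟩
        rw [this, QuotientGroup.eq_one_iff]
        exact (hNmem w.toAdd).2 hw
    have h : H.map P.π = Λ.toSubgroup := by
      ext l
      constructor
      · rintro ⟨a, ha, rfl⟩
        exact ((hH a).1 ha).1
      · intro hl
        obtain ⟨a, ha⟩ := QuotientGroup.mk_surjective (s (Multiplicative.ofAdd ⟨l.toAdd, hl⟩))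
        have hπa : P.π a = l := by
          have := hπs ⟨l.toAdd, hl⟩
          rw [← ha] at this
          exact this
        subst hπa
        exact ⟨a, (hH a).2 ⟨hl, ha⟩, rfl⟩
    refine ⟨⟨H, h', h⟩, ?_⟩
    ext i
    rw [← hy i, eq_comm, hmem, hH]
    refine ⟨by rw [hπg]; exact (b i).2, ?_⟩
    rw [← hs]
    congr 2
    exact Subtype.ext (congrArg Multiplicative.toAdd (hπg i)).symm
  rw [Nat.card_congr (Equiv.ofBijective Ψ ⟨hinj, hsurj⟩), Nat.card_fun, Nat.card_fin]
  rfl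

end CommutatorPresentation

/-! ### The normal zeta function as a sum over sublattices of the centre -/

section

variable {d d' : ℕ} (p : ℕ) (B : Fin d → Fin d → Fin d' → ℤ)

/-- The exponent of the index of `comLat B Λ'`, a power of `p`. -/
def comExp (Λ' : AddSubgroup (Fin d' → ℤ)) : ℕ := Nat.log p (comLat B Λ').index

-- The lattice contains p^k ℤᵈ, so its index is a power of p and the logarithm in `comExp` is exact.
variable {p} in
theorem comLat_index [Fact p.Prime] {Λ' : AddSubgroup (Fin d' → ℤ)} {k : ℕ}
    (h : Λ'.index = p ^ k) : (comLat B Λ').index = p ^ comExp p B Λ' := by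
  have hp : p.Prime := Fact.out
  have hle : (nsmulAddMonoidHom (p ^ k) : (Fin d → ℤ) →+ _).range ≤ comLat B Λ' := by
    rintro _ ⟨x, rfl⟩
    rw [mem_comLat]
    intro j
    rw [nsmulAddMonoidHom_apply, map_nsmul]
    exact nsmul_mem_of_index Λ' h _
  have hdvd := AddSubgroup.index_dvd_of_le hle
  rw [AddSubgroup.index_range_nsmul, ← pow_mul] at hdvd
  obtain ⟨m, -, hm⟩ := (Nat.dvd_prime_pow hp).1 hdvd
  rw [comExp, hm, Nat.log_pow hp.one_lt]

/-- The contribution of the lattices in `s` to the normal zeta function. -/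
def latSum (s : Finset (AddSubgroup (Fin d' → ℤ))) : PowerSeries ℚ :=
  ∑ Λ' ∈ s, PowerSeries.X ^ comExp p B Λ'

theorem card_le_comLat [Fact p.Prime] {Λ' : AddSubgroup (Fin d' → ℤ)} {k : ℕ}
    (h : Λ'.index = p ^ k) (m : ℕ) :
    (Nat.card {Λ : AddSubgroup (Fin d → ℤ) // Λ ≤ comLat B Λ' ∧ Λ.index = p ^ m} : ℚ) =
      PowerSeries.coeff m (zetaZp p d * PowerSeries.X ^ comExp p B Λ') := by
  have hp : p.Prime := Fact.out
  have hX := comLat_index B h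
  rw [PowerSeries.coeff_mul_X_pow']
  split_ifs with hm
  · rw [coeff_zetaZp, ← card_le_of_index (comLat B Λ') (by rw [hX]; exact pow_ne_zero _ hp.ne_zero),
      hX, ← pow_add, Nat.add_sub_cancel' hm]
  · rw [Nat.cast_eq_zero, Nat.card_eq_zero]
    refine Or.inl ⟨?_⟩
    rintro ⟨Λ, hle, hi⟩
    have := AddSubgroup.index_dvd_of_le hle
    rw [hX, hi, Nat.pow_dvd_pow_iff_le_right hp.one_lt] at this
    exact hm this

theorem finite_le_index_eq (Λ₀ : AddSubgroup (Fin d → ℤ)) {m : ℕ} (hm : m ≠ 0) :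
    Finite {Λ : AddSubgroup (Fin d → ℤ) // Λ ≤ Λ₀ ∧ Λ.index = m} :=
  ((finite_setOf_index_eq d m hm).subset fun _ h => h.2).to_subtype

/-- Normal subgroups are sorted by the triple (k, Λ', Λ) with [Z : Λ'] = p^k. Each triple
contributes p^{dk} of them by `card_fibre`, and summing over Λ ≤ `comLat B Λ'` gives the zeta
function of ℤ_pᵈ shifted by `comExp`. -/
theorem localNormalZeta_eq {G : Type*} [Group G] (P : CommutatorPresentation G B) [Fact p.Prime] :
    localNormalZeta p G = zetaZp p d *
      ser (fun k => PowerSeries.C ((p : ℚ) ^ (d * k)) * latSum p B (lats d' (p ^ k))) := by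
  have hp : p.Prime := Fact.out
  ext n
  rw [← ser_mul_left, coeff_ser, localNormalZeta, PowerSeries.coeff_mk]
  let S := Σ (k : Fin (n + 1)) (Λ' : {Λ' : AddSubgroup (Fin d' → ℤ) // Λ'.index = p ^ (k : ℕ)})
    (Λ : {Λ : AddSubgroup (Fin d → ℤ) // Λ ≤ comLat B Λ'.1 ∧ Λ.index = p ^ (n - k)}),
    {H : Subgroup G // H.comap P.ι = Λ'.1.toSubgroup ∧ H.map P.π = Λ.1.toSubgroup}
  let φ : S → {H : Subgroup G // H.Normal ∧ H.index = p ^ n} := fun q =>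
    ⟨q.2.2.2.1, P.normal_of_map_le q.2.2.1.2.1 q.2.2.2.2.1 q.2.2.2.2.2, by
      rw [P.index_eq (P.normal_of_map_le q.2.2.1.2.1 q.2.2.2.2.1 q.2.2.2.2.2) q.2.2.2.2.1
        q.2.2.2.2.2, q.2.1.2, q.2.2.1.2.2, ← pow_add,
        Nat.add_sub_cancel' (Nat.lt_succ_iff.1 q.1.2)]⟩
  have hφ : Function.Bijective φ := by
    constructor
    · rintro ⟨k, ⟨Λ', hΛ'⟩, ⟨Λ, hΛ⟩, ⟨H, h1, h2⟩⟩ ⟨k', ⟨Λ'', hΛ''⟩, ⟨Λ₁, hΛ₁⟩, ⟨H', h1', h2'⟩⟩ h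
      simp only [φ, Subtype.mk.injEq] at h
      subst h
      obtain rfl : Λ' = Λ'' := AddSubgroup.toSubgroup.injective (h1.symm.trans h1')
      obtain rfl : Λ = Λ₁ := AddSubgroup.toSubgroup.injective (h2.symm.trans h2')
      obtain rfl : k = k' := Fin.ext (Nat.pow_right_injective hp.two_le (hΛ'.symm.trans hΛ''))
      rfl
    · rintro ⟨H, hN, hi⟩
      obtain ⟨Λ', h1⟩ := AddSubgroup.toSubgroup.surjective (H.comap P.ι)
      obtain ⟨Λ, h2⟩ := AddSubgroup.toSubgroup.surjective (H.map P.π)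
      have h3 := P.index_eq hN h1.symm h2.symm
      rw [hi] at h3
      obtain ⟨k, hk, hk'⟩ := (Nat.dvd_prime_pow hp).1 (Dvd.intro _ h3.symm)
      refine ⟨⟨⟨k, Nat.lt_succ_of_le hk⟩, ⟨Λ', hk'⟩, ⟨Λ, P.map_le_comLat_of_normal hN h1.symm h2.symm,
        ?_⟩, ⟨H, h1.symm, h2.symm⟩⟩, rfl⟩
      refine Nat.eq_of_mul_eq_mul_left (pow_pos hp.pos k) ?_
      rw [← hk', ← h3, hk', ← pow_add, Nat.add_sub_cancel' hk]
  rw [← Nat.card_congr (Equiv.ofBijective φ hφ)]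
  have hpk : ∀ k, p ^ k ≠ 0 := fun k => pow_ne_zero _ hp.ne_zero
  have fin1 : ∀ k : ℕ, Fintype {Λ' : AddSubgroup (Fin d' → ℤ) // Λ'.index = p ^ k} := fun k =>
    @Fintype.ofFinite _ (finite_setOf_index_eq d' _ (hpk k)).to_subtype
  have fin2 : ∀ (Λ₀ : AddSubgroup (Fin d → ℤ)) (m : ℕ),
      Fintype {Λ : AddSubgroup (Fin d → ℤ) // Λ ≤ Λ₀ ∧ Λ.index = p ^ m} := fun Λ₀ m =>
    @Fintype.ofFinite _ (finite_le_index_eq Λ₀ (hpk m))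
  have card4 : ∀ (k m : ℕ) (Λ' : {Λ' : AddSubgroup (Fin d' → ℤ) // Λ'.index = p ^ k})
      (Λ : {Λ : AddSubgroup (Fin d → ℤ) // Λ ≤ comLat B Λ'.1 ∧ Λ.index = p ^ m}),
      Nat.card {H : Subgroup G // H.comap P.ι = Λ'.1.toSubgroup ∧ H.map P.π = Λ.1.toSubgroup} =
        p ^ (d * k) := by
    intro k m Λ' Λ
    rw [P.card_fibre Λ.2.1 (by rw [Λ.2.2]; exact hpk _), Λ'.2, ← pow_mul, mul_comm]
  have fin4 : ∀ (k m : ℕ) (Λ' : {Λ' : AddSubgroup (Fin d' → ℤ) // Λ'.index = p ^ k})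
      (Λ : {Λ : AddSubgroup (Fin d → ℤ) // Λ ≤ comLat B Λ'.1 ∧ Λ.index = p ^ m}),
      Finite {H : Subgroup G // H.comap P.ι = Λ'.1.toSubgroup ∧ H.map P.π = Λ.1.toSubgroup} :=
    fun k m Λ' Λ => Nat.finite_of_card_ne_zero (by rw [card4]; exact hpk _)
  simp only [S, Nat.card_sigma, card4, Finset.sum_const, smul_eq_mul, Nat.cast_sum,
    Finset.card_univ]
  rw [Fin.sum_univ_eq_sum_range (fun k => ∑ Λ' : {Λ' : AddSubgroup (Fin d' → ℤ) // Λ'.index = p ^ k},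
    ((Fintype.card {Λ : AddSubgroup (Fin d → ℤ) // Λ ≤ comLat B Λ'.1 ∧ Λ.index = p ^ (n - k)} *
      p ^ (d * k) : ℕ) : ℚ))]
  refine Finset.sum_congr rfl fun k _ => ?_
  rw [mul_left_comm, PowerSeries.coeff_C_mul, latSum, Finset.mul_sum, map_sum, Finset.mul_sum]
  have hs := Finset.sum_subtype (F := fin1 k) (lats d' (p ^ k)) (fun Λ' => mem_lats (hpk k)) (fun Λ' =>
    (p : ℚ) ^ (d * k) *
      PowerSeries.coeff (n - k) (zetaZp p d * PowerSeries.X ^ comExp p B Λ'))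
  rw [hs]
  refine Finset.sum_congr rfl fun Λ' _ => ?_
  rw [← card_le_comLat p B Λ'.2, ← Nat.card_eq_fintype_card]
  push_cast; ring

end

/-! ### Lattices in `ℤ³` -/

theorem zmultiples_eq_of_card_prime {V : Type*} [AddGroup V] {p : ℕ} (hp : p.Prime)
    {l : AddSubgroup V} (hl : Nat.card l = p) {x : V} (hx : x ∈ l) (h0 : x ≠ 0) :
    AddSubgroup.zmultiples x = l := by
  have : Fact (Nat.card l).Prime := ⟨hl.symm ▸ hp⟩
  have hle : AddSubgroup.zmultiples x ≤ l := (AddSubgroup.zmultiples_le_of_mem hx)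
  have h1 := ((AddSubgroup.zmultiples x).addSubgroupOf l).eq_bot_or_eq_top_of_prime_card
  rcases h1 with h1 | h1
  · exfalso
    have : (⟨x, hx⟩ : l) ∈ (AddSubgroup.zmultiples x).addSubgroupOf l :=
      AddSubgroup.mem_zmultiples x
    rw [h1, AddSubgroup.mem_bot] at this
    exact h0 (congrArg Subtype.val this)
  · exact le_antisymm hle (AddSubgroup.addSubgroupOf_eq_top.1 h1)

/-- A subgroup of order p outside W has p − 1 non-zero elements, all of them outside W, and every
element outside W generates exactly one such subgroup. -/
theorem card_prime_order_subgroups {V : Type*} [AddCommGroup V] [Finite V] {p : ℕ} (hp : p.Prime)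
    (hV : ∀ x : V, p • x = 0) (W : AddSubgroup V) :
    (p - 1) * Nat.card {l : AddSubgroup V // Nat.card l = p ∧ ¬ l ≤ W} + Nat.card W =
      Nat.card V := by
  classical
  have : Fintype {l : AddSubgroup V // Nat.card l = p ∧ ¬ l ≤ W} := Fintype.ofFinite _
  let φ : (Σ l : {l : AddSubgroup V // Nat.card l = p ∧ ¬ l ≤ W}, {x : l.1 // x ≠ 0}) →
      {x : V // x ∉ W} := fun q => ⟨q.2.1.1, fun h => q.1.2.2 <| by
        rw [← zmultiples_eq_of_card_prime hp q.1.2.1 q.2.1.2 (fun h => q.2.2 (Subtype.ext h))]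
        exact AddSubgroup.zmultiples_le_of_mem h⟩
  have hφ : Function.Bijective φ := by
    constructor
    · rintro ⟨⟨l, hl, hl'⟩, ⟨⟨x, hx⟩, h0⟩⟩ ⟨⟨m, hm, hm'⟩, ⟨⟨y, hy⟩, h0'⟩⟩ h
      simp only [φ, Subtype.mk.injEq] at h
      subst h
      obtain rfl : l = m := by
        rw [← zmultiples_eq_of_card_prime hp hl hx (fun h => h0 (Subtype.ext h)),
          ← zmultiples_eq_of_card_prime hp hm hy (fun h => h0 (Subtype.ext h))]
      rfl
    · rintro ⟨x, hx⟩
      have h0 : x ≠ 0 := fun h => hx (h ▸ zero_mem _)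
      refine ⟨⟨⟨AddSubgroup.zmultiples x, ?_, fun h => hx (h (AddSubgroup.mem_zmultiples x))⟩,
        ⟨⟨x, AddSubgroup.mem_zmultiples x⟩, fun h => h0 (congrArg Subtype.val h)⟩⟩, rfl⟩
      have : Fact p.Prime := ⟨hp⟩
      rw [Nat.card_zmultiples]
      exact addOrderOf_eq_prime (hV x) h0
  have h1 := Nat.card_congr (Equiv.ofBijective φ hφ)
  have h2 : ∀ l : {l : AddSubgroup V // Nat.card l = p ∧ ¬ l ≤ W},
      Nat.card {x : l.1 // x ≠ 0} = p - 1 := by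
    intro l
    have : Fintype l.1 := Fintype.ofFinite _
    rw [Nat.card_eq_fintype_card, Fintype.card_subtype_compl, Fintype.card_subtype_eq,
      ← Nat.card_eq_fintype_card, l.2.1]
  rw [Nat.card_sigma, Finset.sum_congr rfl fun l _ => h2 l, Finset.sum_const, Finset.card_univ,
    smul_eq_mul, ← Nat.card_eq_fintype_card, mul_comm] at h1
  rw [h1]
  have : Fintype V := Fintype.ofFinite _
  rw [Nat.card_eq_fintype_card, Nat.card_eq_fintype_card, Nat.card_eq_fintype_card,
    Fintype.card_subtype_compl]
  refine Nat.sub_add_cancel (Fintype.card_subtype_le _)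

section

variable (p : ℕ)

/-- The lattice `p ℤⁿ`. -/
abbrev pLat (n : ℕ) : AddSubgroup (Fin n → ℤ) := (nsmulAddMonoidHom p).range

/-- The index of `Λ + p ℤ³`. -/
def redIdx (Λ : AddSubgroup (Fin 3 → ℤ)) : ℕ := (Λ ⊔ pLat p 3).index

/-- The lattice `(Λ : p)`. -/
abbrev colon (Λ : AddSubgroup (Fin 3 → ℤ)) : AddSubgroup (Fin 3 → ℤ) :=
  Λ.comap (nsmulAddMonoidHom p)

theorem pLat_index (n : ℕ) : (pLat p n).index = p ^ n := by
  rw [AddSubgroup.index_range_nsmul]; simp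

/-- (Λ : p) is the preimage of Λ under multiplication by p, so its index is that of Λ in Λ + pℤ³. -/
theorem redIdx_mul_index_colon (Λ : AddSubgroup (Fin 3 → ℤ)) :
    redIdx p Λ * (colon p Λ).index = Λ.index := by
  rw [colon, AddSubgroup.index_comap, redIdx, ← AddSubgroup.relIndex_mul_index
    (le_sup_left : Λ ≤ Λ ⊔ pLat p 3), AddSubgroup.relIndex_sup_left, mul_comm]

variable {p}

theorem nsmul_injective (hp : p ≠ 0) (n : ℕ) :
    Function.Injective (nsmulAddMonoidHom p : (Fin n → ℤ) →+ _) := by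
  intro x y h
  ext i
  have := congrFun h i
  simpa [hp] using this

theorem index_map_nsmul (hp : p ≠ 0) {n : ℕ} (Λ : AddSubgroup (Fin n → ℤ)) :
    (Λ.map (nsmulAddMonoidHom p)).index = p ^ n * Λ.index := by
  rw [AddSubgroup.index_map, (AddMonoidHom.ker_eq_bot_iff _).2 (nsmul_injective hp n), sup_bot_eq,
    mul_comm]
  congr 1
  exact pLat_index p n

theorem redIdx_mem (hp : p.Prime) (Λ : AddSubgroup (Fin 3 → ℤ)) :
    redIdx p Λ = 1 ∨ redIdx p Λ = p ∨ redIdx p Λ = p ^ 2 ∨ redIdx p Λ = p ^ 3 := by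
  have h : redIdx p Λ ∣ p ^ 3 :=
    pLat_index p 3 ▸ AddSubgroup.index_dvd_of_le (le_sup_right : pLat p 3 ≤ Λ ⊔ pLat p 3)
  obtain ⟨m, hm, h⟩ := (Nat.dvd_prime_pow hp).1 h
  interval_cases m <;> simp_all

/-- A form of Nakayama's lemma: Λ + pℤ³ = ℤ³ iterates to Λ + pᵐℤ³ = ℤ³ for all m, and p^k ℤ³ already
lies in Λ. -/
theorem eq_top_of_redIdx_eq_one {Λ : AddSubgroup (Fin 3 → ℤ)} {k : ℕ} (h : Λ.index = p ^ k)
    (h1 : redIdx p Λ = 1) : Λ = ⊤ := by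
  rw [redIdx, AddSubgroup.index_eq_one] at h1
  have key : ∀ m : ℕ, Λ ⊔ pLat (p ^ m) 3 = ⊤ := by
    intro m
    induction m with
    | zero => rw [eq_top_iff]; exact fun x _ => AddSubgroup.mem_sup_right ⟨x, by simp⟩
    | succ m ih =>
      rw [eq_top_iff]
      intro x _
      have hx : x ∈ Λ ⊔ pLat (p ^ m) 3 := ih ▸ AddSubgroup.mem_top x
      obtain ⟨a, ha, _, ⟨b, rfl⟩, rfl⟩ := AddSubgroup.mem_sup.1 hx
      have hb : b ∈ Λ ⊔ pLat p 3 := h1 ▸ AddSubgroup.mem_top b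
      obtain ⟨c, hc, _, ⟨e, rfl⟩, rfl⟩ := AddSubgroup.mem_sup.1 hb
      refine AddSubgroup.mem_sup.2 ⟨a + p ^ m • c, add_mem ha (nsmul_mem hc _), p ^ (m + 1) • e,
        ⟨e, rfl⟩, ?_⟩
      simp [pow_succ, mul_smul, add_assoc]
  rw [← key k, eq_comm, sup_eq_left]
  rintro _ ⟨x, rfl⟩
  exact nsmul_mem_of_index Λ h x

theorem le_pLat_of_redIdx (hp : p ≠ 0) {Λ : AddSubgroup (Fin 3 → ℤ)} (h : redIdx p Λ = p ^ 3) :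
    Λ ≤ pLat p 3 := by
  have h1 := AddSubgroup.relIndex_mul_index (le_sup_right : pLat p 3 ≤ Λ ⊔ pLat p 3)
  rw [pLat_index, ← h, redIdx] at h1
  have h2 : (pLat p 3).relIndex (Λ ⊔ pLat p 3) = 1 := by
    refine Nat.eq_of_mul_eq_mul_right (m := (Λ ⊔ pLat p 3).index) ?_ (by rw [h1, one_mul])
    refine Nat.pos_of_ne_zero ?_
    change redIdx p Λ ≠ 0
    rw [h]; exact pow_ne_zero _ hp
  exact le_sup_left.trans (AddSubgroup.relIndex_eq_one.1 h2)

/-- The lattices over `Λ₁` of reduction rank `1` correspond to the lines of `Λ₁/pΛ₁` outside the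
image of `p ℤ³`. -/
theorem card_colon_fibre (hp : p.Prime) (Λ₁ : AddSubgroup (Fin 3 → ℤ)) (h₁ : Λ₁.index ≠ 0) :
    (p - 1) * Nat.card {Λ : AddSubgroup (Fin 3 → ℤ) // colon p Λ = Λ₁ ∧ redIdx p Λ = p ^ 2} +
      redIdx p Λ₁ = p ^ 3 := by
  let N : AddSubgroup Λ₁ := (nsmulAddMonoidHom p : Λ₁ →+ Λ₁).range
  have hNmap : N.map Λ₁.subtype = Λ₁.map (nsmulAddMonoidHom p) := by
    ext x
    constructor
    · rintro ⟨_, ⟨y, rfl⟩, rfl⟩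
      exact ⟨y.1, y.2, by simp⟩
    · rintro ⟨y, hy, rfl⟩
      exact ⟨p • ⟨y, hy⟩, ⟨⟨y, hy⟩, rfl⟩, by simp⟩
  have hNi : N.index = p ^ 3 := by
    have h := AddSubgroup.index_map_subtype N
    rw [hNmap, index_map_nsmul hp.ne_zero] at h
    exact (Nat.eq_of_mul_eq_mul_right (Nat.pos_of_ne_zero h₁) h).symm
  have hfin : Finite (Λ₁ ⧸ N) :=
    AddSubgroup.index_ne_zero_iff_finite.1 (by rw [hNi]; exact pow_ne_zero _ hp.ne_zero)
  let q : Λ₁ →+ Λ₁ ⧸ N := QuotientAddGroup.mk' N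
  have hq : Function.Surjective q := QuotientAddGroup.mk'_surjective N
  have hqker : q.ker = N := QuotientAddGroup.ker_mk' N
  let W₀ : AddSubgroup Λ₁ := (pLat p 3).addSubgroupOf Λ₁
  have hNW : N ≤ W₀ := by
    rintro _ ⟨y, rfl⟩
    exact ⟨y.1, by simp⟩
  let W : AddSubgroup (Λ₁ ⧸ N) := W₀.map q
  have hWcomap : W.comap q = W₀ := by
    rw [AddSubgroup.comap_map_eq, hqker, sup_eq_left]; exact hNW
  have hV : ∀ x : Λ₁ ⧸ N, p • x = 0 := by
    intro x
    obtain ⟨x, rfl⟩ := hq x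
    rw [← map_nsmul, ← AddMonoidHom.mem_ker, hqker]
    exact ⟨x, rfl⟩
  have hcardV : Nat.card (Λ₁ ⧸ N) = p ^ 3 := hNi
  have hcardW : Nat.card W = redIdx p Λ₁ := by
    have h1 : W.index * Nat.card W = p ^ 3 := by rw [← hcardV]; exact W.index_mul_card
    have h2 : W.index = (pLat p 3).relIndex Λ₁ := by
      rw [← AddSubgroup.index_comap_of_surjective W hq, hWcomap]; rfl
    have h3 := AddSubgroup.relIndex_mul_index (le_sup_right : pLat p 3 ≤ Λ₁ ⊔ pLat p 3)
    rw [AddSubgroup.relIndex_sup_right, pLat_index, ← h1, ← h2] at h3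
    refine (Nat.eq_of_mul_eq_mul_left ?_ h3).symm
    exact Nat.pos_of_ne_zero fun h => by
      rw [h, zero_mul] at h1; exact pow_ne_zero 3 hp.ne_zero h1.symm
  have key := card_prime_order_subgroups hp hV W
  rw [hcardV, hcardW] at key
  rw [← key]
  congr 2
  have hle : ∀ Λ : AddSubgroup (Fin 3 → ℤ), colon p Λ = Λ₁ → Λ ≤ Λ₁ := by
    rintro Λ rfl x hx
    exact nsmul_mem hx p
  have hNle : ∀ Λ : AddSubgroup (Fin 3 → ℤ), colon p Λ = Λ₁ → N ≤ Λ.addSubgroupOf Λ₁ := by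
    rintro Λ hΛ _ ⟨⟨y, hy⟩, rfl⟩
    rw [← hΛ] at hy
    exact hy
  have hcardl : ∀ l : AddSubgroup (Λ₁ ⧸ N), (((l.comap q).map Λ₁.subtype).index) * Nat.card l =
      p ^ 3 * Λ₁.index := by
    intro l
    rw [AddSubgroup.index_map_subtype, AddSubgroup.index_comap_of_surjective l hq, ← hcardV,
      ← l.index_mul_card]
    ring
  have hinv : ∀ Λ : AddSubgroup (Fin 3 → ℤ), colon p Λ = Λ₁ →
      (((Λ.addSubgroupOf Λ₁).map q).comap q).map Λ₁.subtype = Λ := by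
    intro Λ hΛ
    rw [AddSubgroup.comap_map_eq, hqker, sup_eq_left.2 (hNle Λ hΛ),
      AddSubgroup.map_addSubgroupOf_eq_of_le (hle Λ hΛ)]
  refine Nat.card_congr (Equiv.ofBijective (fun Λ => ⟨(Λ.1.addSubgroupOf Λ₁).map q, ?_, ?_⟩)
    ⟨?_, ?_⟩)
  · obtain ⟨Λ, hΛ, hr⟩ := Λ
    have h1 := hcardl ((Λ.addSubgroupOf Λ₁).map q)
    rw [hinv Λ hΛ, ← redIdx_mul_index_colon p Λ, hΛ, hr] at h1
    refine Nat.eq_of_mul_eq_mul_left (Nat.pos_of_ne_zero (n := p ^ 2 * Λ₁.index)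
      (mul_ne_zero (pow_ne_zero _ hp.ne_zero) h₁)) (h1.trans (by ring))
  · obtain ⟨Λ, hΛ, hr⟩ := Λ
    intro hlW
    rw [AddSubgroup.map_le_iff_le_comap, hWcomap] at hlW
    have : Λ ≤ pLat p 3 := fun x hx => hlW (x := ⟨x, hle Λ hΛ hx⟩) hx
    rw [redIdx, sup_eq_right.2 this, pLat_index] at hr
    exact absurd (Nat.pow_right_injective hp.two_le hr) (by norm_num)
  · rintro ⟨Λ, hΛ, hr⟩ ⟨Λ', hΛ', hr'⟩ h
    simp only [Subtype.mk.injEq] at h ⊢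
    rw [← hinv Λ hΛ, ← hinv Λ' hΛ', h]
  · rintro ⟨l, hl, hlW⟩
    -- If px lies in the preimage of l but not in pΛ₁, its class generates l, which would then lie
    -- in W. So exactly the x in Λ₁ satisfy px ∈ Λ.
    have hcolon : colon p ((l.comap q).map Λ₁.subtype) = Λ₁ := by
      ext x
      constructor
      · rintro ⟨⟨y, hy⟩, hyl, hyx⟩
        have hyx : y = p • x := hyx
        have h1 : q ⟨y, hy⟩ = 0 := by
          by_contra h0
          refine hlW ?_
          rw [← zmultiples_eq_of_card_prime hp hl hyl h0]
          exact AddSubgroup.zmultiples_le_of_mem ⟨⟨y, hy⟩, ⟨x, hyx.symm⟩, rfl⟩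
        rw [← AddMonoidHom.mem_ker, hqker] at h1
        obtain ⟨z, hz⟩ := h1
        have hz : p • z.1 = y := congrArg Subtype.val hz
        rw [hyx] at hz
        rw [← nsmul_injective hp.ne_zero 3 hz]
        exact z.2
      · intro hx
        refine ⟨p • ⟨x, hx⟩, ?_, by simp⟩
        change q (p • _) ∈ l
        rw [map_nsmul, hV]; exact zero_mem _
    refine ⟨⟨(l.comap q).map Λ₁.subtype, hcolon, ?_⟩, Subtype.ext ?_⟩
    · have h1 := hcardl l
      rw [hl, ← redIdx_mul_index_colon p, hcolon] at h1
      refine Nat.eq_of_mul_eq_mul_right (Nat.pos_of_ne_zero (n := p * Λ₁.index)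
        (mul_ne_zero hp.ne_zero h₁)) (by linear_combination h1)
    · change (((l.comap q).map Λ₁.subtype).addSubgroupOf Λ₁).map q = l
      have : ((l.comap q).map Λ₁.subtype).addSubgroupOf Λ₁ = l.comap q :=
        AddSubgroup.comap_map_eq_self_of_injective Λ₁.subtype_injective _
      rw [this, AddSubgroup.map_comap_eq_self_of_surjective hq]

end

theorem ser_shift_of_eq_zero {D : ℕ → PowerSeries ℚ} {m : ℕ} (h : ∀ k < m, D k = 0) :
    ser D = PowerSeries.X ^ m * ser (fun k => D (k + m)) := by
  induction m generalizing D with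
  | zero => simp
  | succ m ih =>
    rw [ser_shift, h 0 (Nat.succ_pos m), zero_add, ih (fun k hk => h (k + 1) (by omega)),
      pow_succ', mul_assoc]
    simp only [add_assoc]

/-! ### Sorting the lattices by their rank modulo p -/

section

variable {d : ℕ} {p : ℕ} [hp : Fact p.Prime] (B : Fin d → Fin d → Fin 3 → ℤ)

variable (p) in
/-- The contribution of the lattices `Λ` of index `pᵏ` with `[ℤ³ : Λ + pℤ³] = pʲ`. -/
def cdSum (j k : ℕ) : PowerSeries ℚ :=
  latSum p B ((lats 3 (p ^ k)).filter fun Λ => redIdx p Λ = p ^ j)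

variable (p) in
/-- The generating series of the lattices `Λ` with `[ℤ³ : Λ + pℤ³] = pʲ`. -/
def cdSeries (j : ℕ) : PowerSeries ℚ :=
  ser fun k => PowerSeries.C ((p : ℚ) ^ (d * k)) * cdSum p B j k

theorem mem_lats_pow {n k : ℕ} {Λ : AddSubgroup (Fin n → ℤ)} : Λ ∈ lats n (p ^ k) ↔
    Λ.index = p ^ k := mem_lats (pow_ne_zero _ hp.out.ne_zero)

theorem latSum_lats (k : ℕ) : latSum p B (lats 3 (p ^ k)) =
    cdSum p B 0 k + cdSum p B 1 k + cdSum p B 2 k + cdSum p B 3 k := by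
  have h1 := hp.out.one_lt
  have hinj := Nat.pow_right_injective hp.out.two_le
  simp only [cdSum, latSum, Finset.sum_filter, ← Finset.sum_add_distrib]
  refine Finset.sum_congr rfl fun Λ _ => ?_
  have h2 := redIdx_mem hp.out Λ
  obtain ⟨j, hj, hj'⟩ : ∃ j < 4, redIdx p Λ = p ^ j := by
    rcases h2 with h | h | h | h
    exacts [⟨0, by norm_num, by simpa using h⟩, ⟨1, by norm_num, by simpa using h⟩,
      ⟨2, by norm_num, h⟩, ⟨3, by norm_num, h⟩]
  simp only [hj', hinj.eq_iff]
  interval_cases j <;> simp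

omit hp in
theorem comExp_top : comExp p B ⊤ = 0 := by
  have : comLat B (⊤ : AddSubgroup (Fin 3 → ℤ)) = ⊤ := by
    rw [eq_top_iff]; exact fun x _ => mem_comLat.2 fun j => AddSubgroup.mem_top _
  rw [comExp, this, AddSubgroup.index_top, Nat.log_one_right]

theorem cdSum_eq_zero {j k : ℕ} (h : k < j) : cdSum p B j k = 0 := by
  rw [cdSum, latSum, Finset.filter_eq_empty_iff.2, Finset.sum_empty]
  intro Λ hΛ hr
  rw [mem_lats_pow] at hΛ
  have := redIdx_mul_index_colon p Λ
  rw [hΛ, hr] at this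
  have h2 : p ^ j ∣ p ^ k := Dvd.intro _ this
  rw [Nat.pow_dvd_pow_iff_le_right hp.out.one_lt] at h2
  omega

theorem cdSum_zero (k : ℕ) : cdSum p B 0 k = if k = 0 then 1 else 0 := by
  have hsub : ∀ Λ, Λ ∈ (lats 3 (p ^ k)).filter (fun Λ => redIdx p Λ = p ^ 0) ↔
      Λ = ⊤ ∧ k = 0 := by
    intro Λ
    rw [Finset.mem_filter, mem_lats_pow, pow_zero]
    constructor
    · rintro ⟨h, h1⟩
      have := eq_top_of_redIdx_eq_one h h1
      subst this
      rw [AddSubgroup.index_top] at h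
      exact ⟨rfl, by simpa [hp.out.one_lt.ne'] using h.symm⟩
    · rintro ⟨rfl, rfl⟩
      simp [redIdx]
  rw [cdSum, latSum]
  split_ifs with hk
  · have : (lats 3 (p ^ k)).filter (fun Λ => redIdx p Λ = p ^ 0) = {⊤} := by
      ext Λ; rw [hsub, Finset.mem_singleton]; simp [hk]
    rw [this, Finset.sum_singleton, comExp_top, pow_zero]
  · rw [Finset.eq_empty_of_forall_notMem fun Λ h => hk ((hsub Λ).1 h).2, Finset.sum_empty]

variable {B} (hdiv : ∀ Λ : AddSubgroup (Fin 3 → ℤ), p ^ 2 ∣ redIdx p Λ →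
  ∀ x ∈ comLat B Λ, ∃ y, x = p • y)

include hdiv

/-- By `hdiv`, which `dvd_of_noLine` supplies when the reduced curve contains no line, the lattice
attached to Λ is p times the one attached to (Λ : p). Multiplication by p costs a factor pᵈ in the
index. -/
theorem comExp_colon {Λ : AddSubgroup (Fin 3 → ℤ)} {k : ℕ} (h : Λ.index = p ^ k)
    (hr : p ^ 2 ∣ redIdx p Λ) : comExp p B Λ = d + comExp p B (colon p Λ) := by
  have h0 : comLat B Λ = (comLat B (colon p Λ)).map (nsmulAddMonoidHom p) := by
    ext x
    constructor
    · intro hx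
      obtain ⟨y, rfl⟩ := hdiv Λ hr x hx
      refine ⟨y, mem_comLat.2 fun j => ?_, rfl⟩
      have := mem_comLat.1 hx j
      rw [map_nsmul] at this
      exact this
    · rintro ⟨y, hy, rfl⟩
      refine mem_comLat.2 fun j => ?_
      have := mem_comLat.1 hy j
      rw [nsmulAddMonoidHom_apply, map_nsmul]
      exact this
  have h1 : (colon p Λ).index ∣ p ^ k := by
    rw [← h, ← redIdx_mul_index_colon p Λ]; exact Dvd.intro_left _ rfl
  obtain ⟨m, -, hm⟩ := (Nat.dvd_prime_pow hp.out).1 h1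
  rw [comExp, h0, index_map_nsmul hp.out.ne_zero, comLat_index B hm, ← pow_add,
    Nat.log_pow hp.out.one_lt]

/-- The lattices contained in pℤ³ are the pΛ₁, with (pΛ₁ : p) = Λ₁. -/
theorem cdSum_three (k : ℕ) : cdSum p B 3 (k + 3) = PowerSeries.X ^ d * latSum p B (lats 3 (p ^ k)) := by
  rw [cdSum, latSum, latSum, Finset.mul_sum]
  refine Finset.sum_bij (fun Λ _ => colon p Λ) ?_ ?_ ?_ ?_
  · intro Λ hΛ
    rw [Finset.mem_filter, mem_lats_pow] at hΛ
    rw [mem_lats_pow]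
    have := redIdx_mul_index_colon p Λ
    rw [hΛ.1, hΛ.2, pow_add, mul_comm] at this
    exact Nat.eq_of_mul_eq_mul_right (pow_pos hp.out.pos 3) this
  · intro Λ hΛ Λ' hΛ' h
    rw [Finset.mem_filter] at hΛ hΛ'
    have key : ∀ Λ : AddSubgroup (Fin 3 → ℤ), redIdx p Λ = p ^ 3 →
        (colon p Λ).map (nsmulAddMonoidHom p) = Λ := by
      intro Λ hr
      rw [AddSubgroup.map_comap_eq, inf_eq_right]
      exact le_pLat_of_redIdx hp.out.ne_zero hr
    rw [← key Λ hΛ.2, ← key Λ' hΛ'.2, h]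
  · intro Λ hΛ
    rw [mem_lats_pow] at hΛ
    refine ⟨Λ.map (nsmulAddMonoidHom p), ?_, ?_⟩
    · rw [Finset.mem_filter, mem_lats_pow, index_map_nsmul hp.out.ne_zero, hΛ, pow_add, mul_comm]
      refine ⟨rfl, ?_⟩
      have : Λ.map (nsmulAddMonoidHom p) ≤ pLat p 3 := by
        rintro _ ⟨x, _, rfl⟩; exact ⟨x, rfl⟩
      rw [redIdx, sup_eq_right.2 this, pLat_index]
    · exact AddSubgroup.comap_map_eq_self_of_injective (nsmul_injective hp.out.ne_zero 3) _
  · intro Λ hΛ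
    rw [Finset.mem_filter, mem_lats_pow] at hΛ
    rw [comExp_colon hdiv hΛ.1 (hΛ.2 ▸ pow_dvd_pow p (by norm_num)), pow_add]

/-- The fibre of Λ ↦ (Λ : p) over Λ₁ has (p³ − `redIdx p Λ₁`)/(p − 1) elements by
`card_colon_fibre`. It is empty when Λ₁ ⊆ pℤ³, so no fourth term appears. -/
theorem cdSum_two (k : ℕ) : PowerSeries.C ((p : ℚ) - 1) * cdSum p B 2 (k + 2) =
    PowerSeries.X ^ d * (PowerSeries.C ((p : ℚ) ^ 3 - 1) * cdSum p B 0 k +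
      PowerSeries.C ((p : ℚ) ^ 3 - p) * cdSum p B 1 k +
      PowerSeries.C ((p : ℚ) ^ 3 - p ^ 2) * cdSum p B 2 k) := by
  classical
  have hinj := Nat.pow_right_injective hp.out.two_le
  have hmaps : ∀ Λ ∈ (lats 3 (p ^ (k + 2))).filter (fun Λ => redIdx p Λ = p ^ 2),
      colon p Λ ∈ lats 3 (p ^ k) := by
    intro Λ hΛ
    rw [Finset.mem_filter, mem_lats_pow] at hΛ
    rw [mem_lats_pow]
    have := redIdx_mul_index_colon p Λ
    rw [hΛ.1, hΛ.2, pow_add, mul_comm] at this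
    exact Nat.eq_of_mul_eq_mul_right (pow_pos hp.out.pos 2) this
  have hfib : ∀ Λ₁ ∈ lats 3 (p ^ k), (((lats 3 (p ^ (k + 2))).filter
      (fun Λ => redIdx p Λ = p ^ 2)).filter fun Λ => colon p Λ = Λ₁).card * ((p : ℚ) - 1) =
      p ^ 3 - redIdx p Λ₁ := by
    intro Λ₁ h₁
    rw [mem_lats_pow] at h₁
    have key := card_colon_fibre hp.out Λ₁ (by rw [h₁]; exact pow_ne_zero _ hp.out.ne_zero)
    rw [Nat.subtype_card (((lats 3 (p ^ (k + 2))).filter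
      (fun Λ => redIdx p Λ = p ^ 2)).filter fun Λ => colon p Λ = Λ₁)] at key
    · rw [← Nat.cast_pow, ← key]
      push_cast [Nat.cast_sub hp.out.one_lt.le]
      ring
    · intro Λ
      rw [Finset.mem_filter, Finset.mem_filter, mem_lats_pow]
      refine ⟨fun h => ⟨h.2, h.1.2⟩, fun h => ⟨⟨?_, h.2⟩, h.1⟩⟩
      rw [← redIdx_mul_index_colon p Λ, h.1, h.2, h₁]; ring
  have hlhs : PowerSeries.C ((p : ℚ) - 1) * cdSum p B 2 (k + 2) = PowerSeries.X ^ d *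
      ∑ Λ₁ ∈ lats 3 (p ^ k), PowerSeries.C ((p : ℚ) ^ 3 - redIdx p Λ₁) *
        PowerSeries.X ^ comExp p B Λ₁ := by
    rw [cdSum, latSum, ← Finset.sum_fiberwise_of_maps_to hmaps, Finset.mul_sum, Finset.mul_sum]
    refine Finset.sum_congr rfl fun Λ₁ h₁ => ?_
    have : ∀ Λ ∈ ((lats 3 (p ^ (k + 2))).filter
        (fun Λ => redIdx p Λ = p ^ 2)).filter (fun Λ => colon p Λ = Λ₁),
        (PowerSeries.X : PowerSeries ℚ) ^ comExp p B Λ =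
          PowerSeries.X ^ d * PowerSeries.X ^ comExp p B Λ₁ := by
      intro Λ hΛ
      rw [Finset.mem_filter, Finset.mem_filter, mem_lats_pow] at hΛ
      rw [comExp_colon hdiv hΛ.1.1 hΛ.1.2.symm.dvd, hΛ.2, pow_add]
    rw [Finset.sum_congr rfl this, Finset.sum_const, ← hfib Λ₁ h₁, nsmul_eq_mul, map_mul,
      map_natCast]
    ring
  rw [hlhs]
  congr 1
  simp only [cdSum, latSum, Finset.sum_filter, Finset.mul_sum, ← Finset.sum_add_distrib]
  refine Finset.sum_congr rfl fun Λ _ => ?_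
  have h2 := redIdx_mem hp.out Λ
  obtain ⟨j, hj, hj'⟩ : ∃ j < 4, redIdx p Λ = p ^ j := by
    rcases h2 with h | h | h | h
    exacts [⟨0, by norm_num, by simpa using h⟩, ⟨1, by norm_num, by simpa using h⟩,
      ⟨2, by norm_num, h⟩, ⟨3, by norm_num, h⟩]
  simp only [hj', hinj.eq_iff]
  interval_cases j <;> simp

omit hdiv in
theorem cdSeries_zero : cdSeries p B 0 = 1 := by
  rw [cdSeries, ser_shift]
  simp only [cdSum_zero]
  simp only [Nat.add_eq_zero_iff, one_ne_zero, and_false, if_false, mul_zero, if_true, pow_zero,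
    map_one, mul_one]
  have : ser (fun _ => 0) = 0 := by ext; simp [coeff_ser]
  rw [this, mul_zero, add_zero]

/-- Passing from (Λ : p) to Λ multiplies the index by p² and raises `comExp` by d, which explains
the factor p^{2d} T^{d+2}. Together with `cdSeries_three` this reduces everything to the lattices
with cyclic quotient. -/
theorem cdSeries_two : PowerSeries.C ((p : ℚ) - 1) * cdSeries p B 2 =
    PowerSeries.C ((p : ℚ) ^ (2 * d)) * PowerSeries.X ^ (d + 2) *
    (PowerSeries.C ((p : ℚ) ^ 3 - 1) + PowerSeries.C ((p : ℚ) ^ 3 - p) * cdSeries p B 1 +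
      PowerSeries.C ((p : ℚ) ^ 3 - p ^ 2) * cdSeries p B 2) := by
  have h0 : PowerSeries.C ((p : ℚ) ^ 3 - 1) = PowerSeries.C ((p : ℚ) ^ 3 - 1) * cdSeries p B 0 := by
    rw [cdSeries_zero, mul_one]
  rw [h0]
  conv_lhs => rw [cdSeries, ser_shift_of_eq_zero (m := 2) (fun k hk => by
    rw [cdSum_eq_zero B hk, mul_zero])]
  rw [mul_left_comm, ← ser_mul_left]
  simp only [cdSeries, mul_assoc]
  rw [pow_add, mul_comm (PowerSeries.X ^ d), mul_assoc, mul_left_comm]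
  congr 1
  simp only [← ser_mul_left, ← ser_add]
  congr 1
  ext1 k
  rw [mul_left_comm, cdSum_two hdiv, mul_add d, pow_add, map_mul, mul_comm d 2]
  ring

theorem cdSeries_three : cdSeries p B 3 =
    PowerSeries.C ((p : ℚ) ^ (3 * d)) * PowerSeries.X ^ (d + 3) *
    (cdSeries p B 0 + cdSeries p B 1 + cdSeries p B 2 + cdSeries p B 3) := by
  conv_lhs => rw [cdSeries, ser_shift_of_eq_zero (m := 3) (fun k hk => by
    rw [cdSum_eq_zero B hk, mul_zero])]
  rw [mul_assoc, pow_add, mul_comm (PowerSeries.X ^ d), mul_assoc, mul_left_comm]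
  congr 1
  simp only [cdSeries, ← ser_mul_left, ← ser_add]
  congr 1
  ext1 k
  rw [cdSum_three hdiv, mul_add d, pow_add, map_mul, mul_comm d 3, latSum_lats]
  ring

omit hdiv in
theorem localNormalZeta_eq_cdSeries {G : Type*} [Group G] (P : CommutatorPresentation G B) :
    localNormalZeta p G = zetaZp p d *
      (cdSeries p B 0 + cdSeries p B 1 + cdSeries p B 2 + cdSeries p B 3) := by
  rw [localNormalZeta_eq p B P]
  simp only [cdSeries, ← ser_add]
  congr 2
  ext1 k
  rw [latSum_lats]
  ring

end

/-! ### Lattices with cyclic quotient -/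

/-- The lattice of integral vectors on which the linear form `α` is divisible by `n`. -/
def cyc (α : Fin 3 → ℤ) (n : ℕ) : AddSubgroup (Fin 3 → ℤ) where
  carrier := {z | (n : ℤ) ∣ α ⬝ᵥ z}
  zero_mem' := by simp
  add_mem' {x y} hx hy := by
    simp only [Set.mem_ofPred_eq, dotProduct_add] at *
    exact dvd_add hx hy
  neg_mem' {x} hx := by simpa using hx

theorem mem_cyc {α : Fin 3 → ℤ} {n : ℕ} {z : Fin 3 → ℤ} : z ∈ cyc α n ↔ (n : ℤ) ∣ α ⬝ᵥ z := Iff.rfl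

section

variable {p : ℕ} [hp : Fact p.Prime]

/-- The coordinates of `α` are not all divisible by `p`. -/
def Prim (p : ℕ) (α : Fin 3 → ℤ) : Prop := ∃ i, ¬ (p : ℤ) ∣ α i

theorem isCoprime_pow {u : ℤ} (hu : ¬ (p : ℤ) ∣ u) (c : ℕ) : IsCoprime u ((p ^ c : ℕ) : ℤ) := by
  push_cast
  refine IsCoprime.pow_right ?_
  rw [isCoprime_comm]
  exact (Nat.prime_iff_prime_int.1 hp.out).coprime_iff_not_dvd.2 hu

theorem exists_inv {u : ℤ} (hu : ¬ (p : ℤ) ∣ u) (c : ℕ) :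
    ∃ v : ℤ, ((p ^ c : ℕ) : ℤ) ∣ 1 - v * u := by
  obtain ⟨a, b, h⟩ := isCoprime_pow hu c
  exact ⟨a, b, by linear_combination -h⟩

theorem Prim.exists_dot {α : Fin 3 → ℤ} (h : Prim p α) (c : ℕ) :
    ∃ z, ((p ^ c : ℕ) : ℤ) ∣ 1 - α ⬝ᵥ z := by
  obtain ⟨i, hi⟩ := h
  obtain ⟨v, hv⟩ := exists_inv hi c
  exact ⟨Pi.single i v, by simpa [mul_comm] using hv⟩

theorem cyc_index {α : Fin 3 → ℤ} (h : Prim p α) (c : ℕ) : (cyc α (p ^ c)).index = p ^ c := by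
  let f : (Fin 3 → ℤ) →+ ZMod (p ^ c) :=
    { toFun := fun z => ((α ⬝ᵥ z : ℤ) : ZMod (p ^ c))
      map_zero' := by simp
      map_add' := fun x y => by simp [dotProduct_add] }
  have hker : f.ker = cyc α (p ^ c) := by
    ext z
    rw [AddMonoidHom.mem_ker, mem_cyc]
    exact ZMod.intCast_zmod_eq_zero_iff_dvd _ _
  have hsurj : Function.Surjective f := by
    intro y
    obtain ⟨m, rfl⟩ := ZMod.intCast_surjective y
    obtain ⟨z, hz⟩ := h.exists_dot c
    refine ⟨m • z, ?_⟩
    change ((α ⬝ᵥ (m • z) : ℤ) : ZMod (p ^ c)) = m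
    rw [ZMod.intCast_eq_intCast_iff_dvd_sub, dotProduct_smul, smul_eq_mul]
    simpa [mul_sub] using hz.mul_left m
  rw [← hker, AddSubgroup.index_ker, AddMonoidHom.range_eq_top.2 hsurj]
  simp

theorem cyc_sup_pLat (α : Fin 3 → ℤ) (h : Prim p α) {c : ℕ} (hc : 1 ≤ c) :
    cyc α (p ^ c) ⊔ pLat p 3 = cyc α p := by
  apply le_antisymm
  · refine sup_le (fun z hz => ?_) ?_
    · rw [mem_cyc] at *
      exact dvd_trans (Int.natCast_dvd_natCast.2 (dvd_pow_self p (by omega))) hz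
    · rintro _ ⟨x, rfl⟩
      rw [mem_cyc, nsmulAddMonoidHom_apply, dotProduct_smul]
      simp
  · intro z hz
    rw [mem_cyc] at hz
    obtain ⟨t, ht⟩ := hz
    obtain ⟨y, hy⟩ := h.exists_dot c
    refine AddSubgroup.mem_sup.2 ⟨z - (p * t) • y, ?_, (p * t) • y, ⟨t • y, ?_⟩, sub_add_cancel _ _⟩
    · rw [mem_cyc, dotProduct_sub, dotProduct_smul, ht, smul_eq_mul]
      have := hy.mul_left (p * t)
      rwa [mul_sub, mul_one] at this
    · ext i; simp [mul_assoc]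

theorem cyc_redIdx {α : Fin 3 → ℤ} (h : Prim p α) {c : ℕ} (hc : 1 ≤ c) :
    redIdx p (cyc α (p ^ c)) = p := by
  rw [redIdx, cyc_sup_pLat α h hc]
  simpa using cyc_index h 1

/-- Since Λ + pℤ³ has index p, any vector outside it generates ℤ³/Λ. The quotient is therefore
cyclic of order p^c, and Λ is the kernel of a surjective character to ℤ/p^c whose coefficients form
α. -/
theorem exists_eq_cyc {Λ : AddSubgroup (Fin 3 → ℤ)} {c : ℕ} (hc : 1 ≤ c) (hi : Λ.index = p ^ c)
    (hr : redIdx p Λ = p) : ∃ α, Prim p α ∧ Λ = cyc α (p ^ c) := by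
  obtain ⟨g, hg⟩ : ∃ g, g ∉ Λ ⊔ pLat p 3 := by
    by_contra! h
    have : Λ ⊔ pLat p 3 = ⊤ := eq_top_iff.2 fun x _ => h x
    rw [redIdx, this, AddSubgroup.index_top] at hr
    exact hp.out.one_lt.ne hr
  have htop : Λ ⊔ AddSubgroup.zmultiples g = ⊤ := by
    have h1 : (Λ ⊔ AddSubgroup.zmultiples g).index ∣ p ^ c :=
      (AddSubgroup.index_dvd_of_le le_sup_left).trans (dvd_of_eq hi)
    obtain ⟨m, -, hm⟩ := (Nat.dvd_prime_pow hp.out).1 h1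
    refine eq_top_of_redIdx_eq_one hm ?_
    have h2 : redIdx p (Λ ⊔ AddSubgroup.zmultiples g) ∣ p :=
      (AddSubgroup.index_dvd_of_le (sup_le_sup_right le_sup_left _)).trans (dvd_of_eq hr)
    refine ((Nat.dvd_prime hp.out).1 h2).resolve_right fun h3 => hg ?_
    have hle : Λ ⊔ pLat p 3 ≤ Λ ⊔ AddSubgroup.zmultiples g ⊔ pLat p 3 :=
      sup_le_sup_right le_sup_left _
    have h4 := AddSubgroup.relIndex_mul_index hle
    rw [redIdx] at h3 hr
    rw [h3, hr] at h4
    have h5 := AddSubgroup.relIndex_eq_one.1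
      (Nat.eq_of_mul_eq_mul_right hp.out.pos (h4.trans (one_mul p).symm))
    exact h5 (AddSubgroup.mem_sup_left (AddSubgroup.mem_sup_right (AddSubgroup.mem_zmultiples g)))
  let q := QuotientAddGroup.mk' Λ
  have hcyc : IsAddCyclic ((Fin 3 → ℤ) ⧸ Λ) := by
    refine ⟨⟨q g, fun x => ?_⟩⟩
    obtain ⟨x, rfl⟩ := QuotientAddGroup.mk'_surjective Λ x
    have hx : x ∈ Λ ⊔ AddSubgroup.zmultiples g := htop ▸ AddSubgroup.mem_top x
    obtain ⟨l, hl, _, ⟨n, rfl⟩, rfl⟩ := AddSubgroup.mem_sup.1 hx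
    refine ⟨n, ?_⟩
    have : q l = 0 := (QuotientAddGroup.eq_zero_iff l).2 hl
    change n • q g = q (l + n • g)
    rw [map_add, this, zero_add, map_zsmul]
  have hcard : Nat.card ((Fin 3 → ℤ) ⧸ Λ) = p ^ c := hi
  let e : ZMod (p ^ c) ≃+ (Fin 3 → ℤ) ⧸ Λ := (hcard ▸ zmodAddCyclicAddEquiv hcyc)
  let f : (Fin 3 → ℤ) →+ ZMod (p ^ c) := e.symm.toAddMonoidHom.comp q
  choose α hα using fun i => ZMod.intCast_surjective (f (Pi.single i 1))
  have hf : ∀ z, f z = ((α ⬝ᵥ z : ℤ) : ZMod (p ^ c)) := by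
    intro z
    have : z = ∑ i, z i • (Pi.single i 1 : Fin 3 → ℤ) := by
      ext j; simp [Finset.sum_apply, Pi.single_apply]
    conv_lhs => rw [this]
    rw [map_sum, dotProduct, Int.cast_sum]
    refine Finset.sum_congr rfl fun i _ => ?_
    rw [map_zsmul, ← hα]
    simp [mul_comm]
  have hΛ : Λ = cyc α (p ^ c) := by
    ext z
    rw [mem_cyc, ← ZMod.intCast_zmod_eq_zero_iff_dvd, ← hf]
    change _ ↔ e.symm (q z) = 0
    rw [map_eq_zero_iff _ e.symm.injective]
    exact (QuotientAddGroup.eq_zero_iff z).symm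
  refine ⟨α, ?_, hΛ⟩
  by_contra h
  simp only [Prim, not_exists, not_not] at h
  refine hg (AddSubgroup.mem_sup_left ?_)
  exfalso
  have hle : cyc α p = ⊤ := by
    rw [eq_top_iff]
    intro z _
    rw [mem_cyc]
    exact Finset.dvd_sum fun i _ => (h i).mul_right _
  have hcont : ∀ z, f z = 1 → False := by
    intro z hz
    rw [hf] at hz
    have h1 : ((p ^ c : ℕ) : ℤ) ∣ α ⬝ᵥ z - 1 := by
      rw [← ZMod.intCast_eq_intCast_iff_dvd_sub]; simpa using hz.symm
    have h2 : (p : ℤ) ∣ α ⬝ᵥ z := by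
      have : z ∈ cyc α p := hle ▸ AddSubgroup.mem_top z
      exact this
    have h3 : (p : ℤ) ∣ α ⬝ᵥ z - 1 :=
      dvd_trans (Int.natCast_dvd_natCast.2 (dvd_pow_self p (by omega))) h1
    have h4 := dvd_sub h2 h3
    rw [sub_sub_cancel] at h4
    exact hp.out.one_lt.ne' (by exact_mod_cast Int.eq_one_of_dvd_one (by positivity) h4)
  have hfs : Function.Surjective f := e.symm.surjective.comp (QuotientAddGroup.mk'_surjective Λ)
  obtain ⟨z, hz⟩ := hfs 1
  exact hcont z hz

/-- Take z with α·z ≡ 1 and u = β·z. The vectors eᵢ − αᵢ z lie in the common lattice, and evaluating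
β on them gives βᵢ ≡ u αᵢ. -/
theorem exists_unit_of_cyc_eq {α β : Fin 3 → ℤ} (hα : Prim p α) {c : ℕ} (hc : 1 ≤ c)
    (hβ : Prim p β) (h : cyc α (p ^ c) = cyc β (p ^ c)) :
    ∃ u : ℤ, ¬ (p : ℤ) ∣ u ∧ ∀ i, ((p ^ c : ℕ) : ℤ) ∣ β i - u * α i := by
  obtain ⟨z, hz⟩ := hα.exists_dot c
  have key : ∀ i, ((p ^ c : ℕ) : ℤ) ∣ β i - (β ⬝ᵥ z) * α i := by
    intro i
    have h1 : (Pi.single i 1 - α i • z : Fin 3 → ℤ) ∈ cyc α (p ^ c) := by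
      rw [mem_cyc, dotProduct_sub, dotProduct_smul]
      simpa [mul_sub] using hz.mul_left (α i)
    rw [h, mem_cyc, dotProduct_sub, dotProduct_smul] at h1
    simpa [mul_comm] using h1
  refine ⟨β ⬝ᵥ z, fun hu => ?_, key⟩
  obtain ⟨i, hi⟩ := hβ
  refine hi ?_
  have h3 : (p : ℤ) ∣ β i - (β ⬝ᵥ z) * α i :=
    dvd_trans (Int.natCast_dvd_natCast.2 (dvd_pow_self p (by omega))) (key i)
  exact (dvd_sub_left (hu.mul_right _)).1 h3

theorem cyc_congr {α β : Fin 3 → ℤ} {n : ℕ} (h : ∀ i, (n : ℤ) ∣ β i - α i) :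
    cyc α n = cyc β n := by
  ext z
  rw [mem_cyc, mem_cyc]
  have : (n : ℤ) ∣ β ⬝ᵥ z - α ⬝ᵥ z := by
    rw [← sub_dotProduct]; exact Finset.dvd_sum fun i _ => (h i).mul_right _
  exact (dvd_iff_dvd_of_dvd_sub this).symm

theorem cyc_smul {α : Fin 3 → ℤ} {u : ℤ} (hu : ¬ (p : ℤ) ∣ u) (c : ℕ) :
    cyc (u • α) (p ^ c) = cyc α (p ^ c) := by
  ext z
  rw [mem_cyc, mem_cyc, smul_dotProduct, smul_eq_mul]
  exact ⟨fun h => (isCoprime_pow hu c).symm.dvd_of_dvd_mul_left h, fun h => h.mul_left _⟩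

/-- A frame at a point of `ℙ²(𝔽_p)`: integral vectors `w, e₁, e₂` that are independent modulo `p`,
with `w` lifting the point. -/
structure Frame (p : ℕ) [Fact p.Prime] (P : Projectivization (ZMod p) (Fin 3 → ZMod p)) where
  w : Fin 3 → ℤ
  e₁ : Fin 3 → ℤ
  e₂ : Fin 3 → ℤ
  det_unit : ¬ (p : ℤ) ∣ (Matrix.of ![w, e₁, e₂]).det
  red_w : ∃ u : ZMod p, u ≠ 0 ∧ ∀ i, (w i : ZMod p) = u * P.rep i

namespace Frame

variable {P : Projectivization (ZMod p) (Fin 3 → ZMod p)} (fr : Frame p P)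

/-- The point with affine coordinates `(A, B)` in the frame. -/
def pt (A B : ℤ) : Fin 3 → ℤ := fr.w + A • fr.e₁ + B • fr.e₂

theorem dvd_of_comb {n : ℕ} (hn : IsCoprime (Matrix.of ![fr.w, fr.e₁, fr.e₂]).det (n : ℤ))
    {s t r : ℤ} (h : ∀ i, (n : ℤ) ∣ s * fr.w i + t * fr.e₁ i + r * fr.e₂ i) :
    (n : ℤ) ∣ s ∧ (n : ℤ) ∣ t ∧ (n : ℤ) ∣ r := by
  set M := Matrix.of ![fr.w, fr.e₁, fr.e₂] with hM
  have h1 : ∀ i, (n : ℤ) ∣ Matrix.vecMul ![s, t, r] M i := by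
    intro i
    have : Matrix.vecMul ![s, t, r] M i = s * fr.w i + t * fr.e₁ i + r * fr.e₂ i := by
      simp [Matrix.vecMul, dotProduct, Fin.sum_univ_three, hM]
    rw [this]; exact h i
  have h2 : ∀ i, (n : ℤ) ∣ M.det * (![s, t, r] : Fin 3 → ℤ) i := by
    intro i
    have h3 : Matrix.vecMul (Matrix.vecMul ![s, t, r] M) M.adjugate = M.det • ![s, t, r] := by
      rw [Matrix.vecMul_vecMul, Matrix.mul_adjugate, Matrix.vecMul_smul, Matrix.vecMul_one]
    have h4 := congrFun h3 i
    rw [Pi.smul_apply, smul_eq_mul] at h4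
    rw [← h4, Matrix.vecMul, dotProduct]
    exact Finset.dvd_sum fun j _ => (h1 j).mul_right _
  have h5 : ∀ i, (n : ℤ) ∣ (![s, t, r] : Fin 3 → ℤ) i := fun i =>
    hn.symm.dvd_of_dvd_mul_left (h2 i)
  exact ⟨h5 0, h5 1, h5 2⟩

theorem exists_comb {n : ℕ} (hn : IsCoprime (Matrix.of ![fr.w, fr.e₁, fr.e₂]).det (n : ℤ))
    (α : Fin 3 → ℤ) : ∃ s t r : ℤ, ∀ i, (n : ℤ) ∣ α i - (s * fr.w i + t * fr.e₁ i + r * fr.e₂ i) := by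
  set M := Matrix.of ![fr.w, fr.e₁, fr.e₂] with hM
  obtain ⟨a, b, hab⟩ := hn
  let v := a • Matrix.vecMul α M.adjugate
  refine ⟨v 0, v 1, v 2, fun i => ?_⟩
  have : v 0 * fr.w i + v 1 * fr.e₁ i + v 2 * fr.e₂ i = Matrix.vecMul v M i := by
    simp [Matrix.vecMul, dotProduct, Fin.sum_univ_three, hM]
  rw [this]
  have h1 : Matrix.vecMul v M = (a * M.det) • α := by
    rw [Matrix.smul_vecMul, Matrix.vecMul_vecMul, Matrix.adjugate_mul, Matrix.vecMul_smul,
      Matrix.vecMul_one, smul_smul]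
  rw [h1]
  refine ⟨b * α i, ?_⟩
  simp only [Pi.smul_apply, smul_eq_mul]
  linear_combination (-α i) * hab

theorem prim_pt (A B : ℤ) : Prim p (fr.pt (p * A) (p * B)) := by
  by_contra h
  simp only [Prim, not_exists, not_not] at h
  have h1 := fr.dvd_of_comb (n := p) (s := 1) (t := p * A) (r := p * B)
    (by simpa using isCoprime_pow fr.det_unit 1) (fun i => by simpa [pt] using h i)
  exact hp.out.one_lt.ne' (by exact_mod_cast Int.eq_one_of_dvd_one (by positivity) h1.1)

theorem intCast_pt (A B : ℤ) (i : Fin 3) :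
    ((fr.pt (p * A) (p * B) i : ℤ) : ZMod p) = (fr.w i : ZMod p) := by
  simp [pt]

end Frame

instance : Fintype (Projectivization (ZMod p) (Fin 3 → ZMod p)) := Fintype.ofFinite _

variable (fr : ∀ P : Projectivization (ZMod p) (Fin 3 → ZMod p), Frame p P)

/-- The lattices with cyclic quotient of order p^{c+1} are the points of ℙ²(ℤ/p^{c+1}). Those
reducing to P have a unique representative w + pa e₁ + pb e₂ with a and b modulo p^c. -/
theorem sum_cyclic_lats {M : Type*} [AddCommMonoid M] (φ : AddSubgroup (Fin 3 → ℤ) → M) (c : ℕ) :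
    ∑ Λ ∈ (lats 3 (p ^ (c + 1))).filter (fun Λ => redIdx p Λ = p ^ 1), φ Λ =
      ∑ P : Projectivization (ZMod p) (Fin 3 → ZMod p), ∑ a ∈ Finset.range (p ^ c),
        ∑ b ∈ Finset.range (p ^ c), φ (cyc ((fr P).pt (p * a) (p * b)) (p ^ (c + 1))) := by
  have hc : 1 ≤ c + 1 := by omega
  have hpc : 0 < p ^ c := pow_pos hp.out.pos c
  have hpp : (p : ℤ) ∣ ((p ^ (c + 1) : ℕ) : ℤ) :=
    Int.natCast_dvd_natCast.2 (dvd_pow_self p (by omega))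
  simp_rw [← Finset.sum_product']
  symm
  refine Finset.sum_bij (fun q _ => cyc ((fr q.1).pt (p * (q.2.1 : ℤ)) (p * (q.2.2 : ℤ)))
    (p ^ (c + 1))) ?_ ?_ ?_ ?_
  · rintro ⟨P, a, b⟩ -
    rw [Finset.mem_filter, mem_lats_pow, cyc_index ((fr P).prim_pt _ _),
      cyc_redIdx ((fr P).prim_pt _ _) hc, pow_one]
    exact ⟨rfl, rfl⟩
  · rintro ⟨P, a, b⟩ h ⟨P', a', b'⟩ h' heq
    simp only [Finset.mem_product, Finset.mem_univ, Finset.mem_range, true_and] at h h'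
    obtain ⟨u, hu, hu'⟩ := exists_unit_of_cyc_eq ((fr P).prim_pt _ _) hc ((fr P').prim_pt _ _) heq
    have hPP : P = P' := by
      obtain ⟨v, hv, hvw⟩ := (fr P).red_w
      obtain ⟨v', hv', hvw'⟩ := (fr P').red_w
      rw [← P.mk_rep, ← P'.mk_rep, eq_comm, Projectivization.mk_eq_mk_iff']
      refine ⟨v'⁻¹ * u * v, ?_⟩
      ext i
      have h1 := dvd_trans hpp (hu' i)
      rw [← ZMod.intCast_zmod_eq_zero_iff_dvd, Int.cast_sub, Int.cast_mul, Frame.intCast_pt,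
        Frame.intCast_pt, hvw, hvw', sub_eq_zero] at h1
      rw [Pi.smul_apply, smul_eq_mul, mul_assoc, mul_assoc, ← h1, inv_mul_cancel_left₀ hv']
    subst hPP
    have h2 := (fr P).dvd_of_comb (isCoprime_pow (fr P).det_unit (c + 1)) (s := 1 - u)
      (t := p * a' - u * (p * a)) (r := p * b' - u * (p * b)) (fun i => by
        have := hu' i
        simp only [Frame.pt, Pi.add_apply, Pi.smul_apply, smul_eq_mul] at this
        exact this.trans (dvd_of_eq (by ring)))
    have key : ∀ a a' : ℕ, a < p ^ c → a' < p ^ c →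
        ((p ^ (c + 1) : ℕ) : ℤ) ∣ (p : ℤ) * a' - u * (p * a) → a = a' := by
      intro a a' ha ha' hd
      have h3 : ((p ^ (c + 1) : ℕ) : ℤ) ∣ (p : ℤ) * (a' - a) := by
        have := dvd_sub hd (h2.1.mul_right ((p : ℤ) * a))
        exact this.trans (dvd_of_eq (by ring))
      rw [pow_succ, mul_comm, Nat.cast_mul, mul_dvd_mul_iff_left
        (by exact_mod_cast hp.out.ne_zero)] at h3
      have h4 := (Nat.modEq_iff_dvd (n := p ^ c) (a := a) (b := a')).2 h3
      rwa [Nat.ModEq, Nat.mod_eq_of_lt ha, Nat.mod_eq_of_lt ha'] at h4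
    rw [key a a' h.1 h'.1 h2.2.1, key b b' h.2 h'.2 h2.2.2]
  · intro Λ hΛ
    rw [Finset.mem_filter, mem_lats_pow, pow_one] at hΛ
    obtain ⟨α, hα, rfl⟩ := exists_eq_cyc hc hΛ.1 hΛ.2
    have hα0 : (fun i => (α i : ZMod p)) ≠ 0 := by
      obtain ⟨i, hi⟩ := hα
      intro h
      exact hi ((ZMod.intCast_zmod_eq_zero_iff_dvd _ _).1 (congrFun h i))
    let P := Projectivization.mk (ZMod p) (fun i => (α i : ZMod p)) hα0
    obtain ⟨v, hv, hvw⟩ := (fr P).red_w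
    have hrep : ∃ x : ZMod p, ∀ i, (α i : ZMod p) = x * ((fr P).w i) := by
      have h1 : Projectivization.mk (ZMod p) P.rep P.rep_nonzero =
          Projectivization.mk (ZMod p) (fun i => (α i : ZMod p)) hα0 := P.mk_rep
      rw [eq_comm, Projectivization.mk_eq_mk_iff'] at h1
      obtain ⟨y, hy⟩ := h1
      refine ⟨y * v⁻¹, fun i => ?_⟩
      rw [hvw, mul_assoc, inv_mul_cancel_left₀ hv, ← congrFun hy i]; rfl
    obtain ⟨x, hx⟩ := hrep
    obtain ⟨x, rfl⟩ := ZMod.intCast_surjective x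
    obtain ⟨s, t, r, hstr⟩ := (fr P).exists_comb (isCoprime_pow (fr P).det_unit (c + 1)) α
    have h2 := (fr P).dvd_of_comb (n := p) (by simpa using isCoprime_pow (fr P).det_unit 1)
      (s := s - x) (t := t) (r := r) (fun i => by
        have h3 := dvd_trans hpp (hstr i)
        have h4 : (p : ℤ) ∣ α i - x * (fr P).w i := by
          rw [← ZMod.intCast_zmod_eq_zero_iff_dvd]; simp [hx]
        have := dvd_sub h4 h3
        exact this.trans (dvd_of_eq (by ring)))
    obtain ⟨h2s, ⟨t', rfl⟩, ⟨r', rfl⟩⟩ := h2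
    have hs : ¬ (p : ℤ) ∣ s := by
      intro hs
      obtain ⟨i, hi⟩ := hα
      refine hi ?_
      have hx0 : (p : ℤ) ∣ x := (dvd_sub_right hs).1 h2s
      rw [← ZMod.intCast_zmod_eq_zero_iff_dvd] at hx0 ⊢
      rw [hx, hx0, zero_mul]
    -- Divide by the unit coefficient of w, so that the representative takes the form w + p(…).
    obtain ⟨s', hs'⟩ := exists_inv hs (c + 1)
    have hsp : ¬ (p : ℤ) ∣ s' := by
      intro h
      have h5 := dvd_trans hpp hs'
      have h6 := (dvd_sub_left (h.mul_right s)).1 h5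
      exact hp.out.one_lt.ne' (by exact_mod_cast Int.eq_one_of_dvd_one (by positivity) h6)
    have hpos : (0 : ℤ) < ((p ^ c : ℕ) : ℤ) := by exact_mod_cast hpc
    have hlift : ∀ y : ℤ, ∃ a : ℕ, a < p ^ c ∧ ((p ^ (c + 1) : ℕ) : ℤ) ∣ p * (a : ℤ) - p * y := by
      intro y
      refine ⟨(y % ((p ^ c : ℕ) : ℤ)).toNat, ?_, ?_⟩
      · have := Int.emod_lt_of_pos y hpos
        have h0 := Int.emod_nonneg y hpos.ne'
        omega
      · rw [Int.toNat_of_nonneg (Int.emod_nonneg y hpos.ne'), ← mul_sub, pow_succ, mul_comm (p ^ c),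
          Nat.cast_mul]
        refine mul_dvd_mul_left _ ?_
        rw [← dvd_neg, neg_sub]
        exact Int.dvd_self_sub_emod
    obtain ⟨a, ha, ha'⟩ := hlift (s' * t')
    obtain ⟨b, hb, hb'⟩ := hlift (s' * r')
    refine ⟨⟨P, a, b⟩, by simp [ha, hb], ?_⟩
    rw [← cyc_smul hsp (c + 1) (α := α)]
    refine cyc_congr fun i => ?_
    simp only [Frame.pt, Pi.add_apply, Pi.smul_apply, smul_eq_mul]
    have e1 := (hstr i).mul_left s'
    have e2 := hs'.mul_right ((fr P).w i)
    have e3 := ha'.mul_right ((fr P).e₁ i)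
    have e4 := hb'.mul_right ((fr P).e₂ i)
    have := dvd_sub (dvd_sub (dvd_sub e1 e2) e3) e4
    exact this.trans (dvd_of_eq (by ring))
  · rintro ⟨P, a, b⟩ -
    rfl

end

/-! ### Kernels of skew-symmetric matrices -/

section KerCard

variable {R : Type*} [CommRing R] {ι κ : Type*} [Fintype ι] [Fintype κ] [DecidableEq ι]
  [DecidableEq κ]

/-- The number of row vectors killed by a matrix. -/
def kerCard (M : Matrix ι ι R) : ℕ := Nat.card {x : ι → R // Matrix.vecMul x M = 0}

theorem kerCard_mul_mul (P M Q : Matrix ι ι R) (hP : IsUnit P.det) (hQ : IsUnit Q.det) :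
    kerCard (P * M * Q) = kerCard M := by
  refine Nat.card_congr ⟨fun x => ⟨Matrix.vecMul x.1 P, ?_⟩,
    fun x => ⟨Matrix.vecMul x.1 P⁻¹, ?_⟩, fun x => Subtype.ext ?_, fun x => Subtype.ext ?_⟩
  · obtain ⟨x, hx⟩ := x
    have h := congrArg (fun y => Matrix.vecMul y Q⁻¹) hx
    simp only [Matrix.vecMul_vecMul, Matrix.zero_vecMul] at h ⊢
    rwa [Matrix.mul_assoc, Matrix.mul_nonsing_inv _ hQ, Matrix.mul_one] at h
  · rw [Matrix.vecMul_vecMul, Matrix.mul_assoc, Matrix.nonsing_inv_mul_cancel_left _ _ hP,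
      ← Matrix.vecMul_vecMul, x.2, Matrix.zero_vecMul]
  · simp [Matrix.vecMul_vecMul, Matrix.mul_nonsing_inv _ hP]
  · simp [Matrix.vecMul_vecMul, Matrix.nonsing_inv_mul _ hP]

omit [DecidableEq ι] [DecidableEq κ] in
theorem kerCard_submatrix (M : Matrix ι ι R) (e : κ ≃ ι) :
    kerCard (M.submatrix e e) = kerCard M := by
  refine Nat.card_congr ((Equiv.arrowCongr e (Equiv.refl R)).subtypeEquiv fun x => ?_)
  have : Matrix.vecMul x (M.submatrix e e) =
      Matrix.vecMul (Equiv.arrowCongr e (Equiv.refl R) x) M ∘ e := by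
    ext j
    simp only [Matrix.vecMul, dotProduct, Function.comp, Matrix.submatrix_apply]
    exact Fintype.sum_equiv e _ _ (by simp)
  rw [this]
  constructor
  · intro h
    ext j
    have := congrFun h (e.symm j)
    simpa using this
  · intro h
    rw [h]; rfl

omit [DecidableEq κ] in
theorem kerCard_fromBlocks (A : Matrix ι ι R) (D : Matrix κ κ R) (hA : IsUnit A.det) :
    kerCard (Matrix.fromBlocks A 0 0 D) = kerCard D := by
  have key : ∀ x : ι ⊕ κ → R, Matrix.vecMul x (Matrix.fromBlocks A 0 0 D) = 0 ↔
      x ∘ Sum.inl = 0 ∧ Matrix.vecMul (x ∘ Sum.inr) D = 0 := by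
    intro x
    rw [Matrix.vecMul_fromBlocks]
    constructor
    · intro h
      have h1 : Matrix.vecMul (x ∘ Sum.inl) A = 0 := by
        ext i; simpa using congrFun h (Sum.inl i)
      refine ⟨?_, by ext i; simpa using congrFun h (Sum.inr i)⟩
      have h2 := congrArg (fun y => Matrix.vecMul y A⁻¹) h1
      simpa [Matrix.vecMul_vecMul, Matrix.mul_nonsing_inv _ hA] using h2
    · rintro ⟨h1, h2⟩
      rw [h1, h2]
      ext (i | i) <;> simp
  refine Nat.card_congr ⟨fun x => ⟨x.1 ∘ Sum.inr, ((key x.1).1 x.2).2⟩,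
    fun y => ⟨Sum.elim 0 y.1, (key _).2 ⟨rfl, y.2⟩⟩, fun x => Subtype.ext ?_, fun y => rfl⟩
  ext (i | i)
  · simpa using (congrFun ((key x.1).1 x.2).1 i).symm
  · rfl

end KerCard

/-- A skew-symmetric matrix over a field is congruent to an invertible matrix bordered by zeros. -/
theorem exists_skew_normal_form {K : Type*} [Field K] {ι : Type*} [Fintype ι] [DecidableEq ι]
    (M : Matrix ι ι K) (hM : M.transpose = -M) :
    ∃ (k l : ℕ) (e : Fin k ⊕ Fin l ≃ ι) (P : Matrix (Fin k ⊕ Fin l) (Fin k ⊕ Fin l) K)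
      (A : Matrix (Fin k) (Fin k) K), IsUnit P.det ∧ IsUnit A.det ∧
      P * M.submatrix e e * P.transpose = Matrix.fromBlocks A 0 0 0 := by
  -- W is the radical of the form; the form is non-degenerate on any complement V.
  let W : Submodule K (ι → K) := LinearMap.ker M.vecMulLinear
  obtain ⟨V, hV⟩ := Submodule.exists_isCompl W
  let bV := Module.finBasis K V
  let bW := Module.finBasis K W
  let b : Module.Basis _ K (ι → K) := (bV.prod bW).map (Submodule.prodEquivOfIsCompl V W hV.symm)
  let e : Fin (Module.finrank K V) ⊕ Fin (Module.finrank K W) ≃ ι :=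
    b.indexEquiv (Pi.basisFun K ι)
  have hbl : ∀ i, b (Sum.inl i) = bV i := by intro i; simp [b]
  have hbr : ∀ i, b (Sum.inr i) = bW i := by intro i; simp [b]
  let P : Matrix _ _ K := Matrix.of fun i j => b i (e j)
  have hPM : ∀ i, P i ∘ e.symm = b i := by intro i; ext j; simp [P]
  have hP : IsUnit P.det := by
    have h1 : P = (((Pi.basisFun K ι).reindex e.symm).toMatrix b).transpose := by
      ext i j
      simp [P, Module.Basis.toMatrix_apply]
    rw [h1, Matrix.det_transpose, ← Module.Basis.det_apply]
    exact Module.Basis.isUnit_det _ _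
  have hentry : ∀ i j, (P * M.submatrix e e * P.transpose) i j = (Matrix.vecMul (b i) M) ⬝ᵥ b j := by
    intro i j
    have h1 : (P * M.submatrix e e) i = (Matrix.vecMul (b i) M) ∘ e := by
      rw [← hPM]
      ext k
      simp only [Matrix.mul_apply, Matrix.submatrix_apply, Function.comp, Matrix.vecMul, dotProduct]
      exact Fintype.sum_equiv e _ _ (by simp)
    rw [Matrix.mul_apply]
    simp_rw [h1]
    rw [dotProduct]
    refine Fintype.sum_equiv e _ _ fun k => ?_
    simp [P]
  have hskew : ∀ x y : ι → K, Matrix.vecMul x M ⬝ᵥ y = -(Matrix.vecMul y M ⬝ᵥ x) := by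
    intro x y
    rw [← Matrix.dotProduct_mulVec, ← Matrix.vecMul_transpose, hM, Matrix.vecMul_neg,
      dotProduct_neg, dotProduct_comm]
  have hW : ∀ i, Matrix.vecMul (b (Sum.inr i)) M = 0 := by
    intro i
    rw [hbr]
    exact LinearMap.mem_ker.1 (bW i).2
  have hblock : P * M.submatrix e e * P.transpose =
      Matrix.fromBlocks (P * M.submatrix e e * P.transpose).toBlocks₁₁ 0 0 0 := by
    ext (i | i) (j | j)
    · rfl
    · rw [hentry, hskew, hW]; simp
    · rw [hentry, hW]; simp
    · rw [hentry, hW]; simp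
  refine ⟨_, _, e, P, _, hP, ?_, hblock⟩
  set A := (P * M.submatrix e e * P.transpose).toBlocks₁₁ with hA
  rw [isUnit_iff_ne_zero]
  intro hdet
  obtain ⟨v, hv, hvA⟩ := Matrix.exists_vecMul_eq_zero_iff.2 hdet
  let y : ι → K := ∑ i, v i • b (Sum.inl i)
  have hyV : y ∈ V := Submodule.sum_mem _ fun i _ => Submodule.smul_mem _ _ (by rw [hbl]; exact (bV i).2)
  have hy0 : ∀ j, Matrix.vecMul y M ⬝ᵥ b j = 0 := by
    rintro (j | j)
    · have := congrFun hvA j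
      simp only [Matrix.vecMul, dotProduct] at this
      simp only [y, Matrix.sum_vecMul, sum_dotProduct, Matrix.smul_vecMul, smul_dotProduct,
        smul_eq_mul]
      refine Eq.trans (Finset.sum_congr rfl fun i _ => ?_) this
      rw [← hentry]; rfl
    · rw [hskew, hW]; simp
  have hyW : y ∈ W := by
    refine LinearMap.mem_ker.2 ?_
    change Matrix.vecMul y M = 0
    have : ∀ z, Matrix.vecMul y M ⬝ᵥ z = 0 := by
      intro z
      rw [← b.sum_repr z, dotProduct_sum]
      exact Finset.sum_eq_zero fun j _ => by rw [dotProduct_smul, hy0, smul_zero]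
    exact dotProduct_eq_zero _ this
  have hy : y = 0 := by
    have := hV.symm.disjoint.le_bot ⟨hyV, hyW⟩
    exact this
  have hli := Fintype.linearIndependent_iff.1 (b.linearIndependent.comp Sum.inl Sum.inl_injective) v hy
  exact hv (funext hli)

theorem even_of_skew {K : Type*} [Field K] (h2 : (2 : K) ≠ 0) {k : ℕ} (A : Matrix (Fin k) (Fin k) K)
    (hA : A.transpose = -A) (hu : IsUnit A.det) : Even k := by
  by_contra hk
  rw [Nat.not_even_iff_odd] at hk
  have h := congrArg Matrix.det hA
  rw [Matrix.det_transpose, Matrix.det_neg, Fintype.card_fin, hk.neg_one_pow] at h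
  have : 2 * A.det = 0 := by linear_combination h
  exact hu.ne_zero ((mul_eq_zero.1 this).resolve_left h2)

theorem rank_fromBlocks_zero {K : Type*} [Field K] {k l : ℕ} (A : Matrix (Fin k) (Fin k) K)
    (hA : IsUnit A.det) :
    (Matrix.fromBlocks A 0 0 (0 : Matrix (Fin l) (Fin l) K)).rank = k := by
  classical
  have h1 : Matrix.fromBlocks A 0 0 (0 : Matrix (Fin l) (Fin l) K) =
      Matrix.fromBlocks A 0 0 1 * Matrix.fromBlocks 1 0 0 0 := by
    simp [Matrix.fromBlocks_multiply]
  have hdet : IsUnit (Matrix.fromBlocks A 0 0 (1 : Matrix (Fin l) (Fin l) K)).det := by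
    simpa [Matrix.det_fromBlocks_zero₁₂] using hA
  rw [h1, Matrix.rank_mul_eq_right_of_isUnit_det _ _ hdet]
  have h2 : Matrix.fromBlocks (1 : Matrix (Fin k) (Fin k) K) 0 0 (0 : Matrix (Fin l) (Fin l) K) =
      Matrix.diagonal (Sum.elim 1 0) := by
    rw [← Matrix.diagonal_one, ← Matrix.diagonal_zero, Matrix.fromBlocks_diagonal]
    rfl
  rw [h2, Matrix.rank_diagonal, Fintype.card_subtype]
  have : (Finset.univ.filter fun i : Fin k ⊕ Fin l => (Sum.elim 1 0 : _ → K) i ≠ 0) =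
      Finset.univ.map Function.Embedding.inl := by
    ext (i | i) <;> simp
  rw [this, Finset.card_map, Finset.card_univ, Fintype.card_fin]

section Padic

variable {p : ℕ} [hp : Fact p.Prime] {ι : Type*} [Fintype ι] [DecidableEq ι]

/-- The size of the kernel of a matrix over `ℤ_p` modulo `pᶜ`. -/
def kc (c : ℕ) (M : Matrix ι ι ℤ_[p]) : ℕ := kerCard (M.map (PadicInt.toZModPow c))

theorem isUnit_of_toZMod_ne_zero {x : ℤ_[p]} (h : PadicInt.toZMod x ≠ 0) : IsUnit x := by
  by_contra hx
  refine h ?_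
  rw [← RingHom.mem_ker, PadicInt.ker_toZMod]
  exact hx

theorem toZMod_eq_zero_iff {x : ℤ_[p]} : PadicInt.toZMod x = 0 ↔ (p : ℤ_[p]) ∣ x := by
  rw [← RingHom.mem_ker, PadicInt.ker_toZMod, PadicInt.maximalIdeal_eq_span_p,
    Ideal.mem_span_singleton]

theorem toZModPow_eq_zero_iff {c : ℕ} {x : ℤ_[p]} :
    PadicInt.toZModPow c x = 0 ↔ (p : ℤ_[p]) ^ c ∣ x := by
  rw [← RingHom.mem_ker, PadicInt.ker_toZModPow, Ideal.mem_span_singleton]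

theorem kc_mul_mul (c : ℕ) (P M Q : Matrix ι ι ℤ_[p]) (hP : IsUnit P.det) (hQ : IsUnit Q.det) :
    kc c (P * M * Q) = kc c M := by
  rw [kc, Matrix.map_mul, Matrix.map_mul, kerCard_mul_mul]
  · rfl
  · exact RingHom.map_det (PadicInt.toZModPow c) P ▸ hP.map _
  · exact RingHom.map_det (PadicInt.toZModPow c) Q ▸ hQ.map _

omit [DecidableEq ι] in
theorem kc_submatrix {κ : Type*} [Fintype κ] (c : ℕ) (M : Matrix ι ι ℤ_[p]) (e : κ ≃ ι) :
    kc c (M.submatrix e e) = kc c M := by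
  rw [kc, ← Matrix.submatrix_map, kerCard_submatrix]; rfl

/-- Elimination of an invertible block. -/
theorem schur {k l : ℕ} (A : Matrix (Fin k) (Fin k) ℤ_[p]) (B : Matrix (Fin k) (Fin l) ℤ_[p])
    (C : Matrix (Fin l) (Fin k) ℤ_[p]) (D : Matrix (Fin l) (Fin l) ℤ_[p]) (hA : IsUnit A.det) :
    (Matrix.fromBlocks A B C D).det = A.det * (D - C * A⁻¹ * B).det ∧
    ∀ c, kc c (Matrix.fromBlocks A B C D) = kc c (D - C * A⁻¹ * B) := by
  let _ := Matrix.invertibleOfIsUnitDet A hA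
  have h := Matrix.fromBlocks_eq_of_invertible₁₁ A B C D
  rw [Matrix.invOf_eq_nonsing_inv] at h
  constructor
  · rw [h]; simp
  · intro c
    rw [h, kc_mul_mul _ _ _ _ (by simp) (by simp), kc, Matrix.fromBlocks_map]
    have h0 : ∀ {m n : ℕ}, (0 : Matrix (Fin m) (Fin n) ℤ_[p]).map (PadicInt.toZModPow c) = 0 := by
      intro m n; ext; simp
    rw [h0, h0, kerCard_fromBlocks]
    · rfl
    · exact RingHom.map_det (PadicInt.toZModPow c) A ▸ hA.map _

theorem skew_schur {k l : ℕ} {A : Matrix (Fin k) (Fin k) ℤ_[p]} {B : Matrix (Fin k) (Fin l) ℤ_[p]}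
    {C : Matrix (Fin l) (Fin k) ℤ_[p]} {D : Matrix (Fin l) (Fin l) ℤ_[p]}
    (h : (Matrix.fromBlocks A B C D).transpose = -Matrix.fromBlocks A B C D) :
    (D - C * A⁻¹ * B).transpose = -(D - C * A⁻¹ * B) := by
  rw [Matrix.fromBlocks_transpose, Matrix.fromBlocks_neg, Matrix.fromBlocks_inj] at h
  obtain ⟨hA, hC, hB, hD⟩ := h
  have hAi : (A⁻¹).transpose = -A⁻¹ := by
    rw [Matrix.transpose_nonsing_inv, hA]
    by_cases hu : IsUnit A.det
    · refine Matrix.inv_eq_left_inv ?_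
      rw [neg_mul_neg, Matrix.nonsing_inv_mul _ hu]
    · have hu' : ¬ IsUnit (-A).det := by
        rw [← hA, Matrix.det_transpose]; exact hu
      rw [Matrix.nonsing_inv_apply_not_isUnit _ hu, Matrix.nonsing_inv_apply_not_isUnit _ hu']
      simp
  rw [Matrix.transpose_sub, Matrix.transpose_mul, Matrix.transpose_mul, hD, hAi, hB, hC]
  simp [Matrix.mul_assoc]
  abel

theorem skew_congr {R : Type*} [CommRing R] {κ : Type*} [Fintype κ] {M P : Matrix κ κ R}
    (h : M.transpose = -M) :
    (P * M * P.transpose).transpose = -(P * M * P.transpose) := by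
  rw [Matrix.transpose_mul, Matrix.transpose_mul, Matrix.transpose_transpose, h]
  simp [Matrix.mul_assoc]

/-- A skew-symmetric matrix over `ℤ_p` can be replaced by one that vanishes modulo `p`. -/
theorem skew_reduce (h2 : p ≠ 2) (M : Matrix ι ι ℤ_[p]) (hM : M.transpose = -M) :
    ∃ (k l : ℕ) (N : Matrix (Fin l) (Fin l) ℤ_[p]), N.transpose = -N ∧
      (∀ i j, (p : ℤ_[p]) ∣ N i j) ∧ (∃ u, IsUnit u ∧ M.det = u * N.det) ∧
      (∀ c, kc c M = kc c N) ∧ (M.map PadicInt.toZMod).rank = k ∧ k + l = Fintype.card ι ∧ Even k := by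
  have hMb : (M.map PadicInt.toZMod).transpose = -(M.map PadicInt.toZMod) := by
    rw [← Matrix.transpose_map, hM]; ext; simp
  obtain ⟨k, l, e, P', A', hP', hA', hPM⟩ := exists_skew_normal_form (M.map PadicInt.toZMod) hMb
  -- Any entrywise lift of the change of basis over 𝔽_p works, since its determinant is a unit
  -- modulo p. The Schur complement of the lifted invertible block then vanishes modulo p.
  choose lift hlift using ZMod.ringHom_surjective (PadicInt.toZMod (p := p))
  let P : Matrix _ _ ℤ_[p] := P'.map lift
  have hPmap : P.map PadicInt.toZMod = P' := by ext; simp [P, hlift]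
  have hP : IsUnit P.det := by
    refine isUnit_of_toZMod_ne_zero ?_
    have : PadicInt.toZMod P.det = P'.det := by
      rw [RingHom.map_det]; exact congrArg _ hPmap
    rw [this]; exact hP'.ne_zero
  let Q := P * M.submatrix e e * P.transpose
  have hQmap : Q.map PadicInt.toZMod = Matrix.fromBlocks A' 0 0 0 := by
    rw [← hPM, Matrix.map_mul, Matrix.map_mul, Matrix.transpose_map, hPmap]; rfl
  have hQskew : Q.transpose = -Q := skew_congr (by
    rw [Matrix.transpose_submatrix, hM]; rfl)
  have hQ : Q = Matrix.fromBlocks Q.toBlocks₁₁ Q.toBlocks₁₂ Q.toBlocks₂₁ Q.toBlocks₂₂ :=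
    (Matrix.fromBlocks_toBlocks Q).symm
  have hQ11 : Q.toBlocks₁₁.map PadicInt.toZMod = A' := by
    ext i j; exact congrFun (congrFun hQmap (Sum.inl i)) (Sum.inl j)
  have hA : IsUnit Q.toBlocks₁₁.det := by
    refine isUnit_of_toZMod_ne_zero ?_
    have : PadicInt.toZMod Q.toBlocks₁₁.det = A'.det := by
      rw [RingHom.map_det]; exact congrArg _ hQ11
    rw [this]; exact hA'.ne_zero
  obtain ⟨hs1, hs2⟩ := schur Q.toBlocks₁₁ Q.toBlocks₁₂ Q.toBlocks₂₁ Q.toBlocks₂₂ hA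
  have hskewN := skew_schur (hQ ▸ hQskew)
  rw [← hQ] at hs1 hs2
  have hdetQ : Q.det = P.det * P.det * M.det := by
    simp only [Q, Matrix.det_mul, Matrix.det_transpose, Matrix.det_submatrix_equiv_self]; ring
  refine ⟨k, l, _, hskewN, ?_, ?_, ?_, ?_, ?_, ?_⟩
  · intro i j
    have h21 : ∀ j', (p : ℤ_[p]) ∣ Q.toBlocks₂₁ i j' := fun j' => by
      rw [← toZMod_eq_zero_iff]; exact congrFun (congrFun hQmap (Sum.inr i)) (Sum.inl j')
    have h22 : (p : ℤ_[p]) ∣ Q.toBlocks₂₂ i j := by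
      rw [← toZMod_eq_zero_iff]; exact congrFun (congrFun hQmap (Sum.inr i)) (Sum.inr j)
    rw [Matrix.sub_apply, Matrix.mul_assoc, Matrix.mul_apply]
    exact dvd_sub h22 (Finset.dvd_sum fun j' _ => (h21 j').mul_right _)
  · obtain ⟨v, hv⟩ := hP
    refine ⟨(↑(v⁻¹) : ℤ_[p]) * ↑(v⁻¹) * Q.toBlocks₁₁.det, ?_, ?_⟩
    · exact ((Units.isUnit _).mul (Units.isUnit _)).mul hA
    · rw [mul_assoc, ← hs1, hdetQ, ← hv]
      rw [mul_assoc (v : ℤ_[p]), mul_assoc, Units.inv_mul_cancel_left, Units.inv_mul_cancel_left]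
  · intro c
    rw [← hs2, kc_mul_mul _ _ _ _ hP (by rwa [Matrix.det_transpose]), kc_submatrix]
  · have h1 : (P' * (M.map PadicInt.toZMod).submatrix e e * P'.transpose).rank =
        (M.map PadicInt.toZMod).rank := by
      rw [Matrix.rank_mul_eq_left_of_isUnit_det _ _ (by rwa [Matrix.det_transpose]),
        Matrix.rank_mul_eq_right_of_isUnit_det _ _ hP', Matrix.rank_submatrix]
    rw [← h1, hPM, rank_fromBlocks_zero _ hA']
  · have := Fintype.card_congr e
    simpa using this
  · refine even_of_skew (K := ZMod p) ?_ A' ?_ hA'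
    · intro h
      have : ((2 : ℕ) : ZMod p) = 0 := by exact_mod_cast h
      rw [ZMod.natCast_eq_zero_iff] at this
      exact h2 ((Nat.prime_dvd_prime_iff_eq hp.out Nat.prime_two).1 this)
    · have := skew_congr (P := P') (M := (M.map PadicInt.toZMod).submatrix e e) (by
        rw [Matrix.transpose_submatrix, hMb]; rfl)
      rw [hPM, Matrix.fromBlocks_transpose, Matrix.fromBlocks_neg, Matrix.fromBlocks_inj] at this
      exact this.1

/-- The `p`-adic valuation of an integer, truncated at `c`. -/
def tv (p c : ℕ) (x : ℤ) : ℕ := Nat.findGreatest (fun e => (p : ℤ) ^ e ∣ x) c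

omit hp in
theorem tv_le (c : ℕ) (x : ℤ) : tv p c x ≤ c := Nat.findGreatest_le c

omit hp in
theorem le_tv_iff {c e : ℕ} {x : ℤ} (he : e ≤ c) : e ≤ tv p c x ↔ (p : ℤ) ^ e ∣ x := by
  refine ⟨fun h => ?_, fun h => Nat.le_findGreatest he h⟩
  have h0 : (p : ℤ) ^ (tv p c x) ∣ x :=
    Nat.findGreatest_spec (P := fun e => (p : ℤ) ^ e ∣ x) (Nat.zero_le c) (by simp)
  exact (pow_dvd_pow _ h).trans h0

omit hp in
theorem pow_tv_dvd (c : ℕ) (x : ℤ) : (p : ℤ) ^ tv p c x ∣ x :=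
  (le_tv_iff (tv_le c x)).1 le_rfl

theorem tv_eq_iff_gcd (c : ℕ) (x : ℤ) : (p ^ c).gcd x.natAbs = p ^ tv p c x := by
  have h1 : p ^ tv p c x ∣ (p ^ c).gcd x.natAbs := by
    refine Nat.dvd_gcd (pow_dvd_pow _ (tv_le c x)) ?_
    have := pow_tv_dvd (p := p) c x
    rw [← Int.natCast_dvd_natCast, Int.dvd_natAbs]
    exact_mod_cast this
  obtain ⟨m, hm, h⟩ := (Nat.dvd_prime_pow hp.out).1 (Nat.gcd_dvd_left (p ^ c) x.natAbs)
  rw [h] at h1 ⊢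
  have h2 : m ≤ tv p c x := by
    rw [le_tv_iff hm]
    have := h ▸ Nat.gcd_dvd_right (p ^ c) x.natAbs
    rw [← Int.natCast_dvd_natCast, Int.dvd_natAbs] at this
    exact_mod_cast this
  exact le_antisymm (Nat.pow_le_pow_right hp.out.pos h2)
    (Nat.le_of_dvd (pow_pos hp.out.pos _) h1)

/-- On a cyclic group of order p^c, multiplication by x has a kernel of order gcd(p^c, x). -/
theorem card_annihilator (c : ℕ) (x : ℤ) :
    Nat.card {y : ZMod (p ^ c) // y * (x : ZMod (p ^ c)) = 0} = p ^ tv p c x := by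
  have : NeZero (p ^ c) := ⟨pow_ne_zero _ hp.out.ne_zero⟩
  rw [← tv_eq_iff_gcd]
  have h := IsAddCyclic.card_nsmulAddMonoidHom_ker (ZMod (p ^ c)) x.natAbs
  rw [Nat.card_zmod] at h
  rw [← h]
  refine Nat.card_congr (Equiv.subtypeEquivRight fun y => ?_)
  rw [AddMonoidHom.mem_ker, nsmulAddMonoidHom_apply, nsmul_eq_mul, mul_comm]
  rcases Int.natAbs_eq x with h | h
  · conv_lhs => rw [h]
    simp
  · conv_lhs => rw [h]
    simp

/-- A skew matrix of even size at most two is empty or is given by a single entry. The relation x² =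
u · det identifies that entry with x up to a unit, and the kernel is two copies of the annihilator
of x. -/
theorem kc_le_two {l : ℕ} (hl : l ≤ 2) (hev : Even l) (N : Matrix (Fin l) (Fin l) ℤ_[p])
    (hN : N.transpose = -N) (x : ℤ) {u : ℤ_[p]} (hu : IsUnit u)
    (hx : (x : ℤ_[p]) ^ 2 = u * N.det) (c : ℕ) : kc c N = p ^ (2 * tv p c x) := by
  have hl : l = 0 ∨ l = 2 := by
    obtain ⟨m, rfl⟩ := hev; omega
  rcases hl with rfl | rfl
  · rw [Matrix.det_fin_zero, mul_one] at hx
    have hux : IsUnit (x : ℤ_[p]) := by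
      rw [← isUnit_pow_iff (n := 2) two_ne_zero, hx]; exact hu
    have h0 : tv p c x = 0 := by
      by_contra h
      have h1 := (pow_dvd_pow (p : ℤ) (Nat.one_le_iff_ne_zero.2 h)).trans (pow_tv_dvd (p := p) c x)
      rw [pow_one] at h1
      have h2 : (p : ℤ_[p]) ∣ x := by
        have := Int.cast_dvd_cast (α := ℤ_[p]) _ _ h1
        simpa using this
      exact PadicInt.p_nonunit (isUnit_of_dvd_unit h2 hux)
    rw [h0, kc, kerCard]
    have : Unique {x : Fin 0 → ZMod (p ^ c) // Matrix.vecMul x (N.map (PadicInt.toZModPow c)) = 0} :=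
      { default := ⟨0, by simp⟩, uniq := fun a => Subtype.ext (Subsingleton.elim _ _) }
    rw [Nat.card_unique]; simp
  · have hN' : ∀ i j, N i j = -N j i := fun i j => by
      have := congrFun (congrFun hN j) i
      simpa using this
    have hd : ∀ i, N i i = 0 := fun i => by
      have h1 : (2 : ℤ_[p]) * N i i = 0 := by linear_combination hN' i i
      exact (mul_eq_zero.1 h1).resolve_left two_ne_zero
    have hdet : N.det = N 0 1 ^ 2 := by
      rw [Matrix.det_fin_two, hd, hd, hN' 1 0]; ring
    rw [hdet] at hx
    have hassoc : Associated (N 0 1) (x : ℤ_[p]) := by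
      refine associated_of_dvd_dvd ?_ ?_
      · rw [← IsIntegrallyClosed.pow_dvd_pow_iff two_ne_zero, hx]; exact Dvd.intro_left _ rfl
      · rw [← IsIntegrallyClosed.pow_dvd_pow_iff two_ne_zero, hx]
        obtain ⟨v, rfl⟩ := hu
        exact ⟨↑v⁻¹, by rw [mul_right_comm, Units.mul_inv, one_mul]⟩
    obtain ⟨v, hv⟩ := hassoc
    have hann : ∀ y : ZMod (p ^ c), y * PadicInt.toZModPow c (N 0 1) = 0 ↔
        y * (x : ZMod (p ^ c)) = 0 := by
      intro y
      have : (x : ZMod (p ^ c)) = PadicInt.toZModPow c (N 0 1) * PadicInt.toZModPow c v := by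
        rw [← map_mul, hv, map_intCast]
      rw [this, ← mul_assoc]
      exact ((v.isUnit.map (PadicInt.toZModPow c)).mul_left_eq_zero).symm
    rw [kc, kerCard, mul_comm, pow_mul, ← card_annihilator, sq, ← Nat.card_prod]
    have key : ∀ y : Fin 2 → ZMod (p ^ c), Matrix.vecMul y (N.map (PadicInt.toZModPow c)) = 0 ↔
        y 0 * (x : ZMod (p ^ c)) = 0 ∧ y 1 * (x : ZMod (p ^ c)) = 0 := by
      intro y
      rw [← hann, ← hann, _root_.funext_iff, Fin.forall_fin_two]
      simp only [Matrix.vecMul, dotProduct, Fin.sum_univ_two, Matrix.map_apply, hd, map_zero,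
        mul_zero, Pi.zero_apply, zero_add, add_zero, hN' 1 0, map_neg, mul_neg, neg_eq_zero]
      exact and_comm
    exact Nat.card_congr ⟨fun y => ⟨⟨y.1 0, ((key _).1 y.2).1⟩, ⟨y.1 1, ((key _).1 y.2).2⟩⟩,
      fun y => ⟨![y.1.1, y.2.1], (key _).2 ⟨y.1.2, y.2.2⟩⟩,
      fun y => Subtype.ext (by ext i; fin_cases i <;> rfl), fun y => rfl⟩

theorem pow_dvd_det {l : ℕ} (N : Matrix (Fin l) (Fin l) ℤ_[p]) (h : ∀ i j, (p : ℤ_[p]) ∣ N i j) :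
    (p : ℤ_[p]) ^ l ∣ N.det := by
  choose N' hN' using h
  have : N = (p : ℤ_[p]) • Matrix.of N' := by ext i j; simp [hN']
  rw [this, Matrix.det_smul, Fintype.card_fin]
  exact Dvd.intro _ rfl

/-- The kernel size at a point of corank at most two. -/
theorem kc_of_rank (h2 : p ≠ 2) (hev : Even (Fintype.card ι)) (M : Matrix ι ι ℤ_[p])
    (hM : M.transpose = -M) (hr : Fintype.card ι ≤ (M.map PadicInt.toZMod).rank + 2) (x : ℤ)
    {u : ℤ_[p]} (hu : IsUnit u) (hx : (x : ℤ_[p]) ^ 2 = u * M.det) (c : ℕ) :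
    kc c M = p ^ (2 * tv p c x) := by
  obtain ⟨k, l, N, hN, -, ⟨v, hv, hdet⟩, hkc, hrk, hkl, hk⟩ := skew_reduce h2 M hM
  rw [hkc]
  rw [hrk] at hr
  refine kc_le_two (by omega) ?_ N hN x (hu.mul hv) (by rw [hx, hdet]; ring) c
  rw [← hkl, Nat.even_add] at hev
  exact hev.1 hk

end Padic

/-! ### The commutator matrix at a point -/

/-- The commutator matrix at an integral point. -/
def Mat {d : ℕ} (B : Fin d → Fin d → Fin 3 → ℤ) (α : Fin 3 → ℤ) : Matrix (Fin d) (Fin d) ℤ :=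
  Matrix.of fun i j => ∑ k, B i j k * α k

section

variable {d : ℕ} (B : Fin d → Fin d → Fin 3 → ℤ)

theorem Mat_add (α β : Fin 3 → ℤ) : Mat B (α + β) = Mat B α + Mat B β := by
  ext i j; simp [Mat, mul_add, Finset.sum_add_distrib]

theorem Mat_smul (t : ℤ) (α : Fin 3 → ℤ) : Mat B (t • α) = t • Mat B α := by
  ext i j; simp [Mat, Finset.mul_sum, mul_left_comm]

theorem Mat_eq_map (α : Fin 3 → ℤ) : Mat B α = (commutatorMatrix B).map (eval α) := by
  ext i j; simp [Mat, commutatorMatrix]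

theorem det_Mat {F : MvPolynomial (Fin 3) ℤ} (hF : F ^ 2 = (commutatorMatrix B).det)
    (α : Fin 3 → ℤ) : (Mat B α).det = eval α F ^ 2 := by
  rw [← map_pow, hF, Mat_eq_map]
  exact (RingHom.map_det (eval α) _).symm

variable {B} in
theorem Mat_transpose (hB : ∀ i j k, B i j k = -B j i k) (α : Fin 3 → ℤ) :
    (Mat B α).transpose = -Mat B α := by
  ext i j
  simp [Mat, hB j i, Finset.sum_neg_distrib]

theorem CommutatorPresentation.skew {G : Type*} [Group G] {d' : ℕ} {B : Fin d → Fin d → Fin d' → ℤ}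
    (P : CommutatorPresentation G B) (i j : Fin d) (k : Fin d') : B i j k = -B j i k := by
  have h1 := P.commutator_x i j
  have h2 := P.commutator_x j i
  have h3 : P.ι (Multiplicative.ofAdd (B i j)) = P.ι (Multiplicative.ofAdd (-B j i)) := by
    rw [ofAdd_neg, map_inv, ← h1, ← h2]; group
  have h4 : B i j = -B j i := P.ι_injective h3
  exact congrFun h4 k

variable {p : ℕ} [hp : Fact p.Prime]

/-- The image of the commutator matrix over `ℤ_p`. -/
def MatP (p : ℕ) [Fact p.Prime] (α : Fin 3 → ℤ) : Matrix (Fin d) (Fin d) ℤ_[p] :=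
  (Mat B α).map (Int.castRingHom ℤ_[p])

/-- The lattice `comLat B (cyc α (p ^ c))` is the kernel of x ↦ x M(α) modulo p^c on ℤᵈ. Its index
is the order of the image, and image times kernel is p^{cd}. -/
theorem comExp_cyc {α : Fin 3 → ℤ} (hα : Prim p α) (c : ℕ) :
    p ^ comExp p B (cyc α (p ^ c)) * kc c (MatP B p α) = p ^ (c * d) := by
  have : NeZero (p ^ c) := ⟨pow_ne_zero _ hp.out.ne_zero⟩
  set M : Matrix (Fin d) (Fin d) (ZMod (p ^ c)) := (MatP B p α).map (PadicInt.toZModPow c) with hM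
  have hMij : ∀ i j, M i j = ((Mat B α i j : ℤ) : ZMod (p ^ c)) := by
    intro i j; simp [hM, MatP]
  let g : (Fin d → ZMod (p ^ c)) →+ (Fin d → ZMod (p ^ c)) := M.vecMulLinear.toAddMonoidHom
  let q : (Fin d → ℤ) →+ (Fin d → ZMod (p ^ c)) :=
    { toFun := fun x i => (x i : ZMod (p ^ c)), map_zero' := by ext; simp,
      map_add' := fun x y => by ext; simp }
  have hq : Function.Surjective q := by
    intro y
    choose x hx using fun i => ZMod.intCast_surjective (y i)
    exact ⟨x, funext hx⟩
  have hker : comLat B (cyc α (p ^ c)) = (g.comp q).ker := by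
    ext x
    rw [mem_comLat, AddMonoidHom.mem_ker, _root_.funext_iff]
    refine forall_congr' fun j => ?_
    rw [mem_cyc, ← ZMod.intCast_zmod_eq_zero_iff_dvd]
    have : (((α ⬝ᵥ pairing B j x : ℤ)) : ZMod (p ^ c)) = (g.comp q) x j := by
      change _ = Matrix.vecMul (q x) M j
      simp only [Matrix.vecMul, dotProduct, hMij, q, AddMonoidHom.coe_mk, ZeroHom.coe_mk,
        ← Int.cast_mul, ← Int.cast_sum]
      congr 1
      simp only [pairing, Mat, AddMonoidHom.coe_mk, ZeroHom.coe_mk, Finset.sum_apply, Pi.smul_apply,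
        smul_eq_mul, Finset.mul_sum, Matrix.of_apply]
      rw [Finset.sum_comm]
      exact Finset.sum_congr rfl fun _ _ => Finset.sum_congr rfl fun _ _ => by ring
    rw [this]; rfl
  have hr : (g.comp q).range = g.range := by
    rw [AddMonoidHom.range_comp, AddMonoidHom.range_eq_top.2 hq, ← AddMonoidHom.range_eq_map]
  have h1 : (comLat B (cyc α (p ^ c))).index = Nat.card g.range := by
    rw [hker, AddSubgroup.index_ker, hr]
  have h2 : kc c (MatP B p α) = Nat.card g.ker := rfl
  rw [← comLat_index B (cyc_index hα c), h1, h2, ← AddSubgroup.index_ker, AddSubgroup.index_mul_card,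
    Nat.card_fun, Nat.card_zmod, Nat.card_fin, pow_mul]

theorem comExp_cyc_add {α : Fin 3 → ℤ} (hα : Prim p α) {c s : ℕ}
    (h : kc c (MatP B p α) = p ^ s) : comExp p B (cyc α (p ^ c)) + s = c * d := by
  have := comExp_cyc B hα c
  rw [h, ← pow_add] at this
  exact Nat.pow_right_injective hp.out.two_le this

variable {B}

theorem MatP_transpose (hB : ∀ i j k, B i j k = -B j i k) (α : Fin 3 → ℤ) :
    (MatP B p α).transpose = -MatP B p α := by
  rw [MatP, ← Matrix.transpose_map, Mat_transpose hB]; ext; simp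

theorem det_MatP {F : MvPolynomial (Fin 3) ℤ} (hF : F ^ 2 = (commutatorMatrix B).det)
    (α : Fin 3 → ℤ) : ((eval α F : ℤ) : ℤ_[p]) ^ 2 = (MatP B p α).det := by
  have h := congrArg (Int.castRingHom ℤ_[p]) (det_Mat B hF α)
  rw [RingHom.map_det, map_pow] at h
  exact h.symm

theorem not_dvd_iff_isUnit {x : ℤ} : ¬ (p : ℤ) ∣ x ↔ IsUnit (x : ℤ_[p]) := by
  constructor
  · intro h
    refine isUnit_of_toZMod_ne_zero ?_
    rw [map_intCast]
    exact fun h' => h ((ZMod.intCast_zmod_eq_zero_iff_dvd _ _).1 h')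
  · intro h h'
    have := Int.cast_dvd_cast (α := ℤ_[p]) _ _ h'
    exact PadicInt.p_nonunit (isUnit_of_dvd_unit (by simpa using this) h)

theorem padic_pow_dvd_iff {x : ℤ} {n : ℕ} : (p : ℤ_[p]) ^ n ∣ (x : ℤ_[p]) ↔ (p : ℤ) ^ n ∣ x :=
  PadicInt.pow_p_dvd_int_iff n x

/-- The kernel size at a point of corank at most two. -/
theorem comExp_of_rank (h2 : p ≠ 2) (hd : Even d) (hB : ∀ i j k, B i j k = -B j i k)
    {F : MvPolynomial (Fin 3) ℤ} (hF : F ^ 2 = (commutatorMatrix B).det) {α : Fin 3 → ℤ}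
    (hα : Prim p α) (hr : d ≤ ((MatP B p α).map PadicInt.toZMod).rank + 2) (c : ℕ) :
    comExp p B (cyc α (p ^ c)) + 2 * tv p c (eval α F) = c * d := by
  refine comExp_cyc_add B hα ?_
  refine kc_of_rank h2 (by simpa using hd) _ (MatP_transpose hB α) (by simpa using hr) _ isUnit_one ?_ c
  rw [one_mul, det_MatP hF]

theorem map_toZMod_MatP (α : Fin 3 → ℤ) :
    (MatP B p α).map PadicInt.toZMod = (Mat B α).map (Int.castRingHom (ZMod p)) := by
  ext i j; simp [MatP]

/-- The corank is bounded by twice the vanishing order of the Pfaffian. -/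
theorem corank_le (h2 : p ≠ 2) (hB : ∀ i j k, B i j k = -B j i k)
    {F : MvPolynomial (Fin 3) ℤ} (hF : F ^ 2 = (commutatorMatrix B).det) (α : Fin 3 → ℤ) {n : ℕ}
    (hn : ¬ (p : ℤ) ^ (n + 1) ∣ eval α F) :
    d ≤ ((MatP B p α).map PadicInt.toZMod).rank + 2 * n + 1 := by
  obtain ⟨k, l, N, hN, hpN, ⟨v, hv, hdet⟩, hkc, hrk, hkl, hk⟩ :=
    skew_reduce h2 (MatP B p α) (MatP_transpose hB α)
  rw [Fintype.card_fin] at hkl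
  rw [hrk]
  by_contra h
  -- An l×l matrix divisible by p has determinant divisible by p^l, so l ≥ 2(n + 1) would force
  -- p^{2(n+1)} to divide F².
  have hl : 2 * (n + 1) ≤ l := by omega
  have h1 : (p : ℤ_[p]) ^ (2 * (n + 1)) ∣ ((eval α F : ℤ) : ℤ_[p]) ^ 2 := by
    rw [det_MatP hF, hdet]
    exact (((pow_dvd_pow _ hl).trans (pow_dvd_det N hpN))).mul_left _
  rw [mul_comm, pow_mul, IsIntegrallyClosed.pow_dvd_pow_iff two_ne_zero, padic_pow_dvd_iff] at h1
  exact hn h1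

section Node

variable {k l : ℕ} (e : Fin k ⊕ Fin l ≃ Fin d) (Q : Matrix (Fin k ⊕ Fin l) (Fin k ⊕ Fin l) ℤ)

/-- The restriction of the commutator form at `γ` to the kernel of the form at a node. -/
def Dblk (B : Fin d → Fin d → Fin 3 → ℤ) (γ : Fin 3 → ℤ) : Matrix (Fin l) (Fin l) ℤ :=
  (Q * (Mat B γ).submatrix e e * Q.transpose).toBlocks₂₂

theorem Dblk_add (γ δ : Fin 3 → ℤ) : Dblk e Q B (γ + δ) = Dblk e Q B γ + Dblk e Q B δ := by
  have h : (Mat B γ + Mat B δ).submatrix e e = (Mat B γ).submatrix e e + (Mat B δ).submatrix e e := rfl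
  rw [Dblk, Mat_add, h, Matrix.mul_add, Matrix.add_mul]; rfl

theorem Dblk_smul (t : ℤ) (γ : Fin 3 → ℤ) : Dblk e Q B (t • γ) = t • Dblk e Q B γ := by
  have h : (t • Mat B γ).submatrix e e = t • (Mat B γ).submatrix e e := rfl
  rw [Dblk, Mat_smul, h, Matrix.mul_smul, Matrix.smul_mul]; rfl

variable {e Q} {A : Matrix (Fin k) (Fin k) ℤ} {w : Fin 3 → ℤ}

/-- In the basis of the normal form at w, all blocks except the invertible one are divisible by p^μ
at w + p^μ γ. Eliminating the invertible block leaves p^μ D, where D differs from the restriction of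
M(γ) to the radical at w by a multiple of p^μ. -/
theorem node_reduce (hB : ∀ i j k, B i j k = -B j i k)
    (hQw : Q * (Mat B w).submatrix e e * Q.transpose = Matrix.fromBlocks A 0 0 0)
    (hQ : ¬ (p : ℤ) ∣ Q.det) (hA : ¬ (p : ℤ) ∣ A.det) (γ : Fin 3 → ℤ) {μ : ℕ} (hμ : 1 ≤ μ) :
    ∃ D : Matrix (Fin l) (Fin l) ℤ_[p], D.transpose = -D ∧
      D.map PadicInt.toZMod = (Dblk e Q B γ).map (Int.castRingHom (ZMod p)) ∧
      (∃ u, IsUnit u ∧ (MatP B p (w + (p : ℤ) ^ μ • γ)).det = u * ((p : ℤ_[p]) ^ (l * μ) * D.det)) ∧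
      ∀ c, kc c (MatP B p (w + (p : ℤ) ^ μ • γ)) = kc c ((p : ℤ_[p]) ^ μ • D) := by
  let φ := Int.castRingHom ℤ_[p]
  let Qp := Q.map φ
  let G := Q * (Mat B γ).submatrix e e * Q.transpose
  let A₁ : Matrix (Fin k) (Fin k) ℤ_[p] := A.map φ + (p : ℤ_[p]) ^ μ • G.toBlocks₁₁.map φ
  let B₁ := G.toBlocks₁₂.map φ
  let C₁ := G.toBlocks₂₁.map φ
  let D₁ := G.toBlocks₂₂.map φ
  have hQp : IsUnit Qp.det := by
    have : Qp.det = ((Q.det : ℤ) : ℤ_[p]) := (RingHom.map_det φ Q).symm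
    rw [this]; exact not_dvd_iff_isUnit.1 hQ
  have htoA : A₁.map PadicInt.toZMod = A.map (Int.castRingHom (ZMod p)) := by
    ext i j
    have : PadicInt.toZMod ((p : ℤ_[p]) ^ μ) = 0 := by
      rw [toZMod_eq_zero_iff]; exact dvd_pow_self _ (by omega)
    simp only [A₁, Matrix.map_apply, Matrix.add_apply, Matrix.smul_apply, smul_eq_mul, map_add,
      map_mul, this, zero_mul, add_zero]
    simp [φ]
  have hA₁ : IsUnit A₁.det := by
    refine isUnit_of_toZMod_ne_zero ?_
    have : PadicInt.toZMod A₁.det = ((A.det : ℤ) : ZMod p) := by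
      rw [RingHom.map_det]
      exact (congrArg Matrix.det htoA).trans (RingHom.map_det (Int.castRingHom (ZMod p)) A).symm
    rw [this]
    exact fun h => hA ((ZMod.intCast_zmod_eq_zero_iff_dvd _ _).1 h)
  have hconj : Qp * (MatP B p (w + (p : ℤ) ^ μ • γ)).submatrix e e * Qp.transpose =
      Matrix.fromBlocks A₁ ((p : ℤ_[p]) ^ μ • B₁) ((p : ℤ_[p]) ^ μ • C₁) ((p : ℤ_[p]) ^ μ • D₁) := by
    have h1 : Q * (Mat B (w + (p : ℤ) ^ μ • γ)).submatrix e e * Q.transpose =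
        Matrix.fromBlocks A 0 0 0 + (p : ℤ) ^ μ • G := by
      have h : (Mat B w + (p : ℤ) ^ μ • Mat B γ).submatrix e e =
        (Mat B w).submatrix e e + (p : ℤ) ^ μ • (Mat B γ).submatrix e e := rfl
      rw [Mat_add, Mat_smul, ← hQw, h, Matrix.mul_add, Matrix.add_mul]
      congr 1
      rw [Matrix.mul_smul, Matrix.smul_mul]
    have h2 : Qp * (MatP B p (w + (p : ℤ) ^ μ • γ)).submatrix e e * Qp.transpose =
        (Q * (Mat B (w + (p : ℤ) ^ μ • γ)).submatrix e e * Q.transpose).map φ := by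
      rw [Matrix.map_mul, Matrix.map_mul, Matrix.transpose_map]; rfl
    rw [h2, h1]
    ext (i | i) (j | j) <;>
      simp only [Matrix.map_apply, Matrix.add_apply, Matrix.smul_apply, smul_eq_mul, map_add,
        map_mul, map_pow, zero_add, map_natCast, Matrix.fromBlocks_apply₁₁,
        Matrix.fromBlocks_apply₁₂, Matrix.fromBlocks_apply₂₁, Matrix.fromBlocks_apply₂₂,
        Matrix.zero_apply, A₁, B₁, C₁, D₁, Matrix.toBlocks₁₁, Matrix.toBlocks₁₂, Matrix.toBlocks₂₁,
        Matrix.toBlocks₂₂, Matrix.of_apply]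
  have hskew : (Qp * (MatP B p (w + (p : ℤ) ^ μ • γ)).submatrix e e * Qp.transpose).transpose =
      -(Qp * (MatP B p (w + (p : ℤ) ^ μ • γ)).submatrix e e * Qp.transpose) := skew_congr (by
    rw [Matrix.transpose_submatrix, MatP_transpose hB]; rfl)
  rw [hconj] at hskew
  have hN := skew_schur hskew
  obtain ⟨hs1, hs2⟩ := schur A₁ ((p : ℤ_[p]) ^ μ • B₁) ((p : ℤ_[p]) ^ μ • C₁)
    ((p : ℤ_[p]) ^ μ • D₁) hA₁
  let D : Matrix (Fin l) (Fin l) ℤ_[p] := D₁ - (p : ℤ_[p]) ^ μ • (C₁ * A₁⁻¹ * B₁)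
  have hND : (p : ℤ_[p]) ^ μ • D₁ - (p : ℤ_[p]) ^ μ • C₁ * A₁⁻¹ * (p : ℤ_[p]) ^ μ • B₁ =
      (p : ℤ_[p]) ^ μ • D := by
    simp only [D, smul_sub, Matrix.smul_mul, Matrix.mul_smul]
  have hp0 : (p : ℤ_[p]) ^ μ ≠ 0 := pow_ne_zero _ (by exact_mod_cast hp.out.ne_zero)
  rw [hND] at hs1 hs2 hN
  rw [← hconj] at hs1 hs2
  refine ⟨D, ?_, ?_, ?_, ?_⟩
  · rw [Matrix.transpose_smul, ← smul_neg] at hN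
    ext i j
    have := congrFun (congrFun hN i) j
    exact mul_left_cancel₀ hp0 this
  · ext i j
    have : PadicInt.toZMod ((p : ℤ_[p]) ^ μ) = 0 := by
      rw [toZMod_eq_zero_iff]; exact dvd_pow_self _ (by omega)
    simp only [D, Matrix.map_apply, Matrix.sub_apply, Matrix.smul_apply, smul_eq_mul, map_sub,
      map_mul, this, zero_mul, sub_zero]
    simp [D₁, φ, Dblk, G]
  · have hdet : (Qp * (MatP B p (w + (p : ℤ) ^ μ • γ)).submatrix e e * Qp.transpose).det =
        Qp.det * Qp.det * (MatP B p (w + (p : ℤ) ^ μ • γ)).det := by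
      simp only [Matrix.det_mul, Matrix.det_transpose, Matrix.det_submatrix_equiv_self]; ring
    rw [hdet, Matrix.det_smul, Fintype.card_fin, ← pow_mul, mul_comm μ] at hs1
    obtain ⟨v, hv⟩ := hQp
    refine ⟨(↑(v⁻¹) : ℤ_[p]) * ↑(v⁻¹) * A₁.det,
      ((Units.isUnit _).mul (Units.isUnit _)).mul hA₁, ?_⟩
    rw [mul_assoc, ← hs1, ← hv]
    rw [mul_assoc (v : ℤ_[p]), mul_assoc, Units.inv_mul_cancel_left, Units.inv_mul_cancel_left]
  · intro c
    rw [← hs2, kc_mul_mul _ _ _ _ hQp (by rwa [Matrix.det_transpose]), kc_submatrix]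

theorem kc_smul_of_le {c μ : ℕ} (h : c ≤ μ) (D : Matrix (Fin l) (Fin l) ℤ_[p]) :
    kc c ((p : ℤ_[p]) ^ μ • D) = p ^ (l * c) := by
  have h0 : ((p : ℤ_[p]) ^ μ • D).map (PadicInt.toZModPow c) = 0 := by
    ext i j
    rw [Matrix.map_apply, Matrix.zero_apply, toZModPow_eq_zero_iff]
    exact (pow_dvd_pow _ h).mul_right _
  rw [kc, h0, kerCard]
  simp only [Matrix.vecMul_zero]
  have : NeZero (p ^ c) := ⟨pow_ne_zero _ hp.out.ne_zero⟩
  rw [Nat.card_congr (Equiv.subtypeUnivEquiv fun _ => trivial), Nat.card_fun, Nat.card_fin,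
    Nat.card_zmod, ← pow_mul, mul_comm]

/-- Modulo p^{μ+k} the product p^μ y vanishes iff y ≡ 0 modulo p^k. So the kernel is the preimage of
the kernel of D modulo p^k under a reduction map whose fibres have p^{lμ} elements. -/
theorem kc_smul_add (μ k : ℕ) (D : Matrix (Fin l) (Fin l) ℤ_[p]) :
    kc (μ + k) ((p : ℤ_[p]) ^ μ • D) = p ^ (l * μ) * kc k D := by
  have i1 : NeZero (p ^ (μ + k)) := ⟨pow_ne_zero _ hp.out.ne_zero⟩
  have i2 : NeZero (p ^ k) := ⟨pow_ne_zero _ hp.out.ne_zero⟩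
  have hdvd : p ^ k ∣ p ^ (μ + k) := pow_dvd_pow _ (by omega)
  let r : ZMod (p ^ (μ + k)) →+* ZMod (p ^ k) := ZMod.castHom hdvd _
  have hr : Function.Surjective r := ZMod.castHom_surjective hdvd
  have hrt : ∀ x : ℤ_[p], r (PadicInt.toZModPow (μ + k) x) = PadicInt.toZModPow k x := fun x =>
    PadicInt.cast_toZModPow k (μ + k) (by omega) x
  let q : (Fin l → ZMod (p ^ (μ + k))) →+ (Fin l → ZMod (p ^ k)) := r.toAddMonoidHom.compLeft (Fin l)
  have hq : Function.Surjective q := fun y => by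
    choose x hx using fun i => hr (y i)
    exact ⟨x, funext hx⟩
  let S : AddSubgroup (Fin l → ZMod (p ^ k)) :=
    (D.map (PadicInt.toZModPow k)).vecMulLinear.toAddMonoidHom.ker
  have hS : kc k D = Nat.card S := rfl
  have hmem : ∀ x : Fin l → ZMod (p ^ (μ + k)),
      Matrix.vecMul x (((p : ℤ_[p]) ^ μ • D).map (PadicInt.toZModPow (μ + k))) = 0 ↔
        x ∈ S.comap q := by
    intro x
    choose y hy using fun i => ZMod.ringHom_surjective (PadicInt.toZModPow (p := p) (μ + k)) (x i)
    have hxy : x = fun i => PadicInt.toZModPow (μ + k) (y i) := funext fun i => (hy i).symm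
    have hqx : q x = fun i => PadicInt.toZModPow k (y i) := by
      ext i; rw [hxy]; exact hrt (y i)
    have h1 : Matrix.vecMul x (((p : ℤ_[p]) ^ μ • D).map (PadicInt.toZModPow (μ + k))) =
        fun j => PadicInt.toZModPow (μ + k) ((p : ℤ_[p]) ^ μ * Matrix.vecMul y D j) := by
      ext j
      rw [hxy]
      simp only [Matrix.vecMul, dotProduct, Matrix.map_apply, Matrix.smul_apply, smul_eq_mul,
        Finset.mul_sum, map_sum, map_mul]
      exact Finset.sum_congr rfl fun _ _ => by ring
    have h2 : Matrix.vecMul (q x) (D.map (PadicInt.toZModPow k)) =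
        fun j => PadicInt.toZModPow k (Matrix.vecMul y D j) := by
      ext j
      rw [hqx]
      simp only [Matrix.vecMul, dotProduct, Matrix.map_apply, map_sum, map_mul]
    have h3 : x ∈ S.comap q ↔ Matrix.vecMul (q x) (D.map (PadicInt.toZModPow k)) = 0 := Iff.rfl
    rw [h3, h1, h2, _root_.funext_iff, _root_.funext_iff]
    refine forall_congr' fun j => ?_
    change PadicInt.toZModPow (μ + k) _ = 0 ↔ PadicInt.toZModPow k _ = 0
    rw [toZModPow_eq_zero_iff, toZModPow_eq_zero_iff, pow_add, mul_dvd_mul_iff_left]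
    exact pow_ne_zero _ (by exact_mod_cast hp.out.ne_zero)
  have h4 : kc (μ + k) ((p : ℤ_[p]) ^ μ • D) = Nat.card (S.comap q) :=
    Nat.card_congr (Equiv.subtypeEquivRight hmem)
  have h5 := (S.comap q).index_mul_card
  have h6 := S.index_mul_card
  rw [AddSubgroup.index_comap_of_surjective _ hq] at h5
  rw [Nat.card_fun, Nat.card_fin, Nat.card_zmod] at h5 h6
  rw [h4, hS]
  have h7 : S.index ≠ 0 := by
    intro h
    rw [h, zero_mul] at h6
    exact pow_ne_zero _ (pow_ne_zero _ hp.out.ne_zero) h6.symm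
  refine Nat.eq_of_mul_eq_mul_left (Nat.pos_of_ne_zero h7) ?_
  rw [h5, mul_left_comm, h6]
  ring

end Node

end

/-! ### Kernels near a node of corank four -/

section NodeKernel

variable {d : ℕ} {B : Fin d → Fin d → Fin 3 → ℤ} {p : ℕ} [hp : Fact p.Prime]
variable {k : ℕ} {e : Fin k ⊕ Fin 4 ≃ Fin d} {Q : Matrix (Fin k ⊕ Fin 4) (Fin k ⊕ Fin 4) ℤ}
  {A : Matrix (Fin k) (Fin k) ℤ} {w : Fin 3 → ℤ}

theorem padic_p_ne_zero : (p : ℤ_[p]) ≠ 0 := by exact_mod_cast hp.out.ne_zero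

/-- The determinant of the Schur complement at a point of corank four near a node. -/
theorem det_eq_of_node {F : MvPolynomial (Fin 3) ℤ} (hF : F ^ 2 = (commutatorMatrix B).det)
    {γ : Fin 3 → ℤ} {μ : ℕ} {D : Matrix (Fin 4) (Fin 4) ℤ_[p]}
    (hD : ∃ u, IsUnit u ∧ (MatP B p (w + (p : ℤ) ^ μ • γ)).det = u * ((p : ℤ_[p]) ^ (4 * μ) * D.det))
    {x : ℤ} (hx : eval (w + (p : ℤ) ^ μ • γ) F = (p : ℤ) ^ (2 * μ) * x) :
    ∃ u, IsUnit u ∧ (x : ℤ_[p]) ^ 2 = u * D.det := by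
  obtain ⟨u, hu, h⟩ := hD
  refine ⟨u, hu, mul_left_cancel₀ (pow_ne_zero (4 * μ) (padic_p_ne_zero (p := p))) ?_⟩
  rw [← det_MatP hF, hx] at h
  push_cast at h
  rw [mul_left_comm, ← h]
  ring

/-- The point is that D is non-zero modulo p. It reduces to aD₁ + bD₂, where D₁ and D₂ belong to the
tangent directions e₁ and e₂ and are singular, while D₁ + D₂ is invertible because F has exact order
two along e₁ + e₂. If D vanished, D₁ and D₂ would be proportional and their sum singular. A non-zero
skew 4×4 matrix has rank at least two, so `kc_of_rank` applies to D. -/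
theorem kc_node (h2 : p ≠ 2) (hB : ∀ i j k, B i j k = -B j i k)
    {F : MvPolynomial (Fin 3) ℤ} (hF : F ^ 2 = (commutatorMatrix B).det)
    (hQw : Q * (Mat B w).submatrix e e * Q.transpose = Matrix.fromBlocks A 0 0 0)
    (hQ : ¬ (p : ℤ) ∣ Q.det) (hA : ¬ (p : ℤ) ∣ A.det) {e₁ e₂ : Fin 3 → ℤ}
    {x₁ x₂ x₃ : ℤ} (h₁ : eval (w + (p : ℤ) ^ 1 • e₁) F = (p : ℤ) ^ (2 * 1) * (p * x₁))
    (h₂ : eval (w + (p : ℤ) ^ 1 • e₂) F = (p : ℤ) ^ (2 * 1) * (p * x₂))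
    (h₃ : eval (w + (p : ℤ) ^ 1 • (e₁ + e₂)) F = (p : ℤ) ^ (2 * 1) * x₃) (hx₃ : ¬ (p : ℤ) ∣ x₃)
    {a b : ℤ} (hab : ¬ ((p : ℤ) ∣ a ∧ (p : ℤ) ∣ b)) {μ : ℕ} (hμ : 1 ≤ μ) {x : ℤ}
    (hx : eval (w + (p : ℤ) ^ μ • (a • e₁ + b • e₂)) F = (p : ℤ) ^ (2 * μ) * x) (c : ℕ) :
    kc (μ + c) (MatP B p (w + (p : ℤ) ^ μ • (a • e₁ + b • e₂))) = p ^ (4 * μ + 2 * tv p c x) := by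
  obtain ⟨D₁, -, hm₁, hd₁, -⟩ := node_reduce hB hQw hQ hA e₁ le_rfl
  obtain ⟨D₂, -, hm₂, hd₂, -⟩ := node_reduce hB hQw hQ hA e₂ le_rfl
  obtain ⟨D₃, -, hm₃, hd₃, -⟩ := node_reduce hB hQw hQ hA (e₁ + e₂) le_rfl
  obtain ⟨D, hDt, hm, hd, hkc⟩ := node_reduce hB hQw hQ hA (a • e₁ + b • e₂) hμ
  obtain ⟨u₁, hu₁, hx₁'⟩ := det_eq_of_node hF hd₁ h₁
  obtain ⟨u₂, hu₂, hx₂'⟩ := det_eq_of_node hF hd₂ h₂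
  obtain ⟨u₃, hu₃, hx₃'⟩ := det_eq_of_node hF hd₃ h₃
  obtain ⟨u, hu, hx'⟩ := det_eq_of_node hF hd hx
  have hzero : ∀ {u : ℤ_[p]} {y : ℤ} {E : Matrix (Fin 4) (Fin 4) ℤ_[p]}, IsUnit u →
      (y : ℤ_[p]) ^ 2 = u * E.det → ((p : ℤ) ∣ y ↔ (E.map PadicInt.toZMod).det = 0) := by
    intro u y E hu h
    have h' := congrArg PadicInt.toZMod h
    rw [map_mul, RingHom.map_det, map_pow, map_intCast] at h'
    have hu' := (hu.map (PadicInt.toZMod (p := p))).ne_zero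
    rw [← ZMod.intCast_zmod_eq_zero_iff_dvd]
    constructor
    · intro h0
      rw [h0, zero_pow two_ne_zero] at h'
      exact (mul_eq_zero.1 h'.symm).resolve_left hu'
    · intro h0
      have h3 : PadicInt.toZMod.mapMatrix E = E.map PadicInt.toZMod := rfl
      rw [h3, h0, mul_zero] at h'
      exact pow_eq_zero_iff two_ne_zero |>.1 h'
  have hz₁ := (hzero hu₁ hx₁').1 (dvd_mul_right _ _)
  have hz₂ := (hzero hu₂ hx₂').1 (dvd_mul_right _ _)
  have hz₃ := mt (hzero hu₃ hx₃').2 hx₃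
  set φ := Int.castRingHom (ZMod p)
  rw [Dblk_add, Matrix.map_add _ (map_add φ), ← hm₁, ← hm₂] at hm₃
  have hmab : D.map PadicInt.toZMod =
      (a : ZMod p) • D₁.map PadicInt.toZMod + (b : ZMod p) • D₂.map PadicInt.toZMod := by
    rw [hm, hm₁, hm₂, Dblk_add, Dblk_smul, Dblk_smul]
    ext i j
    simp only [Matrix.map_apply, Matrix.add_apply, Matrix.smul_apply, smul_eq_mul, map_add, map_mul]
    rfl
  have hne : D.map PadicInt.toZMod ≠ 0 := by
    intro h0
    rw [h0] at hmab
    refine hab ?_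
    simp only [← ZMod.intCast_zmod_eq_zero_iff_dvd]
    -- A linear relation with s ≠ 0 makes M + N a multiple of the singular matrix N.
    have key : ∀ {s t : ZMod p} {M N : Matrix (Fin 4) (Fin 4) (ZMod p)}, 0 = s • M + t • N →
        N.det = 0 → (M + N).det ≠ 0 → s = 0 := by
      intro s t M N h hN hMN
      by_contra hs
      have : M = (-(t / s)) • N := by
        ext i j
        have := congrFun (congrFun h i) j
        simp only [Matrix.zero_apply, Matrix.add_apply, Matrix.smul_apply, smul_eq_mul] at this ⊢
        field_simp
        linear_combination -this
      have h1 : M + N = (1 - t / s) • N := by rw [this]; module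
      rw [h1, Matrix.det_smul, hN, mul_zero] at hMN
      exact hMN rfl
    rw [hm₃] at hz₃
    exact ⟨key hmab hz₂ hz₃, key (by rw [hmab, add_comm]) hz₁ (by rwa [add_comm])⟩
  have hrk : 4 ≤ (D.map PadicInt.toZMod).rank + 2 := by
    obtain ⟨k', l', N, -, -, -, -, hrk, -, hev⟩ := skew_reduce h2 D hDt
    have h0 : (D.map PadicInt.toZMod).rank ≠ 0 := by
      intro h0
      rw [Matrix.rank, Submodule.finrank_eq_zero, LinearMap.range_eq_bot] at h0
      refine hne ((Matrix.toLin' (R := ZMod p)).injective ?_)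
      rw [map_zero]
      exact h0
    rw [hrk] at h0 ⊢
    obtain ⟨m, rfl⟩ := hev
    omega
  rw [hkc, kc_smul_add, kc_of_rank h2 (by simp; decide) D hDt (by simpa using hrk) x hu hx' c, pow_add]

end NodeKernel

/-! ### Sums over residues -/

section Residues

variable {p : ℕ} [hp : Fact p.Prime] {M : Type*} [AddCommMonoid M]

theorem sum_range_of_periodic {f : ℤ → M} {n : ℕ} (hf : ∀ x y, (n : ℤ) ∣ x - y → f x = f y) (m : ℕ) :
    ∑ a ∈ Finset.range (n * m), f a = m • ∑ a ∈ Finset.range n, f a := by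
  induction m with
  | zero => simp
  | succ m ih =>
    rw [Nat.mul_succ, Finset.sum_range_add, ih, succ_nsmul]
    congr 1
    refine Finset.sum_congr rfl fun a _ => hf _ _ ⟨m, ?_⟩
    push_cast; ring

theorem sum_range_split (f : ℤ → M) (n : ℕ) :
    ∑ a ∈ Finset.range (p * n), f a = ∑ a ∈ Finset.range n, f (p * a) +
      ∑ a ∈ (Finset.range (p * n)).filter (fun a => ¬ p ∣ a), f a := by
  rw [← Finset.sum_filter_add_sum_filter_not (Finset.range (p * n)) (fun a => p ∣ a)]
  congr 1
  symm
  refine Finset.sum_bij (fun a _ => p * a) ?_ ?_ ?_ ?_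
  · intro a ha
    simp only [Finset.mem_filter, Finset.mem_range] at ha ⊢
    exact ⟨Nat.mul_lt_mul_of_pos_left ha hp.out.pos, dvd_mul_right _ _⟩
  · intro a _ b _ h
    exact Nat.eq_of_mul_eq_mul_left hp.out.pos h
  · intro b hb
    simp only [Finset.mem_filter, Finset.mem_range] at hb
    obtain ⟨h, a, rfl⟩ := hb
    exact ⟨a, Finset.mem_range.2 (Nat.lt_of_mul_lt_mul_left h), rfl⟩
  · intro a _
    push_cast; rfl

variable (p) in
/-- The residues prime to `p` modulo `p^(c+1)`. -/
def unitRange (c : ℕ) : Finset ℕ := (Finset.range (p * p ^ c)).filter (fun a => ¬ p ∣ a)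

omit hp in
theorem not_dvd_of_mem_unitRange {c a : ℕ} (h : a ∈ unitRange p c) : ¬ (p : ℤ) ∣ (a : ℤ) := by
  rw [Int.natCast_dvd_natCast]; exact (Finset.mem_filter.1 h).2

theorem card_unitRange (c : ℕ) : (unitRange p c).card = (p - 1) * p ^ c := by
  have := sum_range_split (p := p) (fun _ => 1) (p ^ c)
  simp only [Finset.sum_const, Finset.card_range, smul_eq_mul, mul_one] at this
  rw [unitRange, Nat.sub_mul, one_mul]
  omega

/-- The condition on g makes it injective on residues modulo n, hence a permutation of them. -/
theorem sum_range_comp {f : ℤ → M} {n : ℕ} (hn : 0 < n) (hf : ∀ x y, (n : ℤ) ∣ x - y → f x = f y)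
    {g : ℤ → ℤ} (hg : ∀ x y, (n : ℤ) ∣ g x - g y → (n : ℤ) ∣ x - y) :
    ∑ a ∈ Finset.range n, f (g a) = ∑ a ∈ Finset.range n, f a := by
  have hn' : (0 : ℤ) < n := by exact_mod_cast hn
  let h : ℕ → ℕ := fun a => (g a % n).toNat
  have hh : ∀ a, ((h a : ℕ) : ℤ) = g a % n := fun a => Int.toNat_of_nonneg (Int.emod_nonneg _ hn'.ne')
  have hmaps : ∀ a ∈ Finset.range n, h a ∈ Finset.range n := fun a _ => by
    have := Int.emod_lt_of_pos (g a) hn'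
    rw [Finset.mem_range]; have := hh a; omega
  have hinj : Set.InjOn h (Finset.range n) := by
    intro a ha b hb hab
    have h1 : g a % n = g b % n := by rw [← hh, ← hh, hab]
    have h2 := hg b a (Int.ModEq.dvd h1.symm |> fun h => by simpa using (dvd_neg.2 h))
    have h3 := (Nat.modEq_iff_dvd (n := n) (a := a) (b := b)).2 h2
    simp only [Finset.coe_range, Set.mem_Iio] at ha hb
    rwa [Nat.ModEq, Nat.mod_eq_of_lt ha, Nat.mod_eq_of_lt hb] at h3
  refine Finset.sum_bij (fun a _ => h a) hmaps (fun a ha b hb => hinj ha hb) ?_ ?_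
  · exact fun b hb => by
      obtain ⟨a, ha, rfl⟩ := Finset.surj_on_of_inj_on_of_card_le (fun a _ => h a) hmaps
        (fun a b ha hb => hinj ha hb) le_rfl b hb
      exact ⟨a, ha, rfl⟩
  · intro a _
    exact hf _ _ (by rw [hh]; exact Int.dvd_self_sub_emod)

/-- A family of functions behaving like `κ a b` up to terms of higher order at the prime `p`, which
describes a plane curve near a node. -/
structure NodeFamily (p : ℕ) (H : ℕ → ℤ → ℤ → ℤ) : Prop where
  scale : ∀ m a b, H m (p * a) (p * b) = p ^ 2 * H (m + 1) a b
  unit : ∀ m a b, ¬ (p : ℤ) ∣ a → ¬ (p : ℤ) ∣ b → ¬ (p : ℤ) ∣ H m a b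
  left : ∀ m b, ¬ (p : ℤ) ∣ b → ∃ g : ℤ → ℤ, (∀ a, H m (p * a) b = p * g a) ∧
    ∀ (n : ℕ) x y, (p ^ n : ℤ) ∣ g x - g y → (p ^ n : ℤ) ∣ x - y
  right : ∀ m a, ¬ (p : ℤ) ∣ a → ∃ g : ℤ → ℤ, (∀ b, H m a (p * b) = p * g b) ∧
    ∀ (n : ℕ) x y, (p ^ n : ℤ) ∣ g x - g y → (p ^ n : ℤ) ∣ x - y
  congr : ∀ (m : ℕ) (n a a' b b' : ℤ), n ∣ a - a' → n ∣ b - b' → n ∣ H m a b - H m a' b'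

/-- Split the pairs by divisibility of a and b by p. If exactly one is divisible, H is p times a
permutation of residues in that variable; if neither is, H is a unit. The pairs with both divisible
are left for a recursion. -/
theorem NodeFamily.sum {H : ℕ → ℤ → ℤ → ℤ} (hH : NodeFamily p H) (m c : ℕ) {ψ : ℤ → ℤ → M}
    {φ : ℤ → M} (hφ : ∀ x y, (p ^ (c + 1) : ℤ) ∣ x - y → φ x = φ y)
    {u : M} (hu : ∀ x, ¬ (p : ℤ) ∣ x → φ x = u)
    (hψ : ∀ a b, ¬ ((p : ℤ) ∣ a ∧ (p : ℤ) ∣ b) → ψ a b = φ (H m a b)) :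
    ∑ a ∈ Finset.range (p ^ (c + 1)), ∑ b ∈ Finset.range (p ^ (c + 1)), ψ a b =
      ∑ a ∈ Finset.range (p ^ c), ∑ b ∈ Finset.range (p ^ c), ψ (p * a) (p * b) +
      (2 * ((p - 1) * p ^ c)) • ∑ y ∈ Finset.range (p ^ c), φ (p * y) +
      ((p - 1) * p ^ c) ^ 2 • u := by
  have hpc : 0 < p ^ c := pow_pos hp.out.pos c
  have hf : ∀ x y : ℤ, ((p ^ c : ℕ) : ℤ) ∣ x - y → φ (p * x) = φ (p * y) := by
    intro x y h
    refine hφ _ _ ?_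
    rw [← mul_sub, pow_succ']
    exact mul_dvd_mul_left _ (by exact_mod_cast h)
  have h1 : ∀ a ∈ Finset.range (p ^ c), ∑ b ∈ unitRange p c, ψ (p * a) b =
      ∑ b ∈ unitRange p c, φ (H m (p * a) b) := fun a _ => Finset.sum_congr rfl fun b hb =>
    hψ _ _ fun h => not_dvd_of_mem_unitRange hb h.2
  have h2 : ∑ a ∈ Finset.range (p ^ c), ∑ b ∈ unitRange p c, ψ (p * a) b =
      ((p - 1) * p ^ c) • ∑ y ∈ Finset.range (p ^ c), φ (p * y) := by
    rw [Finset.sum_congr rfl h1, Finset.sum_comm, ← card_unitRange, ← Finset.sum_const]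
    refine Finset.sum_congr rfl fun b hb => ?_
    obtain ⟨g, hg, hg'⟩ := hH.left m b (not_dvd_of_mem_unitRange hb)
    simp_rw [hg]
    exact sum_range_comp (f := fun y => φ (p * y)) hpc hf (fun x y h => by
      exact_mod_cast hg' c x y (by exact_mod_cast h))
  have h3 : ∀ a ∈ unitRange p c, ∑ b ∈ Finset.range (p ^ c), ψ a (p * b) =
      ∑ y ∈ Finset.range (p ^ c), φ (p * y) := by
    intro a ha
    obtain ⟨g, hg, hg'⟩ := hH.right m a (not_dvd_of_mem_unitRange ha)
    rw [← sum_range_comp (f := fun y => φ (p * y)) hpc hf (fun x y h => by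
      exact_mod_cast hg' c x y (by exact_mod_cast h))]
    refine Finset.sum_congr rfl fun b _ => ?_
    rw [hψ _ _ fun h => not_dvd_of_mem_unitRange ha h.1, hg]
  have h4 : ∀ a ∈ unitRange p c, ∑ b ∈ unitRange p c, ψ a b = ((p - 1) * p ^ c) • u := by
    intro a ha
    rw [← card_unitRange, ← Finset.sum_const]
    refine Finset.sum_congr rfl fun b hb => ?_
    rw [hψ _ _ fun h => not_dvd_of_mem_unitRange ha h.1]
    exact hu _ (hH.unit m _ _ (not_dvd_of_mem_unitRange ha) (not_dvd_of_mem_unitRange hb))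
  rw [pow_succ' p c, sum_range_split (p := p) (fun a => ∑ b ∈ Finset.range (p * p ^ c), ψ a b)]
  have hs : ∀ a : ℤ, ∑ b ∈ Finset.range (p * p ^ c), ψ a b = _ := fun a =>
    sum_range_split (ψ a) (p ^ c)
  simp_rw [hs]
  simp only [Finset.sum_add_distrib]
  change _ + ∑ a ∈ Finset.range (p ^ c), ∑ b ∈ unitRange p c, ψ (p * a) b +
    (∑ a ∈ unitRange p c, ∑ b ∈ Finset.range (p ^ c), ψ a (p * b) +
      ∑ a ∈ unitRange p c, ∑ b ∈ unitRange p c, ψ a b) = _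
  rw [h2, Finset.sum_congr rfl h3, Finset.sum_congr rfl h4, Finset.sum_const, Finset.sum_const,
    card_unitRange, smul_smul, ← sq, two_mul, add_smul]
  abel

end Residues

/-! ### The truncated valuation -/

section TruncatedValuation

variable {p : ℕ} [hp : Fact p.Prime]

omit hp in
theorem tv_succ (c : ℕ) (x : ℤ) :
    tv p (c + 1) x = if (p : ℤ) ^ (c + 1) ∣ x then c + 1 else tv p c x := by
  rw [tv, Nat.findGreatest_succ]; rfl

omit hp in
theorem tv_congr {c : ℕ} {x y : ℤ} (h : (p : ℤ) ^ c ∣ x - y) : tv p c x = tv p c y := by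
  have key : ∀ {x y : ℤ}, (p : ℤ) ^ c ∣ x - y → tv p c x ≤ tv p c y := by
    intro x y h
    rw [le_tv_iff (tv_le _ _)]
    have h1 := (pow_dvd_pow (p : ℤ) (tv_le (p := p) c x)).trans h
    exact (dvd_sub_right (pow_tv_dvd c x)).1 h1
  exact le_antisymm (key h) (key (by rw [← dvd_neg, neg_sub]; exact h))

omit hp in
theorem tv_eq_zero {x : ℤ} (h : ¬ (p : ℤ) ∣ x) (c : ℕ) : tv p c x = 0 := by
  by_contra h0
  have h1 : 1 ≤ tv p c x := Nat.one_le_iff_ne_zero.2 h0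
  have h2 := (le_tv_iff (h1.trans (tv_le c x))).1 h1
  exact h (by simpa using h2)

theorem tv_mul (c : ℕ) (x : ℤ) : tv p (c + 1) (p * x) = tv p c x + 1 := by
  have hp0 : (p : ℤ) ≠ 0 := by exact_mod_cast hp.out.ne_zero
  apply le_antisymm
  · have h1 := pow_tv_dvd (p := p) (c + 1) (p * x)
    rcases hm : tv p (c + 1) (p * x) with _ | m
    · omega
    · have h2 := tv_le (p := p) (c + 1) (p * x)
      rw [hm] at h1 h2
      rw [pow_succ', mul_dvd_mul_iff_left hp0] at h1
      have := (le_tv_iff (p := p) (c := c) (e := m) (x := x) (by omega)).2 h1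
      omega
  · rw [le_tv_iff (by have := tv_le (p := p) c x; omega), pow_succ']
    exact mul_dvd_mul_left _ (pow_tv_dvd c x)

end TruncatedValuation

/-! ### Counting solutions near a node -/

section Counting

variable {p : ℕ} [hp : Fact p.Prime] {M : Type*} [AddCommMonoid M]

theorem sum_range_dvd (k : ℕ) (u : M) :
    ∑ y ∈ Finset.range (p ^ k), (if (p : ℤ) ^ k ∣ (y : ℤ) then u else 0) = u := by
  rw [Finset.sum_eq_single_of_mem 0 (Finset.mem_range.2 (pow_pos hp.out.pos k))]
  · simp
  · intro a ha ha0
    rw [if_neg]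
    intro h
    have h' : p ^ k ∣ a := by exact_mod_cast h
    exact absurd (Nat.le_of_dvd (Nat.pos_of_ne_zero ha0) h') (not_le.2 (Finset.mem_range.1 ha))

omit hp in
theorem sum_range_sq_of_periodic {k : ℕ} {ψ : ℤ → ℤ → M} (h : ∀ a a' b b' : ℤ, (p : ℤ) ^ k ∣ a - a' →
    (p : ℤ) ^ k ∣ b - b' → ψ a b = ψ a' b') :
    ∑ a ∈ Finset.range (p ^ (k + 1)), ∑ b ∈ Finset.range (p ^ (k + 1)), ψ a b =
      p ^ 2 • ∑ a ∈ Finset.range (p ^ k), ∑ b ∈ Finset.range (p ^ k), ψ a b := by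
  have h2 : ∀ a : ℤ, ∑ b ∈ Finset.range (p ^ (k + 1)), ψ a b =
      p • ∑ b ∈ Finset.range (p ^ k), ψ a b := by
    intro a
    rw [pow_succ]
    exact sum_range_of_periodic (f := ψ a) (fun x y hxy => h _ _ _ _ (by simp)
      (by exact_mod_cast hxy)) p
  have h3 : ∑ a ∈ Finset.range (p ^ (k + 1)), ∑ b ∈ Finset.range (p ^ k), ψ a b =
      p • ∑ a ∈ Finset.range (p ^ k), ∑ b ∈ Finset.range (p ^ k), ψ a b := by
    rw [pow_succ]
    exact sum_range_of_periodic (f := fun a : ℤ => ∑ b ∈ Finset.range (p ^ k), ψ a b)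
      (fun x y hxy => Finset.sum_congr rfl fun b _ => h _ _ _ _ (by exact_mod_cast hxy) (by simp)) p
  simp only [h2]
  rw [← Finset.smul_sum, h3, smul_smul, sq]

/-- The number of points near a node modulo powers of `p`. -/
theorem NodeFamily.count {H : ℕ → ℤ → ℤ → ℤ} (hH : NodeFamily p H) (k : ℕ) : ∀ m,
    p * ∑ a ∈ Finset.range (p ^ k), ∑ b ∈ Finset.range (p ^ k),
      (if (p : ℤ) ^ k ∣ H m a b then 1 else 0) = p ^ k * (1 + (k + 1) * (p - 1)) := by
  have hp0 : (p : ℤ) ≠ 0 := by exact_mod_cast hp.out.ne_zero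
  obtain ⟨q, hq⟩ : ∃ q, p = q + 1 := ⟨p - 1, by have := hp.out.pos; omega⟩
  have hq' : p - 1 = q := by omega
  have hφ : ∀ (k : ℕ) (x y : ℤ), (p : ℤ) ^ k ∣ x - y →
      (if (p : ℤ) ^ k ∣ x then 1 else 0) = (if (p : ℤ) ^ k ∣ y then 1 else 0) := by
    intro k x y h
    simp only [dvd_iff_dvd_of_dvd_sub h]
  have hu : ∀ (k : ℕ) (x : ℤ), ¬ (p : ℤ) ∣ x → (if (p : ℤ) ^ (k + 1) ∣ x then 1 else 0) = 0 := by
    intro k x hx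
    rw [if_neg fun h => hx ((dvd_pow_self _ (by omega)).trans h)]
  have hsum : ∀ k : ℕ, ∑ y ∈ Finset.range (p ^ k),
      (if (p : ℤ) ^ (k + 1) ∣ (p : ℤ) * y then 1 else 0) = 1 := by
    intro k
    simp only [pow_succ', mul_dvd_mul_iff_left hp0]
    exact sum_range_dvd k 1
  -- Dividing both coordinates by p lowers the required divisibility by two, by `scale`. The factor
  -- p in the statement makes the formula integral at k = 0 as well.
  induction k using Nat.twoStepInduction with
  | zero => intro m; simp [hq]; ring
  | one =>
    intro m
    have h := hH.sum m 0 (ψ := fun a b => if (p : ℤ) ^ 1 ∣ H m a b then 1 else 0) (hφ 1) (hu 0)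
      (fun _ _ _ => rfl)
    rw [zero_add] at h
    rw [h, hsum 0]
    have h1 : (p : ℤ) ^ 1 ∣ H m (p * (0 : ℕ)) (p * (0 : ℕ)) := by
      rw [hH.scale, sq, mul_assoc, pow_one]; exact dvd_mul_right _ _
    simp only [pow_zero, Finset.range_one, Finset.sum_singleton, h1, if_true, hq', smul_eq_mul]
    rw [hq]; ring
  | more k ih _ =>
    intro m
    have h := hH.sum m (k + 1) (ψ := fun a b => if (p : ℤ) ^ (k + 2) ∣ H m a b then 1 else 0)
      (hφ (k + 2)) (hu (k + 1)) (fun _ _ _ => rfl)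
    have h1 : ∀ a b : ℤ, (p : ℤ) ^ (k + 2) ∣ H m (p * a) (p * b) ↔ (p : ℤ) ^ k ∣ H (m + 1) a b := by
      intro a b
      rw [hH.scale, pow_add, mul_comm, mul_dvd_mul_iff_left (pow_ne_zero 2 hp0)]
    simp only [h1] at h
    rw [sum_range_sq_of_periodic (ψ := fun a b => if (p : ℤ) ^ k ∣ H (m + 1) a b then 1 else 0)
      (fun a a' b b' ha hb => hφ k _ _ (hH.congr _ _ _ _ _ _ ha hb)), hsum] at h
    have h2 := ih (m + 1)
    rw [show k + 1 + 1 = k + 2 from rfl] at h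
    rw [h, smul_zero, add_zero, mul_add, smul_eq_mul, mul_left_comm, h2, hq', smul_eq_mul]
    rw [hq]; ring

end Counting

/-! ### Local series -/

theorem ser_rec {D E : ℕ → PowerSeries ℚ} {α : PowerSeries ℚ} (h : ∀ k, D (k + 1) = α * D k + E k) :
    ser D * (1 - PowerSeries.X * α) = D 0 + PowerSeries.X * ser E := by
  have h1 := ser_shift D
  simp_rw [h] at h1
  rw [ser_add, ser_mul_left] at h1
  linear_combination h1

section Local

variable {d : ℕ} (B : Fin d → Fin d → Fin 3 → ℤ) {p : ℕ} [hp : Fact p.Prime]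

/-- The contribution of the lattices `{z : pᶜ ∣ α · z}`, where `α` reduces to a given point, to the
generating series of lattices with cyclic quotient. -/
def localSeries {P : Projectivization (ZMod p) (Fin 3 → ZMod p)} (fr : Frame p P) : PowerSeries ℚ :=
  PowerSeries.X * ser fun k => (p : PowerSeries ℚ) ^ (d * (k + 1)) *
    ∑ a ∈ Finset.range (p ^ k), ∑ b ∈ Finset.range (p ^ k),
      PowerSeries.X ^ comExp p B (cyc (fr.pt (p * a) (p * b)) (p ^ (k + 1)))

theorem cdSeries_one (fr : ∀ P : Projectivization (ZMod p) (Fin 3 → ZMod p), Frame p P) :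
    cdSeries p B 1 = ∑ P, localSeries B (fr P) := by
  simp only [localSeries]
  rw [← Finset.mul_sum, ← ser_sum, cdSeries, ser_shift, cdSum_eq_zero (p := p) (B := B) (j := 1) (k := 0) one_pos, mul_zero, zero_add]
  congr 2
  funext k
  rw [cdSum, latSum, sum_cyclic_lats fr, Finset.mul_sum]
  simp

variable {B} {P : Projectivization (ZMod p) (Fin 3 → ZMod p)} {fr : Frame p P}

local notation "X" => (PowerSeries.X : PowerSeries ℚ)

/-- All p^{2k} lattices at level k + 1 over the point have the same exponent, so the series is
geometric. -/
theorem localSeries_of_unit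
    (h : ∀ (k : ℕ) (a b : ℤ), comExp p B (cyc (fr.pt (p * a) (p * b)) (p ^ (k + 1))) = (k + 1) * d) :
    localSeries B fr * (1 - (p : PowerSeries ℚ) ^ (d + 2) * X ^ (d + 1)) =
      (p : PowerSeries ℚ) ^ d * X ^ (d + 1) := by
  have h1 : ∀ k : ℕ, (p : PowerSeries ℚ) ^ (d * (k + 1)) *
    ∑ a ∈ Finset.range (p ^ k), ∑ b ∈ Finset.range (p ^ k),
      X ^ comExp p B (cyc (fr.pt (p * a) (p * b)) (p ^ (k + 1))) =
      (p : PowerSeries ℚ) ^ d * X ^ d * ((p : PowerSeries ℚ) ^ (d + 2) * X ^ d) ^ k := by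
    intro k
    simp only [h, Finset.sum_const, Finset.card_range, nsmul_eq_mul]
    push_cast
    ring
  simp only [localSeries, h1, ser_mul_left]
  have h2 := ser_pow ((p : PowerSeries ℚ) ^ (d + 2) * X ^ d)
  linear_combination ((p : PowerSeries ℚ) ^ d * X ^ d * X) * h2

section CorankTwo

variable {d₀ : ℕ} {f : ℤ → ℤ → ℤ}

/-- Beyond a contribution of d₀ per level, the exponent is 2(k + 1 − v), where v is the truncated
valuation of f. One further level raises it by two, except where f is divisible by the new power of
p. This gives the recursion `hv`, driven only by the counts N. -/
theorem localSeries_of_corank_two (hd : d = d₀ + 2)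
    (hexp : ∀ (k : ℕ) (a b : ℤ), comExp p B (cyc (fr.pt (p * a) (p * b)) (p ^ (k + 1))) +
      2 * tv p (k + 1) (f a b) = (k + 1) * d)
    (hf0 : ∀ a b, (p : ℤ) ∣ f a b)
    (hf : ∀ n a a' b b' : ℤ, n ∣ a - a' → n ∣ b - b' → p * n ∣ f a b - f a' b') {N : ℕ → ℕ}
    (hN : ∀ k, (N k : PowerSeries ℚ) = ∑ a ∈ Finset.range (p ^ k), ∑ b ∈ Finset.range (p ^ k),
      if (p : ℤ) ^ (k + 1) ∣ f a b then 1 else 0) :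
    localSeries B fr * (1 - (p : PowerSeries ℚ) ^ (d + 2) * X ^ (d + 1)) =
      X * (X ^ 2 * ((p : PowerSeries ℚ) ^ d * X ^ d₀) +
        (1 - X ^ 2) * ser fun k => ((p : PowerSeries ℚ) ^ d * X ^ d₀) ^ (k + 1) * N k) := by
  set Q : PowerSeries ℚ := (p : PowerSeries ℚ) ^ d * X ^ d₀ with hQ
  let v : ℕ → PowerSeries ℚ := fun k => ∑ a ∈ Finset.range (p ^ k), ∑ b ∈ Finset.range (p ^ k),
    X ^ (2 * (k + 1 - tv p (k + 1) (f a b)))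
  have hv0 : v 0 = 1 := by
    simp only [v, pow_zero, Finset.range_one, Finset.sum_singleton, zero_add]
    have : 1 ≤ tv p 1 (f (0 : ℕ) (0 : ℕ)) := (le_tv_iff le_rfl).2 (by simpa using hf0 _ _)
    rw [Nat.sub_eq_zero_of_le this, mul_zero, pow_zero]
  have hper : ∀ k (a a' b b' : ℤ), ((p ^ k : ℕ) : ℤ) ∣ a - a' → ((p ^ k : ℕ) : ℤ) ∣ b - b' →
      tv p (k + 1) (f a b) = tv p (k + 1) (f a' b') := by
    intro k a a' b b' ha hb
    refine tv_congr ?_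
    have := hf _ _ _ _ _ ha hb
    rwa [Nat.cast_pow, ← pow_succ'] at this
  have hv : ∀ k, v (k + 1) = (p : PowerSeries ℚ) ^ 2 * X ^ 2 * v k + (1 - X ^ 2) * N (k + 1) := by
    intro k
    have h1 : ∀ a b : ℤ, X ^ (2 * (k + 1 + 1 - tv p (k + 1 + 1) (f a b))) =
        X ^ 2 * X ^ (2 * (k + 1 - tv p (k + 1) (f a b))) +
          (1 - X ^ 2) * if (p : ℤ) ^ (k + 1 + 1) ∣ f a b then 1 else 0 := by
      intro a b
      rw [tv_succ]
      split_ifs with h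
      · have : tv p (k + 1) (f a b) = k + 1 := le_antisymm (tv_le _ _)
          ((le_tv_iff le_rfl).2 ((pow_dvd_pow _ (by omega)).trans h))
        rw [this]; simp
      · have := tv_le (p := p) (k + 1) (f a b)
        rw [← pow_add]
        simp only [mul_zero, add_zero]
        congr 1; omega
    simp only [v, h1, Finset.sum_add_distrib, ← Finset.mul_sum, ← hN]
    congr 1
    rw [sum_range_sq_of_periodic (ψ := fun a b => X ^ (2 * (k + 1 - tv p (k + 1) (f a b))))
      (fun a a' b b' ha hb => by
        rw [hper k a a' b b' (by exact_mod_cast ha) (by exact_mod_cast hb)]), nsmul_eq_mul]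
    push_cast
    ring
  have h1 : ∀ k : ℕ, (p : PowerSeries ℚ) ^ (d * (k + 1)) *
    ∑ a ∈ Finset.range (p ^ k), ∑ b ∈ Finset.range (p ^ k),
      X ^ comExp p B (cyc (fr.pt (p * a) (p * b)) (p ^ (k + 1))) = Q ^ (k + 1) * v k := by
    intro k
    have h2 : ∀ a b : ℤ, X ^ comExp p B (cyc (fr.pt (p * a) (p * b)) (p ^ (k + 1))) =
        X ^ (d₀ * (k + 1)) * X ^ (2 * (k + 1 - tv p (k + 1) (f a b))) := by
      intro a b
      rw [← pow_add]
      congr 1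
      have h3 := hexp k a b
      have h4 := tv_le (p := p) (k + 1) (f a b)
      obtain ⟨t, ht⟩ := Nat.exists_eq_add_of_le h4
      have h5 : (k + 1) * d = (k + 1) * (d₀ + 2) := by rw [hd]
      have : k + 1 - tv p (k + 1) (f a b) = t := by omega
      rw [this]
      nlinarith
    simp only [h2, ← Finset.mul_sum, v, hQ]
    ring
  have hN0 : (N 0 : PowerSeries ℚ) = 1 := by
    have := hN 0
    simp only [pow_zero, Finset.range_one, Finset.sum_singleton, zero_add, pow_one, hf0,
      if_true] at this
    exact this
  have h2 := ser_rec (D := fun k => Q ^ (k + 1) * v k) (α := Q * ((p : PowerSeries ℚ) ^ 2 * X ^ 2))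
    (E := fun k => (1 - X ^ 2) * (Q ^ (k + 2) * N (k + 1))) (fun k => by simp only [hv]; ring)
  have h3 := ser_shift fun k => Q ^ (k + 1) * N k
  simp only [ser_mul_left] at h2
  simp only [zero_add, hN0, hv0] at h2 h3
  have h4 : X * (Q * ((p : PowerSeries ℚ) ^ 2 * X ^ 2)) = (p : PowerSeries ℚ) ^ (d + 2) * X ^ (d + 1) := by
    rw [hQ, hd]; ring
  rw [h4] at h2
  simp only [localSeries, h1]
  linear_combination X * h2 - X * (1 - X ^ 2) * h3

/-- For fixed b, f permutes the residues in a, so exactly p^k pairs modulo p^k satisfy the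
congruence. -/
theorem localSeries_of_smooth (hd : d = d₀ + 2)
    (hexp : ∀ (k : ℕ) (a b : ℤ), comExp p B (cyc (fr.pt (p * a) (p * b)) (p ^ (k + 1))) +
      2 * tv p (k + 1) (p * f a b) = (k + 1) * d)
    (hf : ∀ n a a' b b' : ℤ, n ∣ a - a' → n ∣ b - b' → n ∣ f a b - f a' b')
    (hinj : ∀ (n : ℕ) (a a' b : ℤ), (p : ℤ) ^ n ∣ f a b - f a' b → (p : ℤ) ^ n ∣ a - a') :
    localSeries B fr * (1 - (p : PowerSeries ℚ) ^ (d + 2) * X ^ (d + 1)) *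
        (1 - (p : PowerSeries ℚ) ^ (d + 1) * X ^ (d₀ + 1)) =
      (p : PowerSeries ℚ) ^ d * X ^ (d₀ + 1) *
        (1 - (p : PowerSeries ℚ) ^ (d + 1) * X ^ (d₀ + 3)) := by
  have hp0 : (p : ℤ) ≠ 0 := by exact_mod_cast hp.out.ne_zero
  have hcount : ∀ k, ((p ^ k : ℕ) : PowerSeries ℚ) =
      ∑ a ∈ Finset.range (p ^ k), ∑ b ∈ Finset.range (p ^ k),
      if (p : ℤ) ^ (k + 1) ∣ p * f a b then 1 else 0 := by
    intro k
    have h1 : ∀ b ∈ Finset.range (p ^ k), ∑ a ∈ Finset.range (p ^ k),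
        (if (p : ℤ) ^ (k + 1) ∣ p * f a b then (1 : PowerSeries ℚ) else 0) = 1 := by
      intro b _
      simp only [pow_succ', mul_dvd_mul_iff_left hp0]
      have hpos : 0 < p ^ k := pow_pos hp.out.pos k
      rw [sum_range_comp (f := fun y => if (p : ℤ) ^ k ∣ y then (1 : PowerSeries ℚ) else 0)
        (g := fun a => f a b) hpos]
      · exact sum_range_dvd k 1
      · intro x y h
        have h' : (p : ℤ) ^ k ∣ x - y := by exact_mod_cast h
        simp only [(dvd_iff_dvd_of_dvd_sub h')]
      · intro x y h
        exact_mod_cast hinj k x y b (by exact_mod_cast h)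
    rw [Finset.sum_comm, Finset.sum_congr rfl h1]
    simp
  have h := localSeries_of_corank_two (f := fun a b => p * f a b) (N := fun k => p ^ k) hd hexp
    (fun a b => dvd_mul_right _ _)
    (fun n a a' b b' ha hb => by rw [← mul_sub]; exact mul_dvd_mul_left _ (hf n a a' b b' ha hb)) hcount
  set Q : PowerSeries ℚ := (p : PowerSeries ℚ) ^ d * X ^ d₀ with hQ
  have h1 : ser (fun k => Q ^ (k + 1) * ((p ^ k : ℕ) : PowerSeries ℚ)) =
      Q * ser fun k => (Q * p) ^ k := by
    rw [← ser_mul_left]; congr 1; funext k; push_cast; ring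
  have h2 := ser_pow (Q * p)
  rw [h1] at h
  rw [h, pow_succ _ d, pow_succ _ d₀, pow_add _ d₀ 3]
  linear_combination (X * (1 - X ^ 2) * Q) * h2

/-- F carries a factor p² near the node, so divisibility by p^{k+1} asks for only k − 1 digits of H.
The count comes from `NodeFamily.count`, with a factor p² for the free last digits of a and b. -/
theorem localSeries_of_node_two (hd : d = d₀ + 2) {H : ℕ → ℤ → ℤ → ℤ} (hH : NodeFamily p H)
    (hexp : ∀ (k : ℕ) (a b : ℤ), comExp p B (cyc (fr.pt (p * a) (p * b)) (p ^ (k + 1))) +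
      2 * tv p (k + 1) (p ^ 2 * H 0 a b) = (k + 1) * d) :
    localSeries B fr * (1 - (p : PowerSeries ℚ) ^ (d + 2) * X ^ (d + 1)) *
        (1 - (p : PowerSeries ℚ) ^ (d + 1) * X ^ (d₀ + 1)) ^ 2 =
      (p : PowerSeries ℚ) ^ d * X ^ (d₀ + 1) *
        (X ^ 2 * (1 - (p : PowerSeries ℚ) ^ (d + 1) * X ^ (d₀ + 1)) ^ 2 +
          (1 - X ^ 2) * (1 + (p - 2) * (p : PowerSeries ℚ) ^ (d + 1) * X ^ (d₀ + 1))) := by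
  have hp0 : (p : ℤ) ≠ 0 := by exact_mod_cast hp.out.ne_zero
  have hp1 : ((p - 1 : ℕ) : PowerSeries ℚ) = p - 1 := by
    rw [Nat.cast_sub hp.out.one_le, Nat.cast_one]
  have hcount : ∀ k, ((p ^ k * (1 + k * (p - 1)) : ℕ) : PowerSeries ℚ) =
      ∑ a ∈ Finset.range (p ^ k), ∑ b ∈ Finset.range (p ^ k),
      if (p : ℤ) ^ (k + 1) ∣ p ^ 2 * H 0 a b then 1 else 0 := by
    intro k
    have h0 : ∑ a ∈ Finset.range (p ^ k), ∑ b ∈ Finset.range (p ^ k),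
        (if (p : ℤ) ^ (k + 1) ∣ p ^ 2 * H 0 a b then 1 else 0) = p ^ k * (1 + k * (p - 1)) := by
      rcases k with _ | k
      · have : ∀ x : ℤ, (p : ℤ) ^ 1 ∣ p ^ 2 * x := fun x => (pow_dvd_pow _ (by omega)).mul_right _
        simp only [zero_add, pow_zero, Finset.range_one, Finset.sum_singleton, this, if_true]
        simp
      · have h1 : ∀ x : ℤ, (p : ℤ) ^ (k + 1 + 1) ∣ p ^ 2 * x ↔ (p : ℤ) ^ k ∣ x := by
          intro x
          rw [add_assoc, pow_add, mul_comm, mul_dvd_mul_iff_left (pow_ne_zero 2 hp0)]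
        simp only [h1]
        rw [sum_range_sq_of_periodic (ψ := fun a b => if (p : ℤ) ^ k ∣ H 0 a b then 1 else 0)
          (fun a a' b b' ha hb => by
            simp only [dvd_iff_dvd_of_dvd_sub (hH.congr 0 _ _ _ _ _ ha hb)])]
        have := hH.count k 0
        rw [smul_eq_mul, sq, mul_assoc, this]
        ring
    rw [← h0]
    push_cast
    rfl
  have h := localSeries_of_corank_two (f := fun a b => p ^ 2 * H 0 a b)
    (N := fun k => p ^ k * (1 + k * (p - 1))) hd hexp
    (fun a b => (dvd_pow_self _ two_ne_zero).mul_right _)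
    (fun n a a' b b' ha hb => by
      rw [← mul_sub]
      exact mul_dvd_mul (dvd_pow_self _ two_ne_zero) (hH.congr 0 n a a' b b' ha hb)) hcount
  set Q : PowerSeries ℚ := (p : PowerSeries ℚ) ^ d * X ^ d₀ with hQ
  set Z := ser fun k => Q ^ (k + 1) * ((p ^ k * (1 + k * (p - 1)) : ℕ) : PowerSeries ℚ) with hZ
  have h1 := ser_rec (D := fun k => Q ^ (k + 1) * ((p ^ k * (1 + k * (p - 1)) : ℕ) : PowerSeries ℚ))
    (α := Q * p) (E := fun k => (Q ^ 2 * p * (p - 1)) * (Q * p) ^ k) (fun k => by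
      push_cast [hp1]
      ring)
  simp only [ser_mul_left, ← hZ] at h1
  simp only [zero_add, pow_one, pow_zero, zero_mul, add_zero, mul_one,
    Nat.cast_one] at h1
  have h2 := ser_pow (Q * p)
  have e1 : (p : PowerSeries ℚ) ^ (d + 1) * X ^ (d₀ + 1) = X * (Q * p) := by rw [hQ]; ring
  have e2 : (p : PowerSeries ℚ) ^ d * X ^ (d₀ + 1) = X * Q := by rw [hQ]; ring
  have e3 : ((p : PowerSeries ℚ) - 2) * (p : PowerSeries ℚ) ^ (d + 1) * X ^ (d₀ + 1) =
    (p - 2) * (X * (Q * p)) := by rw [hQ]; ring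
  rw [h, e1, e2, e3]
  linear_combination (X * (1 - X ^ 2) * (1 - X * (Q * p))) * h1 +
    (X * (1 - X ^ 2) * X * (Q ^ 2 * p * (p - 1))) * h2

end CorankTwo

/-- Points are organised by their distance p^{m+1} from the node. At exactly this distance the 4×4
remainder is p^{m+1} times a matrix of corank at most two; points closer to the node are handled by
raising m. -/
theorem localSeries_of_node_four {d₀ : ℕ} (hd : d = d₀ + 4) {H : ℕ → ℤ → ℤ → ℤ}
    (hH : NodeFamily p H)
    (hexp : ∀ (m k : ℕ) (a b : ℤ), ¬ ((p : ℤ) ∣ a ∧ (p : ℤ) ∣ b) →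
      comExp p B (cyc (fr.pt (p ^ (m + 1) * a) (p ^ (m + 1) * b)) (p ^ (m + 1 + k))) +
        (4 * (m + 1) + 2 * tv p k (H m a b)) = (m + 1 + k) * d)
    (hexp0 : ∀ (m : ℕ) (a b : ℤ),
      comExp p B (cyc (fr.pt (p ^ (m + 1) * a) (p ^ (m + 1) * b)) (p ^ (m + 1))) = (m + 1) * d₀) :
    localSeries B fr * (1 - (p : PowerSeries ℚ) ^ d * X ^ (d₀ + 1)) *
        (1 - (p : PowerSeries ℚ) ^ (d + 2) * X ^ (d₀ + 5)) *
        (1 - (p : PowerSeries ℚ) ^ (d + 1) * X ^ (d₀ + 3)) =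
      (p : PowerSeries ℚ) ^ d * X ^ (d₀ + 1) *
      ((1 - (p : PowerSeries ℚ) ^ (d + 2) * X ^ (d₀ + 5)) *
        (1 - (p : PowerSeries ℚ) ^ (d + 1) * X ^ (d₀ + 3)) +
      (p : PowerSeries ℚ) ^ d * X ^ (d₀ + 1) * ((p - 1) ^ 2 * X ^ 4 *
          (1 - (p : PowerSeries ℚ) ^ (d + 1) * X ^ (d₀ + 3)) +
        2 * (p - 1) * X ^ 2 * (1 - (p : PowerSeries ℚ) ^ (d + 1) * X ^ (d₀ + 5)))) := by
  have hp1 : ((p - 1 : ℕ) : PowerSeries ℚ) = p - 1 := by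
    rw [Nat.cast_sub hp.out.one_le, Nat.cast_one]
  -- E is the excess of the exponent over the part d₀ per level due to the invertible block.
  let E : ℕ → ℕ → ℤ → ℤ → ℕ := fun m k a b =>
    comExp p B (cyc (fr.pt (p ^ (m + 1) * a) (p ^ (m + 1) * b)) (p ^ (m + 1 + k))) - (m + 1 + k) * d₀
  have hE : ∀ (m k : ℕ) (a b : ℤ), ¬ ((p : ℤ) ∣ a ∧ (p : ℤ) ∣ b) →
      E m k a b = 4 * k - 2 * tv p k (H m a b) := by
    intro m k a b hab
    have h := hexp m k a b hab
    have h5 : (m + 1 + k) * d = (m + 1 + k) * d₀ + 4 * (m + 1) + 4 * k := by rw [hd]; ring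
    simp only [E]
    omega
  have hEs : ∀ (m k : ℕ) (a b : ℤ), E m (k + 1) (p * a) (p * b) = E (m + 1) k a b := by
    intro m k a b
    simp only [E, ← mul_assoc, ← pow_succ]
    rw [show m + 1 + (k + 1) = m + 1 + 1 + k by ring]
  -- The bound ensures that nothing is lost in the truncated subtraction defining E.
  have hle : ∀ (k m : ℕ) (a b : ℤ), (m + 1 + k) * d₀ ≤
      comExp p B (cyc (fr.pt (p ^ (m + 1) * a) (p ^ (m + 1) * b)) (p ^ (m + 1 + k))) := by
    intro k
    induction k with
    | zero => intro m a b; exact (hexp0 m a b).ge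
    | succ k ih =>
      intro m a b
      by_cases hab : (p : ℤ) ∣ a ∧ (p : ℤ) ∣ b
      · obtain ⟨⟨a, rfl⟩, b, rfl⟩ := hab
        have := ih (m + 1) a b
        simp only [← mul_assoc, ← pow_succ]
        rwa [show m + 1 + (k + 1) = m + 1 + 1 + k by ring]
      · have h := hexp m (k + 1) a b hab
        have h5 : (m + 1 + (k + 1)) * d = (m + 1 + (k + 1)) * d₀ + 4 * (m + 1) + 4 * (k + 1) := by
          rw [hd]; ring
        have := tv_le (p := p) (k + 1) (H m a b)
        omega
  let U : ℕ → ℕ → PowerSeries ℚ := fun m k =>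
    ∑ a ∈ Finset.range (p ^ k), ∑ b ∈ Finset.range (p ^ k), X ^ E m k a b
  let ξ : ℕ → PowerSeries ℚ := fun k =>
    ∑ y ∈ Finset.range (p ^ k), X ^ (2 * k - 2 * tv p k (y : ℤ))
  -- Θ collects the pairs (a, b) with a unit coordinate: exactly one unit gives the one-variable sum
  -- ξ, two units give a constant exponent.
  let Θ : ℕ → PowerSeries ℚ := fun k =>
    2 * ((p - 1) * (p : PowerSeries ℚ) ^ k) * (X ^ (2 * k + 2) * ξ k) +
      ((p - 1) * (p : PowerSeries ℚ) ^ k) ^ 2 * X ^ (4 * (k + 1))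
  have hU0 : ∀ m, U m 0 = 1 := by
    intro m
    simp only [U, pow_zero, Finset.range_one, Finset.sum_singleton, E, add_zero, hexp0,
      Nat.sub_self]
  have hU : ∀ m k, U m (k + 1) = U (m + 1) k + Θ k := by
    intro m k
    have h := hH.sum m k (ψ := fun a b => X ^ E m (k + 1) a b)
      (φ := fun x => X ^ (4 * (k + 1) - 2 * tv p (k + 1) x)) (u := X ^ (4 * (k + 1)))
      (fun x y hxy => by simp only [tv_congr hxy]) (fun x hx => by simp only [tv_eq_zero hx]; simp)
      (fun a b hab => by simp only [hE m (k + 1) a b hab])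
    simp only [hEs] at h
    have h1 : ∀ y : ℕ, X ^ (4 * (k + 1) - 2 * tv p (k + 1) ((p : ℤ) * (y : ℤ))) =
        X ^ (2 * k + 2) * X ^ (2 * k - 2 * tv p k (y : ℤ)) := by
      intro y
      rw [tv_mul, ← pow_add]
      have := tv_le (p := p) k (y : ℤ)
      congr 1; omega
    simp only [h1, ← Finset.mul_sum] at h
    simp only [U, Θ, ξ, h, nsmul_eq_mul]
    push_cast [hp1]
    ring
  -- The increments Θ do not involve m, hence neither does U; the recursion then closes up in k
  -- alone.
  have hUm : ∀ k m, U m k = U 0 k := by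
    intro k
    induction k with
    | zero => intro m; rw [hU0, hU0]
    | succ k ih => intro m; rw [hU, hU, ih, ih 1]
  have hξ : ∀ k, ξ (k + 1) = p * X ^ 2 * ξ k + (1 - X ^ 2) := by
    intro k
    have h1 : ∀ y : ℤ, X ^ (2 * (k + 1) - 2 * tv p (k + 1) y) =
        X ^ 2 * X ^ (2 * k - 2 * tv p k y) +
          if (p : ℤ) ^ (k + 1) ∣ y then (1 - X ^ 2) else 0 := by
      intro y
      rw [tv_succ]
      split_ifs with h
      · have : tv p k y = k := le_antisymm (tv_le _ _)
          ((le_tv_iff le_rfl).2 ((pow_dvd_pow _ (by omega)).trans h))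
        rw [this]; simp
      · have := tv_le (p := p) k y
        rw [← pow_add, add_zero]
        congr 1; omega
    simp only [ξ, h1, Finset.sum_add_distrib, ← Finset.mul_sum]
    rw [sum_range_dvd, pow_succ p k, sum_range_of_periodic
      (f := fun y : ℤ => X ^ (2 * k - 2 * tv p k y)) (fun x y h => by
        simp only [tv_congr (p := p) (c := k) (x := x) (y := y) (by exact_mod_cast h)]) p, nsmul_eq_mul]
    ring
  have hξ0 : ξ 0 = 1 := by simp [ξ]
  set Q : PowerSeries ℚ := (p : PowerSeries ℚ) ^ d * X ^ d₀ with hQ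
  have h1 : ∀ k : ℕ, (p : PowerSeries ℚ) ^ (d * (k + 1)) *
    ∑ a ∈ Finset.range (p ^ k), ∑ b ∈ Finset.range (p ^ k),
      X ^ comExp p B (cyc (fr.pt (p * a) (p * b)) (p ^ (k + 1))) = Q ^ (k + 1) * U 0 k := by
    intro k
    have h2 : ∀ a b : ℤ, X ^ comExp p B (cyc (fr.pt (p * a) (p * b)) (p ^ (k + 1))) =
        X ^ (d₀ * (k + 1)) * X ^ E 0 k a b := by
      intro a b
      rw [← pow_add]
      congr 1
      have h := hle k 0 a b
      simp only [E]
      simp only [zero_add, pow_one] at h ⊢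
      rw [add_comm k 1, mul_comm d₀]
      omega
    simp only [h2, ← Finset.mul_sum, U, hQ]
    ring
  let ρ : PowerSeries ℚ := Q * p * X ^ 2
  have g1 := ser_rec (D := fun k => Q ^ (k + 1) * U 0 k) (α := Q)
    (E := fun k => Q * (2 * (p - 1) * Q * X ^ 2 * (ρ ^ k * ξ k) +
      (p - 1) ^ 2 * Q * X ^ 4 * (Q * p ^ 2 * X ^ 4) ^ k)) (fun k => by
        rw [hU, hUm k (0 + 1)]; simp only [Θ, ρ]; ring)
  have g2 := ser_rec (D := fun k => ρ ^ k * ξ k) (α := ρ * (p * X ^ 2))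
    (E := fun k => (ρ * (1 - X ^ 2)) * ρ ^ k) (fun k => by rw [hξ]; ring)
  have g3 := ser_pow ρ
  have g4 := ser_pow (Q * p ^ 2 * X ^ 4)
  simp only [ser_add, ser_mul_left, hU0, hξ0, zero_add, pow_one, pow_zero, mul_one] at g1 g2
  simp only [localSeries, h1]
  have e1 : (p : PowerSeries ℚ) ^ d * X ^ (d₀ + 1) = X * Q := by rw [hQ]; ring
  have e2 : (p : PowerSeries ℚ) ^ (d + 2) * X ^ (d₀ + 5) = X * (Q * p ^ 2 * X ^ 4) := by rw [hQ]; ring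
  have e3 : (p : PowerSeries ℚ) ^ (d + 1) * X ^ (d₀ + 3) = X * ρ := by simp only [ρ, hQ]; ring
  have e4 : (p : PowerSeries ℚ) ^ (d + 1) * X ^ (d₀ + 5) = X * ρ * X ^ 2 := by
    simp only [ρ, hQ]; ring
  have e5 : X * (ρ * (p * X ^ 2)) = X * (Q * p ^ 2 * X ^ 4) := by simp only [ρ]; ring
  rw [e5] at g2
  rw [e1, e2, e3, e4]
  set S := ser fun k => Q ^ (k + 1) * U 0 k
  set Z := ser fun k => ρ ^ k * ξ k
  set R := ser fun k => ρ ^ k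
  set V := ser fun k => (Q * (p : PowerSeries ℚ) ^ 2 * X ^ 4) ^ k
  set τ := Q * (p : PowerSeries ℚ) ^ 2 * X ^ 4
  linear_combination X * (1 - X * τ) * (1 - X * ρ) * g1 +
    X * X * Q * (2 * (p - 1) * Q * X ^ 2) * (1 - X * ρ) * g2 +
    X * X * Q * (2 * (p - 1) * Q * X ^ 2) * X * (ρ * (1 - X ^ 2)) * g3 +
    X * X * Q * ((p - 1) ^ 2 * Q * X ^ 4) * (1 - X * ρ) * g4

end Local

/-! ### Homogeneous polynomials -/

section Homogeneous

variable {σ R : Type*} [CommRing R]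

variable (σ R) in
/-- The substitution `xᵢ ↦ t xᵢ`. -/
def scaling : MvPolynomial σ R →ₐ[R] Polynomial (MvPolynomial σ R) :=
  aeval fun i => Polynomial.X * Polynomial.C (X i)

theorem coeff_scaling (f : MvPolynomial σ R) (k : ℕ) :
    (scaling σ R f).coeff k = homogeneousComponent k f := by
  induction f using MvPolynomial.induction_on' with
  | add f g hf hg => rw [map_add, Polynomial.coeff_add, hf, hg, map_add]
  | monomial u r =>
    have h1 : scaling σ R (monomial u r) = Polynomial.C (monomial u r) * Polynomial.X ^ u.degree := by
      rw [scaling, aeval_monomial, monomial_eq, Finsupp.prod, Finsupp.prod, Finsupp.degree_apply]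
      simp only [mul_pow, Finset.prod_mul_distrib, Finset.prod_pow_eq_pow_sum, map_mul, map_prod,
        map_pow]
      rw [show (algebraMap R (Polynomial (MvPolynomial σ R))) r = Polynomial.C (C r) from rfl]
      ring
    rw [h1, Polynomial.coeff_C_mul_X_pow]
    split_ifs with h
    · rw [homogeneousComponent_eq_self (isHomogeneous_monomial r h.symm)]
    · rw [homogeneousComponent_of_mem (isHomogeneous_monomial r rfl), if_neg h]

theorem isHomogeneous_iff_scaling {f : MvPolynomial σ R} {n : ℕ} :
    f.IsHomogeneous n ↔ scaling σ R f = Polynomial.C f * Polynomial.X ^ n := by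
  constructor
  · intro h
    ext1 k
    rw [coeff_scaling, homogeneousComponent_of_mem h, Polynomial.coeff_C_mul_X_pow]
  · intro h
    have h1 := coeff_scaling f n
    rw [h, Polynomial.coeff_C_mul_X_pow, if_pos rfl] at h1
    rw [h1]
    exact homogeneousComponent_isHomogeneous n f

/-- Divisors of homogeneous polynomials are homogeneous. -/
theorem isHomogeneous_of_dvd [IsDomain R] {f g : MvPolynomial σ R} {n : ℕ} (hg : g.IsHomogeneous n)
    (hg0 : g ≠ 0) (h : f ∣ g) : ∃ m, f.IsHomogeneous m := by
  obtain ⟨q, rfl⟩ := h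
  have hf0 : f ≠ 0 := left_ne_zero_of_mul hg0
  have hinj : ∀ f : MvPolynomial σ R, f ≠ 0 → scaling σ R f ≠ 0 := by
    intro f hf h
    refine hf ?_
    have h1 : Polynomial.eval 1 (scaling σ R f) = f := by
      have : (Polynomial.evalRingHom (1 : MvPolynomial σ R)).comp (scaling σ R).toRingHom =
          RingHom.id _ := by
        ext i <;> simp [scaling]
      exact RingHom.congr_fun this f
    rw [← h1, h, Polynomial.eval_zero]
  have h0 := hinj f hf0
  have h0' := hinj q (right_ne_zero_of_mul hg0)
  have h1 := isHomogeneous_iff_scaling.1 hg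
  rw [map_mul] at h1
  -- As polynomials in the scaling variable, the two factors multiply to a monomial, so each has
  -- equal lowest and highest degree.
  have hm : Polynomial.C (f * q) * Polynomial.X ^ n = Polynomial.monomial n (f * q) :=
    Polynomial.C_mul_X_pow_eq_monomial
  rw [hm] at h1
  have h2 := congrArg Polynomial.natDegree h1
  have h3 := congrArg Polynomial.natTrailingDegree h1
  rw [Polynomial.natDegree_mul h0 h0', Polynomial.natDegree_monomial_eq _ hg0] at h2
  rw [Polynomial.natTrailingDegree_mul h0 h0', Polynomial.natTrailingDegree_monomial hg0] at h3
  have h4 := Polynomial.natTrailingDegree_le_natDegree (scaling σ R f)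
  have h5 := Polynomial.natTrailingDegree_le_natDegree (scaling σ R q)
  have h6 : (scaling σ R f).natTrailingDegree = (scaling σ R f).natDegree := by omega
  refine ⟨(scaling σ R f).natDegree, ?_⟩
  have h7 : f = homogeneousComponent (scaling σ R f).natDegree f := by
    conv_lhs => rw [← sum_homogeneousComponent f]
    have hz : ∀ k, k ≠ (scaling σ R f).natDegree → homogeneousComponent k f = 0 := by
      intro k hk
      rw [← coeff_scaling]
      rcases lt_or_gt_of_ne hk with h | h
      · exact Polynomial.coeff_eq_zero_of_lt_natTrailingDegree (by omega)
      · exact Polynomial.coeff_eq_zero_of_natDegree_lt h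
    by_cases hmem : (scaling σ R f).natDegree ∈ Finset.range (f.totalDegree + 1)
    · exact Finset.sum_eq_single_of_mem _ hmem fun k _ hk => hz k hk
    · rw [homogeneousComponent_eq_zero _ _ (by simpa using hmem)]
      exact Finset.sum_eq_zero fun k hk => hz k fun h => hmem (h ▸ hk)
  have h8 := homogeneousComponent_isHomogeneous (scaling σ R f).natDegree f
  rwa [← h7] at h8

theorem isHomogeneous_det {d d' : ℕ} (B : Fin d → Fin d → Fin d' → ℤ) :
    (commutatorMatrix B).det.IsHomogeneous d := by
  rw [Matrix.det_apply]
  refine IsHomogeneous.sum _ _ _ fun τ _ => ?_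
  rw [Units.smul_def, zsmul_eq_mul, show ((Equiv.Perm.sign τ : ℤ) : MvPolynomial (Fin d') ℤ) =
    C ((Equiv.Perm.sign τ : ℤ)) from by simp]
  refine IsHomogeneous.C_mul ?_ _
  have := IsHomogeneous.prod Finset.univ (fun i => commutatorMatrix B (τ i) i) (fun _ => 1)
    (fun i _ => by
      rw [commutatorMatrix, Matrix.of_apply]
      exact IsHomogeneous.sum _ _ _ fun k _ => isHomogeneous_C_mul_X _ _)
  simpa using this

theorem isHomogeneous_pfaffian {d d' : ℕ} {B : Fin d → Fin d → Fin d' → ℤ}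
    {F : MvPolynomial (Fin d') ℤ} (hF : F ^ 2 = (commutatorMatrix B).det) (hF0 : F ≠ 0) :
    ∃ n, F.IsHomogeneous n := by
  have h := isHomogeneous_det B
  rw [← hF] at h
  exact isHomogeneous_of_dvd h (pow_ne_zero 2 hF0) (dvd_pow_self F two_ne_zero)

theorem eval_smul_of_isHomogeneous {f : MvPolynomial σ R} {n : ℕ} (hf : f.IsHomogeneous n)
    (u : R) (v : σ → R) : eval (fun i => u * v i) f = u ^ n * eval v f := by
  rw [eval_eq, eval_eq, Finset.mul_sum]
  refine Finset.sum_congr rfl fun s hs => ?_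
  have hdeg := hf.degree_eq_sum_deg_support hs
  simp only [mul_pow, Finset.prod_mul_distrib, Finset.prod_pow_eq_pow_sum]
  rw [← hdeg]; ring

theorem dvd_eval_sub {f : MvPolynomial σ R} {n : R} {v v' : σ → R} (h : ∀ i, n ∣ v i - v' i) :
    n ∣ eval v f - eval v' f := by
  induction f using MvPolynomial.induction_on with
  | C a => simp
  | add f g hf hg => rw [map_add, map_add, add_sub_add_comm]; exact dvd_add hf hg
  | mul_X f i hf =>
    rw [map_mul, map_mul, eval_X, eval_X]
    have : eval v f * v i - eval v' f * v' i =
      (eval v f - eval v' f) * v i + eval v' f * (v i - v' i) := by ring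
    rw [this]
    exact dvd_add (hf.mul_right _) ((h i).mul_left _)

theorem eval_add_smul [Fintype σ] (f : MvPolynomial σ R) (v u : σ → R) (t : R) :
    ∃ s, eval (v + t • u) f = eval v f + t * ∑ i, u i * eval v (pderiv i f) + t ^ 2 * s := by
  classical
  induction f using MvPolynomial.induction_on with
  | C a => exact ⟨0, by simp⟩
  | add f g hf hg =>
    obtain ⟨s, hs⟩ := hf
    obtain ⟨s', hs'⟩ := hg
    refine ⟨s + s', ?_⟩
    simp only [map_add, hs, hs', mul_add, Finset.sum_add_distrib]
    ring
  | mul_X f i hf =>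
    obtain ⟨s, hs⟩ := hf
    refine ⟨u i * ∑ j, u j * eval v (pderiv j f) + s * (v i + t * u i), ?_⟩
    have h1 : ∑ j, u j * eval v (pderiv j (f * X i)) =
        v i * ∑ j, u j * eval v (pderiv j f) + u i * eval v f := by
      simp only [Derivation.leibniz, pderiv_X, smul_eq_mul, map_add, map_mul, eval_X, mul_add,
        Finset.sum_add_distrib, Finset.mul_sum]
      rw [add_comm]
      congr 1
      · exact Finset.sum_congr rfl fun _ _ => by ring
      · rw [Finset.sum_eq_single i]
        · simp
        · intro j _ hj; simp [Ne.symm hj]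
        · simp
    rw [h1]
    simp only [map_mul, eval_X, hs, Pi.add_apply, Pi.smul_apply, smul_eq_mul]
    ring

end Homogeneous

/-! ### Nodes with integral coordinates -/

/-- The expansion `F(w + y)` at an integral point. -/
def expandInt (F : MvPolynomial (Fin 3) ℤ) (w : Fin 3 → ℤ) : MvPolynomial (Fin 3) ℤ :=
  aeval (fun i => C (w i) + X i) F

theorem eval_expandInt (F : MvPolynomial (Fin 3) ℤ) (w v : Fin 3 → ℤ) :
    eval v (expandInt F w) = eval (w + v) F := by
  rw [expandInt]
  have : (eval v).comp (aeval (fun i => C (w i) + X i) : MvPolynomial (Fin 3) ℤ →ₐ[ℤ] _).toRingHom =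
      eval (w + v) := by
    ext i <;> simp
  exact RingHom.congr_fun this F

/-- An ordinary double point of `F = 0` with integral coordinates and tangents, together with a
normal form of the commutator matrix there. -/
structure IntNode {d : ℕ} (B : Fin d → Fin d → Fin 3 → ℤ) (F : MvPolynomial (Fin 3) ℤ) where
  w : Fin 3 → ℤ
  e₁ : Fin 3 → ℤ
  e₂ : Fin 3 → ℤ
  κ : ℤ
  comp_zero : homogeneousComponent 0 (expandInt F w) = 0
  comp_one : homogeneousComponent 1 (expandInt F w) = 0
  comp_two : ∀ a b : ℤ, eval (a • e₁ + b • e₂) (homogeneousComponent 2 (expandInt F w)) = κ * a * b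
  k : ℕ
  l : ℕ
  e : Fin k ⊕ Fin l ≃ Fin d
  Q : Matrix (Fin k ⊕ Fin l) (Fin k ⊕ Fin l) ℤ
  A : Matrix (Fin k) (Fin k) ℤ
  conj : Q * (Mat B w).submatrix e e * Q.transpose = Matrix.fromBlocks A 0 0 0

namespace IntNode

variable {d : ℕ} {B : Fin d → Fin d → Fin 3 → ℤ} {F : MvPolynomial (Fin 3) ℤ} (N : IntNode B F)

/-- The product of the quantities that must be invertible modulo `p`. -/
def disc : ℤ := (Matrix.of ![N.w, N.e₁, N.e₂]).det * N.κ * N.Q.det * N.A.det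

/-- The terms of degree at least three of the expansion, scaled by `t`. -/
def tail (t : ℤ) : MvPolynomial (Fin 3) ℤ :=
  ∑ k ∈ Finset.range ((expandInt F N.w).totalDegree),
    C (t ^ k) * homogeneousComponent (k + 3) (expandInt F N.w)

/-- The components of degree 0 and 1 vanish and the quadratic one is κab in the tangent frame, which
leaves t² times a perturbation of κab. -/
theorem eval_eq (t a b : ℤ) : eval (N.w + t • (a • N.e₁ + b • N.e₂)) F =
    t ^ 2 * (N.κ * a * b + t * eval (a • N.e₁ + b • N.e₂) (N.tail t)) := by
  set v := a • N.e₁ + b • N.e₂ with hv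
  set E := expandInt F N.w with hE
  have hcomp : ∀ k, eval (t • v) (homogeneousComponent k E) =
      t ^ k * eval v (homogeneousComponent k E) := fun k =>
    eval_smul_of_isHomogeneous (homogeneousComponent_isHomogeneous k E) t v
  have h1 : eval (N.w + t • v) F = ∑ k ∈ Finset.range (E.totalDegree + 3),
      t ^ k * eval v (homogeneousComponent k E) := by
    rw [← eval_expandInt, ← hE]
    conv_lhs => rw [← sum_homogeneousComponent E]
    rw [map_sum]
    simp only [hcomp]
    refine Finset.sum_subset (Finset.range_mono (by omega)) fun k _ hk => ?_
    rw [homogeneousComponent_eq_zero _ _ (by simpa using hk), map_zero, mul_zero]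
  rw [h1, Finset.sum_range_succ', Finset.sum_range_succ', Finset.sum_range_succ', N.comp_zero,
    N.comp_one, N.comp_two a b, tail, ← hE]
  simp only [map_zero, mul_zero, add_zero, map_sum, map_mul, eval_C, zero_add, mul_add,
    Finset.mul_sum]
  rw [add_comm]
  congr 1
  exact Finset.sum_congr rfl fun _ _ => by ring

/-- The rescaled equation of the curve near the node. -/
def fam (p m : ℕ) (a b : ℤ) : ℤ :=
  N.κ * a * b + (p : ℤ) ^ (m + 1) * eval (a • N.e₁ + b • N.e₂) (N.tail ((p : ℤ) ^ (m + 1)))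

variable {p : ℕ} [hp : Fact p.Prime]

omit hp in
theorem eval_eq_fam (m : ℕ) (a b : ℤ) : eval (N.w + (p : ℤ) ^ (m + 1) • (a • N.e₁ + b • N.e₂)) F =
    (p : ℤ) ^ (2 * (m + 1)) * N.fam p m a b := by
  rw [eval_eq, fam, ← pow_mul, mul_comm (m + 1)]

theorem dvd_of_unit_mul {n : ℕ} {x u s : ℤ} (hu : ¬ (p : ℤ) ∣ u)
    (h : (p : ℤ) ^ n ∣ x * (u + p * s)) : (p : ℤ) ^ n ∣ x := by
  have h1 : ¬ (p : ℤ) ∣ u + p * s := fun h => hu ((dvd_add_left (dvd_mul_right _ _)).1 h)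
  have := isCoprime_pow h1 n
  push_cast at this
  exact this.symm.dvd_of_dvd_mul_right h

/-- The term κab dominates, as the tail carries p^{m+1}. When one coordinate is a multiple pa,
differences of the tail gain another factor p, so the quotient by p has slope κb modulo p and is
injective modulo every power of p. -/
theorem nodeFamily (hκ : ¬ (p : ℤ) ∣ N.κ) : NodeFamily p (N.fam p) := by
  have hp0 : (p : ℤ) ≠ 0 := by exact_mod_cast hp.out.ne_zero
  have hpi : Prime (p : ℤ) := Nat.prime_iff_prime_int.1 hp.out
  have hdiff : ∀ (g : MvPolynomial (Fin 3) ℤ) (a a' b b' n : ℤ), n ∣ a - a' → n ∣ b - b' →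
      n ∣ eval (a • N.e₁ + b • N.e₂) g - eval (a' • N.e₁ + b' • N.e₂) g := by
    intro g a a' b b' n ha hb
    refine dvd_eval_sub fun i => ?_
    have := dvd_add (ha.mul_right (N.e₁ i)) (hb.mul_right (N.e₂ i))
    refine this.trans (dvd_of_eq ?_)
    simp only [Pi.add_apply, Pi.smul_apply, smul_eq_mul]; ring
  refine ⟨?_, ?_, ?_, ?_, ?_⟩
  · intro m a b
    refine mul_left_cancel₀ (pow_ne_zero (2 * (m + 1)) hp0) ?_
    rw [← eval_eq_fam, ← mul_assoc, ← pow_add]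
    rw [show 2 * (m + 1) + 2 = 2 * (m + 1 + 1) by ring, ← eval_eq_fam]
    congr 2
    ext i
    simp only [Pi.add_apply, Pi.smul_apply, smul_eq_mul]; ring
  · intro m a b ha hb h
    rw [fam, dvd_add_left ((dvd_pow_self _ (by omega)).mul_right _)] at h
    exact (hpi.dvd_or_dvd h).elim (fun h => (hpi.dvd_or_dvd h).elim hκ ha) hb
  · intro m b hb
    refine ⟨fun a => N.κ * a * b + (p : ℤ) ^ m *
      eval ((p * a : ℤ) • N.e₁ + b • N.e₂) (N.tail ((p : ℤ) ^ (m + 1))), fun a => ?_, ?_⟩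
    · rw [fam]; ring
    · intro n x y h
      obtain ⟨s, hs⟩ := hdiff (N.tail ((p : ℤ) ^ (m + 1))) (p * x) (p * y) b b (p * (x - y))
        (by rw [mul_sub]) (by simp)
      refine dvd_of_unit_mul (u := N.κ * b) (s := (p : ℤ) ^ m * s)
        (fun h => (hpi.dvd_or_dvd h).elim hκ hb) (h.trans (dvd_of_eq ?_))
      linear_combination (p : ℤ) ^ m * hs
  · intro m a ha
    refine ⟨fun b => N.κ * a * b + (p : ℤ) ^ m *
      eval (a • N.e₁ + (p * b : ℤ) • N.e₂) (N.tail ((p : ℤ) ^ (m + 1))), fun a => ?_, ?_⟩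
    · rw [fam]; ring
    · intro n x y h
      obtain ⟨s, hs⟩ := hdiff (N.tail ((p : ℤ) ^ (m + 1))) a a (p * x) (p * y) (p * (x - y))
        (by simp) (by rw [mul_sub])
      refine dvd_of_unit_mul (u := N.κ * a) (s := (p : ℤ) ^ m * s)
        (fun h => (hpi.dvd_or_dvd h).elim hκ ha) (h.trans (dvd_of_eq ?_))
      linear_combination (p : ℤ) ^ m * hs
  · intro m n a a' b b' ha hb
    rw [fam, fam]
    have h1 := (hdiff (N.tail ((p : ℤ) ^ (m + 1))) a a' b b' n ha hb).mul_left ((p : ℤ) ^ (m + 1))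
    have h2 := dvd_add (dvd_add (ha.mul_left (N.κ * b)) (hb.mul_left (N.κ * a'))) h1
    exact h2.trans (dvd_of_eq (by ring))

omit hp in
theorem not_dvd (h : ¬ (p : ℤ) ∣ N.disc) : ¬ (p : ℤ) ∣ (Matrix.of ![N.w, N.e₁, N.e₂]).det ∧
    ¬ (p : ℤ) ∣ N.κ ∧ ¬ (p : ℤ) ∣ N.Q.det ∧ ¬ (p : ℤ) ∣ N.A.det := by
  refine ⟨fun h' => h ?_, fun h' => h ?_, fun h' => h ?_, fun h' => h ?_⟩
  · exact ((h'.mul_right _).mul_right _).mul_right _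
  · exact ((h'.mul_left _).mul_right _).mul_right _
  · exact (h'.mul_left _).mul_right _
  · exact h'.mul_left _

end IntNode

/-! ### The local series at the points of the plane -/

section Shapes

variable (d p : ℕ) (L : PowerSeries ℚ)

local notation "X" => (PowerSeries.X : PowerSeries ℚ)

/-- The shape of the local series at a point off the curve. -/
def UnitSeries : Prop :=
  L * (1 - (p : PowerSeries ℚ) ^ (d + 2) * X ^ (d + 1)) = (p : PowerSeries ℚ) ^ d * X ^ (d + 1)

/-- The shape of the local series at a smooth point. -/
def SmoothSeries : Prop := ∃ d₀, d = d₀ + 2 ∧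
  L * (1 - (p : PowerSeries ℚ) ^ (d + 2) * X ^ (d + 1)) *
      (1 - (p : PowerSeries ℚ) ^ (d + 1) * X ^ (d₀ + 1)) =
    (p : PowerSeries ℚ) ^ d * X ^ (d₀ + 1) * (1 - (p : PowerSeries ℚ) ^ (d + 1) * X ^ (d₀ + 3))

/-- The shape of the local series at a node of corank two. -/
def NodeTwoSeries : Prop := ∃ d₀, d = d₀ + 2 ∧
  L * (1 - (p : PowerSeries ℚ) ^ (d + 2) * X ^ (d + 1)) *
      (1 - (p : PowerSeries ℚ) ^ (d + 1) * X ^ (d₀ + 1)) ^ 2 =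
    (p : PowerSeries ℚ) ^ d * X ^ (d₀ + 1) *
      (X ^ 2 * (1 - (p : PowerSeries ℚ) ^ (d + 1) * X ^ (d₀ + 1)) ^ 2 +
        (1 - X ^ 2) * (1 + (p - 2) * (p : PowerSeries ℚ) ^ (d + 1) * X ^ (d₀ + 1)))

/-- The shape of the local series at a node of corank four. -/
def NodeFourSeries : Prop := ∃ d₀, d = d₀ + 4 ∧
  L * (1 - (p : PowerSeries ℚ) ^ d * X ^ (d₀ + 1)) *
      (1 - (p : PowerSeries ℚ) ^ (d + 2) * X ^ (d₀ + 5)) *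
      (1 - (p : PowerSeries ℚ) ^ (d + 1) * X ^ (d₀ + 3)) =
    (p : PowerSeries ℚ) ^ d * X ^ (d₀ + 1) *
    ((1 - (p : PowerSeries ℚ) ^ (d + 2) * X ^ (d₀ + 5)) *
      (1 - (p : PowerSeries ℚ) ^ (d + 1) * X ^ (d₀ + 3)) +
    (p : PowerSeries ℚ) ^ d * X ^ (d₀ + 1) * ((p - 1) ^ 2 * X ^ 4 *
        (1 - (p : PowerSeries ℚ) ^ (d + 1) * X ^ (d₀ + 3)) +
      2 * (p - 1) * X ^ 2 * (1 - (p : PowerSeries ℚ) ^ (d + 1) * X ^ (d₀ + 5))))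

end Shapes

section Points

variable {d : ℕ} {B : Fin d → Fin d → Fin 3 → ℤ} {F : MvPolynomial (Fin 3) ℤ}
  {p : ℕ} [hp : Fact p.Prime]

theorem map_Mat_congr {α β : Fin 3 → ℤ} (h : ∀ i, (α i : ZMod p) = β i) :
    (Mat B α).map (Int.castRingHom (ZMod p)) = (Mat B β).map (Int.castRingHom (ZMod p)) := by
  ext i j
  simp [Mat, h]

theorem rank_congr {α β : Fin 3 → ℤ} (h : ∀ i, (α i : ZMod p) = β i) :
    ((MatP B p α).map PadicInt.toZMod).rank = ((MatP B p β).map PadicInt.toZMod).rank := by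
  rw [map_toZMod_MatP, map_toZMod_MatP, map_Mat_congr h]

theorem even_rank (h2 : p ≠ 2) (hB : ∀ i j k, B i j k = -B j i k) (α : Fin 3 → ℤ) :
    Even ((MatP B p α).map PadicInt.toZMod).rank := by
  obtain ⟨k, l, N, -, -, -, -, hrk, -, hk⟩ := skew_reduce h2 (MatP B p α) (MatP_transpose hB α)
  rwa [hrk]

namespace IntNode

variable (N : IntNode B F)

theorem eval_w : eval N.w F = 0 := by
  have := N.eval_eq 0 0 0
  simpa using this

theorem card_eq : N.k + N.l = d := by
  have := Fintype.card_congr N.e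
  simpa using this

theorem rank_eq (h : ¬ (p : ℤ) ∣ N.disc) :
    ((MatP B p N.w).map PadicInt.toZMod).rank = N.k := by
  obtain ⟨-, -, hQ, hA⟩ := N.not_dvd h
  let φ := Int.castRingHom (ZMod p)
  have hne : ∀ x : ℤ, ¬ (p : ℤ) ∣ x → IsUnit (φ x) := fun x hx =>
    IsUnit.mk0 _ fun h => hx ((ZMod.intCast_zmod_eq_zero_iff_dvd _ _).1 h)
  have hQ' : IsUnit (N.Q.map φ).det := by
    have := hne _ hQ; rwa [RingHom.map_det] at this
  have hA' : IsUnit (N.A.map φ).det := by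
    have := hne _ hA; rwa [RingHom.map_det] at this
  have h1 : N.Q.map φ * ((Mat B N.w).map φ).submatrix N.e N.e * (N.Q.map φ).transpose =
      Matrix.fromBlocks (N.A.map φ) 0 0 0 := by
    have h2 := congrArg (fun M => M.map φ) N.conj
    simp only [Matrix.map_mul] at h2
    rw [Matrix.fromBlocks_map, Matrix.map_zero _ (map_zero φ), Matrix.map_zero _ (map_zero φ),
      Matrix.map_zero _ (map_zero φ)] at h2
    exact h2
  have h2 := congrArg Matrix.rank h1
  rw [rank_fromBlocks_zero _ hA', Matrix.rank_mul_eq_left_of_isUnit_det _ _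
    (by rwa [Matrix.det_transpose]), Matrix.rank_mul_eq_right_of_isUnit_det _ _ hQ',
    Matrix.rank_submatrix] at h2
  rw [map_toZMod_MatP]
  exact h2

/-- The corank is even. It is positive since F(w) = 0 while the block A is invertible modulo p. It
is at most five because F(w + p(e₁ + e₂)) has valuation exactly two. -/
theorem corank_cases (h2 : p ≠ 2) (hd : Even d) (hB : ∀ i j k, B i j k = -B j i k)
    (hF : F ^ 2 = (commutatorMatrix B).det) (h : ¬ (p : ℤ) ∣ N.disc) : N.l = 2 ∨ N.l = 4 := by
  obtain ⟨-, hκ, hQ, hA⟩ := N.not_dvd h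
  have hk : Even N.k := by rw [← N.rank_eq h]; exact even_rank h2 hB _
  have hl : Even N.l := by
    have := N.card_eq
    rw [← this, Nat.even_add] at hd
    exact hd.1 hk
  have hl0 : N.l ≠ 0 := by
    intro h0
    have h3 := congrArg Matrix.det N.conj
    have h4 : (Matrix.fromBlocks N.A 0 0 (0 : Matrix (Fin N.l) (Fin N.l) ℤ)).det = N.A.det := by
      rw [Matrix.det_fromBlocks_zero₁₂]
      have : IsEmpty (Fin N.l) := by rw [h0]; infer_instance
      rw [Matrix.det_isEmpty (A := (0 : Matrix (Fin N.l) (Fin N.l) ℤ)), mul_one]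
    rw [h4, Matrix.det_mul, Matrix.det_mul, Matrix.det_submatrix_equiv_self, det_Mat B hF,
      N.eval_w] at h3
    refine hA ?_
    rw [← h3]; simp
  have hl4 : N.l ≤ 5 := by
    have h3 := N.eval_eq_fam (p := p) 0 1 1
    have h4 := (N.nodeFamily hκ).unit 0 1 1
      (fun h => hp.out.one_lt.ne' (by exact_mod_cast Int.eq_one_of_dvd_one (by positivity) h))
      (fun h => hp.out.one_lt.ne' (by exact_mod_cast Int.eq_one_of_dvd_one (by positivity) h))
    have h5 := corank_le (n := 2) h2 hB hF (N.w + (p : ℤ) ^ (0 + 1) • ((1 : ℤ) • N.e₁ + (1 : ℤ) • N.e₂))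
      (by
        rw [h3, pow_succ, mul_dvd_mul_iff_left
          (pow_ne_zero _ (by exact_mod_cast hp.out.ne_zero))]
        exact h4)
    rw [rank_congr (β := N.w) (fun i => by simp), N.rank_eq h] at h5
    have := N.card_eq
    omega
  obtain ⟨m, hm⟩ := hl
  omega

variable {P : Projectivization (ZMod p) (Fin 3 → ZMod p)}

/-- The frame at the reduction of a node. -/
def frame (h : ¬ (p : ℤ) ∣ N.disc)
    (hw : ∃ u : ZMod p, u ≠ 0 ∧ ∀ i, (N.w i : ZMod p) = u * P.rep i) : Frame p P where
  w := N.w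
  e₁ := N.e₁
  e₂ := N.e₂
  det_unit := (N.not_dvd h).1
  red_w := hw

variable (h : ¬ (p : ℤ) ∣ N.disc)
  (hw : ∃ u : ZMod p, u ≠ 0 ∧ ∀ i, (N.w i : ZMod p) = u * P.rep i)

theorem frame_pt (t a b : ℤ) :
    (N.frame h hw).pt (t * a) (t * b) = N.w + t • (a • N.e₁ + b • N.e₂) := by
  ext i
  simp only [Frame.pt, frame, Pi.add_apply, Pi.smul_apply, smul_eq_mul]
  ring

theorem nodeTwoSeries (h2 : p ≠ 2) (hd : Even d) (hB : ∀ i j k, B i j k = -B j i k)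
    (hF : F ^ 2 = (commutatorMatrix B).det) (hl : N.l = 2) :
    NodeTwoSeries d p (localSeries B (N.frame h hw)) := by
  have hk := N.card_eq
  refine ⟨N.k, by omega, localSeries_of_node_two (by omega) (N.nodeFamily (N.not_dvd h).2.1)
    fun k a b => ?_⟩
  have h1 := N.eval_eq_fam (p := p) 0 a b
  rw [zero_add, mul_one, pow_one, ← N.frame_pt h hw] at h1
  rw [← h1]
  refine comExp_of_rank h2 hd hB hF ((N.frame h hw).prim_pt a b) ?_ (k + 1)
  rw [rank_congr (β := N.w) (fun i => by rw [frame_pt]; simp), N.rank_eq h]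
  omega

theorem nodeFourSeries (h2 : p ≠ 2) (hB : ∀ i j k, B i j k = -B j i k)
    (hF : F ^ 2 = (commutatorMatrix B).det) (hl : N.l = 4) :
    NodeFourSeries d p (localSeries B (N.frame h hw)) := by
  obtain ⟨-, hκ, hQ, hA⟩ := N.not_dvd h
  have hk := N.card_eq
  have hp1 : ¬ (p : ℤ) ∣ 1 := fun h =>
    hp.out.one_lt.ne' (by exact_mod_cast Int.eq_one_of_dvd_one (by positivity) h)
  have hfam := N.nodeFamily hκ
  have hprim : ∀ (m : ℕ) (a b : ℤ), Prim p (N.w + (p : ℤ) ^ (m + 1) • (a • N.e₁ + b • N.e₂)) := by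
    intro m a b
    have := (N.frame h hw).prim_pt ((p : ℤ) ^ m * a) ((p : ℤ) ^ m * b)
    rwa [← mul_assoc, ← mul_assoc, ← pow_succ', frame_pt] at this
  refine ⟨N.k, by omega, localSeries_of_node_four (by omega) hfam ?_ ?_⟩
  · intro m k a b hab
    rw [frame_pt]
    refine comExp_cyc_add B (hprim m a b) ?_
    obtain ⟨l, e, Q, A, hconj, hQ', hA', hl'⟩ : ∃ (l : ℕ) (e : Fin N.k ⊕ Fin l ≃ Fin d)
        (Q : Matrix (Fin N.k ⊕ Fin l) (Fin N.k ⊕ Fin l) ℤ) (A : Matrix (Fin N.k) (Fin N.k) ℤ),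
        Q * (Mat B N.w).submatrix e e * Q.transpose = Matrix.fromBlocks A 0 0 0 ∧
        ¬ (p : ℤ) ∣ Q.det ∧ ¬ (p : ℤ) ∣ A.det ∧ l = 4 := ⟨N.l, N.e, N.Q, N.A, N.conj, hQ, hA, hl⟩
    subst hl'
    -- The term κab vanishes in the two tangent directions, so only the tail, divisible by p,
    -- remains there.
    have e1 : ∃ x₁, N.fam p 0 1 0 = p * x₁ := ⟨_, by rw [IntNode.fam, zero_add, pow_one, mul_zero, zero_add]⟩
    have e2 : ∃ x₂, N.fam p 0 0 1 = p * x₂ :=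
      ⟨_, by rw [IntNode.fam, zero_add, pow_one, mul_zero, zero_mul, zero_add]⟩
    obtain ⟨x₁, hx₁⟩ := e1
    obtain ⟨x₂, hx₂⟩ := e2
    have f1 := N.eval_eq_fam (p := p) 0 1 0
    have f2 := N.eval_eq_fam (p := p) 0 0 1
    have f3 := N.eval_eq_fam (p := p) 0 1 1
    simp only [zero_add, one_smul, zero_smul, add_zero] at f1 f2 f3
    rw [hx₁] at f1
    rw [hx₂] at f2
    exact kc_node h2 hB hF hconj hQ' hA' f1 f2 f3 (hfam.unit 0 1 1 hp1 hp1) hab (by omega)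
      (N.eval_eq_fam m a b) k
  · intro m a b
    rw [frame_pt]
    obtain ⟨D, -, -, -, hkc⟩ := node_reduce hB N.conj hQ hA (a • N.e₁ + b • N.e₂)
      (Nat.le_add_left 1 m)
    have := comExp_cyc_add B (hprim m a b) (c := m + 1) (s := N.l * (m + 1))
      (by rw [hkc, kc_smul_of_le le_rfl])
    have h5 : (m + 1) * d = (m + 1) * N.k + N.l * (m + 1) :=
      (congrArg ((m + 1) * ·) hk).symm.trans (by ring)
    omega

end IntNode

/-- A frame at a point of the plane with a nonzero coordinate and a prescribed direction. -/
theorem exists_frame (P : Projectivization (ZMod p) (Fin 3 → ZMod p)) {w : Fin 3 → ℤ}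
    (hw : ∃ u : ZMod p, u ≠ 0 ∧ ∀ i, (w i : ZMod p) = u * P.rep i) {i j : Fin 3} (hij : i ≠ j)
    (hj : ¬ (p : ℤ) ∣ w j) : ∃ fr : Frame p P, fr.w = w ∧ fr.e₁ = Pi.single i 1 := by
  have key : ∃ e₂ : Fin 3 → ℤ, ¬ (p : ℤ) ∣ (Matrix.of ![w, Pi.single i 1, e₂]).det := by
    have hj' : ¬ (p : ℤ) ∣ -w j := by rwa [dvd_neg]
    fin_cases i <;> fin_cases j <;> first | exact absurd rfl hij | skip
    · exact ⟨Pi.single 2 1, by rw [Matrix.det_fin_three]; simpa using hj'⟩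
    · exact ⟨Pi.single 1 1, by rw [Matrix.det_fin_three]; simpa using hj⟩
    · exact ⟨Pi.single 2 1, by rw [Matrix.det_fin_three]; simpa using hj⟩
    · exact ⟨Pi.single 0 1, by rw [Matrix.det_fin_three]; simpa using hj'⟩
    · exact ⟨Pi.single 1 1, by rw [Matrix.det_fin_three]; simpa using hj'⟩
    · exact ⟨Pi.single 0 1, by rw [Matrix.det_fin_three]; simpa using hj⟩
  obtain ⟨e₂, he₂⟩ := key
  exact ⟨⟨w, Pi.single i 1, e₂, he₂, hw⟩, rfl, rfl⟩

theorem exists_lift (P : Projectivization (ZMod p) (Fin 3 → ZMod p)) :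
    ∃ w : Fin 3 → ℤ, (∀ i, (w i : ZMod p) = P.rep i) ∧ ∃ j, ¬ (p : ℤ) ∣ w j := by
  choose w hw using fun i => ZMod.intCast_surjective (P.rep i)
  refine ⟨w, hw, ?_⟩
  by_contra h
  push Not at h
  refine P.rep_nonzero (funext fun i => ?_)
  rw [← hw, (ZMod.intCast_zmod_eq_zero_iff_dvd _ _).2 (h i)]
  rfl

theorem eval_baseChange {v : Fin 3 → ZMod p} {w : Fin 3 → ℤ} (h : ∀ i, (w i : ZMod p) = v i)
    (f : MvPolynomial (Fin 3) ℤ) : eval v (baseChange (ZMod p) f) = (eval w f : ZMod p) := by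
  have : v = fun i => Int.castRingHom (ZMod p) (w i) := funext fun i => (h i).symm
  rw [this, baseChange, eval_map]
  exact (eval₂_comp (Int.castRingHom (ZMod p)) w f).symm

theorem unitSeries_of_eval_ne_zero (h2 : p ≠ 2) (hd : Even d) (hB : ∀ i j k, B i j k = -B j i k)
    (hF : F ^ 2 = (commutatorMatrix B).det) (P : Projectivization (ZMod p) (Fin 3 → ZMod p))
    (hP : eval P.rep (baseChange (ZMod p) F) ≠ 0) :
    ∃ fr : Frame p P, UnitSeries d p (localSeries B fr) := by
  obtain ⟨w, hw, j, hj⟩ := exists_lift P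
  obtain ⟨i, hij⟩ := exists_ne j
  obtain ⟨fr, hfw, -⟩ := exists_frame P ⟨1, one_ne_zero, fun i => by rw [hw, one_mul]⟩ hij hj
  refine ⟨fr, localSeries_of_unit fun k a b => ?_⟩
  have hF' : ¬ (p : ℤ) ∣ eval (fr.pt (p * a) (p * b)) F := by
    rw [← ZMod.intCast_zmod_eq_zero_iff_dvd, ← eval_baseChange (v := P.rep) fun i => ?_]
    · exact hP
    · rw [fr.intCast_pt, hfw, hw]
  have h1 := corank_le (n := 0) h2 hB hF (fr.pt (p * a) (p * b)) (by simpa using hF')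
  have h3 := comExp_of_rank h2 hd hB hF (fr.prim_pt a b) (by omega) (k + 1)
  rwa [tv_eq_zero hF', mul_zero, add_zero] at h3

/-- Choose the frame so that e₁ is the coordinate direction with non-zero partial derivative. Then
F/p is injective in a modulo every power of p, by a first-order Taylor expansion. -/
theorem smoothSeries_of_pderiv_ne_zero (h2 : p ≠ 2) (hd : Even d)
    (hB : ∀ i j k, B i j k = -B j i k) (hF : F ^ 2 = (commutatorMatrix B).det) (hF0 : F ≠ 0)
    (P : Projectivization (ZMod p) (Fin 3 → ZMod p))
    (hP : eval P.rep (baseChange (ZMod p) F) = 0) {i : Fin 3}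
    (hi : eval P.rep (baseChange (ZMod p) (pderiv i F)) ≠ 0) :
    ∃ fr : Frame p P, SmoothSeries d p (localSeries B fr) := by
  have hp0 : (p : ℤ) ≠ 0 := by exact_mod_cast hp.out.ne_zero
  have hpi : Prime (p : ℤ) := Nat.prime_iff_prime_int.1 hp.out
  obtain ⟨n, hn⟩ := isHomogeneous_pfaffian hF hF0
  obtain ⟨w, hw, -⟩ := exists_lift P
  rw [eval_baseChange hw, ZMod.intCast_zmod_eq_zero_iff_dvd] at hP
  rw [eval_baseChange hw, Ne, ZMod.intCast_zmod_eq_zero_iff_dvd] at hi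
  -- By Euler's relation, if all coordinates other than the i-th vanished at the point, the i-th
  -- would vanish too. So e₁ can be completed to a frame.
  have hj : ∃ j, i ≠ j ∧ ¬ (p : ℤ) ∣ w j := by
    by_contra hcon
    push Not at hcon
    have heul := congrArg (eval w) hn.sum_X_mul_pderiv
    rw [map_sum, ← Finset.add_sum_erase _ _ (Finset.mem_univ i), map_mul, eval_X, map_nsmul,
      nsmul_eq_mul] at heul
    have h1 : (p : ℤ) ∣ ∑ j ∈ Finset.univ.erase i, eval w (X j * pderiv j F) := by
      refine Finset.dvd_sum fun j hj => ?_
      rw [map_mul, eval_X]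
      exact (hcon j (Finset.ne_of_mem_erase hj).symm).mul_right _
    have h3 : (p : ℤ) ∣ w i * eval w (pderiv i F) := by
      rw [← dvd_add_left h1, heul]; exact hP.mul_left _
    have h4 : (p : ℤ) ∣ w i := (hpi.dvd_or_dvd h3).resolve_right hi
    refine P.rep_nonzero (funext fun j => ?_)
    rw [← hw, Pi.zero_apply, ZMod.intCast_zmod_eq_zero_iff_dvd]
    by_cases hij : i = j
    · rwa [← hij]
    · exact hcon j hij
  obtain ⟨j, hij, hj⟩ := hj
  obtain ⟨fr, hfw, hfe⟩ := exists_frame P ⟨1, one_ne_zero, fun i => by rw [hw, one_mul]⟩ hij hj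
  refine ⟨fr, ?_⟩
  have hmod : ∀ a b : ℤ, ∀ k, (p : ℤ) ∣ fr.pt (p * a) (p * b) k - w k := by
    intro a b k
    rw [← ZMod.intCast_zmod_eq_zero_iff_dvd, Int.cast_sub, fr.intCast_pt, hfw, sub_self]
  have hdvd : ∀ a b : ℤ, (p : ℤ) ∣ eval (fr.pt (p * a) (p * b)) F := fun a b =>
    (dvd_sub_left hP).1 (dvd_eval_sub (hmod a b))
  have hderiv : ∀ a b : ℤ, ¬ (p : ℤ) ∣ eval (fr.pt (p * a) (p * b)) (pderiv i F) := fun a b h =>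
    hi ((dvd_sub_right h).1 (dvd_eval_sub (hmod a b)))
  have htaylor : ∀ a a' b : ℤ, ∃ s, eval (fr.pt (p * a) (p * b)) F - eval (fr.pt (p * a') (p * b)) F =
      p * ((a - a') * (eval (fr.pt (p * a') (p * b)) (pderiv i F) + p * s)) := by
    intro a a' b
    obtain ⟨s, hs⟩ := eval_add_smul F (fr.pt (p * a') (p * b)) (Pi.single i 1) (p * (a - a'))
    have h1 : fr.pt (p * a') (p * b) + ((p : ℤ) * (a - a')) • (Pi.single i 1 : Fin 3 → ℤ) =
        fr.pt (p * a) (p * b) := by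
      rw [← hfe]; ext k
      simp only [Frame.pt, Pi.add_apply, Pi.smul_apply, smul_eq_mul]; ring
    rw [h1, Finset.sum_eq_single i (fun k _ hk => by simp [hk]) (by simp), Pi.single_eq_same,
      one_mul] at hs
    exact ⟨(a - a') * s, by rw [hs]; ring⟩
  choose f hf using hdvd
  have hdiff : ∀ a a' b : ℤ, ∃ s, f a b - f a' b =
      (a - a') * (eval (fr.pt (p * a') (p * b)) (pderiv i F) + p * s) := by
    intro a a' b
    obtain ⟨s, hs⟩ := htaylor a a' b
    rw [hf, hf, ← mul_sub] at hs
    exact ⟨s, mul_left_cancel₀ hp0 hs⟩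
  -- F takes a value not divisible by p² near the point, so the corank is at most three, and being
  -- even it is at most two.
  have hrank : d ≤ ((MatP B p w).map PadicInt.toZMod).rank + 2 := by
    have hex : ∃ a : ℤ, ¬ (p : ℤ) ^ (1 + 1) ∣ eval (fr.pt (p * a) (p * 0)) F := by
      by_contra hcon
      push Not at hcon
      obtain ⟨s, hs⟩ := hdiff 1 0 0
      have h1 : ∀ a, (p : ℤ) ∣ f a 0 := by
        intro a
        have := hcon a
        rwa [hf, pow_succ, pow_one, mul_dvd_mul_iff_left hp0] at this
      have h3 := dvd_sub (h1 1) (h1 0)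
      rw [hs, sub_zero, one_mul, dvd_add_left (dvd_mul_right _ _)] at h3
      exact hderiv 0 0 h3
    obtain ⟨a, ha⟩ := hex
    have h1 := corank_le (n := 1) h2 hB hF _ ha
    have h3 := even_rank (B := B) h2 hB (fr.pt (p * a) (p * 0))
    rw [rank_congr (β := w) fun k => by rw [fr.intCast_pt, hfw]] at h1 h3
    obtain ⟨m, hm⟩ := h3
    obtain ⟨m', hm'⟩ := hd
    omega
  have hd2 : 2 ≤ d := by
    rcases Nat.eq_zero_or_pos d with h0 | h0
    · exfalso
      have h1 := det_Mat B hF w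
      subst h0
      rw [Matrix.det_isEmpty] at h1
      have h3 : (p : ℤ) ∣ 1 := by rw [h1]; exact hP.trans (dvd_pow_self _ two_ne_zero)
      exact hp.out.one_lt.ne' (by exact_mod_cast Int.eq_one_of_dvd_one (by positivity) h3)
    · obtain ⟨m, hm⟩ := hd; omega
  obtain ⟨d₀, hd₀⟩ := Nat.exists_eq_add_of_le' hd2
  refine ⟨d₀, hd₀, localSeries_of_smooth (f := f) hd₀ (fun k a b => ?_) ?_ ?_⟩
  · rw [← hf]
    refine comExp_of_rank h2 hd hB hF (fr.prim_pt a b) ?_ (k + 1)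
    rwa [rank_congr (β := w) fun k => by rw [fr.intCast_pt, hfw]]
  · intro n a a' b b' ha hb
    refine (mul_dvd_mul_iff_left hp0).1 ?_
    rw [mul_sub, ← hf, ← hf]
    refine dvd_eval_sub fun k => ?_
    have := mul_dvd_mul_left (p : ℤ) (dvd_add (ha.mul_right (fr.e₁ k)) (hb.mul_right (fr.e₂ k)))
    refine this.trans (dvd_of_eq ?_)
    simp only [Frame.pt, Pi.add_apply, Pi.smul_apply, smul_eq_mul]; ring
  · intro n a a' b h
    obtain ⟨s, hs⟩ := hdiff a a' b
    rw [hs] at h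
    exact IntNode.dvd_of_unit_mul (hderiv a' b) h

end Points

/-! ### The rational functions in terms of local series -/

section Rational

variable {K : Type*} [Field K]

theorem zpow_of_eq {x : K} {m : ℤ} {n : ℕ} (h : m = n) : x ^ m = x ^ n := by
  rw [h, zpow_natCast]

/-- With q = p^{2d} T^{d+2} and C₁ the series for j = 1, `cdSeries_two` gives (1 − p²q)(1 + C₁ + C₂)
= 1 + (p + 1)q + C₁(1 + pq). W₁ is the value when all p² + p + 1 points contribute as points off the
curve; the next three identities give the correction for a single other point. -/
theorem W₁_eq {r : ℕ} {x y L : K} (h₁ : 1 - x ^ (2 * r + 2) * y ^ (2 * r + 1) ≠ 0)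
    (h₂ : 1 - x ^ (4 * r + 2) * y ^ (2 * r + 2) ≠ 0)
    (hL : L * (1 - x ^ (2 * r + 2) * y ^ (2 * r + 1)) = x ^ (2 * r) * y ^ (2 * r + 1)) :
    1 + (x + 1) * (x ^ (4 * r) * y ^ (2 * r + 2)) +
        (x ^ 2 + x + 1) * L * (1 + x * (x ^ (4 * r) * y ^ (2 * r + 2))) =
      W₁ r x y * (1 - x ^ 2 * (x ^ (4 * r) * y ^ (2 * r + 2))) := by
  rw [W₁]
  simp only [zpow_of_eq (n := 2 * r) (m := 2 * (r : ℤ)) (by push_cast; ring),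
    zpow_of_eq (n := 2 * r + 1) (m := 2 * (r : ℤ) + 1) (by push_cast; ring),
    zpow_of_eq (n := 4 * r) (m := 4 * (r : ℤ)) (by push_cast; ring),
    zpow_of_eq (n := 4 * r + 1) (m := 4 * (r : ℤ) + 1) (by push_cast; ring),
    zpow_of_eq (n := 2 * r + 2) (m := 2 * (r : ℤ) + 2) (by push_cast; ring),
    zpow_of_eq (n := 6 * r + 1) (m := 6 * (r : ℤ) + 1) (by push_cast; ring),
    zpow_of_eq (n := 4 * r + 2) (m := 4 * (r : ℤ) + 2) (by push_cast; ring),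
    zpow_of_eq (n := 4 * r + 3) (m := 4 * (r : ℤ) + 3) (by push_cast; ring)]
  rw [eq_div_of_mul_eq h₁ hL]
  have e : ∀ z : K, z ^ (4 * r) = (z ^ (2 * r)) ^ 2 := fun z => by rw [← pow_mul]; ring_nf
  have e' : ∀ z : K, z ^ (6 * r) = (z ^ (2 * r)) ^ 3 := fun z => by rw [← pow_mul]; ring_nf
  simp only [pow_add, e, e'] at h₁ h₂ ⊢
  generalize x ^ (2 * r) = a at *
  generalize y ^ (2 * r) = b at *
  generalize hD₁ : 1 - a * x ^ 2 * (b * y ^ 1) = D₁ at *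
  generalize hD₂ : 1 - a ^ 2 * x ^ 2 * (b * y ^ 2) = D₂ at *
  field_simp
  subst hD₁ hD₂
  ring

/-- The correction at a smooth point. The size is written through r + 1 so that exponents such as 2r
− 1 become natural numbers. -/
theorem W₂_eq {r : ℕ} {x y L Lu : K} (h₁ : 1 - x ^ (2 * r + 4) * y ^ (2 * r + 3) ≠ 0)
    (h₂ : 1 - x ^ (4 * r + 6) * y ^ (2 * r + 4) ≠ 0) (h₃ : 1 - x ^ (2 * r + 3) * y ^ (2 * r + 1) ≠ 0)
    (hLu : Lu * (1 - x ^ (2 * r + 4) * y ^ (2 * r + 3)) = x ^ (2 * r + 2) * y ^ (2 * r + 3))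
    (hL : L * (1 - x ^ (2 * r + 4) * y ^ (2 * r + 3)) * (1 - x ^ (2 * r + 3) * y ^ (2 * r + 1)) =
      x ^ (2 * r + 2) * y ^ (2 * r + 1) * (1 - x ^ (2 * r + 3) * y ^ (2 * r + 3))) :
    (L - Lu) * (1 + x * (x ^ (4 * r + 4) * y ^ (2 * r + 4))) =
      W₂ ((r + 1 : ℕ) : ℤ) x y * (1 - x ^ 2 * (x ^ (4 * r + 4) * y ^ (2 * r + 4))) := by
  rw [W₂]
  simp only [zpow_of_eq (n := 2 * r + 2) (m := 2 * ((r + 1 : ℕ) : ℤ)) (by push_cast; ring),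
    zpow_of_eq (n := 2 * r + 3) (m := 2 * ((r + 1 : ℕ) : ℤ) + 1) (by push_cast; ring),
    zpow_of_eq (n := 2 * r + 1) (m := 2 * ((r + 1 : ℕ) : ℤ) - 1) (by push_cast; ring),
    zpow_of_eq (n := 4 * r + 5) (m := 4 * ((r + 1 : ℕ) : ℤ) + 1) (by push_cast; ring),
    zpow_of_eq (n := 2 * r + 4) (m := 2 * ((r + 1 : ℕ) : ℤ) + 2) (by push_cast; ring),
    zpow_of_eq (n := 4 * r + 6) (m := 4 * ((r + 1 : ℕ) : ℤ) + 2) (by push_cast; ring)]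
  rw [mul_assoc] at hL
  rw [eq_div_of_mul_eq h₁ hLu, eq_div_of_mul_eq (mul_ne_zero h₁ h₃) hL]
  have e : ∀ z : K, z ^ (4 * r) = (z ^ (2 * r)) ^ 2 := fun z => by rw [← pow_mul]; ring_nf
  simp only [pow_add, e] at h₁ h₂ h₃ ⊢
  generalize x ^ (2 * r) = a at *
  generalize y ^ (2 * r) = b at *
  generalize hD₁ : 1 - a * x ^ 4 * (b * y ^ 3) = D₁ at *
  generalize hD₂ : 1 - a ^ 2 * x ^ 6 * (b * y ^ 4) = D₂ at *
  generalize hD₃ : 1 - a * x ^ 3 * (b * y ^ 1) = D₃ at *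
  field_simp
  subst hD₁ hD₂ hD₃
  ring

/-- A node has two branches, hence the term 2W₂. W₃ is the discrepancy between its local series and
two smooth corrections. -/
theorem W₃_eq {r : ℕ} {x y L Lu : K} (h₁ : 1 - x ^ (2 * r + 4) * y ^ (2 * r + 3) ≠ 0)
    (h₂ : 1 - x ^ (4 * r + 6) * y ^ (2 * r + 4) ≠ 0) (h₃ : 1 - x ^ (2 * r + 3) * y ^ (2 * r + 1) ≠ 0)
    (hLu : Lu * (1 - x ^ (2 * r + 4) * y ^ (2 * r + 3)) = x ^ (2 * r + 2) * y ^ (2 * r + 3))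
    (hL : L * (1 - x ^ (2 * r + 4) * y ^ (2 * r + 3)) *
        (1 - x ^ (2 * r + 3) * y ^ (2 * r + 1)) ^ 2 =
      x ^ (2 * r + 2) * y ^ (2 * r + 1) * (y ^ 2 * (1 - x ^ (2 * r + 3) * y ^ (2 * r + 1)) ^ 2 +
        (1 - y ^ 2) * (1 + (x - 2) * x ^ (2 * r + 3) * y ^ (2 * r + 1)))) :
    (L - Lu) * (1 + x * (x ^ (4 * r + 4) * y ^ (2 * r + 4))) =
      (2 * W₂ ((r + 1 : ℕ) : ℤ) x y + W₃ ((r + 1 : ℕ) : ℤ) x y) *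
        (1 - x ^ 2 * (x ^ (4 * r + 4) * y ^ (2 * r + 4))) := by
  rw [W₂, W₃]
  simp only [zpow_of_eq (n := 2 * r + 2) (m := 2 * ((r + 1 : ℕ) : ℤ)) (by push_cast; ring),
    zpow_of_eq (n := 2 * r + 3) (m := 2 * ((r + 1 : ℕ) : ℤ) + 1) (by push_cast; ring),
    zpow_of_eq (n := 2 * r + 1) (m := 2 * ((r + 1 : ℕ) : ℤ) - 1) (by push_cast; ring),
    zpow_of_eq (n := 4 * r + 5) (m := 4 * ((r + 1 : ℕ) : ℤ) + 1) (by push_cast; ring),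
    zpow_of_eq (n := 2 * r + 4) (m := 2 * ((r + 1 : ℕ) : ℤ) + 2) (by push_cast; ring),
    zpow_of_eq (n := 4 * r + 6) (m := 4 * ((r + 1 : ℕ) : ℤ) + 2) (by push_cast; ring)]
  rw [mul_assoc] at hL
  rw [eq_div_of_mul_eq h₁ hLu, eq_div_of_mul_eq (mul_ne_zero h₁ (pow_ne_zero 2 h₃)) hL]
  have e : ∀ z : K, z ^ (4 * r) = (z ^ (2 * r)) ^ 2 := fun z => by rw [← pow_mul]; ring_nf
  simp only [pow_add, e] at h₁ h₂ h₃ ⊢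
  generalize x ^ (2 * r) = a at *
  generalize y ^ (2 * r) = b at *
  generalize hD₁ : 1 - a * x ^ 4 * (b * y ^ 3) = D₁ at *
  generalize hD₂ : 1 - a ^ 2 * x ^ 6 * (b * y ^ 4) = D₂ at *
  generalize hD₃ : 1 - a * x ^ 3 * (b * y ^ 1) = D₃ at *
  field_simp
  subst hD₁ hD₂ hD₃
  ring

/-- The analogue of `W₃_eq` for corank four, where r ≥ 2 turns 2r − 3 into a natural number. -/
theorem W₄_eq {r : ℕ} {x y L Lu : K} (h₁ : 1 - x ^ (2 * r + 6) * y ^ (2 * r + 5) ≠ 0)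
    (h₂ : 1 - x ^ (4 * r + 10) * y ^ (2 * r + 6) ≠ 0) (h₃ : 1 - x ^ (2 * r + 5) * y ^ (2 * r + 3) ≠ 0)
    (h₄ : 1 - x ^ (2 * r + 4) * y ^ (2 * r + 1) ≠ 0)
    (hLu : Lu * (1 - x ^ (2 * r + 6) * y ^ (2 * r + 5)) = x ^ (2 * r + 4) * y ^ (2 * r + 5))
    (hL : L * (1 - x ^ (2 * r + 4) * y ^ (2 * r + 1)) * (1 - x ^ (2 * r + 6) * y ^ (2 * r + 5)) *
        (1 - x ^ (2 * r + 5) * y ^ (2 * r + 3)) =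
      x ^ (2 * r + 4) * y ^ (2 * r + 1) * ((1 - x ^ (2 * r + 6) * y ^ (2 * r + 5)) *
        (1 - x ^ (2 * r + 5) * y ^ (2 * r + 3)) +
      x ^ (2 * r + 4) * y ^ (2 * r + 1) * ((x - 1) ^ 2 * y ^ 4 *
          (1 - x ^ (2 * r + 5) * y ^ (2 * r + 3)) +
        2 * (x - 1) * y ^ 2 * (1 - x ^ (2 * r + 5) * y ^ (2 * r + 5))))) :
    (L - Lu) * (1 + x * (x ^ (4 * r + 8) * y ^ (2 * r + 6))) =
      (2 * W₂ ((r + 2 : ℕ) : ℤ) x y + W₄ ((r + 2 : ℕ) : ℤ) x y) *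
        (1 - x ^ 2 * (x ^ (4 * r + 8) * y ^ (2 * r + 6))) := by
  rw [W₂, W₄]
  simp only [zpow_of_eq (n := 2 * r + 4) (m := 2 * ((r + 2 : ℕ) : ℤ)) (by push_cast; ring),
    zpow_of_eq (n := 2 * r + 5) (m := 2 * ((r + 2 : ℕ) : ℤ) + 1) (by push_cast; ring),
    zpow_of_eq (n := 2 * r + 3) (m := 2 * ((r + 2 : ℕ) : ℤ) - 1) (by push_cast; ring),
    zpow_of_eq (n := 2 * r + 1) (m := 2 * ((r + 2 : ℕ) : ℤ) - 3) (by push_cast; ring),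
    zpow_of_eq (n := 4 * r + 9) (m := 4 * ((r + 2 : ℕ) : ℤ) + 1) (by push_cast; ring),
    zpow_of_eq (n := 2 * r + 6) (m := 2 * ((r + 2 : ℕ) : ℤ) + 2) (by push_cast; ring),
    zpow_of_eq (n := 4 * r + 10) (m := 4 * ((r + 2 : ℕ) : ℤ) + 2) (by push_cast; ring)]
  rw [mul_assoc, mul_assoc] at hL
  rw [eq_div_of_mul_eq h₁ hLu, eq_div_of_mul_eq (mul_ne_zero h₄ (mul_ne_zero h₁ h₃)) hL]
  have e : ∀ z : K, z ^ (4 * r) = (z ^ (2 * r)) ^ 2 := fun z => by rw [← pow_mul]; ring_nf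
  simp only [pow_add, e] at h₁ h₂ h₃ h₄ ⊢
  generalize x ^ (2 * r) = a at *
  generalize y ^ (2 * r) = b at *
  generalize hD₁ : 1 - a * x ^ 6 * (b * y ^ 5) = D₁ at *
  generalize hD₂ : 1 - a ^ 2 * x ^ 10 * (b * y ^ 6) = D₂ at *
  generalize hD₃ : 1 - a * x ^ 5 * (b * y ^ 3) = D₃ at *
  generalize hD₄ : 1 - a * x ^ 4 * (b * y ^ 1) = D₄ at *
  field_simp
  subst hD₁ hD₂ hD₃ hD₄
  ring

end Rational

/-! ### Absence of lines and the divisibility it implies -/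

section Assembly

variable {d : ℕ} {B : Fin d → Fin d → Fin 3 → ℤ} {F : MvPolynomial (Fin 3) ℤ}
  {p : ℕ} [hp : Fact p.Prime]

variable (F p) in
/-- The reduction of `F` vanishes identically on no line over the prime field. -/
def NoLine : Prop := ∀ a b : Fin 3 → ZMod p, LinearIndependent (ZMod p) ![a, b] →
  ∃ s t : ZMod p, eval (s • a + t • b) (baseChange (ZMod p) F) ≠ 0

/-- The image of Λ modulo p has dimension at most one, so the forms annihilating it have dimension
at least two. -/
theorem exists_orthogonal_pair {Λ : AddSubgroup (Fin 3 → ℤ)} (h : p ^ 2 ∣ redIdx p Λ) :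
    ∃ a b : Fin 3 → ZMod p, LinearIndependent (ZMod p) ![a, b] ∧
      ∀ z ∈ Λ, ∑ i, a i * (z i : ZMod p) = 0 ∧ ∑ i, b i * (z i : ZMod p) = 0 := by
  let q : (Fin 3 → ℤ) →+ (Fin 3 → ZMod p) :=
    (Int.castRingHom (ZMod p)).toAddMonoidHom.compLeft (Fin 3)
  have hq : Function.Surjective q := fun y => by
    choose x hx using fun i => ZMod.intCast_surjective (y i)
    exact ⟨x, funext hx⟩
  have hker : q.ker = pLat p 3 := by
    ext x
    rw [AddMonoidHom.mem_ker, _root_.funext_iff]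
    constructor
    · intro h
      choose y hy using fun i => (ZMod.intCast_zmod_eq_zero_iff_dvd _ _).1 (h i)
      exact ⟨y, funext fun i => by rw [hy]; simp⟩
    · rintro ⟨y, rfl⟩ i
      exact (ZMod.intCast_zmod_eq_zero_iff_dvd _ _).2 (by simp)
  have hidx : (Λ.map q).index = redIdx p Λ := by
    rw [redIdx, AddSubgroup.index_map, hker, AddMonoidHom.range_eq_top.2 hq, AddSubgroup.index_top,
      mul_one]
  let V : Submodule (ZMod p) (Fin 3 → ZMod p) := AddSubgroup.toZModSubmodule p (Λ.map q)
  have hcard : Nat.card V * redIdx p Λ = p ^ 3 := by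
    have h1 : Nat.card (Fin 3 → ZMod p) = p ^ 3 := by rw [Nat.card_fun, Nat.card_fin, Nat.card_zmod]
    rw [← hidx, ← h1]
    exact AddSubgroup.card_mul_index _
  have hfin : Module.finrank (ZMod p) V ≤ 1 := by
    obtain ⟨m, hm⟩ := h
    have h1 : Nat.card V = p ^ Module.finrank (ZMod p) V := by
      rw [Module.natCard_eq_pow_finrank (K := ZMod p), Nat.card_zmod]
    rw [h1, hm] at hcard
    have h2 : p ^ (Module.finrank (ZMod p) V + 2) ∣ p ^ 3 := ⟨m, by rw [← hcard]; ring⟩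
    rw [Nat.pow_dvd_pow_iff_le_right hp.out.one_lt] at h2
    omega
  obtain ⟨v, hv⟩ := finrank_le_one_iff.1 hfin
  let ψ : (Fin 3 → ZMod p) →ₗ[ZMod p] ZMod p := (dotProductBilin (ZMod p) (ZMod p)).flip v.1
  have hψ : ∀ x, ψ x = ∑ i, x i * v.1 i := fun x => rfl
  have h2 : 2 ≤ Module.finrank (ZMod p) ψ.ker := by
    have h3 := ψ.finrank_range_add_finrank_ker
    have h4 := Submodule.finrank_le ψ.range
    rw [Module.finrank_fin_fun] at h3
    rw [Module.finrank_self] at h4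
    omega
  obtain ⟨f, hf⟩ := exists_linearIndependent_of_le_finrank h2
  have hf' := hf.map' ψ.ker.subtype (Submodule.ker_subtype _)
  refine ⟨(f 0).1, (f 1).1, ?_, fun z hz => ?_⟩
  · have h5 : ![(f 0).1, (f 1).1] = ψ.ker.subtype ∘ f := by
      ext i j
      fin_cases i <;> rfl
    rw [h5]
    exact hf'
  · obtain ⟨c, hc⟩ := hv ⟨q z, ⟨z, hz, rfl⟩⟩
    have hc' : ∀ i, (z i : ZMod p) = c * v.1 i := fun i => by
      have := congrFun (congrArg Subtype.val hc) i
      exact this.symm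
    have h5 : ∀ j, ∑ i, (f j).1 i * (z i : ZMod p) = 0 := by
      intro j
      have h6 : ψ (f j).1 = 0 := (f j).2
      rw [hψ] at h6
      simp only [hc', mul_left_comm _ c, ← Finset.mul_sum, h6, mul_zero]
    exact ⟨h5 0, h5 1⟩

/-- The forms annihilating Λ modulo p contain a line of ℙ², and some α on it has F(α) ≠ 0. Then M(α)
is invertible modulo p, and x in `comLat B Λ` satisfies x M(α) ≡ 0. -/
theorem dvd_of_noLine (hF : F ^ 2 = (commutatorMatrix B).det) (hline : NoLine F p)
    (Λ : AddSubgroup (Fin 3 → ℤ)) (h : p ^ 2 ∣ redIdx p Λ) (x : Fin d → ℤ) (hx : x ∈ comLat B Λ) :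
    ∃ y, x = p • y := by
  obtain ⟨a, b, hab, horth⟩ := exists_orthogonal_pair h
  obtain ⟨s, t, hst⟩ := hline a b hab
  choose α hα using fun i => ZMod.intCast_surjective ((s • a + t • b) i)
  rw [eval_baseChange hα] at hst
  let M := (Mat B α).map (Int.castRingHom (ZMod p))
  have hM : IsUnit M.det := by
    have h1 : M.det = ((Mat B α).det : ZMod p) := (RingHom.map_det (Int.castRingHom (ZMod p)) _).symm
    rw [h1, det_Mat B hF, Int.cast_pow]
    exact IsUnit.mk0 _ (pow_ne_zero 2 hst)
  have hxM : Matrix.vecMul (fun i => (x i : ZMod p)) M = 0 := by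
    ext j
    have h1 := horth _ (mem_comLat.1 hx j)
    have h2 : ∑ k, (α k : ZMod p) * ((pairing B j x k : ℤ) : ZMod p) = 0 := by
      simp only [hα, Pi.add_apply, Pi.smul_apply, smul_eq_mul, add_mul, mul_assoc,
        Finset.sum_add_distrib, ← Finset.mul_sum, h1.1, h1.2, mul_zero, add_zero]
    have h3 : ∀ k, pairing B j x k = ∑ i, x i * B i j k := by
      intro k; simp [pairing]
    rw [Pi.zero_apply, ← h2]
    simp only [Matrix.vecMul, dotProduct, M, Matrix.map_apply, Mat, Matrix.of_apply, h3, map_sum,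
      Finset.mul_sum, Int.cast_sum, Int.cast_mul, map_mul]
    rw [Finset.sum_comm]
    refine Finset.sum_congr rfl fun k _ => Finset.sum_congr rfl fun i _ => ?_
    simp only [eq_intCast]; ring
  have hx0 : (fun i => (x i : ZMod p)) = 0 :=
    Matrix.vecMul_injective_of_isUnit ((Matrix.isUnit_iff_isUnit_det M).2 hM) (by simpa using hxM)
  choose y hy using fun i => (ZMod.intCast_zmod_eq_zero_iff_dvd _ _).1 (congrFun hx0 i)
  exact ⟨y, funext fun i => by rw [hy]; simp⟩

variable (F p) in
/-- A point of the plane curve `F = 0` over the prime field. -/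
def OnCurve (P : Projectivization (ZMod p) (Fin 3 → ZMod p)) : Prop :=
  eval P.rep (baseChange (ZMod p) F) = 0

variable (F p) in
/-- The singular points of the reduction. -/
def Sing (P : Projectivization (ZMod p) (Fin 3 → ZMod p)) : Prop :=
  IsSingularPoint (baseChange (ZMod p) F) P.rep

theorem pderiv_baseChange (i : Fin 3) (f : MvPolynomial (Fin 3) ℤ) (R : Type*) [CommRing R] :
    pderiv i (baseChange R f) = baseChange R (pderiv i f) := pderiv_map

omit hp in
theorem one_sub_ne_zero (a b : ℕ) :
    (1 : LaurentSeries ℚ) - (p : LaurentSeries ℚ) ^ a * T ^ (b + 1) ≠ 0 := by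
  have h1 : (1 : PowerSeries ℚ) - (p : PowerSeries ℚ) ^ a * PowerSeries.X ^ (b + 1) ≠ 0 := by
    intro h
    have := congrArg (PowerSeries.constantCoeff (R := ℚ)) h
    simp at this
  intro h
  refine h1 (HahnSeries.ofPowerSeries_injective (Γ := ℤ) (R := ℚ) ?_)
  rw [map_zero, ← h, map_sub, map_one, map_mul, map_pow, map_natCast, map_pow]
  rfl

/-- The kernel defect at a point of the plane over the prime field. -/
theorem rank_map_rep {P : Projectivization (ZMod p) (Fin 3 → ZMod p)} {w : Fin 3 → ℤ}
    (hw : ∃ u : ZMod p, u ≠ 0 ∧ ∀ i, (w i : ZMod p) = u * P.rep i) :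
    ((commutatorMatrix B).map (aeval P.rep : MvPolynomial (Fin 3) ℤ →ₐ[ℤ] ZMod p)).rank =
      ((MatP B p w).map PadicInt.toZMod).rank := by
  obtain ⟨u, hu, hw⟩ := hw
  rw [map_toZMod_MatP]
  have h : (Mat B w).map (Int.castRingHom (ZMod p)) =
      u • (commutatorMatrix B).map (aeval P.rep : MvPolynomial (Fin 3) ℤ →ₐ[ℤ] ZMod p) := by
    ext i j
    simp [Mat, commutatorMatrix, hw, Finset.mul_sum, mul_left_comm]
  rw [h]
  exact (Matrix.rank_smul_of_mem_nonZeroDivisors _ (mem_nonZeroDivisors_of_ne_zero hu)).symm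

end Assembly

/-! ### The zeta function in terms of points of the plane over 𝔽_p -/

section Formula

variable {r : ℕ} {B : Fin (2 * r) → Fin (2 * r) → Fin 3 → ℤ} {F : MvPolynomial (Fin 3) ℤ}
  {p : ℕ} [hp : Fact p.Prime]

variable (p) in
/-- The local series at a point off the curve, as a Laurent series. -/
def unitL (d : ℕ) : LaurentSeries ℚ :=
  (p : LaurentSeries ℚ) ^ d * T ^ (d + 1) / (1 - (p : LaurentSeries ℚ) ^ (d + 2) * T ^ (d + 1))

omit hp in
theorem unitL_mul (d : ℕ) : unitL p d * (1 - (p : LaurentSeries ℚ) ^ (d + 2) * T ^ (d + 1)) =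
    (p : LaurentSeries ℚ) ^ d * T ^ (d + 1) :=
  div_mul_cancel₀ _ (one_sub_ne_zero _ _)

omit hp in
theorem eq_unitL {d : ℕ} {L : PowerSeries ℚ} (h : UnitSeries d p L) :
    (L : LaurentSeries ℚ) = unitL p d := by
  have h1 := congrArg (HahnSeries.ofPowerSeries ℤ ℚ) h
  simp only [map_mul, map_sub, map_one, map_pow, map_natCast] at h1
  exact eq_div_of_mul_eq (one_sub_ne_zero _ _) h1

local notation "𝕡" => (p : LaurentSeries ℚ)

open Classical in
variable (B F p) in
/-- The contribution of a point of the plane to the zeta function. -/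
def contribution (P : Projectivization (ZMod p) (Fin 3 → ZMod p)) : LaurentSeries ℚ :=
  (if OnCurve F p P ∧ ¬ Sing F p P then W₂ r 𝕡 T else 0) +
  (if Sing F p P then 2 * W₂ r 𝕡 T else 0) +
  (if Sing F p P ∧ ((commutatorMatrix B).map
    (aeval P.rep : MvPolynomial (Fin 3) ℤ →ₐ[ℤ] ZMod p)).rank + 2 * 1 = 2 * r then W₃ r 𝕡 T else 0) +
  (if Sing F p P ∧ ((commutatorMatrix B).map
    (aeval P.rep : MvPolynomial (Fin 3) ℤ →ₐ[ℤ] ZMod p)).rank + 2 * 2 = 2 * r then W₄ r 𝕡 T else 0)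

theorem exists_frame_contribution (h2 : p ≠ 2) (hB : ∀ i j k, B i j k = -B j i k)
    (hF : F ^ 2 = (commutatorMatrix B).det) (hF0 : F ≠ 0)
    (hnode : ∀ P, Sing F p P → ∃ N : IntNode B F, ¬ (p : ℤ) ∣ N.disc ∧
      ∃ u : ZMod p, u ≠ 0 ∧ ∀ i, (N.w i : ZMod p) = u * P.rep i)
    (P : Projectivization (ZMod p) (Fin 3 → ZMod p)) :
    ∃ fr : Frame p P, ((localSeries B fr : LaurentSeries ℚ) - unitL p (2 * r)) *
        (1 + 𝕡 * (𝕡 ^ (4 * r) * T ^ (2 * r + 2))) =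
      contribution B F p P * (1 - 𝕡 ^ 2 * (𝕡 ^ (4 * r) * T ^ (2 * r + 2))) := by
  have hev : Even (2 * r) := even_two_mul r
  by_cases hon : OnCurve F p P
  swap
  · obtain ⟨fr, hfr⟩ := unitSeries_of_eval_ne_zero h2 hev hB hF P hon
    have hs : ¬ Sing F p P := fun h => hon h.1
    refine ⟨fr, ?_⟩
    rw [eq_unitL hfr, sub_self, zero_mul, contribution, if_neg (by tauto), if_neg hs,
      if_neg (by tauto), if_neg (by tauto)]
    simp
  by_cases hs : Sing F p P
  swap
  · obtain ⟨i, hi⟩ : ∃ i, eval P.rep (baseChange (ZMod p) (pderiv i F)) ≠ 0 := by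
      by_contra hcon
      push Not at hcon
      exact hs ⟨hon, fun i => by rw [pderiv_baseChange]; exact hcon i⟩
    obtain ⟨fr, d₀, hd₀, hfr⟩ := smoothSeries_of_pderiv_ne_zero h2 hev hB hF hF0 P hon hi
    refine ⟨fr, ?_⟩
    have h1 := congrArg (HahnSeries.ofPowerSeries ℤ ℚ) hfr
    simp only [map_mul, map_sub, map_one, map_pow, map_natCast] at h1
    rw [contribution, if_pos ⟨hon, hs⟩, if_neg hs, if_neg (by tauto), if_neg (by tauto), add_zero,
      add_zero, add_zero]
    have hu := unitL_mul (p := p) (2 * r)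
    generalize localSeries B fr = L at *
    obtain ⟨r', rfl⟩ : ∃ r', r = r' + 1 := ⟨r - 1, by omega⟩
    obtain rfl : d₀ = 2 * r' := by omega
    exact W₂_eq (one_sub_ne_zero _ _) (one_sub_ne_zero _ _) (one_sub_ne_zero _ _) hu h1
  obtain ⟨N, hN, hw⟩ := hnode P hs
  have hrk := (rank_map_rep (B := B) hw).trans (N.rank_eq hN)
  have hcard := N.card_eq
  refine ⟨N.frame hN hw, ?_⟩
  have hu := unitL_mul (p := p) (2 * r)
  rw [contribution, if_neg (by tauto), if_pos hs, zero_add, hrk]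
  rcases N.corank_cases h2 hev hB hF hN with hl | hl
  · obtain ⟨d₀, hd₀, hfr⟩ := N.nodeTwoSeries hN hw h2 hev hB hF hl
    have h1 := congrArg (HahnSeries.ofPowerSeries ℤ ℚ) hfr
    simp only [map_mul, map_add, map_sub, map_one, map_pow, map_natCast, map_ofNat] at h1
    rw [if_pos ⟨hs, by omega⟩, if_neg (by omega), add_zero]
    generalize localSeries B (N.frame hN hw) = L at *
    clear hrk hcard hl
    clear hw hN N hnode
    obtain ⟨r', rfl⟩ : ∃ r', r = r' + 1 := ⟨r - 1, by omega⟩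
    obtain rfl : d₀ = 2 * r' := by omega
    exact W₃_eq (one_sub_ne_zero _ _) (one_sub_ne_zero _ _) (one_sub_ne_zero _ _) hu h1
  · obtain ⟨d₀, hd₀, hfr⟩ := N.nodeFourSeries hN hw h2 hB hF hl
    have h1 := congrArg (HahnSeries.ofPowerSeries ℤ ℚ) hfr
    simp only [map_mul, map_add, map_sub, map_one, map_pow, map_natCast, map_ofNat] at h1
    rw [if_neg (by omega), if_pos ⟨hs, by omega⟩, add_zero]
    generalize localSeries B (N.frame hN hw) = L at *
    clear hrk hcard hl
    clear hw hN N hnode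
    obtain ⟨r', rfl⟩ : ∃ r', r = r' + 2 := ⟨r - 2, by omega⟩
    obtain rfl : d₀ = 2 * r' := by omega
    exact W₄_eq (one_sub_ne_zero _ _) (one_sub_ne_zero _ _) (one_sub_ne_zero _ _)
      (one_sub_ne_zero _ _) hu h1

theorem sum_contribution (hodp : ∀ P : Projectivization (ZMod p) (Fin 3 → ZMod p),
      IsODP (baseChange (ZMod p) F) P.rep ↔ Sing F p P) :
    ∑ P, contribution B F p P =
      ((Nat.card {P // OnCurve F p P ∧ ¬ Sing F p P} + 2 * Nat.card {P // Sing F p P} : ℕ) :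
        LaurentSeries ℚ) * W₂ r 𝕡 T + (odpCount B F p 1 : LaurentSeries ℚ) * W₃ r 𝕡 T +
      (odpCount B F p 2 : LaurentSeries ℚ) * W₄ r 𝕡 T := by
  classical
  have hcount : ∀ (φ : Projectivization (ZMod p) (Fin 3 → ZMod p) → Prop) (c : LaurentSeries ℚ) [DecidablePred φ],
      ∑ P, (if φ P then c else 0) = (Nat.card {P // φ P} : LaurentSeries ℚ) * c := by
    intro φ c _
    rw [← Finset.sum_filter, Finset.sum_const, nsmul_eq_mul, Nat.card_eq_fintype_card,
      Fintype.card_subtype]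
  simp only [contribution, Finset.sum_add_distrib, hcount, odpCount, hodp]
  push_cast
  ring

theorem card_plane : Fintype.card (Projectivization (ZMod p) (Fin 3 → ZMod p)) = p ^ 2 + p + 1 := by
  rw [← Nat.card_eq_fintype_card, Projectivization.card_of_finrank (ZMod p) (Fin 3 → ZMod p)
    (Module.finrank_fin_fun _), Nat.card_zmod]
  simp [Finset.sum_range_succ]
  ring

/-- Here W₂ still has the coefficient #(smooth points) + 2 #(nodes). Identifying it with points on
the non-singular models is a separate geometric matter. -/
theorem zeta_formula {G : Type*} [Group G] (pres : CommutatorPresentation G B) (h2 : p ≠ 2)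
    (hF : F ^ 2 = (commutatorMatrix B).det) (hF0 : F ≠ 0) (hline : NoLine F p)
    (hnode : ∀ P, Sing F p P → ∃ N : IntNode B F, ¬ (p : ℤ) ∣ N.disc ∧
      ∃ u : ZMod p, u ≠ 0 ∧ ∀ i, (N.w i : ZMod p) = u * P.rep i)
    (hodp : ∀ P : Projectivization (ZMod p) (Fin 3 → ZMod p),
      IsODP (baseChange (ZMod p) F) P.rep ↔ Sing F p P) :
    (localNormalZeta p G : LaurentSeries ℚ) /
        ((zetaZp p (2 * r) : LaurentSeries ℚ) * zetaFactor (𝕡 ^ (3 * (2 * r)) * T ^ (2 * r + 3))) =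
      W₁ r 𝕡 T + ((Nat.card {P // OnCurve F p P ∧ ¬ Sing F p P} + 2 * Nat.card {P // Sing F p P} : ℕ) :
        LaurentSeries ℚ) * W₂ r 𝕡 T + (odpCount B F p 1 : LaurentSeries ℚ) * W₃ r 𝕡 T +
      (odpCount B F p 2 : LaurentSeries ℚ) * W₄ r 𝕡 T := by
  have hdiv := dvd_of_noLine (p := p) hF hline
  choose fr hfr using exists_frame_contribution h2 pres.skew hF hF0 hnode
  have hS1 := congrArg (HahnSeries.ofPowerSeries ℤ ℚ) (cdSeries_one B fr)
  have hS2 := congrArg (HahnSeries.ofPowerSeries ℤ ℚ) (cdSeries_two hdiv)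
  have hS3 := congrArg (HahnSeries.ofPowerSeries ℤ ℚ) (cdSeries_three hdiv)
  have hZ := congrArg (HahnSeries.ofPowerSeries ℤ ℚ) (localNormalZeta_eq_cdSeries (p := p) pres)
  have hS0 := cdSeries_zero (p := p) (B := B)
  rw [hS0] at hS3 hZ
  simp only [map_mul, map_add, map_sub, map_one, map_pow, map_natCast] at hS2 hS3 hZ
  rw [map_sum] at hS1
  have hT : HahnSeries.ofPowerSeries ℤ ℚ PowerSeries.X = T := rfl
  rw [hT] at hS2 hS3
  -- Compare each local series with that of a point off the curve and add up the differences.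
  have hsum : (HahnSeries.ofPowerSeries ℤ ℚ (cdSeries p B 1) - (𝕡 ^ 2 + 𝕡 + 1) * unitL p (2 * r)) *
      (1 + 𝕡 * (𝕡 ^ (4 * r) * T ^ (2 * r + 2))) =
      (∑ P, contribution B F p P) * (1 - 𝕡 ^ 2 * (𝕡 ^ (4 * r) * T ^ (2 * r + 2))) := by
    rw [Finset.sum_mul, ← Finset.sum_congr rfl fun P _ => hfr P, ← Finset.sum_mul,
      Finset.sum_sub_distrib, hS1, Finset.sum_const, Finset.card_univ, card_plane, nsmul_eq_mul]
    push_cast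
    rfl
  rw [sum_contribution hodp] at hsum
  have hW := W₁_eq (one_sub_ne_zero _ _) (one_sub_ne_zero _ _) (unitL_mul (p := p) (2 * r))
  have hz0 : HahnSeries.ofPowerSeries ℤ ℚ (zetaZp p (2 * r)) ≠ 0 := by
    rw [Ne, map_eq_zero_iff _ HahnSeries.ofPowerSeries_injective]
    intro h
    have h1 := congrArg (PowerSeries.coeff 0) h
    rw [map_zero, zetaZp, localNormalZeta, PowerSeries.coeff_mk, pow_zero] at h1
    have h3 : Nat.card {H : Subgroup (Multiplicative (Fin (2 * r) → ℤ_[p])) // H.Normal ∧ H.index = 1} = 1 := by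
      rw [Nat.card_eq_one_iff_unique]
      refine ⟨⟨fun a b => Subtype.ext ?_⟩, ⟨⟨⊤, inferInstance, Subgroup.index_top⟩⟩⟩
      rw [Subgroup.index_eq_one.1 a.2.2, Subgroup.index_eq_one.1 b.2.2]
    rw [h3] at h1
    simp at h1
  have hD2 : (1 : LaurentSeries ℚ) - 𝕡 ^ 2 * (𝕡 ^ (4 * r) * T ^ (2 * r + 2)) ≠ 0 := by
    rw [← mul_assoc, ← pow_add]; exact one_sub_ne_zero _ _
  have hD3 : (1 : LaurentSeries ℚ) - 𝕡 ^ (3 * (2 * r)) * T ^ (2 * r + 3) ≠ 0 := one_sub_ne_zero _ _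
  have hp1 : 𝕡 - 1 ≠ 0 := by
    have : CharZero (LaurentSeries ℚ) := algebraRat.charZero _
    rw [sub_ne_zero]
    exact_mod_cast hp.out.one_lt.ne'
  -- By `cdSeries_three`, dividing by the factor ζ_p removes exactly the lattices contained in pℤ³.
  have hL : HahnSeries.ofPowerSeries ℤ ℚ (localNormalZeta p G) /
      (HahnSeries.ofPowerSeries ℤ ℚ (zetaZp p (2 * r)) *
        zetaFactor (𝕡 ^ (3 * (2 * r)) * T ^ (2 * r + 3))) =
      1 + HahnSeries.ofPowerSeries ℤ ℚ (cdSeries p B 1) +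
        HahnSeries.ofPowerSeries ℤ ℚ (cdSeries p B 2) := by
    rw [zetaFactor, hZ, mul_div_mul_left _ _ hz0, div_inv_eq_mul]
    linear_combination hS3
  rw [hL]
  refine mul_left_cancel₀ (mul_ne_zero hp1 hD2) ?_
  linear_combination hS2 + (𝕡 - 1) * hW + (𝕡 - 1) * hsum

end Formula

/-! ### The local ring at a smooth point of an affine plane curve -/

section SmoothChart

variable {k K : Type*} [Field k] [Field K] [Algebra k K]

theorem exists_eq_C_add_X_mul (h : MvPolynomial (Fin 2) k) :
    ∃ a b, h = C (constantCoeff h) + X 0 * a + X 1 * b := by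
  induction h using MvPolynomial.induction_on with
  | C c => exact ⟨0, 0, by simp⟩
  | add p q hp hq =>
    obtain ⟨a, b, h1⟩ := hp
    obtain ⟨a', b', h2⟩ := hq
    refine ⟨a + a', b + b', ?_⟩
    rw [map_add, C_add]
    linear_combination h1 + h2
  | mul_X p i _ =>
    fin_cases i
    · exact ⟨p, 0, by simp [mul_comm]⟩
    · exact ⟨0, p, by simp [mul_comm]⟩

/-- The elements of `K` that are defined at the origin of the plane with coordinates `τ`. -/
def originRing (τ : Fin 2 → K) (_hτ : ∀ h : MvPolynomial (Fin 2) k, aeval τ h = 0 → constantCoeff h = 0) :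
    Subring K where
  carrier := {x | ∃ a b : MvPolynomial (Fin 2) k, constantCoeff b ≠ 0 ∧ x * aeval τ b = aeval τ a}
  mul_mem' := by
    rintro x y ⟨a, b, hb, h⟩ ⟨a', b', hb', h'⟩
    refine ⟨a * a', b * b', by simp [hb, hb'], ?_⟩
    rw [map_mul, map_mul, ← h, ← h']; ring
  one_mem' := ⟨1, 1, by simp, by simp⟩
  add_mem' := by
    rintro x y ⟨a, b, hb, h⟩ ⟨a', b', hb', h'⟩
    refine ⟨a * b' + a' * b, b * b', by simp [hb, hb'], ?_⟩
    rw [map_mul, map_add, map_mul, map_mul, ← h, ← h']; ring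
  zero_mem' := ⟨0, 1, by simp, by simp⟩
  neg_mem' := by
    rintro x ⟨a, b, hb, h⟩
    exact ⟨-a, b, hb, by rw [map_neg, ← h]; ring⟩

variable {τ : Fin 2 → K} {hτ : ∀ h : MvPolynomial (Fin 2) k, aeval τ h = 0 → constantCoeff h = 0}

theorem aeval_mem_originRing (a : MvPolynomial (Fin 2) k) : aeval τ a ∈ originRing τ hτ :=
  ⟨a, 1, by simp, by simp⟩

theorem inv_aeval_mem_originRing {b : MvPolynomial (Fin 2) k} (hb : constantCoeff b ≠ 0) :
    (aeval τ b)⁻¹ ∈ originRing τ hτ :=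
  ⟨1, b, hb, by rw [map_one, inv_mul_cancel₀ (fun h => hb (hτ b h))]⟩

theorem isUnit_originRing {x : originRing τ hτ} {a b : MvPolynomial (Fin 2) k}
    (ha : constantCoeff a ≠ 0)
    (h : (x : K) * aeval τ b = aeval τ a) : IsUnit x := by
  have ha' : aeval τ a ≠ 0 := fun h => ha (hτ a h)
  refine IsUnit.of_mul_eq_one ⟨aeval τ b * (aeval τ a)⁻¹, mul_mem (aeval_mem_originRing b)
    (inv_aeval_mem_originRing ha)⟩ (Subtype.ext ?_)
  change (x : K) * (aeval τ b * (aeval τ a)⁻¹) = 1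
  rw [← mul_assoc, h, mul_inv_cancel₀ ha']

instance isLocalRing_originRing : IsLocalRing (originRing τ hτ) := by
  refine IsLocalRing.of_isUnit_or_isUnit_one_sub_self fun x => ?_
  obtain ⟨a, b, hb, h⟩ := x.2
  by_cases ha : constantCoeff a = 0
  · right
    refine isUnit_originRing (a := b - a) (b := b) (by simpa [ha] using hb) ?_
    change (1 - (x : K)) * _ = _
    rw [map_sub, ← h]; ring
  · exact Or.inl (isUnit_originRing ha h)

theorem constantCoeff_eq_zero_of_not_isUnit {x : originRing τ hτ} (hx : ¬ IsUnit x)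
    {a b : MvPolynomial (Fin 2) k} (h : (x : K) * aeval τ b = aeval τ a) : constantCoeff a = 0 := by
  by_contra ha
  exact hx (isUnit_originRing ha h)

/-- The ring is a quotient of the localisation of k[x, y] at the origin. -/
theorem isNoetherianRing_originRing : IsNoetherianRing (originRing τ hτ) := by
  have hprime : (RingHom.ker (constantCoeff (σ := Fin 2) (R := k))).IsPrime := RingHom.ker_isPrime _
  set M := RingHom.ker (constantCoeff (σ := Fin 2) (R := k)) with hM
  have hunit : ∀ y : M.primeCompl, IsUnit
      ((aeval τ : MvPolynomial (Fin 2) k →ₐ[k] K).toRingHom.codRestrict (originRing τ hτ)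
        aeval_mem_originRing y) := fun y =>
    isUnit_originRing (a := y) (b := 1) (fun h => y.2 h) (by simp)
  let φ : Localization.AtPrime M →+* originRing τ hτ := IsLocalization.lift hunit
  refine isNoetherianRing_of_surjective (Localization.AtPrime M) _ φ fun x => ?_
  obtain ⟨a, b, hb, h⟩ := x.2
  refine ⟨IsLocalization.mk' _ a (⟨b, fun h => hb h⟩ : M.primeCompl), ?_⟩
  rw [IsLocalization.lift_mk'_spec]
  exact Subtype.ext (by rw [← mul_comm] at h; exact h.symm)

theorem isFractionRing_originRing (hgen : IntermediateField.adjoin k (Set.range τ) = ⊤) :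
    IsFractionRing (originRing τ hτ) K := by
  refine IsFractionRing.of_field _ _ fun z => ?_
  have hz : z ∈ IntermediateField.adjoin k (Set.range τ) := hgen ▸ IntermediateField.mem_top
  rw [IntermediateField.mem_adjoin_range_iff] at hz
  obtain ⟨a, b, h⟩ := hz
  exact ⟨⟨_, aeval_mem_originRing a⟩, ⟨_, aeval_mem_originRing b⟩, h⟩

/-- The relation writes τ 1 as τ 0 times w/u with u a unit, so τ 0 alone generates the maximal
ideal. -/
theorem isPrincipal_maximalIdeal_originRing {u w : MvPolynomial (Fin 2) k}
    (hu : constantCoeff u ≠ 0) (huw : τ 1 * aeval τ u = τ 0 * aeval τ w) :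
    (IsLocalRing.maximalIdeal (originRing τ hτ)).IsPrincipal := by
  have h0 : τ 0 ∈ originRing τ hτ := by simpa using aeval_mem_originRing (hτ := hτ) (X 0)
  have hu0 : aeval τ u ≠ 0 := fun h => hu (hτ u h)
  refine ⟨⟨⟨τ 0, h0⟩, le_antisymm (fun x hx => ?_) ?_⟩⟩
  · obtain ⟨a, b, hb, h⟩ := x.2
    have ha := constantCoeff_eq_zero_of_not_isUnit hx h
    have hb0 : aeval τ b ≠ 0 := fun h => hb (hτ b h)
    obtain ⟨c, d, hcd⟩ := exists_eq_C_add_X_mul a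
    rw [ha, C_0, zero_add] at hcd
    refine Ideal.mem_span_singleton'.2 ⟨⟨(aeval τ b)⁻¹ * (aeval τ c + aeval τ w * (aeval τ u)⁻¹ * aeval τ d),
      mul_mem (inv_aeval_mem_originRing hb) (add_mem (aeval_mem_originRing _)
        (mul_mem (mul_mem (aeval_mem_originRing _) (inv_aeval_mem_originRing hu))
          (aeval_mem_originRing _)))⟩, Subtype.ext ?_⟩
    change (aeval τ b)⁻¹ * (aeval τ c + aeval τ w * (aeval τ u)⁻¹ * aeval τ d) * τ 0 = x
    have h1 : aeval τ a = τ 0 * aeval τ c + τ 1 * aeval τ d := by rw [hcd]; simp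
    rw [h1] at h
    field_simp
    linear_combination (-aeval τ u) * h - aeval τ d * huw
  · rw [Ideal.submodule_span_eq, Ideal.span_singleton_le_iff_mem]
    intro hunit
    obtain ⟨y, hy⟩ := hunit.exists_right_inv
    obtain ⟨a, b, hb, h⟩ := y.2
    have h1 : τ 0 * (y : K) = 1 := congrArg Subtype.val hy
    have h2 := hτ (b - X 0 * a) (by
      rw [map_sub, map_mul, ← h, aeval_X, ← mul_assoc, h1, one_mul, sub_self])
    simp at h2
    exact hb h2

theorem aeval_sub_mem_nonunits {O : ValuationSubring K} (hk : ∀ c : k, algebraMap k K c ∈ O)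
    (h : ∀ i, τ i ∈ O.nonunits) (a : MvPolynomial (Fin 2) k) :
    aeval τ a - algebraMap k K (constantCoeff a) ∈ O.nonunits := by
  have hmem : ∀ a : MvPolynomial (Fin 2) k, aeval τ a ∈ O := fun a => by
    induction a using MvPolynomial.induction_on with
    | C c => simpa using hk c
    | add p q hp hq => rw [map_add]; exact add_mem hp hq
    | mul_X p i hp => rw [map_mul, aeval_X]; exact mul_mem hp (O.nonunits_subset (h i))
  obtain ⟨c, d, hcd⟩ := exists_eq_C_add_X_mul a
  have : aeval τ a - algebraMap k K (constantCoeff a) = τ 0 * aeval τ c + τ 1 * aeval τ d := by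
    conv_lhs => rw [hcd]
    simp only [map_add, map_mul, aeval_X, aeval_C, constantCoeff_C, constantCoeff_X, zero_mul,
      add_zero]
    ring
  rw [this]
  rw [ValuationSubring.mem_nonunits_iff] at *
  have key : ∀ (i) (e : MvPolynomial (Fin 2) k), O.valuation (τ i * aeval τ e) < 1 := fun i e => by
    rw [map_mul]
    exact mul_lt_one_of_lt_of_le ((O.mem_nonunits_iff).1 (h i)) ((O.valuation_le_one_iff _).2 (hmem e))
  exact Valuation.map_add_lt _ (key 0 c) (key 1 d)

variable (k) in
/-- `O` is the local ring of a `k`-rational point of the non-singular model of `K`. -/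
def IsModelPoint (O : ValuationSubring K) : Prop :=
  O ≠ ⊤ ∧ (∀ c : k, algebraMap k K c ∈ O) ∧ ∀ x ∈ O, ∃ c : k, x - algebraMap k K c ∈ O.nonunits

theorem isUnit_of_aeval {O : ValuationSubring K} (hk : ∀ c : k, algebraMap k K c ∈ O)
    (h : ∀ i, τ i ∈ O.nonunits) {b : MvPolynomial (Fin 2) k} (hb : constantCoeff b ≠ 0) :
    O.valuation (aeval τ b) = 1 := by
  have h1 := aeval_sub_mem_nonunits hk h b
  rw [ValuationSubring.mem_nonunits_iff] at h1
  have h2 : O.valuation (algebraMap k K (constantCoeff b)) = 1 := by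
    refine le_antisymm ((O.valuation_le_one_iff _).2 (hk _)) ?_
    have h3 := (O.valuation_le_one_iff _).2 (hk (constantCoeff b)⁻¹)
    rw [map_inv₀, map_inv₀] at h3
    exact (inv_le_one₀ (by simpa [zero_lt_iff] using hb)).1 h3
  rw [← h2] at h1 ⊢
  simpa using Valuation.map_add_eq_of_lt_right _ h1

/-- If the local ring of the origin on the curve with coordinate functions `τ` has maximal ideal
generated by `τ 0`, then exactly one point of the non-singular model lies over the origin. -/
theorem existsUnique_modelPoint (hgen : IntermediateField.adjoin k (Set.range τ) = ⊤)
    (hτ : ∀ h : MvPolynomial (Fin 2) k, aeval τ h = 0 → constantCoeff h = 0)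
    (h0 : τ 0 ≠ 0) {u w : MvPolynomial (Fin 2) k}
    (hu : constantCoeff u ≠ 0) (huw : τ 1 * aeval τ u = τ 0 * aeval τ w) :
    ∃! O : ValuationSubring K, IsModelPoint k O ∧ ∀ i, τ i ∈ O.nonunits := by
  have hN := isNoetherianRing_originRing (hτ := hτ)
  -- A Noetherian local domain with principal maximal ideal is a valuation ring.
  have hV : ValuationRing (originRing τ hτ) :=
    ((tfae_of_isNoetherianRing_of_isLocalRing_of_isDomain (originRing τ hτ)).out 4 1).1
      (isPrincipal_maximalIdeal_originRing hu huw)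
  have hf := isFractionRing_originRing (hτ := hτ) hgen
  have hor : ∀ x : K, x ∈ originRing τ hτ ∨ x⁻¹ ∈ originRing τ hτ := fun x => by
    rcases ValuationRing.isInteger_or_isInteger (originRing τ hτ) x with ⟨y, hy⟩ | ⟨y, hy⟩
    · exact Or.inl (hy ▸ y.2)
    · exact Or.inr (hy ▸ y.2)
  let O₀ : ValuationSubring K := { originRing τ hτ with mem_or_inv_mem' := hor }
  have hk₀ : ∀ c : k, algebraMap k K c ∈ O₀ := fun c => by
    have h := aeval_mem_originRing (hτ := hτ) (C c)
    rw [aeval_C] at h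
    exact h
  have hτ₀ : ∀ a : MvPolynomial (Fin 2) k, constantCoeff a = 0 → aeval τ a ∈ O₀.nonunits :=
    fun a ha => by
    rw [ValuationSubring.mem_nonunits_iff_or]
    refine or_iff_not_imp_left.2 fun hne hmem => ?_
    obtain ⟨c, d, hd, h⟩ := hmem
    have := hτ (d - a * c) (by rw [map_sub, map_mul, ← h]; field_simp; ring)
    simp [ha] at this
    exact hd this
  have hi : ∀ i, τ i ∈ O₀.nonunits := fun i => by simpa using hτ₀ (X i) (by simp)
  refine ⟨O₀, ⟨⟨?_, hk₀, ?_⟩, hi⟩, ?_⟩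
  · intro htop
    have h1 := hi 0
    rw [ValuationSubring.mem_nonunits_iff_or, htop] at h1
    exact h1.elim h0 fun h => h (ValuationSubring.mem_top _)
  · rintro x ⟨a, b, hb, h⟩
    refine ⟨constantCoeff a / constantCoeff b, ?_⟩
    have hb0 : aeval τ b ≠ 0 := fun h => hb (hτ b h)
    have h1 : x - algebraMap k K (constantCoeff a / constantCoeff b) =
        (aeval τ b)⁻¹ * aeval τ (a - C (constantCoeff a / constantCoeff b) * b) := by
      rw [map_sub, ← h, map_mul, aeval_C]; field_simp
    rw [h1, ValuationSubring.mem_nonunits_iff, mul_comm, map_mul]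
    refine mul_lt_one_of_lt_of_le (O₀.mem_nonunits_iff.1 (hτ₀ _ ?_))
      ((O₀.valuation_le_one_iff _).2 (inv_aeval_mem_originRing (hτ := hτ) hb))
    simp [hb]
  -- Any other such O dominates O₀, and a valuation ring is maximal for domination.
  · rintro O ⟨⟨_, hk, _⟩, hO⟩
    have hle : ∀ x ∈ O₀, x ∈ O := by
      rintro x ⟨a, b, hb, h⟩
      have hb1 := isUnit_of_aeval hk hO hb
      rw [← O.valuation_le_one_iff]
      have h2 := congrArg O.valuation h
      rw [map_mul, hb1, mul_one] at h2
      rw [h2, O.valuation_le_one_iff]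
      simpa using add_mem (O.nonunits_subset (aeval_sub_mem_nonunits hk hO a)) (hk (constantCoeff a))
    refine le_antisymm (fun x hx => ?_) hle
    by_contra hx0
    obtain ⟨a, b, hb, h⟩ := (hor x).resolve_left hx0
    have hxz : x ≠ 0 := by rintro rfl; exact hx0 (zero_mem O₀)
    have ha : constantCoeff a = 0 := by
      by_contra ha
      refine hx0 ⟨b, a, ha, ?_⟩
      rw [← h]; field_simp
    have h1 := aeval_sub_mem_nonunits hk hO a
    rw [ha, map_zero, sub_zero, ← h, O.mem_nonunits_iff, map_mul, isUnit_of_aeval hk hO hb, mul_one,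
      map_inv₀] at h1
    have h2 := (O.valuation_le_one_iff _).2 hx
    exact (not_le_of_gt h1) ((one_le_inv₀ (by simpa [zero_lt_iff] using hxz)).2 h2)

end SmoothChart

/-! ### Points of the non-singular model over a smooth point and over a node -/

section AffineBranches

variable {k K : Type*} [Field k] [Field K] [Algebra k K] {s t : K} {g : MvPolynomial (Fin 2) k}

/-- Since u(0) ≠ 0, the tangent is not the line X 0 = 0, and s is a local parameter. -/
theorem existsUnique_modelPoint_of_smooth
    (hgen : IntermediateField.adjoin k (Set.range ![s, t]) = ⊤)
    (hker : ∀ h : MvPolynomial (Fin 2) k, aeval ![s, t] h = 0 → g ∣ h) (hg : aeval ![s, t] g = 0)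
    {w u : MvPolynomial (Fin 2) k} (hgw : g = X 0 * w + X 1 * u) (hu : constantCoeff u ≠ 0) :
    ∃! O : ValuationSubring K, IsModelPoint k O ∧ s ∈ O.nonunits ∧ t ∈ O.nonunits := by
  have hτ : ∀ h : MvPolynomial (Fin 2) k, aeval ![s, t] h = 0 → constantCoeff h = 0 := fun h hh => by
    obtain ⟨q, rfl⟩ := hker h hh
    simp [hgw]
  -- If s = 0 then g divides X 0, say X 0 = gq. The X 1-coefficients give u(0) q(0) = 0, so q(0) =
  -- 0, and the X 0-coefficients then give 1 = 0.
  have h0 : s ≠ 0 := by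
    rintro rfl
    obtain ⟨q, hq⟩ := hker (X 0) (by simp)
    have h1 := congrArg (fun x => constantCoeff (pderiv 1 x)) hq
    have h2 := congrArg (fun x => constantCoeff (pderiv 0 x)) hq
    simp [hgw, Derivation.leibniz, pderiv_X, hu] at h1 h2
    simp [h1] at h2
  have := existsUnique_modelPoint (τ := ![s, t]) hgen hτ h0 (u := u) (w := -w) hu (by
    rw [hgw] at hg
    simp at hg ⊢
    linear_combination hg)
  simpa [Fin.forall_fin_two] using this

/-- The substitution `(x₀, x₁) ↦ (x₀, x₀ x₁)` describing a chart of the blow-up of the origin. -/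
def blowUp : MvPolynomial (Fin 2) k →ₐ[k] MvPolynomial (Fin 2) k := aeval ![X 0, X 0 * X 1]

theorem constantCoeff_blowUp (h : MvPolynomial (Fin 2) k) :
    constantCoeff (blowUp h) = constantCoeff h := by
  induction h using MvPolynomial.induction_on with
  | C c => simp [blowUp]
  | add p q hp hq => rw [map_add, map_add, hp, hq, map_add]
  | mul_X p i _ => fin_cases i <;> simp [blowUp]

/-- The substitution becomes invertible once X 0 is inverted. -/
theorem exists_blowUp_eq (h : MvPolynomial (Fin 2) k) :
    ∃ n H, blowUp H = (X 0 : MvPolynomial (Fin 2) k) ^ n * h := by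
  induction h using MvPolynomial.induction_on with
  | C c => exact ⟨0, C c, by simp [blowUp]⟩
  | add p q hp hq =>
    obtain ⟨n, H, h1⟩ := hp
    obtain ⟨m, H', h2⟩ := hq
    refine ⟨n + m, X 0 ^ m * H + X 0 ^ n * H', ?_⟩
    rw [map_add, map_mul, map_mul, h1, h2]
    simp [blowUp]
    ring
  | mul_X p i hp =>
    obtain ⟨n, H, h1⟩ := hp
    fin_cases i
    · refine ⟨n, H * X 0, ?_⟩
      rw [map_mul, h1]; simp [blowUp]; ring
    · refine ⟨n + 1, H * X 1, ?_⟩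
      rw [map_mul, h1]; simp [blowUp]; ring

theorem aeval_blowUp (hs : s ≠ 0) (h : MvPolynomial (Fin 2) k) :
    aeval ![s, t / s] (blowUp h) = aeval ![s, t] h := by
  have : (aeval ![s, t / s]).comp blowUp = (aeval ![s, t] : MvPolynomial (Fin 2) k →ₐ[k] K) := by
    ext i
    fin_cases i <;> simp [blowUp]
    field_simp
  exact DFunLike.congr_fun this h

theorem ne_zero_of_node (hker : ∀ h : MvPolynomial (Fin 2) k, aeval ![s, t] h = 0 → g ∣ h)
    {A M B : MvPolynomial (Fin 2) k} (hgA : g = X 0 ^ 2 * A + X 0 * X 1 * M + X 1 ^ 2 * B) :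
    s ≠ 0 := by
  rintro rfl
  obtain ⟨q, hq⟩ := hker (X 0) (by simp)
  have h2 := congrArg (fun x => constantCoeff (pderiv 0 x)) hq
  simp [hgA, Derivation.leibniz, pderiv_X] at h2

/-- In the chart with coordinates s and t/s, the strict transform has constant term A(0) = 0 and X
1-coefficient M(0) ≠ 0 at the origin. So it passes smoothly through the origin and the result for a
principal maximal ideal applies. -/
theorem existsUnique_modelPoint_of_node
    (hgen : IntermediateField.adjoin k (Set.range ![s, t]) = ⊤)
    (hker : ∀ h : MvPolynomial (Fin 2) k, aeval ![s, t] h = 0 → g ∣ h) (hg : aeval ![s, t] g = 0)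
    {A M B : MvPolynomial (Fin 2) k} (hgA : g = X 0 ^ 2 * A + X 0 * X 1 * M + X 1 ^ 2 * B)
    (hA : constantCoeff A = 0) (hM : constantCoeff M ≠ 0) :
    ∃! O : ValuationSubring K, IsModelPoint k O ∧ s ∈ O.nonunits ∧ t / s ∈ O.nonunits := by
  have hs := ne_zero_of_node hker hgA
  obtain ⟨a, b, hab⟩ := exists_eq_C_add_X_mul A
  rw [hA, C_0, zero_add] at hab
  set g' : MvPolynomial (Fin 2) k := blowUp A + X 1 * blowUp M + X 1 ^ 2 * blowUp B with hg'
  have hgg : blowUp g = X 0 ^ 2 * g' := by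
    rw [hgA, hg']
    simp only [map_add, map_mul, map_pow]
    simp only [blowUp, aeval_X, Matrix.cons_val_zero, Matrix.cons_val_one]
    ring
  have hX : Prime (X 0 : MvPolynomial (Fin 2) k) := X_prime
  -- The exceptional line X 0 = 0 is not part of the strict transform, so powers of X 0 can be
  -- cancelled when testing divisibility by g'.
  have hndvd : ¬ (X 0 : MvPolynomial (Fin 2) k) ∣ g' := by
    rintro ⟨q, hq⟩
    have h1 := congrArg (fun x => constantCoeff (pderiv 1 x)) hq
    have hbA : blowUp A = X 0 * (blowUp a + X 1 * blowUp b) := by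
      rw [hab]; simp only [map_add, map_mul]
      simp only [blowUp, aeval_X, Matrix.cons_val_zero, Matrix.cons_val_one]
      ring
    rw [hg', hbA] at h1
    simp [Derivation.leibniz, pderiv_X, constantCoeff_blowUp, hM] at h1
  have hτ : ∀ h : MvPolynomial (Fin 2) k, aeval ![s, t / s] h = 0 → constantCoeff h = 0 := fun h hh => by
    obtain ⟨n, H, hH⟩ := exists_blowUp_eq h
    obtain ⟨q, hq⟩ := hker H (by rw [← aeval_blowUp hs, hH, map_mul, hh, mul_zero])
    have h1 : (X 0 : MvPolynomial (Fin 2) k) ^ n * h = g' * (X 0 ^ 2 * blowUp q) := by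
      rw [← hH, hq, map_mul, hgg]; ring
    obtain ⟨q', hq'⟩ := hX.pow_dvd_of_dvd_mul_left n hndvd (h1 ▸ Dvd.intro _ rfl)
    rw [hq', mul_left_comm] at h1
    rw [mul_left_cancel₀ (pow_ne_zero n hX.ne_zero) h1, hg']
    simp [constantCoeff_blowUp, hA]
  have hle : IntermediateField.adjoin k (Set.range ![s, t / s]) = ⊤ := by
    rw [eq_top_iff, ← hgen, IntermediateField.adjoin_le_iff]
    have h0 := IntermediateField.subset_adjoin k (Set.range ![s, t / s]) ⟨0, rfl⟩
    have h1 := IntermediateField.subset_adjoin k (Set.range ![s, t / s]) ⟨1, rfl⟩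
    rintro _ ⟨i, rfl⟩
    fin_cases i
    · exact h0
    · have := mul_mem h0 h1
      simpa [mul_div_cancel₀ _ hs] using this
  have key := existsUnique_modelPoint (τ := ![s, t / s]) hle hτ hs
    (u := blowUp M + X 1 * blowUp B) (w := -(blowUp a + X 1 * blowUp b))
    (by simpa [constantCoeff_blowUp] using hM) (by
      have h1 : aeval ![s, t / s] (X 0 ^ 2 * g') = 0 := by rw [← hgg, aeval_blowUp hs, hg]
      rw [hg', hab] at h1
      simp only [map_add, map_mul, map_pow, map_neg, aeval_blowUp hs] at h1 ⊢
      simp only [aeval_X, Matrix.cons_val_zero, Matrix.cons_val_one] at h1 ⊢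
      have h2 := (mul_eq_zero.1 h1).resolve_left (pow_ne_zero 2 hs)
      field_simp at h2 ⊢
      linear_combination h2)
  simpa [Fin.forall_fin_two] using key

/-- The two charts of the blow-up give one point each, distinguished by which of s, t has the larger
valuation. Equal valuations are impossible: in the equation the term s t M would strictly dominate
the other two. -/
theorem ncard_modelPoint_of_node
    (hgen : IntermediateField.adjoin k (Set.range ![s, t]) = ⊤)
    (hker : ∀ h : MvPolynomial (Fin 2) k, aeval ![s, t] h = 0 → g ∣ h) (hg : aeval ![s, t] g = 0)
    {A M B : MvPolynomial (Fin 2) k} (hgA : g = X 0 ^ 2 * A + X 0 * X 1 * M + X 1 ^ 2 * B)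
    (hA : constantCoeff A = 0) (hM : constantCoeff M ≠ 0) (hB : constantCoeff B = 0) :
    {O : ValuationSubring K | IsModelPoint k O ∧ s ∈ O.nonunits ∧ t ∈ O.nonunits}.ncard = 2 := by
  let e : MvPolynomial (Fin 2) k ≃ₐ[k] MvPolynomial (Fin 2) k := renameEquiv k (Equiv.swap 0 1)
  have he : ∀ h, aeval ![t, s] (e h) = aeval ![s, t] h := fun h => by
    change aeval ![t, s] (rename (Equiv.swap 0 1) h) = _
    rw [aeval_rename]
    congr 2
    ext i; fin_cases i <;> simp
  have hce : ∀ h, constantCoeff (e h) = constantCoeff h := fun h => constantCoeff_rename _ _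
  have hgen' : IntermediateField.adjoin k (Set.range ![t, s]) = ⊤ := by
    rw [← hgen]
    congr 1
    simp [Set.pair_comm]
  have hker' : ∀ h : MvPolynomial (Fin 2) k, aeval ![t, s] h = 0 → e g ∣ h := fun h hh => by
    obtain ⟨q, hq⟩ := hker (e.symm h) (by rw [← he, AlgEquiv.apply_symm_apply, hh])
    exact ⟨e q, by rw [← map_mul, ← hq, AlgEquiv.apply_symm_apply]⟩
  have heg : e g = X 0 ^ 2 * e B + X 0 * X 1 * e M + X 1 ^ 2 * e A := by
    have h0 : e (X 0) = X 1 := (rename_X _ _).trans (by simp)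
    have h1 : e (X 1) = X 0 := (rename_X _ _).trans (by simp)
    rw [hgA]
    simp only [map_add, map_mul, map_pow, h0, h1]
    ring
  obtain ⟨O₁, ⟨hp₁, hs₁, ht₁⟩, hu₁⟩ := existsUnique_modelPoint_of_node hgen hker hg hgA hA hM
  obtain ⟨O₂, ⟨hp₂, ht₂, hs₂⟩, hu₂⟩ := existsUnique_modelPoint_of_node hgen' hker'
    (by rw [he, hg]) heg (by rw [hce, hB]) (by rwa [hce])
  have hs := ne_zero_of_node hker hgA
  have ht := ne_zero_of_node hker' heg
  have hprod : ∀ {O : ValuationSubring K} {x y : K}, x ≠ 0 → x ∈ O.nonunits → y / x ∈ O.nonunits →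
      y ∈ O.nonunits := fun {O x y} hx h1 h2 => by
    rw [← mul_div_cancel₀ y hx]; exact mul_mem h1 h2
  refine Set.ncard_eq_two.2 ⟨O₁, O₂, ?_, Set.ext fun O => ⟨?_, ?_⟩⟩
  · rintro rfl
    rw [O₁.mem_nonunits_iff, map_div₀] at ht₁ hs₂
    rw [div_lt_one₀ (by simpa [zero_lt_iff] using hs)] at ht₁
    rw [div_lt_one₀ (by simpa [zero_lt_iff] using ht)] at hs₂
    exact lt_asymm ht₁ hs₂
  · rintro ⟨hp, hsO, htO⟩
    have hk := hp.2.1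
    have hτ : ∀ i, ![s, t] i ∈ O.nonunits := by simp [Fin.forall_fin_two, hsO, htO]
    have hvM := isUnit_of_aeval hk hτ hM
    have hvA := aeval_sub_mem_nonunits hk hτ A
    have hvB := aeval_sub_mem_nonunits hk hτ B
    rw [hA, map_zero, sub_zero, O.mem_nonunits_iff] at hvA
    rw [hB, map_zero, sub_zero, O.mem_nonunits_iff] at hvB
    rcases lt_trichotomy (O.valuation s) (O.valuation t) with h | h | h
    · right
      exact hu₂ O ⟨hp, htO, by
        rwa [O.mem_nonunits_iff, map_div₀, div_lt_one₀ (by simpa [zero_lt_iff] using ht)]⟩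
    · exfalso
      have h1 : s * t * aeval ![s, t] M = -(s ^ 2 * aeval ![s, t] A + t ^ 2 * aeval ![s, t] B) := by
        rw [hgA] at hg
        simp at hg
        linear_combination hg
      have h2 := congrArg O.valuation h1
      rw [Valuation.map_neg, map_mul, map_mul, hvM, mul_one, ← h] at h2
      have hpos : 0 < O.valuation s * O.valuation s := by simpa [zero_lt_iff] using hs
      have h3 : O.valuation (s ^ 2 * aeval ![s, t] A + t ^ 2 * aeval ![s, t] B) <
          O.valuation s * O.valuation s := by
        refine Valuation.map_add_lt _ ?_ ?_
        · rw [map_mul, map_pow, sq]; exact mul_lt_of_lt_one_right hpos hvA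
        · rw [map_mul, map_pow, ← h, sq]; exact mul_lt_of_lt_one_right hpos hvB
      exact absurd h2 h3.ne'
    · left
      exact hu₁ O ⟨hp, hsO, by
        rwa [O.mem_nonunits_iff, map_div₀, div_lt_one₀ (by simpa [zero_lt_iff] using hs)]⟩
  · rintro (rfl | rfl)
    · exact ⟨hp₁, hs₁, hprod hs hs₁ ht₁⟩
    · exact ⟨hp₂, hprod ht ht₂ hs₂, ht₂⟩

end AffineBranches

/-! ### Low-order terms of the expansion at a point -/

section Expansion

theorem homogeneousComponent_pderiv {σ R : Type*} [CommRing R] (j : σ) (h : MvPolynomial σ R) (n : ℕ) :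
    homogeneousComponent n (pderiv j h) = pderiv j (homogeneousComponent (n + 1) h) := by
  induction h using MvPolynomial.induction_on' with
  | add f g hf hg => simp only [map_add, hf, hg]
  | monomial u r =>
    have hm := isHomogeneous_monomial (σ := σ) (d := u) r rfl
    rw [homogeneousComponent_of_mem hm, homogeneousComponent_of_mem (hm.pderiv (i := j))]
    by_cases h0 : u.degree = 0
    · have : u = 0 := (Finsupp.degree_eq_zero_iff u).1 h0
      simp [this]
    · by_cases h1 : n + 1 = u.degree
      · rw [if_pos h1, if_pos (by omega)]
      · rw [if_neg h1, if_neg (by omega), map_zero]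

theorem homogeneousComponent_zero_mul {σ R : Type*} [CommRing R] (f g : MvPolynomial σ R) :
    homogeneousComponent 0 (f * g) = homogeneousComponent 0 f * homogeneousComponent 0 g := by
  simp only [← coeff_scaling, map_mul]
  exact Polynomial.mul_coeff_zero _ _

theorem homogeneousComponent_one_mul {σ R : Type*} [CommRing R] (f g : MvPolynomial σ R) :
    homogeneousComponent 1 (f * g) = homogeneousComponent 0 f * homogeneousComponent 1 g +
      homogeneousComponent 1 f * homogeneousComponent 0 g := by
  simp only [← coeff_scaling, map_mul]
  exact Polynomial.mul_coeff_one _ _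

theorem homogeneousComponent_two_mul {σ R : Type*} [CommRing R] (f g : MvPolynomial σ R) :
    homogeneousComponent 2 (f * g) = homogeneousComponent 0 f * homogeneousComponent 2 g +
      homogeneousComponent 1 f * homogeneousComponent 1 g +
      homogeneousComponent 2 f * homogeneousComponent 0 g := by
  simp only [← coeff_scaling, map_mul]
  rw [Polynomial.coeff_mul, Finset.Nat.sum_antidiagonal_eq_sum_range_succ
    (fun i j => (scaling σ R f).coeff i * (scaling σ R g).coeff j), Finset.sum_range_succ,
    Finset.sum_range_succ, Finset.sum_range_one]

theorem homogeneousComponent_zero_eq {σ R : Type*} [CommRing R] (f : MvPolynomial σ R) :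
    homogeneousComponent 0 f = C (constantCoeff f) := homogeneousComponent_zero f

theorem homogeneousComponent_one_eq {R : Type*} [CommRing R] {σ : Type*} [Fintype σ]
    (f : MvPolynomial σ R) :
    homogeneousComponent 1 f = ∑ i, C (constantCoeff (pderiv i f)) * X i := by
  classical
  induction f using MvPolynomial.induction_on with
  | C c => rw [homogeneousComponent_of_mem (isHomogeneous_C σ c)]; simp
  | add f g hf hg => simp only [map_add, hf, hg, add_mul, Finset.sum_add_distrib]
  | mul_X f i hf =>
    rw [homogeneousComponent_one_mul, homogeneousComponent_of_mem (isHomogeneous_X R i),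
      homogeneousComponent_of_mem (isHomogeneous_X R i), if_pos rfl, if_neg (by norm_num), mul_zero,
      add_zero, homogeneousComponent_zero_eq, Finset.sum_eq_single i]
    · simp [Derivation.leibniz]
    · intro j _ hj
      simp [Derivation.leibniz, pderiv_X, hj.symm]
    · simp

variable {k : Type*} [Field k]

theorem constantCoeff_expandAt (f : MvPolynomial (Fin 3) k) (v : Fin 3 → k) :
    constantCoeff (expandAt f v) = eval v f := by
  have : constantCoeff.comp (aeval (fun i => C (v i) + X i) :
      MvPolynomial (Fin 3) k →ₐ[k] MvPolynomial (Fin 3) k).toRingHom = eval v := by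
    ext i <;> simp
  exact DFunLike.congr_fun this f

theorem pderiv_expandAt (f : MvPolynomial (Fin 3) k) (v : Fin 3 → k) (i : Fin 3) :
    pderiv i (expandAt f v) = expandAt (pderiv i f) v := by
  unfold expandAt
  induction f using MvPolynomial.induction_on with
  | C c => simp
  | add f g hf hg => simp only [map_add, hf, hg]
  | mul_X f j hf =>
    simp only [map_mul, Derivation.leibniz, aeval_X, map_add, hf, pderiv_C, pderiv_X, smul_eq_mul,
      zero_add]
    by_cases h : i = j <;> simp [h]

theorem homogeneousComponent_zero_expandAt (f : MvPolynomial (Fin 3) k) (v : Fin 3 → k) :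
    homogeneousComponent 0 (expandAt f v) = C (eval v f) := by
  rw [homogeneousComponent_zero_eq, constantCoeff_expandAt]

theorem homogeneousComponent_one_expandAt (f : MvPolynomial (Fin 3) k) (v : Fin 3 → k) :
    homogeneousComponent 1 (expandAt f v) = linForm fun i => eval v (pderiv i f) := by
  simp only [homogeneousComponent_one_eq, pderiv_expandAt, constantCoeff_expandAt, linForm]

theorem pderiv_linForm (a : Fin 3 → k) (i : Fin 3) : pderiv i (linForm a) = C (a i) := by
  rw [linForm, map_sum, Finset.sum_eq_single i]
  · simp [Derivation.leibniz]
  · intro j _ hj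
    simp [Derivation.leibniz, pderiv_X, hj]
  · simp

theorem linForm_eq_zero {a : Fin 3 → k} : linForm a = 0 ↔ a = 0 := by
  refine ⟨fun h => funext fun i => ?_, fun h => by simp [h, linForm]⟩
  have := pderiv_linForm a i
  rw [h, map_zero] at this
  exact (C_eq_zero.1 this.symm)

theorem eval_linForm (a v : Fin 3 → k) : eval v (linForm a) = ∑ i, a i * v i := by
  simp [linForm]

theorem smul_linForm (c : k) (a : Fin 3 → k) : C c * linForm a = linForm (c • a) := by
  simp [linForm, Finset.mul_sum, mul_assoc]

theorem isSingularPoint_iff {f : MvPolynomial (Fin 3) k} {v : Fin 3 → k} :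
    IsSingularPoint f v ↔ homogeneousComponent 0 (expandAt f v) = 0 ∧
      homogeneousComponent 1 (expandAt f v) = 0 := by
  rw [homogeneousComponent_zero_expandAt, homogeneousComponent_one_expandAt, linForm_eq_zero,
    C_eq_zero, IsSingularPoint, funext_iff]
  rfl

theorem sum_mul_eval_pderiv {f : MvPolynomial (Fin 3) k} {n : ℕ} (hf : f.IsHomogeneous n)
    (v : Fin 3 → k) : ∑ i, v i * eval v (pderiv i f) = n * eval v f := by
  have := congrArg (eval v) hf.sum_X_mul_pderiv
  simpa using this

theorem eval_pderiv_pderiv {f : MvPolynomial (Fin 3) k} {v a b : Fin 3 → k}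
    (h : homogeneousComponent 2 (expandAt f v) = linForm a * linForm b) (i j : Fin 3) :
    eval v (pderiv i (pderiv j f)) = a i * b j + a j * b i := by
  have h1 : homogeneousComponent 0 (pderiv i (pderiv j (expandAt f v))) =
      C (a i * b j + a j * b i) := by
    rw [homogeneousComponent_pderiv, homogeneousComponent_pderiv, h]
    simp only [Derivation.leibniz, smul_eq_mul, map_add, pderiv_linForm, pderiv_C, mul_zero,
      zero_add, C_mul]
    ring
  rw [pderiv_expandAt, pderiv_expandAt, homogeneousComponent_zero_expandAt] at h1
  exact C_injective _ _ h1

/-- The tangent lines at a double point pass through the point. -/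
theorem tangent_apply_eq_zero {f : MvPolynomial (Fin 3) k} {n : ℕ} (hf : f.IsHomogeneous n)
    {v a b : Fin 3 → k} (hs : IsSingularPoint f v) (hab : LinearIndependent k ![a, b])
    (h : homogeneousComponent 2 (expandAt f v) = linForm a * linForm b) :
    ∑ i, a i * v i = 0 ∧ ∑ i, b i * v i = 0 := by
  -- Euler's relation for the partial derivatives, which vanish at v, says that the Hessian
  -- annihilates v.
  have key : ∀ j, (∑ i, b i * v i) * a j + (∑ i, a i * v i) * b j = 0 := fun j => by
    have h1 := sum_mul_eval_pderiv (hf.pderiv (i := j)) v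
    rw [hs.2 j, mul_zero] at h1
    rw [← h1, Finset.sum_mul, Finset.sum_mul, ← Finset.sum_add_distrib]
    refine Finset.sum_congr rfl fun i _ => ?_
    rw [eval_pderiv_pderiv h]
    ring
  have := LinearIndependent.pair_iff.1 hab _ _ (funext key)
  exact ⟨this.2, this.1⟩

end Expansion

/-! ### Branches of a curve and of its components -/

section Branches

variable {k : Type*} [Field k]

/-- The point `v` of the curve `f = 0` is a smooth point or an ordinary double point with rational
tangents, or it does not lie on the curve, according to the number `n` of branches. -/
def HasBranches (f : MvPolynomial (Fin 3) k) (v : Fin 3 → k) : ℕ → Prop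
  | 0 => homogeneousComponent 0 (expandAt f v) ≠ 0
  | 1 => homogeneousComponent 0 (expandAt f v) = 0 ∧ homogeneousComponent 1 (expandAt f v) ≠ 0
  | 2 => homogeneousComponent 0 (expandAt f v) = 0 ∧ homogeneousComponent 1 (expandAt f v) = 0 ∧
    ∃ a b : Fin 3 → k, LinearIndependent k ![a, b] ∧
      homogeneousComponent 2 (expandAt f v) = linForm a * linForm b
  | _ => False

theorem linForm_mul_linForm_ne_zero {a b : Fin 3 → k} (h : LinearIndependent k ![a, b]) :
    linForm a * linForm b ≠ 0 :=
  mul_ne_zero (fun h0 => h.ne_zero 0 (linForm_eq_zero.1 h0))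
    (fun h0 => h.ne_zero 1 (linForm_eq_zero.1 h0))

theorem linearIndependent_smul_pair {a b : Fin 3 → k} (h : LinearIndependent k ![a, b]) {c : k}
    (hc : c ≠ 0) : LinearIndependent k ![c • a, b] := by
  rw [LinearIndependent.pair_iff] at h ⊢
  intro s t hst
  rw [smul_smul] at hst
  have := h _ _ hst
  exact ⟨by simpa [hc] using this.1, this.2⟩

theorem expandAt_mul (f g : MvPolynomial (Fin 3) k) (v : Fin 3 → k) :
    expandAt (f * g) v = expandAt f v * expandAt g v := map_mul _ _ _

theorem HasBranches.of_unit_mul {f g : MvPolynomial (Fin 3) k} {v : Fin 3 → k}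
    (hfg : homogeneousComponent 0 (expandAt f v) = 0)
    (hg : homogeneousComponent 0 (expandAt g v) ≠ 0) {n : ℕ} (h : HasBranches (f * g) v n) :
    HasBranches f v n := by
  obtain ⟨c, hc⟩ : ∃ c, homogeneousComponent 0 (expandAt g v) = C c := ⟨_, homogeneousComponent_zero_eq _⟩
  match n, h with
  | 0, h => rw [HasBranches, expandAt_mul, homogeneousComponent_zero_mul, hfg, zero_mul] at h
            exact absurd rfl h
  | 1, ⟨_, h1⟩ =>
    rw [expandAt_mul, homogeneousComponent_one_mul, hfg, zero_mul, zero_add] at h1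
    exact ⟨hfg, left_ne_zero_of_mul h1⟩
  | 2, ⟨_, h1, a, b, hab, h2⟩ =>
    rw [expandAt_mul, homogeneousComponent_one_mul, hfg, zero_mul, zero_add] at h1
    have h1' := (mul_eq_zero.1 h1).resolve_right hg
    rw [expandAt_mul, homogeneousComponent_two_mul, hfg, h1', zero_mul, zero_mul, zero_add, zero_add,
      hc] at h2
    have hc0 : c ≠ 0 := by rintro rfl; exact hg (by rw [hc, C_0])
    refine ⟨hfg, h1', c⁻¹ • a, b, linearIndependent_smul_pair hab (inv_ne_zero hc0), ?_⟩
    rw [← smul_linForm, mul_assoc, ← h2, mul_left_comm, ← C_mul, inv_mul_cancel₀ hc0, C_1, mul_one]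

/-- If both factors pass through v, the quadratic part is the product of their linear parts, so both
are smooth at v. If only one does, the other is a unit there and has no influence. -/
theorem HasBranches.exists_of_mul {f g : MvPolynomial (Fin 3) k} {v : Fin 3 → k} {n : ℕ}
    (h : HasBranches (f * g) v n) : ∃ i j, HasBranches f v i ∧ HasBranches g v j ∧ i + j = n := by
  by_cases hf : homogeneousComponent 0 (expandAt f v) = 0 <;>
    by_cases hg : homogeneousComponent 0 (expandAt g v) = 0
  · match n, h with
    | 0, h => rw [HasBranches, expandAt_mul, homogeneousComponent_zero_mul, hf, zero_mul] at h
              exact absurd rfl h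
    | 1, ⟨_, h1⟩ =>
      rw [expandAt_mul, homogeneousComponent_one_mul, hf, hg, zero_mul, mul_zero, zero_add] at h1
      exact absurd rfl h1
    | 2, ⟨_, _, a, b, hab, h2⟩ =>
      rw [expandAt_mul, homogeneousComponent_two_mul, hf, hg, zero_mul, mul_zero, zero_add,
        add_zero] at h2
      have hne := h2 ▸ linForm_mul_linForm_ne_zero hab
      exact ⟨1, 1, ⟨hf, left_ne_zero_of_mul hne⟩, ⟨hg, right_ne_zero_of_mul hne⟩, rfl⟩
  · exact ⟨n, 0, h.of_unit_mul hf hg, hg, rfl⟩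
  · exact ⟨0, n, hf, (mul_comm f g ▸ h).of_unit_mul hg hf, zero_add n⟩
  · match n, h with
    | 0, _ => exact ⟨0, 0, hf, hg, rfl⟩
    | 1, ⟨h, _⟩ => rw [expandAt_mul, homogeneousComponent_zero_mul] at h
                   exact absurd h (mul_ne_zero hf hg)
    | 2, ⟨h, _⟩ => rw [expandAt_mul, homogeneousComponent_zero_mul] at h
                   exact absurd h (mul_ne_zero hf hg)

theorem HasBranches.exists_of_prod {ι : Type*} (s : Finset ι) {f : ι → MvPolynomial (Fin 3) k}
    {v : Fin 3 → k} {n : ℕ} (h : HasBranches (∏ i ∈ s, f i) v n) :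
    ∃ m : ι → ℕ, (∀ i ∈ s, HasBranches (f i) v (m i)) ∧ ∑ i ∈ s, m i = n := by
  classical
  induction s using Finset.induction_on generalizing n with
  | empty =>
    have h1 : ∀ j, homogeneousComponent j (expandAt (1 : MvPolynomial (Fin 3) k) v) =
        if j = 0 then 1 else 0 := fun j => by
      rw [expandAt, map_one, homogeneousComponent_of_mem (isHomogeneous_one (Fin 3) k)]
    rw [Finset.prod_empty] at h
    match n, h with
    | 0, _ => exact ⟨fun _ => 0, by simp, by simp⟩
    | 1, ⟨h, _⟩ => simp [h1] at h
    | 2, ⟨h, _⟩ => simp [h1] at h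
  | insert i s hi ih =>
    rw [Finset.prod_insert hi] at h
    obtain ⟨a, b, ha, hb, rfl⟩ := h.exists_of_mul
    obtain ⟨m, hm, rfl⟩ := ih hb
    refine ⟨Function.update m i a, fun j hj => ?_, ?_⟩
    · by_cases hji : j = i
      · subst hji; simpa using ha
      · rw [Function.update_of_ne hji]
        exact hm j ((Finset.mem_insert.1 hj).resolve_left hji)
    · rw [Finset.sum_insert hi, Function.update_self]
      congr 1
      exact Finset.sum_congr rfl fun j hj => Function.update_of_ne (ne_of_mem_of_not_mem hj hi) _ _

end Branches

/-! ### The fibre of the non-singular model over a point of the plane -/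

section Fibre

variable {k K : Type*} [Field k] [Field K] [Algebra k K]

/-- `z` are homogeneous coordinates of the generic point of the plane curve `f = 0`, with function
field `K`. -/
structure PlaneModel (f : MvPolynomial (Fin 3) k) (z : Fin 3 → K) : Prop where
  homogeneous : ∃ n, f.IsHomogeneous n
  gen : IntermediateField.adjoin k (Set.range fun ij : Fin 3 × Fin 3 => z ij.1 / z ij.2) = ⊤
  ne_zero : z ≠ 0
  aeval_eq : aeval z f = 0
  dvd : ∀ n (h : MvPolynomial (Fin 3) k), h.IsHomogeneous n → aeval z h = 0 → f ∣ h

variable (k) in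
/-- The rational points of the non-singular model lying over the point `v` of the plane. -/
def fibre (z : Fin 3 → K) (v : Fin 3 → k) : Set (ValuationSubring K) :=
  {O | IsModelPoint k O ∧ ∃ c : K, ∀ i, c * z i - algebraMap k K (v i) ∈ O.nonunits}

theorem aeval_mul_of_isHomogeneous {f : MvPolynomial (Fin 3) k} {n : ℕ} (hf : f.IsHomogeneous n)
    (u : K) (z : Fin 3 → K) : aeval (fun i => u * z i) f = u ^ n * aeval z f := by
  rw [aeval_def, aeval_def, eval₂_eq_eval_map, eval₂_eq_eval_map,
    eval_smul_of_isHomogeneous (hf.map _)]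

theorem algebraMap_mul_mem_nonunits {O : ValuationSubring K} (hk : ∀ c : k, algebraMap k K c ∈ O)
    (c : k) {x : K} (hx : x ∈ O.nonunits) : algebraMap k K c * x ∈ O.nonunits := by
  rw [mul_comm, O.mem_nonunits_iff, map_mul]
  exact mul_lt_one_of_lt_of_le (O.mem_nonunits_iff.1 hx) ((O.valuation_le_one_iff _).2 (hk c))

theorem valuation_eq_one {O : ValuationSubring K} (hk : ∀ c : k, algebraMap k K c ∈ O)
    {c : k} (hc : c ≠ 0) {x : K} (hx : x - algebraMap k K c ∈ O.nonunits) : O.valuation x = 1 := by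
  have h2 : O.valuation (algebraMap k K c) = 1 := by
    refine le_antisymm ((O.valuation_le_one_iff _).2 (hk _)) ?_
    have h3 := (O.valuation_le_one_iff _).2 (hk c⁻¹)
    rw [map_inv₀, map_inv₀] at h3
    exact (inv_le_one₀ (by simpa [zero_lt_iff] using hc)).1 h3
  rw [O.mem_nonunits_iff, ← h2] at hx
  rw [← h2]
  simpa using Valuation.map_add_eq_of_lt_right _ hx

/-- Local coordinates at a point `e 0` of the plane: dual bases `e` and `ℓ`. -/
structure DualFrame (e ℓ : Matrix (Fin 3) (Fin 3) k) : Prop where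
  mul_eq : ℓ * e.transpose = 1

namespace DualFrame

variable {e ℓ : Matrix (Fin 3) (Fin 3) k} (D : DualFrame e ℓ)

include D

theorem pairing (i j : Fin 3) : ∑ m, ℓ i m * e j m = if i = j then 1 else 0 := by
  have := congrFun (congrFun D.mul_eq i) j
  rwa [Matrix.mul_apply, Matrix.one_apply] at this

theorem resolution (m n : Fin 3) : ∑ i, e i m * ℓ i n = if m = n then 1 else 0 := by
  have h : e.transpose * ℓ = 1 := mul_eq_one_comm.1 D.mul_eq
  have := congrFun (congrFun h m) n
  rwa [Matrix.mul_apply, Matrix.one_apply] at this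

end DualFrame

/-- The coordinates of `z` in a dual frame. -/
def coord (ℓ : Matrix (Fin 3) (Fin 3) k) (z : Fin 3 → K) (i : Fin 3) : K :=
  ∑ m, algebraMap k K (ℓ i m) * z m

theorem sum_coord {e ℓ : Matrix (Fin 3) (Fin 3) k} (D : DualFrame e ℓ) (z : Fin 3 → K) (m : Fin 3) :
    ∑ i, algebraMap k K (e i m) * coord ℓ z i = z m := by
  simp only [coord, Finset.mul_sum]
  rw [Finset.sum_comm]
  have : ∀ n, ∑ i, algebraMap k K (e i m) * (algebraMap k K (ℓ i n) * z n) =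
      algebraMap k K (if m = n then 1 else 0) * z n := fun n => by
    rw [← D.resolution m n, map_sum, Finset.sum_mul]
    exact Finset.sum_congr rfl fun i _ => by rw [map_mul, mul_assoc]
  simp [this]

/-- The equation of the curve in the affine coordinates of a dual frame. -/
def affineEq (e : Matrix (Fin 3) (Fin 3) k) : MvPolynomial (Fin 3) k →ₐ[k] MvPolynomial (Fin 2) k :=
  aeval fun m => C (e 0 m) + (C (e 1 m) * X 0 + C (e 2 m) * X 1)

/-- Homogenisation with respect to the form ℓ 0, which becomes 1 in the affine chart. -/
theorem exists_affineEq_eq {e ℓ : Matrix (Fin 3) (Fin 3) k} (D : DualFrame e ℓ)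
    (h : MvPolynomial (Fin 2) k) :
    ∃ n, ∃ H : MvPolynomial (Fin 3) k, H.IsHomogeneous n ∧ affineEq e H = h := by
  have hlin : ∀ i, affineEq e (linForm (ℓ i)) = C (if i = 0 then 1 else 0) +
      (C (if i = 1 then 1 else 0) * X 0 + C (if i = 2 then 1 else 0) * X 1) := fun i => by
    rw [← D.pairing i 0, ← D.pairing i 1, ← D.pairing i 2]
    simp only [linForm, affineEq, map_sum, map_mul, aeval_X, algHom_C, algebraMap_eq, mul_add,
      Finset.sum_add_distrib, Finset.sum_mul, mul_assoc]
  have hhom : ∀ i, (linForm (ℓ i)).IsHomogeneous 1 := fun i =>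
    IsHomogeneous.sum _ _ _ fun j _ => by
      simpa using (isHomogeneous_C (Fin 3) (ℓ i j)).mul (isHomogeneous_X k j)
  have h0 : affineEq e (linForm (ℓ 0)) = 1 := by rw [hlin]; simp
  have h1 : affineEq e (linForm (ℓ 1)) = X 0 := by rw [hlin]; simp
  have h2 : affineEq e (linForm (ℓ 2)) = X 1 := by rw [hlin]; simp
  induction h using MvPolynomial.induction_on with
  | C c => exact ⟨0, C c, isHomogeneous_C _ _, by simp [affineEq]⟩
  | add p q hp hq =>
    obtain ⟨n, H, hH, rfl⟩ := hp
    obtain ⟨m, H', hH', rfl⟩ := hq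
    refine ⟨n + m, H * linForm (ℓ 0) ^ m + linForm (ℓ 0) ^ n * H', ?_, ?_⟩
    · exact (hH.mul (by simpa using (hhom 0).pow m)).add ((by simpa using (hhom 0).pow n :
        IsHomogeneous _ n).mul hH')
    · simp [h0]
  | mul_X p i hp =>
    obtain ⟨n, H, hH, rfl⟩ := hp
    fin_cases i
    · exact ⟨n + 1, H * linForm (ℓ 1), hH.mul (hhom 1), by rw [map_mul, h1]; rfl⟩
    · exact ⟨n + 1, H * linForm (ℓ 2), hH.mul (hhom 2), by rw [map_mul, h2]; rfl⟩

section Local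

variable {f : MvPolynomial (Fin 3) k} {z : Fin 3 → K} (hz : PlaneModel f z)
  {e ℓ : Matrix (Fin 3) (Fin 3) k} (D : DualFrame e ℓ) (hv : eval (e 0) f = 0)

include hz D hv

/-- Otherwise f would divide the form ℓ 0, which takes the value 1 at the point e 0 of the curve. -/
theorem coord_ne_zero : coord ℓ z 0 ≠ 0 := by
  intro h
  have hl : aeval z (linForm (ℓ 0)) = 0 := by rw [← h]; simp [linForm, coord]
  obtain ⟨q, hq⟩ := hz.dvd 1 (linForm (ℓ 0)) (IsHomogeneous.sum _ _ _ fun j _ => by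
      simpa using (isHomogeneous_C (Fin 3) (ℓ 0 j)).mul (isHomogeneous_X k j)) hl
  have h1 := congrArg (eval (e 0)) hq
  rw [eval_linForm, D.pairing, map_mul, hv] at h1
  simp at h1

theorem eq_coord_mul (m : Fin 3) : z m = coord ℓ z 0 * (algebraMap k K (e 0 m) +
    (algebraMap k K (e 1 m) * (coord ℓ z 1 / coord ℓ z 0) +
      algebraMap k K (e 2 m) * (coord ℓ z 2 / coord ℓ z 0))) := by
  have h0 := coord_ne_zero hz D hv
  conv_lhs => rw [← sum_coord D z m, Fin.sum_univ_three]
  field_simp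
  ring

theorem aeval_affineEq {n : ℕ} {H : MvPolynomial (Fin 3) k} (hH : H.IsHomogeneous n) :
    aeval z H = coord ℓ z 0 ^ n *
      aeval ![coord ℓ z 1 / coord ℓ z 0, coord ℓ z 2 / coord ℓ z 0] (affineEq e H) := by
  have h1 : (aeval ![coord ℓ z 1 / coord ℓ z 0, coord ℓ z 2 / coord ℓ z 0]).comp (affineEq e) =
      aeval fun m => (algebraMap k K (e 0 m) +
        (algebraMap k K (e 1 m) * (coord ℓ z 1 / coord ℓ z 0) +
        algebraMap k K (e 2 m) * (coord ℓ z 2 / coord ℓ z 0))) := by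
    ext i; simp [affineEq]
  rw [← AlgHom.comp_apply, h1, ← aeval_mul_of_isHomogeneous hH]
  congr 2
  exact funext (eq_coord_mul hz D hv)

theorem affineEq_dvd {h : MvPolynomial (Fin 2) k}
    (hh : aeval ![coord ℓ z 1 / coord ℓ z 0, coord ℓ z 2 / coord ℓ z 0] h = 0) :
    affineEq e f ∣ h := by
  obtain ⟨n, H, hH, rfl⟩ := exists_affineEq_eq D h
  exact map_dvd _ (hz.dvd n H hH (by rw [aeval_affineEq hz D hv hH, hh, mul_zero]))

theorem aeval_affineEq_eq_zero :
    aeval ![coord ℓ z 1 / coord ℓ z 0, coord ℓ z 2 / coord ℓ z 0] (affineEq e f) = 0 := by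
  obtain ⟨n, hn⟩ := hz.homogeneous
  have := aeval_affineEq hz D hv hn
  rw [hz.aeval_eq] at this
  exact (mul_eq_zero.1 this.symm).resolve_left (pow_ne_zero _ (coord_ne_zero hz D hv))

theorem adjoin_coord : IntermediateField.adjoin k
    (Set.range ![coord ℓ z 1 / coord ℓ z 0, coord ℓ z 2 / coord ℓ z 0]) = ⊤ := by
  rw [eq_top_iff, ← hz.gen, IntermediateField.adjoin_le_iff]
  rintro _ ⟨⟨i, j⟩, rfl⟩
  set L := IntermediateField.adjoin k
    (Set.range ![coord ℓ z 1 / coord ℓ z 0, coord ℓ z 2 / coord ℓ z 0]) with hL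
  have h1 : coord ℓ z 1 / coord ℓ z 0 ∈ L := IntermediateField.subset_adjoin k _ ⟨0, rfl⟩
  have h2 : coord ℓ z 2 / coord ℓ z 0 ∈ L := IntermediateField.subset_adjoin k _ ⟨1, rfl⟩
  dsimp only
  rw [eq_coord_mul hz D hv i, eq_coord_mul hz D hv j, mul_div_mul_left _ _ (coord_ne_zero hz D hv)]
  have hmem : ∀ m, algebraMap k K (e 0 m) +
    (algebraMap k K (e 1 m) * (coord ℓ z 1 / coord ℓ z 0) +
      algebraMap k K (e 2 m) * (coord ℓ z 2 / coord ℓ z 0)) ∈ L := fun m =>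
    add_mem (L.algebraMap_mem _) (add_mem (mul_mem (L.algebraMap_mem _) h1)
      (mul_mem (L.algebraMap_mem _) h2))
  exact div_mem (hmem i) (hmem j)

theorem fibre_eq : fibre k z (e 0) = {O | IsModelPoint k O ∧
    coord ℓ z 1 / coord ℓ z 0 ∈ O.nonunits ∧ coord ℓ z 2 / coord ℓ z 0 ∈ O.nonunits} := by
  have h0 := coord_ne_zero hz D hv
  ext O
  refine and_congr_right fun hO => ⟨?_, ?_⟩
  · rintro ⟨c, hc⟩
    have key : ∀ i, c * coord ℓ z i - algebraMap k K (if i = 0 then 1 else 0) ∈ O.nonunits := fun i => by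
      have : c * coord ℓ z i - algebraMap k K (if i = 0 then 1 else 0) =
          ∑ m, algebraMap k K (ℓ i m) * (c * z m - algebraMap k K (e 0 m)) := by
        rw [← D.pairing i 0, coord, Finset.mul_sum, map_sum, ← Finset.sum_sub_distrib]
        exact Finset.sum_congr rfl fun m _ => by rw [map_mul]; ring
      rw [this]
      exact sum_mem fun m _ => algebraMap_mul_mem_nonunits hO.2.1 _ (hc m)
    have hone := valuation_eq_one hO.2.1 one_ne_zero (by simpa using key 0)
    have hc0 : c ≠ 0 := by rintro rfl; simp at hone
    have : ∀ i, i ≠ 0 → coord ℓ z i / coord ℓ z 0 ∈ O.nonunits := fun i hi => by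
      have h1 := key i
      rw [if_neg hi, map_zero, sub_zero, O.mem_nonunits_iff] at h1
      rw [← mul_div_mul_left _ _ hc0, O.mem_nonunits_iff, map_div₀, hone, div_one]
      exact h1
    exact ⟨this 1 (by decide), this 2 (by decide)⟩
  · rintro ⟨h1, h2⟩
    refine ⟨(coord ℓ z 0)⁻¹, fun i => ?_⟩
    rw [eq_coord_mul hz D hv i, inv_mul_cancel_left₀ h0, add_sub_cancel_left]
    exact add_mem (algebraMap_mul_mem_nonunits hO.2.1 _ h1) (algebraMap_mul_mem_nonunits hO.2.1 _ h2)

end Local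

/-- If O lay over v, then f(cz) = 0 would reduce to f(v) ≠ 0 in the residue field. -/
theorem fibre_eq_empty {f : MvPolynomial (Fin 3) k} {z : Fin 3 → K} (hz : PlaneModel f z)
    {v : Fin 3 → k} (hv : eval v f ≠ 0) : fibre k z v = ∅ := by
  refine Set.eq_empty_of_forall_notMem fun O => ?_
  rintro ⟨hO, c, hc⟩
  have hmem : ∀ i, c * z i ∈ O := fun i => by
    simpa using add_mem (O.nonunits_subset (hc i)) (hO.2.1 (v i))
  have key : ∀ h : MvPolynomial (Fin 3) k, aeval (fun i => c * z i) h ∈ O ∧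
      aeval (fun i => c * z i) h - algebraMap k K (eval v h) ∈ O.nonunits := fun h => by
    induction h using MvPolynomial.induction_on with
    | C a => exact ⟨by simpa using hO.2.1 a, by simp [O.nonunits.zero_mem]⟩
    | add p q hp hq =>
      simp only [map_add, add_sub_add_comm]
      exact ⟨add_mem hp.1 hq.1, add_mem hp.2 hq.2⟩
    | mul_X p i hp =>
      simp only [map_mul, aeval_X, eval_X]
      refine ⟨mul_mem hp.1 (hmem i), ?_⟩
      have h1 : aeval (fun i => c * z i) p * (c * z i) - algebraMap k K (eval v p) * algebraMap k K (v i) =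
          (c * z i - algebraMap k K (v i)) * aeval (fun i => c * z i) p +
          algebraMap k K (v i) * (aeval (fun i => c * z i) p - algebraMap k K (eval v p)) := by ring
      rw [h1]
      refine add_mem ?_ (algebraMap_mul_mem_nonunits hO.2.1 _ hp.2)
      rw [O.mem_nonunits_iff, map_mul]
      exact mul_lt_one_of_lt_of_le (O.mem_nonunits_iff.1 (hc i)) ((O.valuation_le_one_iff _).2 hp.1)
  obtain ⟨n, hn⟩ := hz.homogeneous
  have h1 := valuation_eq_one hO.2.1 hv (key f).2
  rw [aeval_mul_of_isHomogeneous hn, hz.aeval_eq, mul_zero, map_zero] at h1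
  exact zero_ne_one h1

section Components

theorem homogeneousComponent_aeval {σ τ : Type*} (φ : σ → MvPolynomial τ k)
    (hφ : ∀ i, (φ i).IsHomogeneous 1) (h : MvPolynomial σ k) (n : ℕ) :
    homogeneousComponent n (aeval φ h) = aeval φ (homogeneousComponent n h) := by
  have key : (scaling τ k).comp (aeval φ) =
      (Polynomial.mapAlgHom (aeval φ)).comp (scaling σ k) := by
    ext1 i
    have h1 := isHomogeneous_iff_scaling.1 (hφ i)
    simp only [AlgHom.comp_apply, aeval_X, h1, Polynomial.coe_mapAlgHom]
    simp [scaling]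
  have := congrArg (fun x => Polynomial.coeff x n) (DFunLike.congr_fun key h)
  simpa [coeff_scaling] using this

/-- The linear part of the substitution `affineEq`. -/
def tangentMap (e : Matrix (Fin 3) (Fin 3) k) : MvPolynomial (Fin 3) k →ₐ[k] MvPolynomial (Fin 2) k :=
  aeval fun m => C (e 1 m) * X 0 + C (e 2 m) * X 1

theorem homogeneousComponent_affineEq (e : Matrix (Fin 3) (Fin 3) k) (f : MvPolynomial (Fin 3) k)
    (n : ℕ) : homogeneousComponent n (affineEq e f) =
      tangentMap e (homogeneousComponent n (expandAt f (e 0))) := by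
  have h1 : affineEq e = (tangentMap e).comp (aeval fun i => C (e 0 i) + X i) := by
    ext i; simp [affineEq, tangentMap]
  rw [h1, AlgHom.comp_apply, tangentMap, homogeneousComponent_aeval]
  · rfl
  · intro i
    refine IsHomogeneous.add ?_ ?_
    · simpa using (isHomogeneous_C (Fin 2) (e 1 i)).mul (isHomogeneous_X k 0)
    · simpa using (isHomogeneous_C (Fin 2) (e 2 i)).mul (isHomogeneous_X k 1)

theorem tangentMap_linForm (e : Matrix (Fin 3) (Fin 3) k) (a : Fin 3 → k) :
    tangentMap e (linForm a) = C (∑ m, a m * e 1 m) * X 0 + C (∑ m, a m * e 2 m) * X 1 := by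
  simp only [linForm, tangentMap, map_sum, map_mul, aeval_X, algHom_C, algebraMap_eq, mul_add,
      Finset.sum_add_distrib, Finset.sum_mul, mul_assoc]

theorem homogeneousComponent_one_decomp (w u : MvPolynomial (Fin 2) k) :
    homogeneousComponent 1 (X 0 * w + X 1 * u) =
      C (constantCoeff w) * X 0 + C (constantCoeff u) * X 1 := by
  simp only [map_add, homogeneousComponent_one_mul, homogeneousComponent_of_mem (isHomogeneous_X k _),
    homogeneousComponent_zero_eq]
  simp [mul_comm]

theorem homogeneousComponent_two_decomp (A M B : MvPolynomial (Fin 2) k) :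
    homogeneousComponent 2 (X 0 ^ 2 * A + X 0 * X 1 * M + X 1 ^ 2 * B) =
      C (constantCoeff A) * X 0 ^ 2 + C (constantCoeff M) * (X 0 * X 1) +
        C (constantCoeff B) * X 1 ^ 2 := by
  have h1 : ∀ (i j : Fin 2) (h : MvPolynomial (Fin 2) k), homogeneousComponent 2 (X i * X j * h) =
      C (constantCoeff h) * (X i * X j) := fun i j h => by
    have : (X i * X j : MvPolynomial (Fin 2) k).IsHomogeneous 2 :=
      (isHomogeneous_X k i).mul (isHomogeneous_X k j)
    rw [homogeneousComponent_two_mul, homogeneousComponent_of_mem this,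
      homogeneousComponent_of_mem this, homogeneousComponent_of_mem this, homogeneousComponent_zero_eq]
    simp [mul_comm]
  rw [map_add, map_add, sq, sq, h1, h1, h1]

end Components

theorem ncard_fibre_of_smooth {f : MvPolynomial (Fin 3) k} {z : Fin 3 → K} (hz : PlaneModel f z)
    {e ℓ : Matrix (Fin 3) (Fin 3) k} (D : DualFrame e ℓ) (hv : eval (e 0) f = 0) {a : Fin 3 → k}
    (h : homogeneousComponent 1 (expandAt f (e 0)) = linForm a) (ha : ∑ m, a m * e 2 m ≠ 0) :
    (fibre k z (e 0)).ncard = 1 := by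
  obtain ⟨w, u, hwu⟩ := exists_eq_C_add_X_mul (affineEq e f)
  have h0 := homogeneousComponent_affineEq e f 0
  rw [homogeneousComponent_zero_expandAt, homogeneousComponent_zero_eq, hv, C_0, map_zero] at h0
  rw [h0, zero_add] at hwu
  have h1 := homogeneousComponent_affineEq e f 1
  rw [h, tangentMap_linForm, hwu, homogeneousComponent_one_decomp] at h1
  have hu : constantCoeff u ≠ 0 := by
    have h2 := congrArg (eval ![0, 1]) h1
    simp at h2
    rwa [h2]
  rw [fibre_eq hz D hv, Set.ncard_eq_one]
  obtain ⟨O, hO, huniq⟩ := existsUnique_modelPoint_of_smooth (adjoin_coord hz D hv)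
    (fun _ => affineEq_dvd hz D hv) (aeval_affineEq_eq_zero hz D hv) hwu hu
  exact ⟨O, Set.ext fun O' => ⟨huniq O', fun h => h ▸ hO⟩⟩

/-- In the frame dual to the tangent lines, the quadratic part of the affine equation is X 0 · X 1.
-/
theorem ncard_fibre_of_node {f : MvPolynomial (Fin 3) k} {z : Fin 3 → K} (hz : PlaneModel f z)
    {e ℓ : Matrix (Fin 3) (Fin 3) k} (D : DualFrame e ℓ) (hs : IsSingularPoint f (e 0))
    (h : homogeneousComponent 2 (expandAt f (e 0)) = linForm (ℓ 1) * linForm (ℓ 2)) :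
    (fibre k z (e 0)).ncard = 2 := by
  obtain ⟨w, u, hwu⟩ := exists_eq_C_add_X_mul (affineEq e f)
  obtain ⟨a, b, hab⟩ := exists_eq_C_add_X_mul w
  obtain ⟨c, d, hcd⟩ := exists_eq_C_add_X_mul u
  have h0 := homogeneousComponent_affineEq e f 0
  rw [(isSingularPoint_iff.1 hs).1, homogeneousComponent_zero_eq, map_zero] at h0
  rw [h0, zero_add] at hwu
  have h1 := homogeneousComponent_affineEq e f 1
  rw [(isSingularPoint_iff.1 hs).2, hwu, homogeneousComponent_one_decomp, map_zero] at h1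
  have hw : constantCoeff w = 0 := by simpa using congrArg (eval ![1, 0]) h1
  have hu : constantCoeff u = 0 := by simpa using congrArg (eval ![0, 1]) h1
  rw [hw, C_0, zero_add] at hab
  rw [hu, C_0, zero_add] at hcd
  have hg : affineEq e f = X 0 ^ 2 * a + X 0 * X 1 * (b + c) + X 1 ^ 2 * d := by
    rw [hwu, hab, hcd]; ring
  have h2 := homogeneousComponent_affineEq e f 2
  rw [h, map_mul, tangentMap_linForm, tangentMap_linForm, D.pairing, D.pairing, D.pairing, D.pairing,
    hg, homogeneousComponent_two_decomp] at h2
  simp at h2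
  have ha : constantCoeff a = 0 := by simpa using congrArg (eval ![1, 0]) h2
  have hd : constantCoeff d = 0 := by simpa using congrArg (eval ![0, 1]) h2
  have hbc : constantCoeff b + constantCoeff c = 1 := by
    simpa [ha, hd] using congrArg (eval ![1, 1]) h2
  rw [fibre_eq hz D hs.1]
  exact ncard_modelPoint_of_node (adjoin_coord hz D hs.1)
    (fun _ => affineEq_dvd hz D hs.1) (aeval_affineEq_eq_zero hz D hs.1) hg ha
    (by rw [map_add, hbc]; exact one_ne_zero) hd

theorem exists_dualFrame_of_det {e : Matrix (Fin 3) (Fin 3) k} (h : e.det ≠ 0) :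
    ∃ ℓ, DualFrame e ℓ :=
  ⟨e.transpose⁻¹, ⟨Matrix.nonsing_inv_mul _ (by rw [Matrix.det_transpose]; exact h.isUnit)⟩⟩

theorem exists_dualFrame_of_smooth {v a : Fin 3 → k} (hv : v ≠ 0) (ha : a ≠ 0)
    (hav : ∑ i, a i * v i = 0) :
    ∃ e ℓ : Matrix (Fin 3) (Fin 3) k, DualFrame e ℓ ∧ e 0 = v ∧ ∑ m, a m * e 2 m ≠ 0 := by
  obtain ⟨i, hi⟩ := Function.ne_iff.1 ha
  have hj : ∃ j, j ≠ i ∧ v j ≠ 0 := by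
    by_contra hcon
    push Not at hcon
    refine hv (funext fun j => ?_)
    by_cases hji : j = i
    · subst hji
      rw [Finset.sum_eq_single j (fun m _ hm => by rw [hcon m hm, mul_zero]) (by simp)] at hav
      exact (mul_eq_zero.1 hav).resolve_left hi
    · exact hcon j hji
  obtain ⟨j, hji, hvj⟩ := hj
  obtain ⟨m, hm⟩ : ∃ m : Fin 3, m ≠ i ∧ m ≠ j :=
    (by decide : ∀ i j : Fin 3, ∃ m, m ≠ i ∧ m ≠ j) i j
  have hdet : (Matrix.of ![v, Pi.single m 1, Pi.single i 1]).det ≠ 0 := by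
    rw [Matrix.det_fin_three]
    fin_cases i <;> fin_cases j <;> fin_cases m <;> simp_all
  obtain ⟨ℓ, hℓ⟩ := exists_dualFrame_of_det hdet
  refine ⟨_, ℓ, hℓ, rfl, ?_⟩
  simpa [Pi.single_apply] using hi

theorem exists_dualFrame_of_node {v a b : Fin 3 → k} (hv : v ≠ 0) (hab : LinearIndependent k ![a, b])
    (hav : ∑ i, a i * v i = 0) (hbv : ∑ i, b i * v i = 0) :
    ∃ e ℓ : Matrix (Fin 3) (Fin 3) k, DualFrame e ℓ ∧ e 0 = v ∧ ℓ 1 = a ∧ ℓ 2 = b := by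
  obtain ⟨i, hi⟩ := Function.ne_iff.1 hv
  set c : Fin 3 → k := Pi.single i (v i)⁻¹ with hc
  have hcv : ∑ m, c m * v m = 1 := by
    rw [hc, Finset.sum_eq_single i (fun m _ hm => by simp [hm]) (by simp)]
    simp [inv_mul_cancel₀ hi]
  set ℓ : Matrix (Fin 3) (Fin 3) k := Matrix.of ![c, a, b] with hℓ
  have hind : LinearIndependent k ℓ.row := by
    change LinearIndependent k ![c, a, b]
    rw [Fintype.linearIndependent_iff]
    intro g hg
    have h0 : g 0 = 0 := by
      have h1 : ∑ m, (∑ j, g j • ![c, a, b] j) m * v m = 0 := by rw [hg]; simp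
      simp only [Fin.sum_univ_three, Pi.add_apply, Pi.smul_apply, smul_eq_mul, Matrix.cons_val] at h1 hcv hav hbv
      linear_combination h1 - g 0 * hcv - g 1 * hav - g 2 * hbv
    have h12 := LinearIndependent.pair_iff.1 hab (g 1) (g 2) (by
      simpa [Fin.sum_univ_three, h0] using hg)
    intro j; fin_cases j
    exacts [h0, h12.1, h12.2]
  have hunit := Matrix.linearIndependent_rows_iff_isUnit.1 hind
  have hdet : IsUnit ℓ.det := (Matrix.isUnit_iff_isUnit_det _).1 hunit
  have hmul : ℓ.mulVec v = Pi.single 0 1 := by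
    ext j; fin_cases j
    · simpa [Matrix.mulVec, dotProduct, hℓ] using hcv
    · simpa [Matrix.mulVec, dotProduct, hℓ] using hav
    · simpa [Matrix.mulVec, dotProduct, hℓ] using hbv
  refine ⟨(ℓ⁻¹).transpose, ℓ, ⟨by rw [Matrix.transpose_transpose, Matrix.mul_nonsing_inv _ hdet]⟩, ?_,
    rfl, rfl⟩
  have h1 : (ℓ⁻¹).mulVec (Pi.single 0 1) = v := by
    rw [← hmul, Matrix.mulVec_mulVec, Matrix.nonsing_inv_mul _ hdet, Matrix.one_mulVec]
  rw [← h1]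
  ext j
  simp [Matrix.transpose_apply]

/-- The number of points of the non-singular model over a point is its number of branches. -/
theorem ncard_fibre {f : MvPolynomial (Fin 3) k} {z : Fin 3 → K} (hz : PlaneModel f z)
    {v : Fin 3 → k} (hv : v ≠ 0) {n : ℕ} (h : HasBranches f v n) :
    (fibre k z v).ncard = n ∧ (fibre k z v).Finite := by
  obtain ⟨m, hf⟩ := hz.homogeneous
  match n, h with
  | 0, h =>
    rw [HasBranches, homogeneousComponent_zero_expandAt, Ne, C_eq_zero] at h
    simp [fibre_eq_empty hz h]
  | 1, ⟨h0, h1⟩ =>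
    rw [homogeneousComponent_zero_expandAt, C_eq_zero] at h0
    rw [homogeneousComponent_one_expandAt, Ne, linForm_eq_zero] at h1
    have hav := sum_mul_eval_pderiv hf v
    rw [h0, mul_zero] at hav
    obtain ⟨e, ℓ, D, rfl, he⟩ := exists_dualFrame_of_smooth hv h1 (by
      rw [← hav]; exact Finset.sum_congr rfl fun i _ => mul_comm _ _)
    have := ncard_fibre_of_smooth hz D h0 (homogeneousComponent_one_expandAt _ _) he
    exact ⟨this, Set.finite_of_ncard_ne_zero (by omega)⟩
  | 2, ⟨h0, h1, a, b, hab, h2⟩ =>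
    have hs := isSingularPoint_iff.2 ⟨h0, h1⟩
    obtain ⟨hav, hbv⟩ := tangent_apply_eq_zero hf hs hab h2
    obtain ⟨e, ℓ, D, rfl, rfl, rfl⟩ := exists_dualFrame_of_node hv hab hav hbv
    have := ncard_fibre_of_node hz D hs h2
    exact ⟨this, Set.finite_of_ncard_ne_zero (by omega)⟩

end Fibre

/-! ### Counting the points of the model by their centres -/

section Count

variable {k K : Type*} [Field k] [Field K] [Algebra k K]

/-- Divide z by a coordinate of largest valuation and reduce; the residues are not all zero. -/
theorem exists_mem_fibre {z : Fin 3 → K} (hz : z ≠ 0) {O : ValuationSubring K} (hO : IsModelPoint k O) :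
    ∃ v : Fin 3 → k, v ≠ 0 ∧ O ∈ fibre k z v := by
  obtain ⟨i, hi⟩ := Finite.exists_max fun i => O.valuation (z i)
  have hzi : z i ≠ 0 := by
    intro h
    refine hz (funext fun j => ?_)
    have := hi j
    rw [h, map_zero] at this
    simpa using this
  have hmem : ∀ j, (z i)⁻¹ * z j ∈ O := fun j => by
    rw [← O.valuation_le_one_iff, map_mul, map_inv₀]
    exact inv_mul_le_one_of_le₀ (hi j) zero_le
  choose v hv using fun j => hO.2.2 _ (hmem j)
  refine ⟨v, fun h => ?_, hO, (z i)⁻¹, hv⟩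
  have := hv i
  rw [h, inv_mul_cancel₀ hzi] at this
  simp [ValuationSubring.mem_nonunits_iff] at this

theorem smul_mem_fibre {z : Fin 3 → K} {O : ValuationSubring K} {v : Fin 3 → k} (a : k)
    (h : O ∈ fibre k z v) : O ∈ fibre k z (a • v) := by
  obtain ⟨hO, c, hc⟩ := h
  refine ⟨hO, algebraMap k K a * c, fun i => ?_⟩
  have := algebraMap_mul_mem_nonunits hO.2.1 a (hc i)
  rw [Pi.smul_apply, smul_eq_mul, map_mul]
  convert this using 1
  ring

/-- The ratio of the two scaling factors is integral, and its residue is the factor of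
proportionality. -/
theorem exists_smul_eq_of_mem_fibre {z : Fin 3 → K} {O : ValuationSubring K} {v w : Fin 3 → k}
    (hv : v ≠ 0) (hw : w ≠ 0) (h : O ∈ fibre k z v) (h' : O ∈ fibre k z w) :
    ∃ a : k, a ≠ 0 ∧ a • v = w := by
  obtain ⟨hO, c, hc⟩ := h
  obtain ⟨-, c', hc'⟩ := h'
  obtain ⟨i, hi⟩ := Function.ne_iff.1 hv
  obtain ⟨j, hj⟩ := Function.ne_iff.1 hw
  have hci := valuation_eq_one hO.2.1 hi (hc i)
  have hcj := valuation_eq_one hO.2.1 hj (hc' j)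
  have hmem : ∀ {c : K} {v : Fin 3 → k}, (∀ i, c * z i - algebraMap k K (v i) ∈ O.nonunits) →
      ∀ m, c * z m ∈ O := fun {c v} h m => by
    simpa using add_mem (O.nonunits_subset (h m)) (hO.2.1 (v m))
  have hc0 : c ≠ 0 := by rintro rfl; simp at hci
  have hzi : z i ≠ 0 := by intro h; simp [h] at hci
  have hq : c' / c ∈ O := by
    have : c' / c = (c' * z i) / (c * z i) := by field_simp
    rw [← O.valuation_le_one_iff, this, map_div₀, hci, div_one, O.valuation_le_one_iff]
    exact hmem hc' i
  obtain ⟨a, ha⟩ := hO.2.2 _ hq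
  have hinj : ∀ x : k, algebraMap k K x ∈ O.nonunits → x = 0 := fun x hx => by
    by_contra hx0
    have := valuation_eq_one hO.2.1 hx0 (x := algebraMap k K x) (by simp [O.nonunits.zero_mem])
    rw [O.mem_nonunits_iff, this] at hx
    exact lt_irrefl _ hx
  have haw : a • v = w := funext fun m => by
    rw [Pi.smul_apply, smul_eq_mul, ← sub_eq_zero]
    refine hinj _ ?_
    have h1 : algebraMap k K (a * v m - w m) = (c' * z m - algebraMap k K (w m)) -
        (c' / c - algebraMap k K a) * (c * z m) -
        algebraMap k K a * (c * z m - algebraMap k K (v m)) := by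
      rw [map_sub, map_mul]; field_simp; ring
    rw [h1]
    refine sub_mem (sub_mem (hc' m) ?_) (algebraMap_mul_mem_nonunits hO.2.1 _ (hc m))
    rw [O.mem_nonunits_iff, map_mul]
    exact mul_lt_one_of_lt_of_le (O.mem_nonunits_iff.1 ha) ((O.valuation_le_one_iff _).2 (hmem hc m))
  exact ⟨a, by rintro rfl; exact hw (by rw [← haw, zero_smul]), haw⟩

/-- Every rational point of the model is centred at exactly one point of the plane, and the number
of those over P is its number of branches. -/
theorem card_modelPoint [Finite k] {f : MvPolynomial (Fin 3) k} {z : Fin 3 → K} (hz : PlaneModel f z)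
    [Fintype (Projectivization k (Fin 3 → k))] {n : Projectivization k (Fin 3 → k) → ℕ}
    (hn : ∀ P, HasBranches f P.rep (n P)) : Nat.card (ModelPoint k K) = ∑ P, n P := by
  have key : ∀ O : ModelPoint k K, ∃ P : Projectivization k (Fin 3 → k), O.1 ∈ fibre k z P.rep :=
    fun O => by
    obtain ⟨v, hv, h⟩ := exists_mem_fibre (k := k) hz.ne_zero O.2
    refine ⟨Projectivization.mk k v hv, ?_⟩
    obtain ⟨a, ha⟩ := Projectivization.exists_smul_eq_mk_rep k v hv
    rw [← ha]
    exact smul_mem_fibre (a : k) h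
  choose π hπ using key
  have huniq : ∀ (O : ModelPoint k K) P, O.1 ∈ fibre k z P.rep → π O = P := fun O P h => by
    obtain ⟨a, ha, h1⟩ := exists_smul_eq_of_mem_fibre P.rep_nonzero (π O).rep_nonzero h (hπ O)
    rw [← Projectivization.mk_rep (π O), ← Projectivization.mk_rep P, Projectivization.mk_eq_mk_iff']
    exact ⟨a, h1⟩
  let e : ModelPoint k K ≃ Σ P : Projectivization k (Fin 3 → k), fibre k z P.rep :=
    { toFun := fun O => ⟨π O, O.1, hπ O⟩
      invFun := fun x => ⟨x.2.1, x.2.2.1⟩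
      left_inv := fun O => rfl
      right_inv := fun ⟨P, O, hO⟩ => by
        have h := huniq ⟨O, hO.1⟩ P hO
        refine Sigma.ext h ?_
        dsimp only
        congr! 1
        rw [h] }
  have hfin : ∀ P : Projectivization k (Fin 3 → k), Finite (fibre k z P.rep) := fun P =>
    (ncard_fibre hz P.rep_nonzero (hn P)).2
  rw [Nat.card_congr e, Nat.card_sigma]
  exact Finset.sum_congr rfl fun P _ => (ncard_fibre hz P.rep_nonzero (hn P)).1

end Count

/-! ### Generic coordinates in the function field -/

section FunctionField

variable {k : Type*} [Field k] (f : MvPolynomial (Fin 3) k) [hprime : (Ideal.span {f}).IsPrime]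

/-- The coordinates ξ themselves need not lie in the function field, but their ratios to a fixed
non-zero one do, and this rescaling does not affect the vanishing of forms. -/
theorem exists_planeModel {n : ℕ} (hf : f.IsHomogeneous n) :
    ∃ z : Fin 3 → functionField f, PlaneModel f z := by
  let R := MvPolynomial (Fin 3) k ⧸ Ideal.span {f}
  let ξ : Fin 3 → FractionRing R := fun i =>
    algebraMap R (FractionRing R) (Ideal.Quotient.mk (Ideal.span {f}) (X i))
  have hξ : ∀ h : MvPolynomial (Fin 3) k, aeval ξ h = algebraMap R (FractionRing R)
      (Ideal.Quotient.mk (Ideal.span {f}) h) := fun h => by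
    have : (aeval ξ : MvPolynomial (Fin 3) k →ₐ[k] FractionRing R) =
        ((IsScalarTower.toAlgHom k R (FractionRing R)).comp (Ideal.Quotient.mkₐ k (Ideal.span {f}))) := by
      ext i; simp [ξ]; rfl
    rw [this]; rfl
  have hzero : ∀ h : MvPolynomial (Fin 3) k, aeval ξ h = 0 ↔ f ∣ h := fun h => by
    rw [hξ, map_eq_zero_iff _ (IsFractionRing.injective R (FractionRing R)),
      Ideal.Quotient.eq_zero_iff_mem, Ideal.mem_span_singleton]
  obtain ⟨j, hj⟩ : ∃ j, ξ j ≠ 0 := by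
    by_contra hcon
    push Not at hcon
    have hdvd : ∀ j, f ∣ X j := fun j => (hzero _).1 (by rw [aeval_X, hcon j])
    have hu : ¬ IsUnit f := fun h => hprime.ne_top (Ideal.span_singleton_eq_top.2 h)
    obtain ⟨q, hq⟩ := hdvd 0
    have hqu := ((X_prime (R := k) (i := (0 : Fin 3))).irreducible.isUnit_or_isUnit hq).resolve_left hu
    have h01 : (X 0 : MvPolynomial (Fin 3) k) ∣ X 1 :=
      (hq ▸ (hqu.mul_right_dvd.2 dvd_rfl) : (X 0 : MvPolynomial (Fin 3) k) ∣ f).trans (hdvd 1)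
    obtain ⟨r, hr⟩ := h01
    have := congrArg (eval ![0, 1, 0]) hr
    simp at this
  have hmem : ∀ i l, ξ i / ξ l ∈ functionField f := fun i l =>
    IntermediateField.subset_adjoin _ _ ⟨(i, l), rfl⟩
  let z : Fin 3 → functionField f := fun i => ⟨ξ i / ξ j, hmem i j⟩
  have hval : ∀ {m : ℕ} {h : MvPolynomial (Fin 3) k}, h.IsHomogeneous m → (aeval z h = 0 ↔ f ∣ h) :=
    fun {m h} hm => by
    rw [← hzero, ← map_eq_zero (functionField f).val]
    have h1 : (functionField f).val (aeval z h) = aeval (fun i => (ξ j)⁻¹ * ξ i) h := by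
      have : (functionField f).val.comp (aeval z) = aeval (fun i => (ξ j)⁻¹ * ξ i) := by
        ext i
        simp [z, div_eq_inv_mul]
      exact DFunLike.congr_fun this h
    rw [h1, aeval_mul_of_isHomogeneous hm, mul_eq_zero, or_iff_right (pow_ne_zero _ (inv_ne_zero hj))]
  refine ⟨z, ⟨n, hf⟩, ?_, ?_, (hval hf).2 dvd_rfl, fun m h hm => (hval hm).1⟩
  · refine IntermediateField.map_injective (functionField f).val ?_
    rw [IntermediateField.adjoin_map, ← AlgHom.fieldRange_eq_map, IntermediateField.fieldRange_val]
    refine congrArg (IntermediateField.adjoin k) ?_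
    rw [← Set.range_comp]
    congr 1
    ext il
    change (ξ il.1 / ξ j) / (ξ il.2 / ξ j) = ξ il.1 / ξ il.2
    rw [div_div_div_cancel_right₀ hj]
  · intro h
    have := congrArg Subtype.val (congrFun h j)
    simp [z, div_self hj] at this

end FunctionField

theorem modelPointCount_eq {k : Type*} [Field k] [Finite k] {f : MvPolynomial (Fin 3) k} {m : ℕ}
    (hf : f.IsHomogeneous m) (hp : Prime f) [Fintype (Projectivization k (Fin 3 → k))]
    {n : Projectivization k (Fin 3 → k) → ℕ} (hn : ∀ P, HasBranches f P.rep (n P)) :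
    modelPointCount f = ∑ P, n P := by
  have hprime : (Ideal.span {f}).IsPrime := (Ideal.span_singleton_prime hp.ne_zero).2 hp
  obtain ⟨z, hz⟩ := exists_planeModel f hf
  rw [modelPointCount, dif_pos hprime, card_modelPoint hz hn]

/-- The sum of the numbers of points of the non-singular models of the components of a curve all
of whose singular points are ordinary double points with rational tangents. -/
theorem sum_modelPointCount {k ι : Type*} [Field k] [Finite k] [Fintype ι]
    {f : ι → MvPolynomial (Fin 3) k} (hf : ∀ i, ∃ m, (f i).IsHomogeneous m) (hp : ∀ i, Prime (f i))
    [Fintype (Projectivization k (Fin 3 → k))] {n : Projectivization k (Fin 3 → k) → ℕ}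
    (hn : ∀ P, HasBranches (∏ i, f i) P.rep (n P)) :
    ∑ i, modelPointCount (f i) = ∑ P, n P := by
  choose m hm hsum using fun P => HasBranches.exists_of_prod Finset.univ (hn P)
  rw [Finset.sum_congr rfl fun P _ => (hsum P).symm, Finset.sum_comm]
  refine Finset.sum_congr rfl fun i _ => ?_
  obtain ⟨d, hd⟩ := hf i
  exact modelPointCount_eq hd (hp i) fun P => hm P i (Finset.mem_univ i)

/-! ### Double points under base change and rescaling -/

section BaseChange

variable {k K : Type*} [Field k] [Field K] (φ : k →+* K)

theorem map_linForm (a : Fin 3 → k) : map φ (linForm a) = linForm fun i => φ (a i) := by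
  simp [linForm]

theorem homogeneousComponent_map {σ R S : Type*} [CommRing R] [CommRing S] (φ : R →+* S)
    (f : MvPolynomial σ R) (n : ℕ) :
    homogeneousComponent n (map φ f) = map φ (homogeneousComponent n f) := by
  ext m
  simp only [coeff_homogeneousComponent, coeff_map]
  split_ifs <;> simp

theorem expandAt_map (f : MvPolynomial (Fin 3) k) (v : Fin 3 → k) :
    expandAt (map φ f) (fun i => φ (v i)) = map φ (expandAt f v) := by
  unfold expandAt
  induction f using MvPolynomial.induction_on with
  | C c => simp
  | add f g hf hg => simp only [map_add, hf, hg]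
  | mul_X f i hf => simp only [map_mul, hf, map_X, aeval_X, map_add, map_C]

theorem linearIndependent_map_pair {a b : Fin 3 → k} (h : LinearIndependent k ![a, b]) :
    LinearIndependent K ![fun i => φ (a i), fun i => φ (b i)] := by
  rw [← crossProduct_ne_zero_iff_linearIndependent] at h ⊢
  obtain ⟨i, hi⟩ := Function.ne_iff.1 h
  refine Function.ne_iff.2 ⟨i, fun h0 => hi ?_⟩
  rw [cross_apply] at h0 ⊢
  refine φ.injective ?_
  rw [Pi.zero_apply, map_zero]
  fin_cases i <;> simpa using h0

theorem IsRationalODP.map {f : MvPolynomial (Fin 3) k} {v : Fin 3 → k} (h : IsRationalODP f v) :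
    IsRationalODP (MvPolynomial.map φ f) fun i => φ (v i) := by
  obtain ⟨hv, h0, h1, a, b, hab, h2⟩ := h
  refine ⟨fun h => hv (funext fun i => ?_), ?_, ?_, fun i => φ (a i), fun i => φ (b i),
    linearIndependent_map_pair φ hab, ?_⟩
  · simpa using congrFun h i
  · rw [expandAt_map, homogeneousComponent_map, h0, map_zero]
  · rw [expandAt_map, homogeneousComponent_map, h1, map_zero]
  · rw [expandAt_map, homogeneousComponent_map, h2, map_mul, map_linForm, map_linForm]

theorem homogeneousComponent_expandAt_smul {f : MvPolynomial (Fin 3) k} {n : ℕ}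
    (hf : f.IsHomogeneous n) (u : k) (v : Fin 3 → k) (j : ℕ) :
    C (u ^ j) * homogeneousComponent j (expandAt f (u • v)) =
      C (u ^ n) * homogeneousComponent j (expandAt f v) := by
  let ψ : MvPolynomial (Fin 3) k →ₐ[k] MvPolynomial (Fin 3) k := aeval fun i => C u * X i
  have hψ : ∀ {m : ℕ} {h : MvPolynomial (Fin 3) k}, h.IsHomogeneous m → ψ h = C (u ^ m) * h :=
    fun {m h} hm => by
    rw [C_pow, ← aeval_X_left_apply h]
    simp only [ψ]
    conv_lhs => rw [aeval_X_left_apply]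
    rw [aeval_def, eval₂_eq_eval_map, eval_smul_of_isHomogeneous (hm.map _), ← eval₂_eq_eval_map]
    rfl
  have h1 : ψ (expandAt f (u • v)) = C (u ^ n) * expandAt f v := by
    have h2 : ψ (expandAt f (u • v)) = aeval (fun i => C u * (C (v i) + X i)) f := by
      have : ψ.comp (aeval fun i => C ((u • v) i) + X i) = aeval (fun i => C u * (C (v i) + X i)) := by
        ext i; simp [ψ, mul_add]
      exact DFunLike.congr_fun this f
    rw [h2, aeval_def, eval₂_eq_eval_map, eval_smul_of_isHomogeneous (hf.map _),
      ← eval₂_eq_eval_map, C_pow]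
    rfl
  have h2 := congrArg (homogeneousComponent j) h1
  rw [homogeneousComponent_aeval _ (fun i => by
    simpa using (isHomogeneous_C (Fin 3) u).mul (isHomogeneous_X k i)),
    homogeneousComponent_C_mul] at h2
  rw [← h2]
  exact (hψ (homogeneousComponent_isHomogeneous j _)).symm

theorem IsRationalODP.smul {f : MvPolynomial (Fin 3) k} {n : ℕ} (hf : f.IsHomogeneous n)
    {v : Fin 3 → k} (h : IsRationalODP f v) {u : k} (hu : u ≠ 0) : IsRationalODP f (u • v) := by
  obtain ⟨hv, h0, h1, a, b, hab, h2⟩ := h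
  have key := homogeneousComponent_expandAt_smul hf u v
  have hC : ∀ j, (C (u ^ j) : MvPolynomial (Fin 3) k) ≠ 0 := fun j => by simpa using fun h => absurd h hu
  refine ⟨smul_ne_zero hu hv, ?_, ?_, (u ^ n / u ^ 2) • a, b, linearIndependent_smul_pair hab
    (div_ne_zero (pow_ne_zero _ hu) (pow_ne_zero _ hu)), ?_⟩
  · have := key 0
    rw [h0, mul_zero] at this
    exact (mul_eq_zero.1 this).resolve_left (hC 0)
  · have := key 1
    rw [h1, mul_zero] at this
    exact (mul_eq_zero.1 this).resolve_left (hC 1)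
  · have := key 2
    refine mul_left_cancel₀ (hC 2) ?_
    rw [this, h2, ← smul_linForm, mul_assoc, ← mul_assoc (C _) (C _), ← C_mul,
      mul_div_cancel₀ _ (pow_ne_zero _ hu)]

end BaseChange

/-! ### From the algebraic closure of ℚ to almost all primes -/

section Spread

attribute [local instance] algebraMvPolynomial

variable {σ : Type*} [Finite σ]

/-- By the Nullstellensatz the system generates the unit ideal over ℚ; clearing denominators leaves
a non-zero integer in the ideal over ℤ. -/
theorem exists_C_mem_span (S : Set (MvPolynomial σ ℤ))
    (h : ∀ x : σ → AlgebraicClosure ℚ, ∃ f ∈ S, eval₂ (Int.castRingHom _) x f ≠ 0) :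
    ∃ N : ℤ, N ≠ 0 ∧ C N ∈ Ideal.span S := by
  have htop : Ideal.map (algebraMap (MvPolynomial σ ℤ) (MvPolynomial σ ℚ)) (Ideal.span S) = ⊤ := by
    rw [← Ideal.radical_eq_top, ← vanishingIdeal_zeroLocus_eq_radical (K := AlgebraicClosure ℚ),
      Ideal.map_span, zeroLocus_span]
    convert vanishingIdeal_empty
    refine Set.eq_empty_of_forall_notMem fun x hx => ?_
    obtain ⟨f, hf, hne⟩ := h x
    refine hne ?_
    have := hx _ ⟨f, hf, rfl⟩
    rw [algebraMap_def, aeval_def, eval₂_map] at this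
    convert this
    exact RingHom.ext_int _ _
  have h1 := (Ideal.eq_top_iff_one _).1 htop
  rw [IsLocalization.mem_map_algebraMap_iff ((nonZeroDivisors ℤ).map (C (σ := σ)))] at h1
  obtain ⟨⟨⟨f, hf⟩, ⟨_, N, hN, rfl⟩⟩, h2⟩ := h1
  refine ⟨N, nonZeroDivisors.ne_zero hN, ?_⟩
  rw [one_mul] at h2
  have hinj : Function.Injective (algebraMap (MvPolynomial σ ℤ) (MvPolynomial σ ℚ)) := by
    rw [algebraMap_def]
    exact map_injective _ (algebraMap ℤ ℚ).injective_int
  rw [show (C N : MvPolynomial σ ℤ) = f from hinj h2]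
  exact hf

/-- A system of integral equations without solutions over an algebraic closure of `ℚ` has no
solutions modulo all but finitely many primes. -/
theorem exists_forall_not_dvd (S : Set (MvPolynomial σ ℤ))
    (h : ∀ x : σ → AlgebraicClosure ℚ, ∃ f ∈ S, eval₂ (Int.castRingHom _) x f ≠ 0) :
    ∃ N : ℤ, N ≠ 0 ∧ ∀ (p : ℕ) [Fact p.Prime], ¬ (p : ℤ) ∣ N → ∀ x : σ → ZMod p,
      ∃ f ∈ S, eval₂ (Int.castRingHom _) x f ≠ 0 := by
  obtain ⟨N, hN, hmem⟩ := exists_C_mem_span S h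
  refine ⟨N, hN, fun p _ hp x => ?_⟩
  by_contra hcon
  push Not at hcon
  refine hp ((ZMod.intCast_zmod_eq_zero_iff_dvd N p).1 ?_)
  have hle : Ideal.span S ≤ RingHom.ker (eval₂Hom (Int.castRingHom (ZMod p)) x) :=
    Ideal.span_le.2 fun f hf => hcon f hf
  simpa using hle hmem

end Spread

/-! ### Intersection of two homogeneous surfaces -/

section CommonZero

variable {K : Type*} [Field K]

/-- The ideals generated by the first j variables form a chain of primes. -/
theorem three_le_height_ker_constantCoeff :
    3 ≤ (RingHom.ker (constantCoeff (σ := Fin 3) (R := K))).height := by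
  let q : ℕ → Ideal (MvPolynomial (Fin 3) K) := fun j =>
    RingHom.ker (aeval (fun i : Fin 3 => if i.1 < j then 0 else X i) :
      MvPolynomial (Fin 3) K →ₐ[K] MvPolynomial (Fin 3) K)
  have hprime : ∀ j, (q j).IsPrime := fun j => RingHom.ker_isPrime _
  have hle : ∀ j, q j ≤ q (j + 1) := fun j f hf => by
    have : (aeval (fun i : Fin 3 => if i.1 < j + 1 then 0 else X i) :
        MvPolynomial (Fin 3) K →ₐ[K] MvPolynomial (Fin 3) K) =
        (aeval (fun i : Fin 3 => if i.1 < j + 1 then 0 else X i)).comp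
          (aeval (fun i : Fin 3 => if i.1 < j then 0 else X i)) := by
      ext1 i
      simp only [AlgHom.comp_apply, aeval_X]
      by_cases h : i.1 < j
      · simp [h, Nat.lt_succ_of_lt h]
      · simp [h]
    simp only [q, RingHom.mem_ker] at hf ⊢
    rw [this, AlgHom.comp_apply, hf, map_zero]
  have hlt : ∀ j : Fin 3, q j < q (j + 1) := fun j => by
    refine lt_of_le_of_ne (hle j) fun h => ?_
    have h1 : (X j : MvPolynomial (Fin 3) K) ∈ q (j + 1) := by simp [q, RingHom.mem_ker]
    rw [← h] at h1
    simp [q, RingHom.mem_ker] at h1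
  have h3 : q 3 ≤ RingHom.ker (constantCoeff (σ := Fin 3) (R := K)) := fun f hf => by
    have : (constantCoeff : MvPolynomial (Fin 3) K →+* K) = constantCoeff.comp
        (aeval (fun i : Fin 3 => if i.1 < 3 then 0 else X i) :
          MvPolynomial (Fin 3) K →ₐ[K] MvPolynomial (Fin 3) K).toRingHom := by
      ext i <;> simp
    rw [RingHom.mem_ker, this]
    exact (congrArg constantCoeff (RingHom.mem_ker.1 hf)).trans (map_zero _)
  refine le_trans ?_ (Ideal.height_mono h3)
  have h0 := Ideal.height_add_one_le_of_lt_of_isPrime (hlt 0)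
  have h1 := Ideal.height_add_one_le_of_lt_of_isPrime (hlt 1)
  have h2 := Ideal.height_add_one_le_of_lt_of_isPrime (hlt 2)
  calc (3 : ℕ∞) ≤ (q 0).height + 1 + 1 + 1 := by
        rw [add_assoc, add_assoc]; norm_num
    _ ≤ (q 1).height + 1 + 1 := by gcongr; exact h0
    _ ≤ (q 2).height + 1 := by gcongr; exact h1
    _ ≤ (q 3).height := h2

/-- Two surfaces through the origin of affine three-space meet in another point. -/
theorem exists_common_zero [IsAlgClosed K] {g h : MvPolynomial (Fin 3) K}
    (hg : constantCoeff g = 0) (hh : constantCoeff h = 0) :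
    ∃ v : Fin 3 → K, v ≠ 0 ∧ eval v g = 0 ∧ eval v h = 0 := by
  classical
  by_contra hcon
  push Not at hcon
  set m := RingHom.ker (constantCoeff (σ := Fin 3) (R := K)) with hm
  have hprime : m.IsPrime := RingHom.ker_isPrime _
  set I := Ideal.span (({g, h} : Finset (MvPolynomial (Fin 3) K)) : Set (MvPolynomial (Fin 3) K)) with hI
  have hIm : I ≤ m := Ideal.span_le.2 (by
    intro x hx
    simp at hx
    rcases hx with rfl | rfl
    exacts [hg, hh])
  -- With the origin as the only common zero, the Nullstellensatz makes m minimal over an ideal with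
  -- two generators, against Krull's height theorem.
  have hrad : m ≤ I.radical := by
    rw [← vanishingIdeal_zeroLocus_eq_radical (K := K)]
    intro f hf x hx
    rw [hI, zeroLocus_span] at hx
    have hx0 : x = 0 := by
      by_contra hne
      exact hcon x hne (hx g (by simp)) (hx h (by simp))
    rw [hx0, aeval_zero, RingHom.mem_ker.1 hf, map_zero]
  have hmin : m ∈ I.minimalPrimes := ⟨⟨hprime, hIm⟩, fun J hJ _ =>
    hrad.trans (hJ.1.radical_le_iff.2 hJ.2)⟩
  have h1 := Ideal.height_le_card_of_mem_minimalPrimes_span_finset hmin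
  have h2 : (3 : ℕ∞) ≤ (2 : ℕ) := (three_le_height_ker_constantCoeff (K := K)).trans
    (h1.trans (by exact_mod_cast Finset.card_le_two))
  norm_num at h2

end CommonZero

/-! ### Linear forms as irreducible polynomials -/

section LinearForms

variable {k : Type*} [Field k]

theorem isHomogeneous_linForm (a : Fin 3 → k) : (linForm a).IsHomogeneous 1 :=
  IsHomogeneous.sum _ _ _ fun j _ => by
    simpa using (isHomogeneous_C (Fin 3) (a j)).mul (isHomogeneous_X k j)

theorem irreducible_linForm {a : Fin 3 → k} (ha : a ≠ 0) : Irreducible (linForm a) := by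
  have h0 : linForm a ≠ 0 := fun h => ha (linForm_eq_zero.1 h)
  refine irreducible_of_totalDegree_eq_one ((isHomogeneous_linForm a).totalDegree h0) fun x hx => ?_
  obtain ⟨m, hm⟩ := ne_zero_iff.1 h0
  refine IsUnit.mk0 _ fun h => hm ?_
  have := hx m
  rwa [h, zero_dvd_iff] at this

theorem linForm_injective : Function.Injective (linForm (K := k)) := fun a b h => by
  refine funext fun i => C_injective (Fin 3) k ?_
  rw [← pderiv_linForm, ← pderiv_linForm, h]

theorem exists_smul_of_linForm_dvd {a b : Fin 3 → k} (h : linForm a ∣ linForm b) :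
    ∃ t : k, b = t • a := by
  obtain ⟨q, hq⟩ := h
  refine ⟨constantCoeff q, ?_⟩
  have h1 := congrArg (homogeneousComponent 1) hq
  rw [homogeneousComponent_one_mul, homogeneousComponent_of_mem (isHomogeneous_linForm _),
    homogeneousComponent_of_mem (isHomogeneous_linForm _),
    homogeneousComponent_of_mem (isHomogeneous_linForm _), if_pos rfl, if_neg (by norm_num),
    if_pos rfl, zero_mul, zero_add, homogeneousComponent_zero_eq, mul_comm, smul_linForm] at h1
  exact linForm_injective h1

end LinearForms

/-! ### Geometric irreducibility of the components -/

section GeometricIrreducibility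

local notation "Ω" => AlgebraicClosure ℚ

theorem baseChange_eq_map (E : MvPolynomial (Fin 3) ℤ) :
    baseChange Ω E = map (algebraMap ℚ Ω) (baseChange ℚ E) := by
  rw [baseChange, baseChange, map_map]
  congr 1

theorem map_baseChange {k : Type*} [Field k] (E : MvPolynomial (Fin 3) ℤ) (σ : k →+* k) :
    map σ (baseChange k E) = baseChange k E := by
  rw [baseChange, map_map, RingHom.ext_int (σ.comp _)]

/-- Galois descent, one coefficient at a time. -/
theorem exists_map_eq_of_fixed {g : MvPolynomial (Fin 3) Ω}
    (h : ∀ σ : Ω ≃ₐ[ℚ] Ω, map (σ : Ω →+* Ω) g = g) : ∃ g₀, map (algebraMap ℚ Ω) g₀ = g := by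
  refine mem_range_map_iff_coeffs_subset.2 ?_
  intro x hx
  obtain ⟨m, -, rfl⟩ := mem_coeffs_iff.1 (Finset.mem_coe.1 hx)
  have : IsGalois ℚ Ω := by
    rw [Subsingleton.elim (DivisionRing.toRatAlgebra : Algebra ℚ Ω) (AlgebraicClosure.instAlgebra ℚ)]
    exact @IsAlgClosure.isGalois ℚ Ω _ _ (AlgebraicClosure.instAlgebra ℚ) _ _
  refine (InfiniteGalois.mem_range_algebraMap_iff_fixed _).2 fun σ => ?_
  conv_rhs => rw [← h σ, coeff_map]
  rfl

/-- By unique factorisation the rational form a divides α or its conjugate. In either case α is a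
multiple of a, hence so is its conjugate, and then b is proportional to a. So two conjugate forms
cannot be the two distinct rational tangents. -/
theorem not_smul_of_linForm_mul {a b : Fin 3 → Ω} (hab : LinearIndependent Ω ![a, b])
    {α : Fin 3 → Ω} {c : Ω} {σ : Ω ≃ₐ[ℚ] Ω} (ha : ∀ i, σ (a i) = a i)
    (h : linForm a * linForm b = C c * (linForm α * linForm fun i => σ (α i))) : False := by
  have hne := linForm_mul_linForm_ne_zero hab
  have ha0 : a ≠ 0 := hab.ne_zero 0
  have hp := (irreducible_linForm ha0).prime
  have hdvd : linForm a ∣ linForm α ∨ linForm a ∣ linForm fun i => σ (α i) := by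
    have h1 : linForm a ∣ C c * (linForm α * linForm fun i => σ (α i)) := h ▸ Dvd.intro _ rfl
    rcases hp.dvd_or_dvd h1 with h2 | h2
    · exact absurd ((hp.not_isUnit) (isUnit_of_dvd_unit h2 ((isUnit_iff_ne_zero.2 (fun hc => hne (by
        rw [h, hc, C_0, zero_mul]))).map C))) not_false
    · exact hp.dvd_or_dvd h2
  obtain ⟨t, ht⟩ : ∃ t : Ω, α = t • a := by
    rcases hdvd with h1 | h1
    · exact exists_smul_of_linForm_dvd h1
    · obtain ⟨t, ht⟩ := exists_smul_of_linForm_dvd h1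
      refine ⟨σ.symm t, funext fun i => σ.injective ?_⟩
      have := congrFun ht i
      simpa [ha] using this
  have hσ : (fun i => σ (α i)) = σ t • a := funext fun i => by simp [ht, ha]
  rw [hσ, ht, ← smul_linForm, ← smul_linForm] at h
  have h2 : linForm b = linForm ((c * t * σ t) • a) := by
    refine mul_left_cancel₀ (left_ne_zero_of_mul hne) ?_
    rw [h, ← smul_linForm, C_mul, C_mul]
    ring
  have h3 : b = (c * t * σ t) • a := linForm_injective h2
  have := LinearIndependent.pair_iff.1 hab (c * t * σ t) (-1) (by rw [h3]; simp)
  simp at this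

theorem eval_map_algEquiv (g : MvPolynomial (Fin 3) Ω) (σ : Ω ≃ₐ[ℚ] Ω) (w : Fin 3 → ℚ) :
    eval (fun i => algebraMap ℚ Ω (w i)) (map (σ : Ω →+* Ω) g) =
      σ (eval (fun i => algebraMap ℚ Ω (w i)) g) := by
  have h1 := eval₂_comp (σ : Ω →+* Ω) (fun i => algebraMap ℚ Ω (w i)) g
  have h2 : (σ : Ω →+* Ω) ∘ (fun i => algebraMap ℚ Ω (w i)) = fun i => algebraMap ℚ Ω (w i) :=
    funext fun i => σ.commutes _
  rw [h2] at h1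
  rw [eval_map, ← h1]
  rfl

theorem constantCoeff_eq_zero_of_not_isUnit_of_isHomogeneous {k : Type*} [Field k]
    {g : MvPolynomial (Fin 3) k} {n : ℕ} (hg : g.IsHomogeneous n) (hg0 : g ≠ 0) (hu : ¬ IsUnit g) :
    constantCoeff g = 0 := by
  by_contra h
  have hn : n = 0 := by
    have := hg (d := 0) h
    simpa using this.symm
  subst hn
  have hC := totalDegree_eq_zero_iff_eq_C.1 ((totalDegree_zero_iff_isHomogeneous (Fin 3)).2 hg)
  rw [hC] at hu hg0
  exact hu ((IsUnit.mk0 _ fun h => hg0 (by rw [h, C_0])).map C)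

/-- A component over `ℚ` of a curve with only rational ordinary double points with rational tangents
is geometrically irreducible. -/
theorem irreducible_baseChange_algebraicClosure {F E : MvPolynomial (Fin 3) ℤ} {n : ℕ}
    (hF : F.IsHomogeneous n) (hF0 : F ≠ 0) (hsing : HasOnlyRationalODPs F)
    (hdvd : baseChange ℚ E ∣ baseChange ℚ F) (hirr : Irreducible (baseChange ℚ E)) :
    Irreducible (baseChange Ω E) := by
  have hinj : Function.Injective (map (σ := Fin 3) (algebraMap ℚ Ω)) :=
    map_injective _ (algebraMap ℚ Ω).injective
  have hFQ0 : baseChange ℚ F ≠ 0 := fun h => hF0 (map_injective (Int.castRingHom ℚ)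
    (RingHom.injective_int _) (by rw [map_zero]; exact h))
  have hFΩ0 : baseChange Ω F ≠ 0 := fun h => hFQ0 (hinj (by rw [map_zero, ← baseChange_eq_map, h]))
  obtain ⟨m, hEhom⟩ := isHomogeneous_of_dvd (hF.map _) hFQ0 hdvd
  have hE0 : constantCoeff (baseChange Ω E) = 0 := by
    rw [baseChange_eq_map, constantCoeff_map, constantCoeff_eq_zero_of_not_isUnit_of_isHomogeneous
      hEhom hirr.ne_zero hirr.not_isUnit, map_zero]
  have hEΩhom : (baseChange Ω E).IsHomogeneous m := by rw [baseChange_eq_map]; exact hEhom.map _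
  have hEne : baseChange Ω E ≠ 0 := by
    rw [baseChange_eq_map]; exact (map_ne_zero_iff _ hinj).2 hirr.ne_zero
  obtain ⟨s, hs⟩ : baseChange Ω E ∣ baseChange Ω F := by
    rw [baseChange_eq_map, baseChange_eq_map]; exact map_dvd _ hdvd
  have hEu : ¬ IsUnit (baseChange Ω E) := fun h => by
    have := h.map (constantCoeff (σ := Fin 3) (R := Ω))
    rw [hE0] at this
    exact not_isUnit_zero this
  obtain ⟨g₀, hg₀, hg₀E⟩ := WfDvdMonoid.exists_irreducible_factor hEu hEne
  obtain ⟨d, hd⟩ := ne_zero_iff.1 hg₀.ne_zero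
  have hunit : IsUnit (C (coeff d g₀)⁻¹ : MvPolynomial (Fin 3) Ω) :=
    (IsUnit.mk0 _ (inv_ne_zero hd)).map C
  -- Normalising one coefficient to 1 makes any two associated conjugates of g equal.
  set g := C (coeff d g₀)⁻¹ * g₀ with hgdef
  have hg : Irreducible g := (irreducible_isUnit_mul hunit).2 hg₀
  have hgd : coeff d g = 1 := by rw [hgdef, coeff_C_mul, inv_mul_cancel₀ hd]
  obtain ⟨q, hq⟩ : g ∣ baseChange Ω E := (hunit.mul_left_dvd).2 hg₀E
  clear_value g
  by_cases hfix : ∀ σ : Ω ≃ₐ[ℚ] Ω, map (σ : Ω →+* Ω) g = g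
  · obtain ⟨g₁, hg₁⟩ := exists_map_eq_of_fixed hfix
    obtain ⟨q₁, hq₁⟩ := exists_map_eq_of_fixed (g := q) fun σ => by
      have := congrArg (map (σ : Ω →+* Ω)) hq
      rw [map_baseChange, map_mul, hfix σ, hq] at this
      exact (mul_left_cancel₀ hg.ne_zero this).symm
    have h1 : baseChange ℚ E = g₁ * q₁ := hinj (by
      rw [← baseChange_eq_map, map_mul, hg₁, hq₁, hq])
    rcases hirr.isUnit_or_isUnit h1 with h2 | h2
    · exact absurd (hg₁ ▸ h2.map (map (algebraMap ℚ Ω))) hg.not_isUnit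
    · rw [hq]
      exact (irreducible_mul_isUnit (hq₁ ▸ h2.map (map (algebraMap ℚ Ω)))).2 hg
  · exfalso
    push Not at hfix
    obtain ⟨σ, hσ⟩ := hfix
    set g' := map (σ : Ω →+* Ω) g with hg'
    have hg'irr : Irreducible g' :=
      (MulEquiv.irreducible_iff (mapEquiv (Fin 3) σ.toRingEquiv)).2 hg
    clear_value g'
    -- A conjugate dividing g is associated to it, and the normalised coefficient forces equality,
    -- against the choice of σ.
    have hnot : ¬ g' ∣ g := fun h => by
      obtain ⟨u, hu⟩ := h
      have huu := (hg.isUnit_or_isUnit hu).resolve_left hg'irr.not_isUnit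
      have hC := (isUnit_iff_totalDegree_of_isReduced.1 huu).2
      rw [totalDegree_eq_zero_iff_eq_C] at hC
      have h1 := congrArg (coeff d) hu
      rw [hC, mul_comm, coeff_C_mul, hg', coeff_map, hgd, map_one, mul_one] at h1
      rw [hC, ← h1, C_1, mul_one] at hu
      exact hσ hu.symm
    have hg'E : g' ∣ g * q := by
      rw [← hq, ← map_baseChange E (σ : Ω →+* Ω), hq, map_mul, ← hg']
      exact Dvd.intro _ rfl
    obtain ⟨q', hq'⟩ := (hg'irr.prime.dvd_or_dvd hg'E).resolve_left hnot
    have hFg : baseChange Ω F = g * (g' * (q' * s)) := by rw [hs, hq, hq']; ring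
    obtain ⟨m', hghom⟩ := isHomogeneous_of_dvd hEΩhom hEne ⟨q, hq⟩
    have hg0 := constantCoeff_eq_zero_of_not_isUnit_of_isHomogeneous hghom hg.ne_zero hg.not_isUnit
    have hg'0 : constantCoeff g' = 0 := by rw [hg', constantCoeff_map, hg0, map_zero]
    -- The two distinct conjugate components meet. Their common point is singular on F = 0, hence
    -- rational, and its tangents are proportional to those of g and of its conjugate.
    obtain ⟨v, hv, hgv, hg'v⟩ := exists_common_zero hg0 hg'0
    obtain ⟨w, c, rfl, hw⟩ := hsing v hv (by
      rw [hFg]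
      exact ⟨by simp [hgv], fun i => by simp [Derivation.leibniz, hgv, hg'v]⟩)
    have hc : c ≠ 0 := by rintro rfl; exact hv (funext fun i => by simp)
    rw [eval_smul_of_isHomogeneous hghom] at hgv
    have hgw := (mul_eq_zero.1 hgv).resolve_left (pow_ne_zero _ hc)
    have hg'w : eval (fun i => algebraMap ℚ Ω (w i)) g' = 0 := by
      rw [hg', eval_map_algEquiv, hgw, map_zero]
    obtain ⟨-, -, -, a, b, hab, h2⟩ := hw
    have h3 := congrArg (map (algebraMap ℚ Ω)) h2
    rw [← homogeneousComponent_map, ← expandAt_map, ← baseChange_eq_map, map_mul, map_linForm,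
      map_linForm, hFg, expandAt_mul, expandAt_mul, homogeneousComponent_two_mul,
      homogeneousComponent_zero_mul, homogeneousComponent_one_mul, homogeneousComponent_zero_expandAt,
      homogeneousComponent_zero_expandAt, hgw, hg'w, C_0] at h3
    refine not_smul_of_linForm_mul (linearIndependent_map_pair (algebraMap ℚ Ω) hab) (σ := σ)
      (α := fun i => eval (fun i => algebraMap ℚ Ω (w i)) (pderiv i g))
      (c := eval (fun i => algebraMap ℚ Ω (w i)) (q' * s)) (fun i => σ.commutes _) ?_
    rw [← h3, homogeneousComponent_one_expandAt g, homogeneousComponent_one_expandAt g',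
      homogeneousComponent_zero_expandAt]
    have h4 : (fun i => eval (fun i => algebraMap ℚ Ω (w i)) (pderiv i g')) = fun i =>
        σ (eval (fun i => algebraMap ℚ Ω (w i)) (pderiv i g)) := funext fun i => by
      rw [hg', pderiv_map, eval_map_algEquiv]
    rw [h4]
    ring

end GeometricIrreducibility

/-! ### Statements valid for almost all primes -/

section AlmostAll

/-- `Q p` holds for every prime `p` outside the divisors of a non-zero integer. -/
def ForAlmostAll (Q : (p : ℕ) → [Fact p.Prime] → Prop) : Prop :=
  ∃ N : ℤ, N ≠ 0 ∧ ∀ (p : ℕ) [Fact p.Prime], ¬ (p : ℤ) ∣ N → Q p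

variable {Q Q' : (p : ℕ) → [Fact p.Prime] → Prop}

theorem ForAlmostAll.mono (h : ForAlmostAll Q) (hQ : ∀ (p : ℕ) [Fact p.Prime], Q p → Q' p) :
    ForAlmostAll Q' := by
  obtain ⟨N, hN, h⟩ := h
  exact ⟨N, hN, fun p _ hp => hQ p (h p hp)⟩

theorem ForAlmostAll.and (h : ForAlmostAll Q) (h' : ForAlmostAll Q') :
    ForAlmostAll fun p _ => Q p ∧ Q' p := by
  obtain ⟨N, hN, h⟩ := h
  obtain ⟨N', hN', h'⟩ := h'
  exact ⟨N * N', mul_ne_zero hN hN', fun p _ hp =>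
    ⟨h p fun hd => hp (hd.mul_right _), h' p fun hd => hp (hd.mul_left _)⟩⟩

theorem forAlmostAll_finset {ι : Type*} (s : Finset ι) {Q : ι → (p : ℕ) → [Fact p.Prime] → Prop}
    (h : ∀ i ∈ s, ForAlmostAll (Q i)) : ForAlmostAll fun p _ => ∀ i ∈ s, Q i p := by
  classical
  induction s using Finset.induction_on with
  | empty => exact ⟨1, one_ne_zero, by simp⟩
  | insert i s _ ih =>
    refine ((h i (Finset.mem_insert_self i s)).and
      (ih fun j hj => h j (Finset.mem_insert_of_mem hj))).mono fun p _ hp j hj => ?_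
    rcases Finset.mem_insert.1 hj with rfl | hj
    exacts [hp.1, hp.2 j hj]

theorem forAlmostAll_not_dvd {N : ℤ} (hN : N ≠ 0) : ForAlmostAll fun p _ => ¬ (p : ℤ) ∣ N :=
  ⟨N, hN, fun _ _ h => h⟩

theorem forAlmostAll_exists_ne {σ : Type*} [Finite σ] (S : Set (MvPolynomial σ ℤ))
    (h : ∀ x : σ → AlgebraicClosure ℚ, ∃ f ∈ S, eval₂ (Int.castRingHom _) x f ≠ 0) :
    ForAlmostAll fun p _ => ∀ x : σ → ZMod p, ∃ f ∈ S, eval₂ (Int.castRingHom _) x f ≠ 0 :=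
  exists_forall_not_dvd S h

end AlmostAll

local notation "Ω" => AlgebraicClosure ℚ

/-! ### No line lies on the reduced curve -/

section Lines

/-- A linear form dividing F would be associated to one of the geometrically irreducible Eᵢ, all of
which have degree greater than one. -/
theorem not_linForm_dvd {ι : Type*} [Fintype ι] {F : MvPolynomial (Fin 3) ℤ}
    {E : ι → MvPolynomial (Fin 3) ℤ} (hE : ∀ i, Irreducible (baseChange Ω (E i)))
    (hprod : baseChange Ω F ∣ ∏ i, baseChange Ω (E i)) (hdeg : ∀ i, 1 < (E i).totalDegree)
    {a : Fin 3 → Ω} (ha : a ≠ 0) : ¬ linForm a ∣ baseChange Ω F := by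
  intro h
  have hirr := irreducible_linForm ha
  obtain ⟨i, -, hi⟩ := (hirr.prime.dvd_finsetProd_iff _).1 (h.trans hprod)
  obtain ⟨u, hu⟩ := hirr.associated_of_dvd (hE i) hi
  have hC := (isUnit_iff_totalDegree_of_isReduced.1 u.isUnit).2
  have hinj : Function.Injective (Int.castRingHom Ω) := RingHom.injective_int _
  have h1 : (baseChange Ω (E i)).totalDegree = (E i).totalDegree := by
    rw [totalDegree, totalDegree, baseChange, support_map_of_injective _ hinj]
  have h2 := totalDegree_mul (linForm a) (u : MvPolynomial (Fin 3) Ω)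
  rw [hu, h1, hC, (isHomogeneous_linForm a).totalDegree hirr.ne_zero] at h2
  have := hdeg i
  omega

/-- The point of the line `x_k = u x_{k+1} + v x_{k+2}` with parameters `s`, `t`. -/
def linePoint {R : Type*} [CommRing R] (k : Fin 3) (u v s t : R) : Fin 3 → R := fun m =>
  if m = k then s * u + t * v else if m = k + 1 then s else t

/-- If F vanished at all integral parameters, it would vanish on the whole line, and the equation of
the line would divide it. -/
theorem exists_eval_linePoint_ne_zero {F : MvPolynomial (Fin 3) ℤ}
    (h : ∀ a : Fin 3 → Ω, a ≠ 0 → ¬ linForm a ∣ baseChange Ω F) (k : Fin 3) (u v : Ω) :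
    ∃ s t : ℤ, eval (linePoint k u v (s : Ω) (t : Ω)) (baseChange Ω F) ≠ 0 := by
  by_contra hcon
  push Not at hcon
  set L : MvPolynomial (Fin 3) Ω := C u * X (k + 1) + C v * X (k + 2) with hL
  have hdvd : ∀ f : MvPolynomial (Fin 3) Ω, X k - L ∣ f - aeval (fun m => if m = k then L else X m) f :=
    fun f => by
    induction f using MvPolynomial.induction_on with
    | C c => simp
    | add p q hp hq => rw [map_add, add_sub_add_comm]; exact dvd_add hp hq
    | mul_X p i hp =>
      rw [map_mul, aeval_X, show p * X i - aeval (fun m => if m = k then L else X m) p *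
        (if i = k then L else X i) = (p - aeval (fun m => if m = k then L else X m) p) *
        (if i = k then L else X i) + p * (X i - if i = k then L else X i) by ring]
      refine dvd_add (hp.mul_right _) (Dvd.dvd.mul_left ?_ _)
      split_ifs with hi
      · rw [hi]
      · simp
  have hzero : aeval (fun m => if m = k then L else X m) (baseChange Ω F) = 0 := by
    refine funext_set (fun _ => Set.range (Int.cast : ℤ → Ω))
      (fun _ => Set.infinite_range_of_injective Int.cast_injective) fun x hx => ?_
    choose z hz using fun i => hx i (Set.mem_univ i)
    have h1 := hcon (z (k + 1)) (z (k + 2))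
    rw [map_zero, ← h1]
    have h2 : (eval x).comp (aeval (fun m => if m = k then L else X m) :
        MvPolynomial (Fin 3) Ω →ₐ[Ω] _).toRingHom =
        eval (linePoint k u v ((z (k + 1) : ℤ) : Ω) ((z (k + 2) : ℤ) : Ω)) := by
      ext m
      · simp
      · simp only [RingHom.comp_apply, AlgHom.toRingHom_eq_coe, RingHom.coe_coe, aeval_X, eval_X,
          linePoint, hz]
        split_ifs with h3 h4
        · simp [hL, mul_comm]
        · simp [h4]
        · have : m = k + 2 := (by decide : ∀ k m : Fin 3, ¬ m = k → ¬ m = k + 1 → m = k + 2) k m h3 h4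
          simp [this]
    exact DFunLike.congr_fun h2 (baseChange Ω F)
  have hlin : X k - L = linForm (fun m => if m = k then 1 else if m = k + 1 then -u else -v) := by
    rw [linForm, hL]
    fin_cases k <;> simp [Fin.sum_univ_three] <;> ring
  have hd := hdvd (baseChange Ω F)
  rw [hzero, sub_zero, hlin] at hd
  refine h _ ?_ hd
  exact Function.ne_iff.2 ⟨k, by simp⟩

/-- The span of a and b is the plane orthogonal to a × b. Solving for a coordinate where a × b is
non-zero puts it in the parametrised form, and the explicit coefficients of a and b come from
Cramer's rule. -/
theorem noLine_of_forall_exists {F : MvPolynomial (Fin 3) ℤ} {p : ℕ} [Fact p.Prime]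
    (h : ∀ (k : Fin 3) (u v : ZMod p), ∃ s t : ℤ,
      eval (linePoint k u v (s : ZMod p) (t : ZMod p)) (baseChange (ZMod p) F) ≠ 0) : NoLine F p := by
  intro a b hab
  rw [← crossProduct_ne_zero_iff_linearIndependent] at hab
  obtain ⟨k, hk⟩ := Function.ne_iff.1 hab
  set n := crossProduct a b with hn
  have hk' : n k ≠ 0 := hk
  obtain ⟨s, t, hst⟩ := h k (-n (k + 1) / n k) (-n (k + 2) / n k)
  refine ⟨(s * b (k + 2) - t * b (k + 1)) / n k, -(s * a (k + 2) - t * a (k + 1)) / n k, ?_⟩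
  suffices hpt : ((s * b (k + 2) - t * b (k + 1)) / n k) • a + (-(s * a (k + 2) - t * a (k + 1)) / n k) • b =
      linePoint k (-n (k + 1) / n k) (-n (k + 2) / n k) (s : ZMod p) (t : ZMod p) by
    rwa [hpt]
  have h0 : n 0 = a 1 * b 2 - a 2 * b 1 := by simp [hn, cross_apply]
  have h1 : n 1 = a 2 * b 0 - a 0 * b 2 := by simp [hn, cross_apply]
  have h2 : n 2 = a 0 * b 1 - a 1 * b 0 := by simp [hn, cross_apply]
  clear_value n
  have key : ∀ m, ((s * b (k + 2) - t * b (k + 1)) * a m - (s * a (k + 2) - t * a (k + 1)) * b m) =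
      n k * linePoint k (-n (k + 1) / n k) (-n (k + 2) / n k) (s : ZMod p) (t : ZMod p) m := fun m => by
    simp only [linePoint]
    split_ifs with h3 h4
    · subst h3
      field_simp
      fin_cases m <;> simp [h0, h1, h2] <;> ring
    · subst h4
      fin_cases k <;> simp [h0, h1, h2] <;> ring
    · obtain rfl : m = k + 2 :=
        (by decide : ∀ k m : Fin 3, ¬ m = k → ¬ m = k + 1 → m = k + 2) k m h3 h4
      fin_cases k <;> simp [h0, h1, h2] <;> ring
  ext m
  rw [← mul_right_inj' hk', ← key m]
  simp only [Pi.add_apply, Pi.smul_apply, smul_eq_mul]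
  field_simp
  ring

/-- The lines are parametrised by (u, v) in three charts. The values of F at the points with
integral parameters (s, t) are integral polynomials in u, v without common zero over the algebraic
closure of ℚ. -/
theorem forAlmostAll_noLine {F : MvPolynomial (Fin 3) ℤ}
    (h : ∀ a : Fin 3 → Ω, a ≠ 0 → ¬ linForm a ∣ baseChange Ω F) : ForAlmostAll fun p _ => NoLine F p := by
  let f : Fin 3 → ℤ × ℤ → MvPolynomial (Fin 2) ℤ := fun k st =>
    aeval (linePoint k (X 0) (X 1) (C st.1) (C st.2)) F
  have hf : ∀ {R : Type} [CommRing R] (k : Fin 3) (st : ℤ × ℤ) (x : Fin 2 → R), eval₂ (Int.castRingHom R) x (f k st) =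
      eval (linePoint k (x 0) (x 1) (st.1 : R) (st.2 : R)) (baseChange R F) := fun k st x => by
    rw [baseChange, eval_map]
    have : (eval₂Hom (Int.castRingHom _) x).comp (aeval (linePoint k (X 0) (X 1) (C st.1) (C st.2)) :
        MvPolynomial (Fin 3) ℤ →ₐ[ℤ] MvPolynomial (Fin 2) ℤ).toRingHom =
        eval₂Hom (Int.castRingHom _) (linePoint k (x 0) (x 1) (st.1 : _) (st.2 : _)) := by
      refine ringHom_ext (fun m => by simp) fun m => ?_
      simp only [linePoint, RingHom.comp_apply, AlgHom.toRingHom_eq_coe, RingHom.coe_coe, aeval_X,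
        eval₂Hom_X']
      split_ifs <;> simp only [map_add, map_mul, eval₂Hom_X', eq_intCast, map_intCast]
    exact DFunLike.congr_fun this F
  refine (forAlmostAll_finset Finset.univ (Q := fun k p _ => ∀ x : Fin 2 → ZMod p,
    ∃ g ∈ Set.range (f k), eval₂ (Int.castRingHom _) x g ≠ 0) fun k _ => forAlmostAll_exists_ne _ fun x => ?_).mono
    fun p _ hp => noLine_of_forall_exists fun k u v => ?_
  · obtain ⟨s, t, hst⟩ := exists_eval_linePoint_ne_zero h k (x 0) (x 1)
    exact ⟨_, ⟨(s, t), rfl⟩, by rwa [hf]⟩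
  · obtain ⟨_, ⟨st, rfl⟩, hne⟩ := hp k (Finset.mem_univ k) ![u, v]
    rw [hf] at hne
    exact ⟨st.1, st.2, hne⟩

end Lines

/-! ### Irreducibility modulo almost all primes -/

section Reduction

/-- The exponents of the monomials of degree `a`. -/
abbrev Exponent (a : ℕ) : Type := {d : Fin 3 →₀ ℕ // d.degree = a}

instance (a : ℕ) : Finite (Exponent a) :=
  Set.Finite.subset (Finsupp.finite_of_degree_le a) fun _ h => le_of_eq h

instance (a : ℕ) : Fintype (Exponent a) := Fintype.ofFinite _

/-- The homogeneous polynomial of degree `a` with given coefficients. -/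
def formOfCoeffs {R : Type*} [CommRing R] {a : ℕ} (c : Exponent a → R) : MvPolynomial (Fin 3) R :=
  ∑ d, monomial d.1 (c d)

section

variable {R S : Type*} [CommRing R] [CommRing S] {a : ℕ}

theorem isHomogeneous_formOfCoeffs (c : Exponent a → R) : (formOfCoeffs c).IsHomogeneous a :=
  IsHomogeneous.sum _ _ _ fun d _ => isHomogeneous_monomial _ d.2

theorem map_formOfCoeffs (φ : R →+* S) (c : Exponent a → R) :
    map φ (formOfCoeffs c) = formOfCoeffs fun d => φ (c d) := by
  simp [formOfCoeffs, map_monomial]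

theorem formOfCoeffs_coeff {g : MvPolynomial (Fin 3) R} (hg : g.IsHomogeneous a) :
    formOfCoeffs (fun d : Exponent a => coeff d.1 g) = g := by
  ext m
  simp only [formOfCoeffs, coeff_sum, coeff_monomial]
  by_cases hm : m.degree = a
  · rw [Finset.sum_eq_single ⟨m, hm⟩] <;> simp +contextual [Subtype.ext_iff]
  · rw [Finset.sum_eq_zero fun d _ => if_neg (fun h : d.1 = m => hm (h ▸ d.2))]
    exact (hg.coeff_eq_zero hm).symm

end

/-- The equations for a factorization of `E` into forms of degrees `a` and `b`. -/
def factorEquations (E : MvPolynomial (Fin 3) ℤ) (a b : ℕ) :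
    Set (MvPolynomial (Exponent a ⊕ Exponent b) ℤ) :=
  Set.range fun m => coeff m (formOfCoeffs (fun d : Exponent a => X (Sum.inl d)) *
    formOfCoeffs (fun d : Exponent b => X (Sum.inr d)) - map C E)

theorem forall_factorEquations {R : Type*} [CommRing R] {E : MvPolynomial (Fin 3) ℤ} {a b : ℕ}
    {x : Exponent a ⊕ Exponent b → R} :
    (∀ f ∈ factorEquations E a b, eval₂ (Int.castRingHom R) x f = 0) ↔
      formOfCoeffs (fun d => x (Sum.inl d)) * formOfCoeffs (fun d => x (Sum.inr d)) =
        baseChange R E := by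
  rw [← sub_eq_zero, MvPolynomial.ext_iff]
  simp only [factorEquations, Set.forall_mem_range]
  refine forall_congr' fun m => ?_
  rw [← coe_eval₂Hom, ← coeff_map, map_sub, map_mul, map_formOfCoeffs, map_formOfCoeffs, map_map,
    coeff_zero, baseChange]
  simp only [eval₂Hom_X']
  rw [RingHom.ext_int ((eval₂Hom (Int.castRingHom R) x).comp C) (Int.castRingHom R)]

theorem not_isUnit_of_isHomogeneous {k : Type*} [Field k] {g : MvPolynomial (Fin 3) k} {a : ℕ}
    (hg : g.IsHomogeneous a) (hg0 : g ≠ 0) (ha : a ≠ 0) : ¬ IsUnit g := fun h => by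
  have h1 := (isUnit_iff_totalDegree_of_isReduced.1 h).2
  rw [hg.totalDegree hg0] at h1
  exact ha h1

/-- A geometrically irreducible curve has irreducible reduction modulo almost all primes. -/
theorem forAlmostAll_irreducible {E : MvPolynomial (Fin 3) ℤ} {m : ℕ} (hE : E.IsHomogeneous m)
    (hirr : Irreducible (baseChange Ω E)) :
    ForAlmostAll fun p _ => Irreducible (baseChange (ZMod p) E) := by
  have hE0 : E ≠ 0 := by rintro rfl; exact hirr.ne_zero (map_zero _)
  obtain ⟨d, hd⟩ := ne_zero_iff.1 hE0
  have hm : m ≠ 0 := by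
    rintro rfl
    have hh : (baseChange Ω E).IsHomogeneous 0 := hE.map _
    have hC := totalDegree_eq_zero_iff_eq_C.1 ((totalDegree_zero_iff_isHomogeneous (Fin 3)).2 hh)
    refine hirr.not_isUnit (hC ▸ (IsUnit.mk0 _ fun h => hirr.ne_zero ?_).map C)
    rw [hC, h, C_0]
  -- A non-trivial factorisation is into forms of positive degrees a and b. For each of these
  -- finitely many pairs the coefficients solve an integral system with no solution over the
  -- algebraic closure of ℚ.
  have hfac : ∀ ab ∈ (Finset.range (m + 1) ×ˢ Finset.range (m + 1)).filter
      (fun ab => ab.1 ≠ 0 ∧ ab.2 ≠ 0), ForAlmostAll fun p _ =>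
      ∀ x : Exponent ab.1 ⊕ Exponent ab.2 → ZMod p,
        ∃ f ∈ factorEquations E ab.1 ab.2, eval₂ (Int.castRingHom _) x f ≠ 0 := by
    intro ab hab
    obtain ⟨ha, hb⟩ := (Finset.mem_filter.1 hab).2
    refine forAlmostAll_exists_ne _ fun x => ?_
    by_contra hcon
    push Not at hcon
    have h1 := forall_factorEquations.1 hcon
    have hne := h1 ▸ hirr.ne_zero
    rcases hirr.isUnit_or_isUnit h1.symm with h2 | h2
    · exact not_isUnit_of_isHomogeneous (isHomogeneous_formOfCoeffs _) (left_ne_zero_of_mul hne) ha h2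
    · exact not_isUnit_of_isHomogeneous (isHomogeneous_formOfCoeffs _) (right_ne_zero_of_mul hne) hb h2
  refine ((forAlmostAll_finset _ hfac).and (forAlmostAll_not_dvd hd)).mono fun p _ hp => ?_
  have hEp : (baseChange (ZMod p) E).IsHomogeneous m := hE.map _
  have hEp0 : baseChange (ZMod p) E ≠ 0 := ne_zero_iff.2 ⟨d, by
    rw [baseChange, coeff_map]
    exact fun h => hp.2 ((ZMod.intCast_zmod_eq_zero_iff_dvd _ _).1 h)⟩
  refine ⟨not_isUnit_of_isHomogeneous hEp hEp0 hm, fun {g h} hgh => ?_⟩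
  by_contra hcon
  push Not at hcon
  have hg0 : g ≠ 0 := left_ne_zero_of_mul (hgh ▸ hEp0)
  have hh0 : h ≠ 0 := right_ne_zero_of_mul (hgh ▸ hEp0)
  obtain ⟨a, ha⟩ := isHomogeneous_of_dvd hEp hEp0 ⟨h, hgh⟩
  obtain ⟨b, hb⟩ := isHomogeneous_of_dvd hEp hEp0 ⟨g, by rw [hgh, mul_comm]⟩
  have hab : a + b = m := (ha.mul hb).inj_right (hgh ▸ hEp) (hgh ▸ hEp0)
  have hpos : ∀ {g : MvPolynomial (Fin 3) (ZMod p)} {a : ℕ}, g.IsHomogeneous a → g ≠ 0 → ¬ IsUnit g →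
      a ≠ 0 := by
    rintro g a hg hg0 hu rfl
    have hC := totalDegree_eq_zero_iff_eq_C.1 ((totalDegree_zero_iff_isHomogeneous (Fin 3)).2 hg)
    refine hu (hC ▸ (IsUnit.mk0 _ fun h => hg0 ?_).map C)
    rw [hC, h, C_0]
  obtain ⟨f, hf, hne⟩ := hp.1 (a, b) (Finset.mem_filter.2 ⟨Finset.mem_product.2
    ⟨Finset.mem_range.2 (by omega), Finset.mem_range.2 (by omega)⟩, hpos ha hg0 hcon.1, hpos hb hh0 hcon.2⟩)
    (Sum.elim (fun d => coeff d.1 g) (fun d => coeff d.1 h))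
  refine hne (forall_factorEquations.2 ?_ f hf)
  simp only [Sum.elim_inl, Sum.elim_inr]
  rw [formOfCoeffs_coeff ha, formOfCoeffs_coeff hb, hgh]

end Reduction

/-! ### Integral models of the nodes -/

section IntegralNodes

theorem exists_int_multiple {ι : Type*} [Finite ι] (f : ι → ℚ) :
    ∃ m : ℤ, m ≠ 0 ∧ ∃ g : ι → ℤ, ∀ i, (g i : ℚ) = m * f i := by
  obtain ⟨b, hb⟩ := IsLocalization.exist_integer_multiples_of_finite (nonZeroDivisors ℤ) f
  choose g hg using hb
  exact ⟨b, nonZeroDivisors.ne_zero b.2, g, fun i => by simpa [Algebra.smul_def] using hg i⟩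

theorem expandAt_baseChange {k : Type*} [Field k] (F : MvPolynomial (Fin 3) ℤ) (W : Fin 3 → ℤ) :
    expandAt (baseChange k F) (fun i => (W i : k)) = map (Int.castRingHom k) (expandInt F W) := by
  unfold expandAt expandInt baseChange
  induction F using MvPolynomial.induction_on with
  | C c => simp
  | add f g hf hg => simp only [map_add, hf, hg]
  | mul_X f i hf => simp only [map_mul, hf, map_X, aeval_X, map_add, map_C]; rfl

theorem homogeneousComponent_expandInt_eq_zero {F : MvPolynomial (Fin 3) ℤ} {W : Fin 3 → ℤ} {j : ℕ}
    (h : homogeneousComponent j (expandAt (baseChange ℚ F) fun i => (W i : ℚ)) = 0) :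
    homogeneousComponent j (expandInt F W) = 0 := by
  rw [expandAt_baseChange, homogeneousComponent_map] at h
  exact map_injective _ (RingHom.injective_int _) (by rw [h, map_zero])

theorem IsRationalODP.isSingularPoint {k : Type*} [Field k] {f : MvPolynomial (Fin 3) k}
    {v : Fin 3 → k} (h : IsRationalODP f v) : IsSingularPoint f v :=
  isSingularPoint_iff.2 ⟨h.2.1, h.2.2.1⟩

theorem IsRationalODP.exists_int {F : MvPolynomial (Fin 3) ℤ} {n : ℕ} (hF : F.IsHomogeneous n)
    {w : Fin 3 → ℚ} (hw : IsRationalODP (baseChange ℚ F) w) : ∃ m : ℚ, m ≠ 0 ∧ ∃ W : Fin 3 → ℤ,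
      (∀ i, (W i : ℚ) = m * w i) ∧ IsRationalODP (baseChange ℚ F) fun i => (W i : ℚ) := by
  obtain ⟨m, hm, W, hW⟩ := exists_int_multiple w
  have hm' : (m : ℚ) ≠ 0 := by exact_mod_cast hm
  refine ⟨m, hm', W, hW, ?_⟩
  rw [show (fun i => (W i : ℚ)) = (m : ℚ) • w from funext hW]
  exact hw.smul (hF.map _) hm'

/-- Take a frame dual to the two tangents and clear denominators by m₁ and m₂; the quadratic part
becomes (m₁x)(m₂y), so κ = m₁m₂. The normal form of M(W) over ℚ is rescaled in the same way. -/
theorem exists_intNode {d : ℕ} {B : Fin d → Fin d → Fin 3 → ℤ} (hB : ∀ i j k, B i j k = -B j i k)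
    {F : MvPolynomial (Fin 3) ℤ} {n : ℕ} (hF : F.IsHomogeneous n) {W : Fin 3 → ℤ}
    (hW : IsRationalODP (baseChange ℚ F) fun i => (W i : ℚ)) :
    ∃ N : IntNode B F, N.w = W ∧ N.disc ≠ 0 := by
  have hs := hW.isSingularPoint
  obtain ⟨hW0, h0, h1, a, b, hab, h2⟩ := hW
  obtain ⟨haW, hbW⟩ := tangent_apply_eq_zero (hF.map _) hs hab h2
  obtain ⟨e, ℓ, D, he, rfl, rfl⟩ := exists_dualFrame_of_node hW0 hab haW hbW
  obtain ⟨m₁, hm₁, e₁, he₁⟩ := exists_int_multiple (e 1)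
  obtain ⟨m₂, hm₂, e₂, he₂⟩ := exists_int_multiple (e 2)
  have hskew : ((Mat B W).map (Int.castRingHom ℚ)).transpose = -(Mat B W).map (Int.castRingHom ℚ) := by
    ext i j
    simp only [Matrix.transpose_apply, Matrix.map_apply, Matrix.neg_apply, Mat, Matrix.of_apply,
      ← map_neg, ← Finset.sum_neg_distrib]
    congr 1
    exact Finset.sum_congr rfl fun k _ => by rw [hB j i k]; ring
  obtain ⟨k, l, ε, P, A, hP, hA, hconj⟩ := exists_skew_normal_form _ hskew
  obtain ⟨m, hm, Q, hQ⟩ := exists_int_multiple fun ij : (Fin k ⊕ Fin l) × (Fin k ⊕ Fin l) => P ij.1 ij.2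
  have hm' : (m : ℚ) ≠ 0 := by exact_mod_cast hm
  let Q' : Matrix (Fin k ⊕ Fin l) (Fin k ⊕ Fin l) ℤ := Matrix.of fun i j => Q (i, j)
  have hQ' : Q'.map (Int.castRingHom ℚ) = (m : ℚ) • P := by
    ext i j; simpa [Q'] using hQ (i, j)
  let Z := Q' * (Mat B W).submatrix ε ε * Q'.transpose
  have hZ : Z.map (Int.castRingHom ℚ) = Matrix.fromBlocks (((m : ℚ) * m) • A) 0 0 0 := by
    rw [Matrix.map_mul, Matrix.map_mul, Matrix.transpose_map, hQ', ← Matrix.submatrix_map,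
      Matrix.transpose_smul, Matrix.smul_mul, Matrix.smul_mul, Matrix.mul_smul, hconj, smul_smul,
      Matrix.fromBlocks_smul, smul_zero, smul_zero, smul_zero]
  have hZ' : Z = Matrix.fromBlocks Z.toBlocks₁₁ 0 0 0 := by
    ext i j
    have h3 := congrFun (congrFun hZ i) j
    rcases i with i | i <;> rcases j with j | j <;> simp at h3 ⊢
    · rfl
    all_goals exact h3
  have hA' : Z.toBlocks₁₁.map (Int.castRingHom ℚ) = ((m : ℚ) * m) • A := by
    ext i j
    exact congrFun (congrFun hZ (Sum.inl i)) (Sum.inl j)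
  have hpair : ∀ i j, ∑ x, ℓ i x * e j x = if i = j then 1 else 0 := D.pairing
  refine ⟨⟨W, e₁, e₂, m₁ * m₂, homogeneousComponent_expandInt_eq_zero h0,
    homogeneousComponent_expandInt_eq_zero h1, fun x y => ?_, k, l, ε, Q', Z.toBlocks₁₁, hZ'⟩, rfl, ?_⟩
  · rw [expandAt_baseChange, homogeneousComponent_map] at h2
    have h3 := congrArg (eval fun i => (((x • e₁ + y • e₂) i : ℤ) : ℚ)) h2
    rw [map_mul, eval_linForm, eval_linForm, eval_map] at h3
    have h4 := (eval₂_comp (Int.castRingHom ℚ) (x • e₁ + y • e₂)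
      (homogeneousComponent 2 (expandInt F W))).trans h3
    have hlin : ∀ i, ∑ j, ℓ i j * (((x • e₁ + y • e₂) j : ℤ) : ℚ) =
        x * m₁ * (if i = 1 then 1 else 0) + y * m₂ * (if i = 2 then 1 else 0) := fun i => by
      rw [← hpair i 1, ← hpair i 2, Finset.mul_sum, Finset.mul_sum, ← Finset.sum_add_distrib]
      refine Finset.sum_congr rfl fun j _ => ?_
      simp only [Pi.add_apply, Pi.smul_apply, smul_eq_mul]
      push_cast
      rw [he₁, he₂]
      ring
    rw [hlin, hlin] at h4
    simp only [Fin.reduceEq, if_true, if_false, mul_one, mul_zero, add_zero, zero_add, eq_intCast] at h4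
    have h5 : ((eval (x • e₁ + y • e₂) (homogeneousComponent 2 (expandInt F W)) : ℤ) : ℚ) =
        ((m₁ * m₂ * x * y : ℤ) : ℚ) := by
      rw [h4]; push_cast; ring
    exact_mod_cast h5
  · refine mul_ne_zero (mul_ne_zero (mul_ne_zero ?_ (mul_ne_zero hm₁ hm₂)) ?_) ?_
    · have h3 : (Matrix.of ![W, e₁, e₂]).map (Int.castRingHom ℚ) =
          Matrix.diagonal ![1, (m₁ : ℚ), (m₂ : ℚ)] * e := by
        ext i j
        rw [Matrix.diagonal_mul]
        fin_cases i
        · simp [he]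
        · simpa using he₁ j
        · simpa using he₂ j
      intro h
      have h4 := RingHom.map_det (Int.castRingHom ℚ) (Matrix.of ![W, e₁, e₂])
      change (Matrix.of ![W, e₁, e₂]).det = 0 at h
      rw [h, map_zero, RingHom.mapMatrix_apply, h3, Matrix.det_mul, Matrix.det_diagonal] at h4
      have h5 := congrArg Matrix.det D.mul_eq
      rw [Matrix.det_mul, Matrix.det_transpose, Matrix.det_one] at h5
      have h6 : e.det ≠ 0 := right_ne_zero_of_mul (h5 ▸ one_ne_zero)
      have : (m₁ : ℚ) * m₂ ≠ 0 := mul_ne_zero (by exact_mod_cast hm₁) (by exact_mod_cast hm₂)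
      simp [Fin.prod_univ_three] at h4
      tauto
    · intro h
      have h4 := RingHom.map_det (Int.castRingHom ℚ) Q'
      change Q'.det = 0 at h
      rw [h, map_zero, RingHom.mapMatrix_apply, hQ', Matrix.det_smul] at h4
      exact mul_ne_zero (pow_ne_zero _ hm') hP.ne_zero h4.symm
    · intro h
      have h4 := RingHom.map_det (Int.castRingHom ℚ) Z.toBlocks₁₁
      change Z.toBlocks₁₁.det = 0 at h
      rw [h, map_zero, RingHom.mapMatrix_apply, hA', Matrix.det_smul] at h4
      exact mul_ne_zero (pow_ne_zero _ (mul_ne_zero hm' hm')) hA.ne_zero h4.symm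

/-- The tangents with cleared denominators reduce to independent forms as long as p does not divide
a chosen non-zero coordinate of their cross product. The point and the scalar m₁m₂ must also stay
non-zero. -/
theorem forAlmostAll_isRationalODP {F : MvPolynomial (Fin 3) ℤ} {W : Fin 3 → ℤ}
    (hW : IsRationalODP (baseChange ℚ F) fun i => (W i : ℚ)) : ForAlmostAll fun p _ =>
      IsRationalODP (baseChange (ZMod p) F) fun i => (W i : ZMod p) := by
  obtain ⟨hW0, h0, h1, a, b, hab, h2⟩ := hW
  obtain ⟨m₁, hm₁, a', ha'⟩ := exists_int_multiple a
  obtain ⟨m₂, hm₂, b', hb'⟩ := exists_int_multiple b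
  let L : (Fin 3 → ℤ) → MvPolynomial (Fin 3) ℤ := fun a => ∑ i, C (a i) * X i
  have hL : ∀ {k : Type} [Field k] (a : Fin 3 → ℤ), map (Int.castRingHom k) (L a) =
      linForm fun i => (a i : k) := fun a => by simp [L, linForm]
  obtain ⟨m, hm⟩ : ∃ m, m = m₁ * m₂ := ⟨_, rfl⟩
  have hm₁' : (m₁ : ℚ) ≠ 0 := by exact_mod_cast hm₁
  have hm₂' : (m₂ : ℚ) ≠ 0 := by exact_mod_cast hm₂
  have hcomp : C m * homogeneousComponent 2 (expandInt F W) = L a' * L b' := by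
    refine map_injective (Int.castRingHom ℚ) (RingHom.injective_int _) ?_
    rw [map_mul, map_mul, hL, hL, ← homogeneousComponent_map, ← expandAt_baseChange, h2,
      show (fun i => (a' i : ℚ)) = (m₁ : ℚ) • a from funext ha',
      show (fun i => (b' i : ℚ)) = (m₂ : ℚ) • b from funext hb', ← smul_linForm, ← smul_linForm, map_C, hm,
      eq_intCast, Int.cast_mul, C_mul]
    ring
  obtain ⟨j, hj⟩ := Function.ne_iff.1 hW0
  have hj' : W j ≠ 0 := by simpa using hj
  have hcross : crossProduct a' b' ≠ 0 := by
    have hab' : crossProduct (fun i => (a' i : ℚ)) (fun i => (b' i : ℚ)) ≠ 0 := by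
      rw [show (fun i => (a' i : ℚ)) = (m₁ : ℚ) • a from funext ha',
        show (fun i => (b' i : ℚ)) = (m₂ : ℚ) • b from funext hb', map_smul, map_smul,
        LinearMap.smul_apply]
      exact smul_ne_zero hm₂' (smul_ne_zero hm₁' (crossProduct_ne_zero_iff_linearIndependent.2 hab))
    intro h
    refine hab' ?_
    rw [cross_apply] at h ⊢
    ext i
    have := congrArg (Int.cast : ℤ → ℚ) (congrFun h i)
    fin_cases i <;> simpa using this
  obtain ⟨i, hi⟩ := Function.ne_iff.1 hcross
  refine ((forAlmostAll_not_dvd hi).and ((forAlmostAll_not_dvd hj').and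
    (forAlmostAll_not_dvd (hm ▸ mul_ne_zero hm₁ hm₂ : m ≠ 0)))).mono fun p _ hp => ?_
  obtain ⟨hpi, hpj, hpm⟩ := hp
  have hcast : ∀ {x : ℤ}, ¬ (p : ℤ) ∣ x → (x : ZMod p) ≠ 0 := fun hx h =>
    hx ((ZMod.intCast_zmod_eq_zero_iff_dvd _ _).1 h)
  refine ⟨Function.ne_iff.2 ⟨j, hcast hpj⟩, ?_, ?_, ((m : ZMod p)⁻¹) • fun i => (a' i : ZMod p),
    fun i => (b' i : ZMod p), linearIndependent_smul_pair ?_ (inv_ne_zero (hcast hpm)), ?_⟩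
  · rw [expandAt_baseChange, homogeneousComponent_map, homogeneousComponent_expandInt_eq_zero h0, map_zero]
  · rw [expandAt_baseChange, homogeneousComponent_map, homogeneousComponent_expandInt_eq_zero h1, map_zero]
  · rw [← crossProduct_ne_zero_iff_linearIndependent]
    refine Function.ne_iff.2 ⟨i, fun h => hcast hpi ?_⟩
    rw [cross_apply] at h ⊢
    fin_cases i <;> simpa using h
  · have h3 := congrArg (map (Int.castRingHom (ZMod p))) hcomp
    rw [map_mul, map_mul, hL, hL, map_C] at h3
    rw [expandAt_baseChange, homogeneousComponent_map, ← smul_linForm, mul_assoc, ← h3, ← mul_assoc,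
      ← C_mul, eq_intCast, inv_mul_cancel₀ (hcast hpm), C_1, one_mul]

end IntegralNodes

/-! ### Singular points modulo p are reductions of nodes -/

section SingularReduction

/-- First order Taylor expansion of an integral polynomial with a remainder vanishing at `δ = 0`. -/
theorem exists_eval₂_add {A : Type*} [CommRing A] (w δ : Fin 3 → A) (G : MvPolynomial (Fin 3) ℤ) :
    ∃ R : Fin 3 → A, (∀ j, R j ∈ Ideal.span (Set.range δ)) ∧
      eval₂ (Int.castRingHom A) (w + δ) G = eval₂ (Int.castRingHom A) w G +
        ∑ j, (eval₂ (Int.castRingHom A) w (pderiv j G) + R j) * δ j := by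
  induction G using MvPolynomial.induction_on with
  | C c => exact ⟨0, fun _ => zero_mem _, by simp [-eq_intCast]⟩
  | add f g hf hg =>
    obtain ⟨R, hR, h⟩ := hf
    obtain ⟨R', hR', h'⟩ := hg
    refine ⟨R + R', fun j => add_mem (hR j) (hR' j), ?_⟩
    simp only [eval₂_add, h, h', map_add, Pi.add_apply, Fin.sum_univ_three]
    ring
  | mul_X f i hf =>
    obtain ⟨R, hR, h⟩ := hf
    refine ⟨fun j => R j * w i + (eval₂ (Int.castRingHom A) w (pderiv j f) + R j) * δ i, fun j =>
      add_mem (Ideal.mul_mem_right _ _ (hR j))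
        (Ideal.mul_mem_left _ _ (Ideal.subset_span ⟨i, rfl⟩)), ?_⟩
    have hd : ∀ j, eval₂ (Int.castRingHom A) w (pderiv j (f * X i)) =
        eval₂ (Int.castRingHom A) w f * (if i = j then 1 else 0) +
          w i * eval₂ (Int.castRingHom A) w (pderiv j f) := fun j => by
      rw [Derivation.leibniz, pderiv_X, smul_eq_mul, smul_eq_mul, eval₂_add, eval₂_mul, eval₂_mul,
        eval₂_X, Pi.single_apply]
      split_ifs <;> simp_all
    have hs : δ i = ∑ j, (if i = j then 1 else 0) * δ j := by simp
    simp only [eval₂_mul, eval₂_X, h, hd, Pi.add_apply]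
    simp only [Fin.sum_univ_three] at hs ⊢
    linear_combination eval₂ (Int.castRingHom A) w f * hs

/-- At a node the Hessian has kernel spanned by w. Adding w to the k-th column, where w_k ≠ 0, makes
the matrix invertible. -/
theorem det_hessian_add_ne_zero {f : MvPolynomial (Fin 3) ℚ} {n : ℕ} (hf : f.IsHomogeneous n)
    {w : Fin 3 → ℚ} (hw : IsRationalODP f w) {k : Fin 3} (hk : w k ≠ 0) :
    (Matrix.of fun i j => eval w (pderiv j (pderiv i f)) + if j = k then w i else 0).det ≠ 0 := by
  have hs := hw.isSingularPoint
  obtain ⟨hw0, -, -, a, b, hab, h2⟩ := hw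
  obtain ⟨haw, hbw⟩ := tangent_apply_eq_zero hf hs hab h2
  obtain ⟨e, ℓ, D, rfl, rfl, rfl⟩ := exists_dualFrame_of_node hw0 hab haw hbw
  intro hdet
  obtain ⟨y, hy0, hy⟩ := Matrix.exists_mulVec_eq_zero_iff.2 hdet
  have key : ∀ i, ℓ 1 i * (∑ j, ℓ 2 j * y j) + ℓ 2 i * (∑ j, ℓ 1 j * y j) + e 0 i * y k = 0 :=
    fun i => by
      have := congrFun hy i
      rw [Matrix.mulVec, dotProduct] at this
      simp only [Matrix.of_apply, eval_pderiv_pderiv h2, add_mul, Finset.sum_add_distrib, ite_mul,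
        zero_mul, Finset.sum_ite_eq', Finset.mem_univ, if_true, Pi.zero_apply] at this
      rw [← this, Finset.mul_sum, Finset.mul_sum]
      simp only [Fin.sum_univ_three]
      ring
  have hdot : ∀ v : Fin 3 → ℚ, (∑ i, ℓ 1 i * v i) * (∑ j, ℓ 2 j * y j) +
      (∑ i, ℓ 2 i * v i) * (∑ j, ℓ 1 j * y j) + (∑ i, e 0 i * v i) * y k = 0 := fun v => by
    simp only [Fin.sum_univ_three] at key ⊢
    linear_combination v 0 * key 0 + v 1 * key 1 + v 2 * key 2
  have hyk : y k = 0 := by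
    have h := hdot (e 0)
    rw [haw, hbw, zero_mul, zero_mul, zero_add, zero_add] at h
    -- The coefficient w·w is a sum of rational squares, so it is non-zero.
    refine (mul_eq_zero.1 h).resolve_left fun h => hk ?_
    exact mul_self_eq_zero.1 ((Finset.sum_eq_zero_iff_of_nonneg fun i _ => mul_self_nonneg _).1 h k
      (Finset.mem_univ k))
  have h1 := hdot (e 1)
  have h3 := hdot (e 2)
  rw [D.pairing, D.pairing, hyk] at h1 h3
  have hc : ∀ m, y m = e 0 m * coord ℓ y 0 := fun m => by
    rw [← sum_coord D y m, Fin.sum_univ_three]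
    simp only [coord, Algebra.algebraMap_self, RingHom.id_apply]
    simp at h1 h3
    rw [h1, h3]
    ring
  have hc0 := (mul_eq_zero.1 ((hc k).symm.trans hyk)).resolve_left hk
  exact hy0 (funext fun m => by rw [hc m, hc0, mul_zero]; rfl)

/-- Expand the partial derivatives of F at W with displacement δ = W_k z − W. For a singular z with
z_k = 1 this reads Mδ = 0, where M is the Hessian up to terms vanishing with δ. So r = det M ≠ 0
forces δ = 0, that is z is the point W. At the point W itself r is a non-zero integer. The extra
k-th column in M is harmless because δ_k = 0. -/
theorem exists_separating {F : MvPolynomial (Fin 3) ℤ} {n : ℕ} (hF : F.IsHomogeneous n)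
    {W : Fin 3 → ℤ} (hW : IsRationalODP (baseChange ℚ F) fun i => (W i : ℚ)) {k : Fin 3}
    (hk : W k ≠ 0) : ∃ r : MvPolynomial (Fin 3) ℤ,
      (∀ {K : Type} [Field K] [CharZero K] (x : Fin 3 → K), (∀ i, W k * x i = W i) →
        eval₂ (Int.castRingHom K) x r ≠ 0) ∧
      ∀ (p : ℕ) [Fact p.Prime] (z : Fin 3 → ZMod p), z k = 1 →
        IsSingularPoint (baseChange (ZMod p) F) z → eval₂ (Int.castRingHom (ZMod p)) z r ≠ 0 →
          ∀ i, (W k : ZMod p) * z i = W i := by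
  let δ : Fin 3 → MvPolynomial (Fin 3) ℤ := fun i => C (W k) * X i - C (W i)
  choose R hR hT using fun i => exists_eval₂_add (fun i => C (W i)) δ (pderiv i F)
  let H : Matrix (Fin 3) (Fin 3) ℤ :=
    Matrix.of fun i j => eval W (pderiv j (pderiv i F)) + if j = k then W i else 0
  have hC : ∀ G : MvPolynomial (Fin 3) ℤ, eval₂ (Int.castRingHom (MvPolynomial (Fin 3) ℤ))
      (fun i => C (W i)) G = C (eval W G) := fun G => by
    rw [RingHom.ext_int (Int.castRingHom (MvPolynomial (Fin 3) ℤ)) C]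
    exact (eval₂_comp C W G).symm
  have hcast : ∀ G : MvPolynomial (Fin 3) ℤ, ((eval W G : ℤ) : ℚ) =
      eval (fun i => (W i : ℚ)) (baseChange ℚ G) := fun G => by
    rw [baseChange, eval_map]; exact eval₂_comp (Int.castRingHom ℚ) W G
  let M : Matrix (Fin 3) (Fin 3) (MvPolynomial (Fin 3) ℤ) := Matrix.of fun i j => C (H i j) + R i j
  have hH : ∀ i j, H i j = eval W (pderiv j (pderiv i F)) + if j = k then W i else 0 := fun _ _ => rfl
  have hM' : ∀ i j, M i j = C (H i j) + R i j := fun _ _ => rfl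
  have hsing := hW.isSingularPoint
  refine ⟨M.det, fun {K} _ _ x hx => ?_, fun p _ z hzk hz hr => ?_⟩
  · have hM : (eval₂Hom (Int.castRingHom K) x).mapMatrix M = (Int.castRingHom K).mapMatrix H := by
      ext i j
      have hRx : Ideal.span (Set.range δ) ≤ RingHom.ker (eval₂Hom (Int.castRingHom K) x) :=
        Ideal.span_le.2 (by rintro _ ⟨i, rfl⟩; simp [δ, hx, -eq_intCast, eq_intCast (Int.castRingHom K)])
      have := hRx (hR i j)
      rw [RingHom.mem_ker] at this
      rw [RingHom.mapMatrix_apply, RingHom.mapMatrix_apply, Matrix.map_apply, Matrix.map_apply, hM']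
      rw [map_add, this, add_zero, coe_eval₂Hom, eval₂_C]
    have h1 := RingHom.map_det (eval₂Hom (Int.castRingHom K) x) M
    rw [hM, ← RingHom.map_det] at h1
    rw [← coe_eval₂Hom, h1, eq_intCast, Int.cast_ne_zero]
    intro h2
    refine det_hessian_add_ne_zero (hF.map _) hW (k := k) (by exact_mod_cast hk) ?_
    have h3 := RingHom.map_det (Int.castRingHom ℚ) H
    rw [h2, map_zero] at h3
    refine Eq.trans (congrArg Matrix.det ?_) h3.symm
    ext i j
    simp only [RingHom.mapMatrix_apply, Matrix.map_apply, Matrix.of_apply, H, eq_intCast,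
      Int.cast_add, hcast, ← pderiv_baseChange, Int.cast_ite, Int.cast_zero]
    rfl
  · let ev := eval₂Hom (Int.castRingHom (ZMod p)) z
    have hev : ∀ c, ev (C c) = c := fun c => by
      rw [coe_eval₂Hom, eval₂_C, eq_intCast]
    have hevX : ∀ i, ev (X i) = z i := fun i => by rw [coe_eval₂Hom, eval₂_X]
    have hevδ : ∀ i, ev (δ i) = W k * z i - W i := fun i => by
      rw [map_sub, map_mul, hev, hev, hevX]
    have hδ : (fun i => ev (δ i)) = 0 := by
      refine Matrix.eq_zero_of_mulVec_eq_zero (M := ev.mapMatrix M) ?_ ?_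
      · rw [← RingHom.map_det]; exact hr
      · ext i
        have h1 := congrArg ev (hT i)
        have h0 : eval W (pderiv i F) = 0 := by
          have := hsing.2 i
          rw [pderiv_baseChange, ← hcast] at this
          exact_mod_cast this
        have h2 : ev (eval₂ (Int.castRingHom _) ((fun i => C (W i)) + δ) (pderiv i F)) = 0 := by
          rw [← coe_eval₂Hom, ← RingHom.comp_apply, comp_eval₂Hom]
          have h3 := eval_smul_of_isHomogeneous ((hF.map (Int.castRingHom (ZMod p))).pderiv (i := i))
            (W k : ZMod p) z
          rw [show eval z (pderiv i (map (Int.castRingHom (ZMod p)) F)) = 0 from hz.2 i, mul_zero] at h3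
          rw [← h3, pderiv_map, eval_map, coe_eval₂Hom]
          congr 1
          · exact RingHom.ext_int _ _
          · funext j
            rw [Pi.add_apply, map_add, hev, hevδ, add_sub_cancel]
        rw [h2, hC, h0, C_0, zero_add, map_sum] at h1
        have hk0 : ev (δ k) = 0 := by rw [hevδ, hzk, mul_one, sub_self]
        rw [Matrix.mulVec, dotProduct, Pi.zero_apply, h1]
        refine Finset.sum_congr rfl fun j _ => ?_
        rw [RingHom.mapMatrix_apply, Matrix.map_apply, hM', hH, map_mul, hC]
        rcases eq_or_ne j k with rfl | hj
        · rw [hk0, mul_zero, mul_zero]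
        · rw [if_neg hj, add_zero]
    intro i
    exact sub_eq_zero.1 ((hevδ i).symm.trans (congrFun hδ i))

/-- The equations of the singular points in the chart, together with all the separating r, have no
solution over the algebraic closure of ℚ, because every such singular point is one of the nodes W. A
non-zero integer is then a combination involving only finitely many r, and those W account for all
singular points modulo almost all p. Finiteness of the singular locus is not needed beforehand. -/
theorem exists_finset_singular_reduction {F : MvPolynomial (Fin 3) ℤ} {n : ℕ}
    (hF : F.IsHomogeneous n) (hsing : HasOnlyRationalODPs F) (k : Fin 3) :
    ∃ 𝒲 : Finset (Fin 3 → ℤ), (∀ W ∈ 𝒲, W k ≠ 0 ∧ IsRationalODP (baseChange ℚ F) fun i => (W i : ℚ)) ∧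
      ForAlmostAll fun p _ => ∀ z : Fin 3 → ZMod p, z k = 1 →
        IsSingularPoint (baseChange (ZMod p) F) z → ∃ W ∈ 𝒲, ∀ i, (W k : ZMod p) * z i = W i := by
  classical
  let 𝒩 := {W : Fin 3 → ℤ // W k ≠ 0 ∧ IsRationalODP (baseChange ℚ F) fun i => (W i : ℚ)}
  choose r hr hrp using fun W : 𝒩 => exists_separating hF W.2.2 W.2.1
  let S₀ : Set (MvPolynomial (Fin 3) ℤ) := insert F (insert (X k - 1) (Set.range fun i => pderiv i F))
  obtain ⟨N, hN, hmem⟩ := exists_C_mem_span (S₀ ∪ Set.range r) fun x => by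
    by_contra hcon
    push Not at hcon
    have hxk : x k = 1 := by
      have := hcon (X k - 1) (by simp [S₀])
      rw [eval₂_sub, eval₂_X, eval₂_one] at this
      exact sub_eq_zero.1 this
    have hxs : IsSingularPoint (baseChange Ω F) x := by
      refine ⟨?_, fun i => ?_⟩
      · rw [baseChange, eval_map]
        exact hcon F (by simp [S₀])
      · rw [pderiv_baseChange, baseChange, eval_map]
        exact hcon _ (by simp [S₀])
    obtain ⟨w, c, hxw, hw⟩ := hsing x (fun h => by simp [h] at hxk) hxs
    obtain ⟨m, hm, W, hW, hWodp⟩ := hw.exists_int hF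
    have hx : ∀ i, x i = c * algebraMap ℚ Ω (w i) := congrFun hxw
    have hcast : ∀ i, (W i : Ω) = algebraMap ℚ Ω m * algebraMap ℚ Ω (w i) := fun i => by
      rw [← map_mul, ← hW, map_intCast]
    have hcw := (hx k).symm.trans hxk
    have hwk : w k ≠ 0 := fun h => by simp [h] at hcw
    have hWk : W k ≠ 0 := fun h => mul_ne_zero hm hwk (by rw [← hW, h, Int.cast_zero])
    refine hr ⟨W, hWk, hWodp⟩ x (fun i => ?_) (hcon _ (Or.inr ⟨_, rfl⟩))
    rw [hcast, hcast, hx]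
    linear_combination algebraMap ℚ Ω m * algebraMap ℚ Ω (w i) * hcw
  rw [Ideal.span_union, Submodule.mem_sup] at hmem
  obtain ⟨a, ha, b, hb, hab⟩ := hmem
  obtain ⟨c, rfl⟩ := Finsupp.mem_span_range_iff_exists_finsupp.1 hb
  refine ⟨c.support.image Subtype.val, fun W hW => ?_, N, hN, fun p _ hp z hzk hz => ?_⟩
  · obtain ⟨W', -, rfl⟩ := Finset.mem_image.1 hW
    exact W'.2
  · by_contra hcon
    push Not at hcon
    refine hp ((ZMod.intCast_zmod_eq_zero_iff_dvd N p).1 ?_)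
    let ev := eval₂Hom (Int.castRingHom (ZMod p)) z
    have hra : ev a = 0 := by
      have hle : Ideal.span S₀ ≤ RingHom.ker ev := by
        refine Ideal.span_le.2 ?_
        rintro f (rfl | rfl | ⟨i, rfl⟩)
        · exact (eval_map _ _ _).symm.trans hz.1
        · change ev (X k - 1) = 0
          rw [map_sub, map_one, coe_eval₂Hom, eval₂_X, hzk, sub_self]
        · have := hz.2 i
          rw [pderiv_baseChange, baseChange, eval_map] at this
          exact this
      exact hle ha
    have hrb : ev (c.sum fun i a => a • r i) = 0 := by
      rw [Finsupp.sum, map_sum]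
      refine Finset.sum_eq_zero fun W hW => ?_
      rw [smul_eq_mul, map_mul]
      obtain ⟨i, hi⟩ := hcon W.1 (Finset.mem_image_of_mem _ hW)
      by_contra h
      exact hi (hrp W p z hzk hz (right_ne_zero_of_mul h) i)
    have := congrArg ev hab
    rw [map_add, hra, hrb, add_zero, coe_eval₂Hom, eval₂_C, eq_intCast] at this
    exact this.symm

theorem IsSingularPoint.smul {K : Type*} [Field K] {f : MvPolynomial (Fin 3) K} {n : ℕ}
    (hf : f.IsHomogeneous n) {v : Fin 3 → K} (h : IsSingularPoint f v) (u : K) :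
    IsSingularPoint f (u • v) :=
  ⟨(eval_smul_of_isHomogeneous hf u v).trans (by rw [h.1, mul_zero]), fun i =>
    (eval_smul_of_isHomogeneous hf.pderiv u v).trans (by rw [h.2 i, mul_zero])⟩

/-- For almost all primes the singular points of the reduction are the reductions of integral
nodes, and are nodes with rational tangents. -/
theorem forAlmostAll_sing {d : ℕ} {B : Fin d → Fin d → Fin 3 → ℤ}
    (hB : ∀ i j k, B i j k = -B j i k) {F : MvPolynomial (Fin 3) ℤ} {n : ℕ}
    (hF : F.IsHomogeneous n) (hsing : HasOnlyRationalODPs F) : ForAlmostAll fun p _ =>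
      ∀ P, Sing F p P → IsRationalODP (baseChange (ZMod p) F) P.rep ∧
        ∃ N : IntNode B F, ¬ (p : ℤ) ∣ N.disc ∧
          ∃ u : ZMod p, u ≠ 0 ∧ ∀ i, (N.w i : ZMod p) = u * P.rep i := by
  choose 𝒲 h𝒲 hp using exists_finset_singular_reduction hF hsing
  have hnode : ∀ k, ∀ W ∈ 𝒲 k, ForAlmostAll fun p _ => ¬ (p : ℤ) ∣ W k ∧
      IsRationalODP (baseChange (ZMod p) F) (fun i => (W i : ZMod p)) ∧
        ∃ N : IntNode B F, N.w = W ∧ ¬ (p : ℤ) ∣ N.disc := fun k W hW => by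
    obtain ⟨N, hN, hdisc⟩ := exists_intNode hB hF (h𝒲 k W hW).2
    exact ((forAlmostAll_not_dvd (h𝒲 k W hW).1).and ((forAlmostAll_isRationalODP (h𝒲 k W hW).2).and
      (forAlmostAll_not_dvd hdisc))).mono fun p _ h => ⟨h.1, h.2.1, N, hN, h.2.2⟩
  refine ((forAlmostAll_finset Finset.univ fun k _ => hp k).and (forAlmostAll_finset Finset.univ
    fun k _ => forAlmostAll_finset (𝒲 k) (hnode k))).mono fun p _ h P hP => ?_
  obtain ⟨k, hk⟩ := Function.ne_iff.1 P.rep_nonzero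
  change P.rep k ≠ 0 at hk
  obtain ⟨W, hW, hWz⟩ := h.1 k (Finset.mem_univ k) ((P.rep k)⁻¹ • P.rep) (inv_mul_cancel₀ hk)
    (IsSingularPoint.smul (hF.map _) hP _)
  obtain ⟨hWk, hodp, N, rfl, hdisc⟩ := h.2 k (Finset.mem_univ k) W hW
  have hWk' : (N.w k : ZMod p) ≠ 0 := fun h => hWk ((ZMod.intCast_zmod_eq_zero_iff_dvd _ _).1 h)
  have hu : ∀ i, (N.w i : ZMod p) = N.w k * (P.rep k)⁻¹ * P.rep i := fun i => by
    rw [← hWz i, Pi.smul_apply, smul_eq_mul, mul_assoc]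
  have hu0 := mul_ne_zero hWk' (inv_ne_zero hk)
  refine ⟨?_, N, hdisc, _, hu0, hu⟩
  have := hodp.smul (hF.map _) (inv_ne_zero hu0)
  rwa [show (fun i => (N.w i : ZMod p)) = (N.w k * (P.rep k)⁻¹ : ZMod p) • P.rep from funext hu,
    inv_smul_smul₀ hu0] at this

end SingularReduction

/-! ### Points on the models of the reduced components -/

section ModelPointsOfReduction

theorem IsODP.isSingularPoint {k : Type*} [Field k] {f : MvPolynomial (Fin 3) k} {v : Fin 3 → k}
    (h : IsODP f v) : IsSingularPoint f v := by
  obtain ⟨-, h0, h1, -⟩ := h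
  have hinj : Function.Injective (map (σ := Fin 3) (algebraMap k (AlgebraicClosure k))) :=
    map_injective _ (algebraMap k _).injective
  rw [expandAt_map, homogeneousComponent_map] at h0 h1
  exact isSingularPoint_iff.2 ⟨hinj (h0.trans (map_zero _).symm), hinj (h1.trans (map_zero _).symm)⟩

theorem HasBranches.of_C_mul {k : Type*} [Field k] {f g : MvPolynomial (Fin 3) k} {v : Fin 3 → k}
    {a b : k} (ha : a ≠ 0) (hb : b ≠ 0) (hfg : C b * f = C a * g) {n : ℕ} (h : HasBranches f v n) :
    HasBranches g v n := by
  have hf : f = g * C (b⁻¹ * a) := by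
    rw [C_mul, mul_comm g, mul_assoc, ← hfg, ← mul_assoc, ← C_mul, inv_mul_cancel₀ hb, C_1, one_mul]
  rw [hf] at h
  obtain ⟨i, j, hi, hj, rfl⟩ := h.exists_of_mul
  have h0 : homogeneousComponent 0 (expandAt (C (σ := Fin 3) (b⁻¹ * a)) v) ≠ 0 := by
    rw [homogeneousComponent_zero_expandAt, eval_C, Ne, C_eq_zero]
    exact mul_ne_zero (inv_ne_zero hb) ha
  match j, hj with
  | 0, _ => exact hi
  | 1, hj => exact absurd hj.1 h0
  | 2, hj => exact absurd hj.1 h0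

theorem exists_C_mul_eq {f g : MvPolynomial (Fin 3) ℤ}
    (h : Associated (baseChange ℚ g) (baseChange ℚ f)) :
    ∃ a b : ℤ, a ≠ 0 ∧ b ≠ 0 ∧ C b * f = C a * g := by
  obtain ⟨u, hu⟩ := h
  obtain ⟨hu0, hdeg⟩ := isUnit_iff_totalDegree_of_isReduced.1 u.isUnit
  rw [totalDegree_eq_zero_iff_eq_C] at hdeg
  rw [hdeg] at hu
  obtain ⟨c, hc⟩ : ∃ c, c = coeff 0 (u : MvPolynomial (Fin 3) ℚ) := ⟨_, rfl⟩
  rw [← hc] at hu hu0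
  refine ⟨c.num, c.den, Rat.num_ne_zero.2 hu0.ne_zero, by exact_mod_cast c.den_ne_zero,
    map_injective (Int.castRingHom ℚ) (RingHom.injective_int _) ?_⟩
  change baseChange ℚ g * C c = map (Int.castRingHom ℚ) f at hu
  rw [map_mul, map_mul, ← hu, map_C, map_C, mul_left_comm, ← C_mul, mul_comm]
  simp only [eq_intCast, Int.cast_natCast, Rat.den_mul_eq_num]
  rfl

open Classical in
theorem sum_branches (F : MvPolynomial (Fin 3) ℤ) (p : ℕ) [Fact p.Prime] :
    (∑ P, if Sing F p P then 2 else if OnCurve F p P then 1 else 0) =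
      Nat.card {P // OnCurve F p P ∧ ¬ Sing F p P} + 2 * Nat.card {P // Sing F p P} := by
  rw [Nat.card_eq_fintype_card, Nat.card_eq_fintype_card, Fintype.card_subtype, Fintype.card_subtype,
    Finset.card_filter, Finset.card_filter, Finset.mul_sum, ← Finset.sum_add_distrib]
  refine Finset.sum_congr rfl fun P _ => ?_
  by_cases hs : Sing F p P <;> by_cases hc : OnCurve F p P <;> simp [hs, hc]

open Classical in
theorem hasBranches_baseChange {F : MvPolynomial (Fin 3) ℤ} {p : ℕ} [Fact p.Prime]
    (h : ∀ P, Sing F p P → IsRationalODP (baseChange (ZMod p) F) P.rep)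
    (P : Projectivization (ZMod p) (Fin 3 → ZMod p)) :
    HasBranches (baseChange (ZMod p) F) P.rep
      (if Sing F p P then 2 else if OnCurve F p P then 1 else 0) := by
  have h0 : homogeneousComponent 0 (expandAt (baseChange (ZMod p) F) P.rep) = 0 ↔ OnCurve F p P := by
    rw [homogeneousComponent_zero_expandAt, C_eq_zero, OnCurve]
  split_ifs with hs hc
  · exact (h P hs).2
  · exact ⟨h0.2 hc, fun h1 => hs (isSingularPoint_iff.2 ⟨h0.2 hc, h1⟩)⟩
  · exact mt h0.1 hc

/-- The Eᵢ stay prime modulo p, and their product is F up to non-zero constants. The branches of F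
at each point are thus distributed among the components, and the total is one for each smooth point
and two for each node. -/
theorem forAlmostAll_sum_modelPointCount {ι : Type*} [Fintype ι] {F : MvPolynomial (Fin 3) ℤ} {n : ℕ}
    (hF : F.IsHomogeneous n) (hF0 : F ≠ 0) (hsing : HasOnlyRationalODPs F)
    {E : ι → MvPolynomial (Fin 3) ℤ} (hEirr : ∀ i, Irreducible (baseChange ℚ (E i)))
    (hE : Associated (∏ i, baseChange ℚ (E i)) (baseChange ℚ F)) : ForAlmostAll fun p _ =>
      (∀ P, Sing F p P → IsRationalODP (baseChange (ZMod p) F) P.rep) →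
        ∑ i, modelPointCount (baseChange (ZMod p) (E i)) =
          Nat.card {P // OnCurve F p P ∧ ¬ Sing F p P} + 2 * Nat.card {P // Sing F p P} := by
  classical
  have hdvd : ∀ i, baseChange ℚ (E i) ∣ baseChange ℚ F := fun i =>
    (Finset.dvd_prod_of_mem _ (Finset.mem_univ i)).trans hE.dvd
  have hinj : Function.Injective (Int.castRingHom ℚ) := RingHom.injective_int _
  have hFQ0 : baseChange ℚ F ≠ 0 := fun h => hF0 (map_injective _ hinj (h.trans (map_zero _).symm))
  have hEhom : ∀ i, ∃ m, (E i).IsHomogeneous m := fun i => by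
    obtain ⟨m, hm⟩ := isHomogeneous_of_dvd (hF.map _) hFQ0 (hdvd i)
    exact ⟨m, hm.of_map hinj⟩
  obtain ⟨a, b, ha, hb, hab⟩ := exists_C_mul_eq (f := F) (g := ∏ i, E i) (by
    rwa [baseChange, map_prod])
  refine ((forAlmostAll_finset Finset.univ fun i _ => forAlmostAll_irreducible (hEhom i).choose_spec
    (irreducible_baseChange_algebraicClosure hF hF0 hsing (hdvd i) (hEirr i))).and
    ((forAlmostAll_not_dvd ha).and (forAlmostAll_not_dvd hb))).mono fun p _ h hodp => ?_
  have hcast : ∀ {x : ℤ}, ¬ (p : ℤ) ∣ x → (x : ZMod p) ≠ 0 := fun hx h =>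
    hx ((ZMod.intCast_zmod_eq_zero_iff_dvd _ _).1 h)
  rw [← sum_branches]
  refine sum_modelPointCount (fun i => ?_) (fun i => (h.1 i (Finset.mem_univ i)).prime) fun P =>
    (hasBranches_baseChange hodp P).of_C_mul (hcast h.2.1) (hcast h.2.2) ?_
  · obtain ⟨m, hm⟩ := hEhom i
    exact ⟨m, hm.map _⟩
  · have := congrArg (map (Int.castRingHom (ZMod p))) hab
    rwa [map_mul, map_mul, map_C, map_C, map_prod, eq_intCast, eq_intCast] at this

end ModelPointsOfReduction

end PfaffianZeta

end

/-! ### Conclusion -/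

theorem theorem2 {G : Type*} [Group G] (r : ℕ)
    -- a presentation of `G` by commutator relations, with `d = 2r` and `d' = 3`
    (B : Fin (2 * r) → Fin (2 * r) → Fin 3 → ℤ)
    (hG : Nonempty (PfaffianZeta.CommutatorPresentation G B))
    -- the Pfaffian `F = √(det M(y))` is non-zero and square-free
    (F : MvPolynomial (Fin 3) ℤ)
    (hF : F ^ 2 = (PfaffianZeta.commutatorMatrix B).det)
    (hF0 : F ≠ 0)
    (hFsq : Squarefree (PfaffianZeta.baseChange ℚ F))
    -- the irreducible components `Eᵢ` of the curve `F = 0` over `ℚ`, none of which is a line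
    (l : ℕ) (E : Fin l → MvPolynomial (Fin 3) ℤ)
    (hEirr : ∀ i, Irreducible (PfaffianZeta.baseChange ℚ (E i)))
    (hE : Associated (∏ i, PfaffianZeta.baseChange ℚ (E i)) (PfaffianZeta.baseChange ℚ F))
    (hlines : ∀ i, 1 < (E i).totalDegree)
    -- all singularities are rational ordinary double points with rational slopes
    (hsing : PfaffianZeta.HasOnlyRationalODPs F) :
    ∃ S : Finset ℕ, ∀ (p : ℕ) [Fact p.Prime], p ∉ S →
      (PfaffianZeta.localNormalZeta p G : LaurentSeries ℚ) /
          ((PfaffianZeta.zetaZp p (2 * r) : LaurentSeries ℚ) *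
            PfaffianZeta.zetaFactor
              ((p : LaurentSeries ℚ) ^ (3 * (2 * r)) * PfaffianZeta.T ^ (2 * r + 3))) =
        PfaffianZeta.W₁ r (p : LaurentSeries ℚ) PfaffianZeta.T
        + ((∑ i, PfaffianZeta.modelPointCount (PfaffianZeta.baseChange (ZMod p) (E i)) : ℕ) :
              LaurentSeries ℚ) * PfaffianZeta.W₂ r (p : LaurentSeries ℚ) PfaffianZeta.T
        + (PfaffianZeta.odpCount B F p 1 : LaurentSeries ℚ)
            * PfaffianZeta.W₃ r (p : LaurentSeries ℚ) PfaffianZeta.T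
        + (PfaffianZeta.odpCount B F p 2 : LaurentSeries ℚ)
            * PfaffianZeta.W₄ r (p : LaurentSeries ℚ) PfaffianZeta.T := by
  obtain ⟨pres⟩ := hG
  obtain ⟨n, hFn⟩ := PfaffianZeta.isHomogeneous_pfaffian hF hF0
  have hdvd : ∀ i, PfaffianZeta.baseChange ℚ (E i) ∣ PfaffianZeta.baseChange ℚ F := fun i =>
    (Finset.dvd_prod_of_mem _ (Finset.mem_univ i)).trans hE.dvd
  have hprod : PfaffianZeta.baseChange (AlgebraicClosure ℚ) F ∣
      ∏ i, PfaffianZeta.baseChange (AlgebraicClosure ℚ) (E i) := by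
    have h := map_dvd (MvPolynomial.map (σ := Fin 3) (algebraMap ℚ (AlgebraicClosure ℚ))) hE.symm.dvd
    rw [map_prod] at h
    simpa only [PfaffianZeta.baseChange_eq_map] using h
  obtain ⟨N, hN, hp⟩ := (PfaffianZeta.forAlmostAll_sing pres.skew hFn hsing).and
    ((PfaffianZeta.forAlmostAll_sum_modelPointCount hFn hF0 hsing hEirr hE).and
    ((PfaffianZeta.forAlmostAll_noLine fun a ha => PfaffianZeta.not_linForm_dvd (fun i =>
      PfaffianZeta.irreducible_baseChange_algebraicClosure hFn hF0 hsing (hdvd i) (hEirr i))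
        hprod hlines ha).and (PfaffianZeta.forAlmostAll_not_dvd two_ne_zero)))
  -- The exceptional primes are the divisors of one non-zero integer N covering all the conditions,
  -- including p ≠ 2 for skew elimination.
  refine ⟨N.natAbs.primeFactors, fun p _ hpS => ?_⟩
  obtain ⟨hnode, hcount, hline, h2⟩ := hp p fun hd => hpS (Nat.mem_primeFactors.2
    ⟨Fact.out, Int.natCast_dvd.1 hd, Int.natAbs_ne_zero.2 hN⟩)
  rw [hcount fun P hP => (hnode P hP).1]
  exact PfaffianZeta.zeta_formula pres (fun h => h2 (by rw [h]; rfl)) hF hF0 hline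
    (fun P hP => (hnode P hP).2) fun P => ⟨fun h => h.isSingularPoint, fun h => (hnode P h).1.map _⟩
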